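/- Let $(z,w)=(z_1,\dots,z_8,w_1,\dots,w_8)$ be the coordinates of $\mathbb{C}^{8+8}$ and let $M^{24}\subset\mathbb{C}^{8+8}$ be the real quadric submanifold of real dimension $24$ given by $$\begin{aligned} \mathrm{Re}\,w_1&=\tfrac12\big(|z_1|^2+|z_2|^2+|z_3|^2+|z_4|^2\big),\qquad \mathrm{Re}\,w_2=\tfrac12\big(|z_5|^2+|z_6|^2+|z_7|^2+|z_8|^2\big),\\ \mathrm{Im}\,w_3&=\mathrm{Im}\,a,\quad \mathrm{Re}\,w_4=\mathrm{Re}\,a,\qquad a=z_1\bar z_7+z_2\bar z_8+z_5\bar z_3+z_6\bar z_4,\\ \mathrm{Im}\,w_5&=\mathrm{Im}\,b,\quad \mathrm{Re}\,w_6=\mathrm{Re}\,b,\qquad b=z_1\bar z_6-z_3\bar z_8+z_5\bar z_2-z_7\bar z_4,\\ \mathrm{Im}\,w_7&=\mathrm{Im}\,d,\quad \mathrm{Re}\,w_8=\mathrm{Re}\,d,\qquad d=z_2\bar z_6+z_3\bar z_7-z_5\bar z_1-z_8\bar z_4. \end{aligned}$$ Let $\mathfrak{hol}(M)$ be the real Lie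 algebra of the holomorphic vector fields $L=\sum_i Z_i(z,w)\,\partial_{z_i}+\sum_j W_j(z,w)\,\partial_{w_j}$ on $\mathbb{C}^{8+8}$ such that $L+\overline L$ is tangent to $M$ along $M$. Assign the weights $[z_i]=1$, $[w_j]=2$, $[\partial_{z_i}]=-1$, $[\partial_{w_j}]=-2$, and for $k\in\mathbb{Z}$ let $\mathfrak{g}_k\subset\mathfrak{hol}(M)$ be the subspace of the polynomial vector fields all of whose terms have weight $k$. Then the following hold. 1. The 78 polynomial vector fields listed below form a basis of the real vector space $\mathfrak{hol}(M)$; in particular $\dim_{\mathbb{R}}\mathfrak{hol}(M)=78$. 2. The same list describes the local infinitesimal CR symmetries: if $U\subset\mathbb{C}^{8+8}$ is open and connected with $U\cap M\neq\emptyset$, and $L$ is a holomorphic vector field on $U$ such that $L+\overline L$ is tangent to $M$ along $U\cap M$, then $L$ is the restriction to $U$ of exactly one element of $\mathfrak{hol}(M)$. 3. $\mathfrak{hol}(M)=\bigoplus_{k\in\mathbb{Z}}\mathfrak{g}_k$ with $[\mathfrak{g}_j,\mathfrak{g}_k]\subset\mathfrak{g}_{j+k}$, where $\mathfrak{g}_k=0$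 for $|k|\geq 3$, the dimensions of $\mathfrak{g}_{-2},\mathfrak{g}_{-1},\mathfrak{g}_0,\mathfrak{g}_1,\mathfrak{g}_2$ are $8,16,30,16,8$, and each $\mathfrak{g}_k$ has as a basis the listed vector fields of weight $k$. 4. $\mathfrak{hol}(M)$ is isomorphic to the Lie algebra $E_{III}=\mathfrak{e}_{6(-14)}$, the real form of the complex simple Lie algebra of type $E_6$ whose Killing form has signature $(32,46)$ (32 positive and 46 negative squares). The vector fields are as follows, with $i=\sqrt{-1}$ and with the upper index of a name equal to the weight. Weight $-2$ (8 vector fields): - $L_{w_3}^{-2}=\partial_{w_3}$ - $L_{w_5}^{-2}=\partial_{w_5}$ - $L_{w_7}^{-2}=\partial_{w_7}$ - $IL_{w_1}^{-2}=i\partial_{w_1}$ - $IL_{w_2}^{-2}=i\partial_{w_2}$ - $IL_{w_4}^{-2}=i\partial_{w_4}$ - $IL_{w_6}^{-2}=i\partial_{w_6}$ - $IL_{w_8}^{-2}=i\partial_{w_8}$ Weight $-1$ (16 vector fields): - $L_{z_1}^{-1}=\partial_{z_1}+z_1\partial_{w_1}-z_7\partial_{w_3}+z_7\partial_{w_4}-z_6\partial_{w_5}+z_6\partial_{w_6}-z_5\partial_{w_7}-z_5\partial_{w_8}$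 - $L_{z_2}^{-1}=\partial_{z_2}+z_2\partial_{w_1}-z_8\partial_{w_3}+z_8\partial_{w_4}+z_5\partial_{w_5}+z_5\partial_{w_6}-z_6\partial_{w_7}+z_6\partial_{w_8}$ - $L_{z_3}^{-1}=\partial_{z_3}+z_3\partial_{w_1}+z_5\partial_{w_3}+z_5\partial_{w_4}+z_8\partial_{w_5}-z_8\partial_{w_6}-z_7\partial_{w_7}+z_7\partial_{w_8}$ - $L_{z_4}^{-1}=\partial_{z_4}+z_4\partial_{w_1}+z_6\partial_{w_3}+z_6\partial_{w_4}-z_7\partial_{w_5}-z_7\partial_{w_6}-z_8\partial_{w_7}-z_8\partial_{w_8}$ - $L_{z_5}^{-1}=\partial_{z_5}+z_5\partial_{w_2}-z_3\partial_{w_3}+z_3\partial_{w_4}-z_2\partial_{w_5}+z_2\partial_{w_6}+z_1\partial_{w_7}-z_1\partial_{w_8}$ - $L_{z_6}^{-1}=\partial_{z_6}+z_6\partial_{w_2}-z_4\partial_{w_3}+z_4\partial_{w_4}+z_1\partial_{w_5}+z_1\partial_{w_6}+z_2\partial_{w_7}+z_2\partial_{w_8}$ - $L_{z_7}^{-1}=\partial_{z_7}+z_7\partial_{w_2}+z_1\partial_{w_3}+z_1\partial_{w_4}+z_4\partial_{w_5}-z_4\partial_{w_6}+z_3\partial_{w_7}+z_3\partial_{w_8}$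 - $L_{z_8}^{-1}=\partial_{z_8}+z_8\partial_{w_2}+z_2\partial_{w_3}+z_2\partial_{w_4}-z_3\partial_{w_5}-z_3\partial_{w_6}+z_4\partial_{w_7}-z_4\partial_{w_8}$ - $IL_{z_1}^{-1}=i(\partial_{z_1}-z_1\partial_{w_1}+z_7\partial_{w_3}-z_7\partial_{w_4}+z_6\partial_{w_5}-z_6\partial_{w_6}+z_5\partial_{w_7}+z_5\partial_{w_8})$ - $IL_{z_2}^{-1}=i(\partial_{z_2}-z_2\partial_{w_1}+z_8\partial_{w_3}-z_8\partial_{w_4}-z_5\partial_{w_5}-z_5\partial_{w_6}+z_6\partial_{w_7}-z_6\partial_{w_8})$ - $IL_{z_3}^{-1}=i(\partial_{z_3}-z_3\partial_{w_1}-z_5\partial_{w_3}-z_5\partial_{w_4}-z_8\partial_{w_5}+z_8\partial_{w_6}+z_7\partial_{w_7}-z_7\partial_{w_8})$ - $IL_{z_4}^{-1}=i(\partial_{z_4}-z_4\partial_{w_1}-z_6\partial_{w_3}-z_6\partial_{w_4}+z_7\partial_{w_5}+z_7\partial_{w_6}+z_8\partial_{w_7}+z_8\partial_{w_8})$ - $IL_{z_5}^{-1}=i(\partial_{z_5}-z_5\partial_{w_2}+z_3\partial_{w_3}-z_3\partial_{w_4}+z_2\partial_{w_5}-z_2\partial_{w_6}-z_1\partial_{w_7}+z_1\partial_{w_8})$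 - $IL_{z_6}^{-1}=i(\partial_{z_6}-z_6\partial_{w_2}+z_4\partial_{w_3}-z_4\partial_{w_4}-z_1\partial_{w_5}-z_1\partial_{w_6}-z_2\partial_{w_7}-z_2\partial_{w_8})$ - $IL_{z_7}^{-1}=i(\partial_{z_7}-z_7\partial_{w_2}-z_1\partial_{w_3}-z_1\partial_{w_4}-z_4\partial_{w_5}+z_4\partial_{w_6}-z_3\partial_{w_7}-z_3\partial_{w_8})$ - $IL_{z_8}^{-1}=i(\partial_{z_8}-z_8\partial_{w_2}-z_2\partial_{w_3}-z_2\partial_{w_4}+z_3\partial_{w_5}+z_3\partial_{w_6}-z_4\partial_{w_7}+z_4\partial_{w_8})$ Weight $0$ (30 vector fields): - $L_1^0=z_7\partial_{z_1}+z_8\partial_{z_2}+z_5\partial_{z_3}+z_6\partial_{z_4}+w_4\partial_{w_1}+2w_2\partial_{w_4}$ - $L_2^0=z_6\partial_{z_1}+z_5\partial_{z_2}-z_8\partial_{z_3}-z_7\partial_{z_4}+w_6\partial_{w_1}+2w_2\partial_{w_6}$ - $L_3^0=-z_5\partial_{z_1}+z_6\partial_{z_2}+z_7\partial_{z_3}-z_8\partial_{z_4}+w_8\partial_{w_1}+2w_2\partial_{w_8}$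 - $L_4^0=z_3\partial_{z_5}+z_4\partial_{z_6}+z_1\partial_{z_7}+z_2\partial_{z_8}+w_4\partial_{w_2}+2w_1\partial_{w_4}$ - $L_5^0=z_2\partial_{z_5}+z_1\partial_{z_6}-z_4\partial_{z_7}-z_3\partial_{z_8}+w_6\partial_{w_2}+2w_1\partial_{w_6}$ - $L_6^0=-z_1\partial_{z_5}+z_2\partial_{z_6}+z_3\partial_{z_7}-z_4\partial_{z_8}+w_8\partial_{w_2}+2w_1\partial_{w_8}$ - $L_7^0=z_1\partial_{z_1}+z_2\partial_{z_2}+z_3\partial_{z_3}+z_4\partial_{z_4}+2w_1\partial_{w_1}+w_3\partial_{w_3}+w_4\partial_{w_4}+w_5\partial_{w_5}+w_6\partial_{w_6}+w_7\partial_{w_7}+w_8\partial_{w_8}$ - $L_8^0=z_4\partial_{z_1}-z_1\partial_{z_4}+z_8\partial_{z_5}-z_5\partial_{z_8}+w_5\partial_{w_3}-w_6\partial_{w_4}-w_3\partial_{w_5}+w_4\partial_{w_6}$ - $L_9^0=-z_4\partial_{z_3}+z_3\partial_{z_4}-z_6\partial_{z_5}+z_5\partial_{z_6}+w_7\partial_{w_5}-w_8\partial_{w_6}-w_5\partial_{w_7}+w_6\partial_{w_8}$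 - $L_{10}^0=z_3\partial_{z_2}-z_2\partial_{z_3}+z_7\partial_{z_6}-z_6\partial_{z_7}-w_5\partial_{w_3}-w_6\partial_{w_4}+w_3\partial_{w_5}+w_4\partial_{w_6}$ - $L_{11}^0=z_4\partial_{z_2}-z_2\partial_{z_4}-z_7\partial_{z_5}+z_5\partial_{z_7}+w_7\partial_{w_3}-w_8\partial_{w_4}-w_3\partial_{w_7}+w_4\partial_{w_8}$ - $L_{12}^0=z_3\partial_{z_1}-z_1\partial_{z_3}-z_8\partial_{z_6}+z_6\partial_{z_8}+w_7\partial_{w_3}+w_8\partial_{w_4}-w_3\partial_{w_7}-w_4\partial_{w_8}$ - $L_{13}^0=-z_2\partial_{z_1}+z_1\partial_{z_2}-z_8\partial_{z_7}+z_7\partial_{z_8}-w_7\partial_{w_5}-w_8\partial_{w_6}+w_5\partial_{w_7}+w_6\partial_{w_8}$ - $L_{14}^0=z_5\partial_{z_5}+z_6\partial_{z_6}+z_7\partial_{z_7}+z_8\partial_{z_8}+2w_2\partial_{w_2}+w_3\partial_{w_3}+w_4\partial_{w_4}+w_5\partial_{w_5}+w_6\partial_{w_6}+w_7\partial_{w_7}+w_8\partial_{w_8}$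 - $IL_1^0=i(z_7\partial_{z_1}+z_8\partial_{z_2}-z_5\partial_{z_3}-z_6\partial_{z_4}-w_3\partial_{w_1}+2w_2\partial_{w_3})$ - $IL_2^0=i(z_6\partial_{z_1}-z_5\partial_{z_2}-z_8\partial_{z_3}+z_7\partial_{z_4}-w_5\partial_{w_1}+2w_2\partial_{w_5})$ - $IL_3^0=i(z_5\partial_{z_1}+z_6\partial_{z_2}+z_7\partial_{z_3}+z_8\partial_{z_4}-w_7\partial_{w_1}+2w_2\partial_{w_7})$ - $IL_4^0=i(z_3\partial_{z_5}+z_4\partial_{z_6}-z_1\partial_{z_7}-z_2\partial_{z_8}-w_3\partial_{w_2}+2w_1\partial_{w_3})$ - $IL_5^0=i(z_2\partial_{z_5}-z_1\partial_{z_6}-z_4\partial_{z_7}+z_3\partial_{z_8}-w_5\partial_{w_2}+2w_1\partial_{w_5})$ - $IL_6^0=i(z_1\partial_{z_5}+z_2\partial_{z_6}+z_3\partial_{z_7}+z_4\partial_{z_8}+w_7\partial_{w_2}-2w_1\partial_{w_7})$ - $IL_7^0=i(z_1\partial_{z_1}-z_4\partial_{z_4}+z_5\partial_{z_5}-z_8\partial_{z_8}+w_4\partial_{w_3}+w_3\partial_{w_4}+w_6\partial_{w_5}+w_5\partial_{w_6})$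 - $IL_8^0=i(z_2\partial_{z_2}+z_4\partial_{z_4}+z_6\partial_{z_6}+z_8\partial_{z_8}-w_6\partial_{w_5}-w_5\partial_{w_6})$ - $IL_9^0=i(z_3\partial_{z_3}-z_4\partial_{z_4}+z_5\partial_{z_5}-z_6\partial_{z_6}+w_6\partial_{w_5}+w_5\partial_{w_6}+w_8\partial_{w_7}+w_7\partial_{w_8})$ - $IL_{10}^0=i(z_4\partial_{z_3}+z_3\partial_{z_4}+z_6\partial_{z_5}+z_5\partial_{z_6}+w_8\partial_{w_5}-w_7\partial_{w_6}-w_6\partial_{w_7}+w_5\partial_{w_8})$ - $IL_{11}^0=i(z_4\partial_{z_2}+z_2\partial_{z_4}-z_7\partial_{z_5}-z_5\partial_{z_7}-w_8\partial_{w_3}+w_7\partial_{w_4}+w_4\partial_{w_7}-w_3\partial_{w_8})$ - $IL_{12}^0=i(z_4\partial_{z_1}+z_1\partial_{z_4}+z_8\partial_{z_5}+z_5\partial_{z_8}-w_6\partial_{w_3}+w_5\partial_{w_4}+w_4\partial_{w_5}-w_3\partial_{w_6})$ - $IL_{13}^0=i(z_3\partial_{z_1}+z_1\partial_{z_3}-z_8\partial_{z_6}-z_6\partial_{z_8}+w_8\partial_{w_3}+w_7\partial_{w_4}+w_4\partial_{w_7}+w_3\partial_{w_8})$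 - $IL_{14}^0=i(z_3\partial_{z_2}+z_2\partial_{z_3}+z_7\partial_{z_6}+z_6\partial_{z_7}-w_6\partial_{w_3}-w_5\partial_{w_4}-w_4\partial_{w_5}-w_3\partial_{w_6})$ - $IL_{15}^0=i(2z_4\partial_{z_4}-z_5\partial_{z_5}+z_6\partial_{z_6}+z_7\partial_{z_7}+z_8\partial_{z_8}-w_4\partial_{w_3}-w_3\partial_{w_4}-w_6\partial_{w_5}-w_5\partial_{w_6}-w_8\partial_{w_7}-w_7\partial_{w_8})$ - $IL_{16}^0=i(z_2\partial_{z_1}+z_1\partial_{z_2}+z_8\partial_{z_7}+z_7\partial_{z_8}+w_8\partial_{w_5}+w_7\partial_{w_6}+w_6\partial_{w_7}+w_5\partial_{w_8})$ Weight $1$ (16 vector fields): - $L_{z_1z_1}^1=-(-2z_1^2+2w_1)\partial_{z_1}+2z_1z_2\partial_{z_2}+2z_1z_3\partial_{z_3}+2z_1z_4\partial_{z_4}+(2z_1z_5+w_7+w_8)\partial_{z_5}+(2z_1z_6+w_5-w_6)\partial_{z_6}+(2z_1z_7+w_3-w_4)\partial_{z_7}+(2z_2z_7-2z_3z_6+2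z_4z_5)\partial_{z_8}+2z_1w_1\partial_{w_1}+(w_3z_7+w_4z_7+w_5z_6+w_6z_6+w_7z_5-w_8z_5)\partial_{w_2}-(2w_1z_7-w_3z_1-w_4z_1+w_5z_4+w_6z_4+w_7z_3-w_8z_3)\partial_{w_3}+(2w_1z_7+w_3z_1+w_4z_1+w_5z_4+w_6z_4+w_7z_3-w_8z_3)\partial_{w_4}-(2w_1z_6-w_3z_4-w_4z_4-w_5z_1-w_6z_1+w_7z_2-w_8z_2)\partial_{w_5}+(2w_1z_6-w_3z_4-w_4z_4+w_5z_1+w_6z_1+w_7z_2-w_8z_2)\partial_{w_6}-(2w_1z_5-w_3z_3-w_4z_3-w_5z_2-w_6z_2-w_7z_1+w_8z_1)\partial_{w_7}-(2w_1z_5-w_3z_3-w_4z_3-w_5z_2-w_6z_2+w_7z_1-w_8z_1)\partial_{w_8}$ - $L_{z_2z_2}^1=2z_1z_2\partial_{z_1}-(-2z_2^2+2w_1)\partial_{z_2}+2z_2z_3\partial_{z_3}+2z_2z_4\partial_{z_4}-(-2z_2z_5+w_5+w_6)\partial_{z_5}+(2z_2z_6+w_7-w_8)\partial_{z_6}+(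2z_1z_8+2z_3z_6-2z_4z_5)\partial_{z_7}+(2z_2z_8+w_3-w_4)\partial_{z_8}+2z_2w_1\partial_{w_1}+(w_3z_8+w_4z_8-w_5z_5+w_6z_5+w_7z_6+w_8z_6)\partial_{w_2}-(2w_1z_8-w_3z_2-w_4z_2-w_5z_3+w_6z_3+w_7z_4+w_8z_4)\partial_{w_3}+(2w_1z_8+w_3z_2+w_4z_2-w_5z_3+w_6z_3+w_7z_4+w_8z_4)\partial_{w_4}+(2w_1z_5-w_3z_3-w_4z_3+w_5z_2-w_6z_2+w_7z_1+w_8z_1)\partial_{w_5}+(2w_1z_5-w_3z_3-w_4z_3-w_5z_2+w_6z_2+w_7z_1+w_8z_1)\partial_{w_6}-(2w_1z_6-w_3z_4-w_4z_4+w_5z_1-w_6z_1-w_7z_2-w_8z_2)\partial_{w_7}+(2w_1z_6-w_3z_4-w_4z_4+w_5z_1-w_6z_1+w_7z_2+w_8z_2)\partial_{w_8}$ - $L_{z_3z_3}^1=2z_1z_3\partial_{z_1}+2z_2z_3\partial_{z_2}-(-2z_3^2+2w_1)\partial_{z_3}+2z_3z_4\partial_{z_4}-(-2z_3z_5+w_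3+w_4)\partial_{z_5}-(2z_1z_8-2z_2z_7-2z_4z_5)\partial_{z_6}+(2z_3z_7+w_7-w_8)\partial_{z_7}-(-2z_3z_8+w_5-w_6)\partial_{z_8}+2z_3w_1\partial_{w_1}-(w_3z_5-w_4z_5+w_5z_8+w_6z_8-w_7z_7-w_8z_7)\partial_{w_2}+(2w_1z_5+w_3z_3-w_4z_3-w_5z_2-w_6z_2+w_7z_1+w_8z_1)\partial_{w_3}+(2w_1z_5-w_3z_3+w_4z_3-w_5z_2-w_6z_2+w_7z_1+w_8z_1)\partial_{w_4}+(2w_1z_8+w_3z_2-w_4z_2+w_5z_3+w_6z_3+w_7z_4+w_8z_4)\partial_{w_5}-(2w_1z_8+w_3z_2-w_4z_2-w_5z_3-w_6z_3+w_7z_4+w_8z_4)\partial_{w_6}-(2w_1z_7+w_3z_1-w_4z_1+w_5z_4+w_6z_4-w_7z_3-w_8z_3)\partial_{w_7}+(2w_1z_7+w_3z_1-w_4z_1+w_5z_4+w_6z_4+w_7z_3+w_8z_3)\partial_{w_8}$ - $L_{z_4z_4}^1=2z_1z_4\partial_{z_1}+2z_2z_4\partial_{z_2}+2z_3z_4\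partial_{z_3}-(-2z_4^2+2w_1)\partial_{z_4}+(2z_1z_8-2z_2z_7+2z_3z_6)\partial_{z_5}-(-2z_4z_6+w_3+w_4)\partial_{z_6}+(2z_4z_7+w_5+w_6)\partial_{z_7}+(2z_4z_8+w_7+w_8)\partial_{z_8}+2z_4w_1\partial_{w_1}-(w_3z_6-w_4z_6-w_5z_7+w_6z_7-w_7z_8+w_8z_8)\partial_{w_2}+(2w_1z_6+w_3z_4-w_4z_4+w_5z_1-w_6z_1+w_7z_2-w_8z_2)\partial_{w_3}+(2w_1z_6-w_3z_4+w_4z_4+w_5z_1-w_6z_1+w_7z_2-w_8z_2)\partial_{w_4}-(2w_1z_7+w_3z_1-w_4z_1-w_5z_4+w_6z_4+w_7z_3-w_8z_3)\partial_{w_5}-(2w_1z_7+w_3z_1-w_4z_1+w_5z_4-w_6z_4+w_7z_3-w_8z_3)\partial_{w_6}-(2w_1z_8+w_3z_2-w_4z_2-w_5z_3+w_6z_3-w_7z_4+w_8z_4)\partial_{w_7}-(2w_1z_8+w_3z_2-w_4z_2-w_5z_3+w_6z_3+w_7z_4-w_8z_4)\partial_{w_8}$ - $L_{z_5z_5}^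1=-(-2z_1z_5+w_7-w_8)\partial_{z_1}+(2z_2z_5+w_5-w_6)\partial_{z_2}+(2z_3z_5+w_3-w_4)\partial_{z_3}+(2z_1z_8-2z_2z_7+2z_3z_6)\partial_{z_4}-(-2z_5^2+2w_2)\partial_{z_5}+2z_5z_6\partial_{z_6}+2z_5z_7\partial_{z_7}+2z_5z_8\partial_{z_8}+(w_3z_3+w_4z_3+w_5z_2+w_6z_2-w_7z_1-w_8z_1)\partial_{w_1}+2w_2z_5\partial_{w_2}-(2w_2z_3-w_3z_5-w_4z_5+w_5z_8+w_6z_8-w_7z_7-w_8z_7)\partial_{w_3}+(2w_2z_3+w_3z_5+w_4z_5+w_5z_8+w_6z_8-w_7z_7-w_8z_7)\partial_{w_4}-(2w_2z_2-w_3z_8-w_4z_8-w_5z_5-w_6z_5-w_7z_6-w_8z_6)\partial_{w_5}+(2w_2z_2-w_3z_8-w_4z_8+w_5z_5+w_6z_5-w_7z_6-w_8z_6)\partial_{w_6}+(2w_2z_1-w_3z_7-w_4z_7-w_5z_6-w_6z_6+w_7z_5+w_8z_5)\partial_{w_7}-(2w_2z_1-w_3z_7-w_4z_7-w_5z_6-w_6z_6-w_7z_5-w_8z_5)\partial_{w_8}$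 - $L_{z_6z_6}^1=-(-2z_1z_6+w_5+w_6)\partial_{z_1}-(-2z_2z_6+w_7+w_8)\partial_{z_2}-(2z_1z_8-2z_2z_7-2z_4z_5)\partial_{z_3}+(2z_4z_6+w_3-w_4)\partial_{z_4}+2z_5z_6\partial_{z_5}-(-2z_6^2+2w_2)\partial_{z_6}+2z_6z_7\partial_{z_7}+2z_6z_8\partial_{z_8}+(w_3z_4+w_4z_4-w_5z_1+w_6z_1-w_7z_2+w_8z_2)\partial_{w_1}+2w_2z_6\partial_{w_2}-(2w_2z_4-w_3z_6-w_4z_6-w_5z_7+w_6z_7-w_7z_8+w_8z_8)\partial_{w_3}+(2w_2z_4+w_3z_6+w_4z_6-w_5z_7+w_6z_7-w_7z_8+w_8z_8)\partial_{w_4}+(2w_2z_1-w_3z_7-w_4z_7+w_5z_6-w_6z_6-w_7z_5+w_8z_5)\partial_{w_5}+(2w_2z_1-w_3z_7-w_4z_7-w_5z_6+w_6z_6-w_7z_5+w_8z_5)\partial_{w_6}+(2w_2z_2-w_3z_8-w_4z_8+w_5z_5-w_6z_5+w_7z_6-w_8z_6)\partial_{w_7}+(2w_2z_2-w_3z_8-w_4z_8+w_5z_5-w_6z_5-w_7z_6+w_8z_6)\partial_{w_8}$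 - $L_{z_7z_7}^1=-(-2z_1z_7+w_3+w_4)\partial_{z_1}+(2z_1z_8+2z_3z_6-2z_4z_5)\partial_{z_2}-(-2z_3z_7+w_7+w_8)\partial_{z_3}-(-2z_4z_7+w_5-w_6)\partial_{z_4}+2z_5z_7\partial_{z_5}+2z_6z_7\partial_{z_6}-(-2z_7^2+2w_2)\partial_{z_7}+2z_7z_8\partial_{z_8}-(w_3z_1-w_4z_1+w_5z_4+w_6z_4+w_7z_3-w_8z_3)\partial_{w_1}+2w_2z_7\partial_{w_2}+(2w_2z_1+w_3z_7-w_4z_7-w_5z_6-w_6z_6-w_7z_5+w_8z_5)\partial_{w_3}+(2w_2z_1-w_3z_7+w_4z_7-w_5z_6-w_6z_6-w_7z_5+w_8z_5)\partial_{w_4}+(2w_2z_4+w_3z_6-w_4z_6+w_5z_7+w_6z_7-w_7z_8+w_8z_8)\partial_{w_5}-(2w_2z_4+w_3z_6-w_4z_6-w_5z_7-w_6z_7-w_7z_8+w_8z_8)\partial_{w_6}+(2w_2z_3+w_3z_5-w_4z_5+w_5z_8+w_6z_8+w_7z_7-w_8z_7)\partial_{w_7}+(2w_2z_3+w_3z_5-w_4z_5+w_5z_8+w_6z_8-w_7z_7+w_8z_7)\partial_{w_8}$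 - $L_{z_8z_8}^1=(2z_2z_7-2z_3z_6+2z_4z_5)\partial_{z_1}-(-2z_2z_8+w_3+w_4)\partial_{z_2}+(2z_3z_8+w_5+w_6)\partial_{z_3}-(-2z_4z_8+w_7-w_8)\partial_{z_4}+2z_5z_8\partial_{z_5}+2z_6z_8\partial_{z_6}+2z_7z_8\partial_{z_7}-(-2z_8^2+2w_2)\partial_{z_8}-(w_3z_2-w_4z_2-w_5z_3+w_6z_3+w_7z_4+w_8z_4)\partial_{w_1}+2w_2z_8\partial_{w_2}+(2w_2z_2+w_3z_8-w_4z_8+w_5z_5-w_6z_5-w_7z_6-w_8z_6)\partial_{w_3}+(2w_2z_2-w_3z_8+w_4z_8+w_5z_5-w_6z_5-w_7z_6-w_8z_6)\partial_{w_4}-(2w_2z_3+w_3z_5-w_4z_5-w_5z_8+w_6z_8-w_7z_7-w_8z_7)\partial_{w_5}-(2w_2z_3+w_3z_5-w_4z_5+w_5z_8-w_6z_8-w_7z_7-w_8z_7)\partial_{w_6}+(2w_2z_4+w_3z_6-w_4z_6-w_5z_7+w_6z_7+w_7z_8+w_8z_8)\partial_{w_7}-(2w_2z_4+w_3z_6-w_4z_6-w_5z_7+w_6z_7-w_7z_8-w_8z_8)\partial_{w_8}$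 - $IL_{z_1z_1}^1=i((2z_1^2+2w_1)\partial_{z_1}+2z_1z_2\partial_{z_2}+2z_1z_3\partial_{z_3}+2z_1z_4\partial_{z_4}-(-2z_1z_5+w_7+w_8)\partial_{z_5}-(-2z_1z_6+w_5-w_6)\partial_{z_6}-(-2z_1z_7+w_3-w_4)\partial_{z_7}+(2z_2z_7-2z_3z_6+2z_4z_5)\partial_{z_8}+2z_1w_1\partial_{w_1}+(w_3z_7+w_4z_7+w_5z_6+w_6z_6+w_7z_5-w_8z_5)\partial_{w_2}-(2w_1z_7-w_3z_1-w_4z_1+w_5z_4+w_6z_4+w_7z_3-w_8z_3)\partial_{w_3}+(2w_1z_7+w_3z_1+w_4z_1+w_5z_4+w_6z_4+w_7z_3-w_8z_3)\partial_{w_4}-(2w_1z_6-w_3z_4-w_4z_4-w_5z_1-w_6z_1+w_7z_2-w_8z_2)\partial_{w_5}+(2w_1z_6-w_3z_4-w_4z_4+w_5z_1+w_6z_1+w_7z_2-w_8z_2)\partial_{w_6}-(2w_1z_5-w_3z_3-w_4z_3-w_5z_2-w_6z_2-w_7z_1+w_8z_1)\partial_{w_7}-(2w_1z_5-w_3z_3-w_4z_3-w_5z_2-w_6z_2+w_7z_1-w_8z_1)\partial_{w_8})$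 - $IL_{z_2z_2}^1=i(2z_1z_2\partial_{z_1}+(2z_2^2+2w_1)\partial_{z_2}+2z_2z_3\partial_{z_3}+2z_2z_4\partial_{z_4}+(2z_2z_5+w_5+w_6)\partial_{z_5}-(-2z_2z_6+w_7-w_8)\partial_{z_6}+(2z_1z_8+2z_3z_6-2z_4z_5)\partial_{z_7}-(-2z_2z_8+w_3-w_4)\partial_{z_8}+2z_2w_1\partial_{w_1}+(w_3z_8+w_4z_8-w_5z_5+w_6z_5+w_7z_6+w_8z_6)\partial_{w_2}-(2w_1z_8-w_3z_2-w_4z_2-w_5z_3+w_6z_3+w_7z_4+w_8z_4)\partial_{w_3}+(2w_1z_8+w_3z_2+w_4z_2-w_5z_3+w_6z_3+w_7z_4+w_8z_4)\partial_{w_4}+(2w_1z_5-w_3z_3-w_4z_3+w_5z_2-w_6z_2+w_7z_1+w_8z_1)\partial_{w_5}+(2w_1z_5-w_3z_3-w_4z_3-w_5z_2+w_6z_2+w_7z_1+w_8z_1)\partial_{w_6}-(2w_1z_6-w_3z_4-w_4z_4+w_5z_1-w_6z_1-w_7z_2-w_8z_2)\partial_{w_7}+(2w_1z_6-w_3z_4-w_4z_4+w_5z_1-w_6z_1+w_7z_2+w_8z_2)\partial_{w_8})$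 - $IL_{z_3z_3}^1=i(2z_1z_3\partial_{z_1}+2z_2z_3\partial_{z_2}+(2z_3^2+2w_1)\partial_{z_3}+2z_3z_4\partial_{z_4}+(2z_3z_5+w_3+w_4)\partial_{z_5}-(2z_1z_8-2z_2z_7-2z_4z_5)\partial_{z_6}-(-2z_3z_7+w_7-w_8)\partial_{z_7}+(2z_3z_8+w_5-w_6)\partial_{z_8}+2z_3w_1\partial_{w_1}-(w_3z_5-w_4z_5+w_5z_8+w_6z_8-w_7z_7-w_8z_7)\partial_{w_2}+(2w_1z_5+w_3z_3-w_4z_3-w_5z_2-w_6z_2+w_7z_1+w_8z_1)\partial_{w_3}+(2w_1z_5-w_3z_3+w_4z_3-w_5z_2-w_6z_2+w_7z_1+w_8z_1)\partial_{w_4}+(2w_1z_8+w_3z_2-w_4z_2+w_5z_3+w_6z_3+w_7z_4+w_8z_4)\partial_{w_5}-(2w_1z_8+w_3z_2-w_4z_2-w_5z_3-w_6z_3+w_7z_4+w_8z_4)\partial_{w_6}-(2w_1z_7+w_3z_1-w_4z_1+w_5z_4+w_6z_4-w_7z_3-w_8z_3)\partial_{w_7}+(2w_1z_7+w_3z_1-w_4z_1+w_5z_4+w_6z_4+w_7z_3+w_8z_3)\partial_{w_8})$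 - $IL_{z_4z_4}^1=i(2z_1z_4\partial_{z_1}+2z_2z_4\partial_{z_2}+2z_3z_4\partial_{z_3}+(2z_4^2+2w_1)\partial_{z_4}+(2z_1z_8-2z_2z_7+2z_3z_6)\partial_{z_5}+(2z_4z_6+w_3+w_4)\partial_{z_6}-(-2z_4z_7+w_5+w_6)\partial_{z_7}-(-2z_4z_8+w_7+w_8)\partial_{z_8}+2z_4w_1\partial_{w_1}-(w_3z_6-w_4z_6-w_5z_7+w_6z_7-w_7z_8+w_8z_8)\partial_{w_2}+(2w_1z_6+w_3z_4-w_4z_4+w_5z_1-w_6z_1+w_7z_2-w_8z_2)\partial_{w_3}+(2w_1z_6-w_3z_4+w_4z_4+w_5z_1-w_6z_1+w_7z_2-w_8z_2)\partial_{w_4}-(2w_1z_7+w_3z_1-w_4z_1-w_5z_4+w_6z_4+w_7z_3-w_8z_3)\partial_{w_5}-(2w_1z_7+w_3z_1-w_4z_1+w_5z_4-w_6z_4+w_7z_3-w_8z_3)\partial_{w_6}-(2w_1z_8+w_3z_2-w_4z_2-w_5z_3+w_6z_3-w_7z_4+w_8z_4)\partial_{w_7}-(2w_1z_8+w_3z_2-w_4z_2-w_5z_3+w_6z_3+w_7z_4-w_8z_4)\partial_{w_8})$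 - $IL_{z_5z_5}^1=i((2z_1z_5+w_7-w_8)\partial_{z_1}-(-2z_2z_5+w_5-w_6)\partial_{z_2}-(-2z_3z_5+w_3-w_4)\partial_{z_3}+(2z_1z_8-2z_2z_7+2z_3z_6)\partial_{z_4}+(2z_5^2+2w_2)\partial_{z_5}+2z_5z_6\partial_{z_6}+2z_5z_7\partial_{z_7}+2z_5z_8\partial_{z_8}+(w_3z_3+w_4z_3+w_5z_2+w_6z_2-w_7z_1-w_8z_1)\partial_{w_1}+2z_5w_2\partial_{w_2}-(2w_2z_3-w_3z_5-w_4z_5+w_5z_8+w_6z_8-w_7z_7-w_8z_7)\partial_{w_3}+(2w_2z_3+w_3z_5+w_4z_5+w_5z_8+w_6z_8-w_7z_7-w_8z_7)\partial_{w_4}-(2w_2z_2-w_3z_8-w_4z_8-w_5z_5-w_6z_5-w_7z_6-w_8z_6)\partial_{w_5}+(2w_2z_2-w_3z_8-w_4z_8+w_5z_5+w_6z_5-w_7z_6-w_8z_6)\partial_{w_6}+(2w_2z_1-w_3z_7-w_4z_7-w_5z_6-w_6z_6+w_7z_5+w_8z_5)\partial_{w_7}-(2w_2z_1-w_3z_7-w_4z_7-w_5z_6-w_6z_6-w_7z_5-w_8z_5)\partial_{w_8})$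 - $IL_{z_6z_6}^1=i((2z_1z_6+w_5+w_6)\partial_{z_1}+(2z_2z_6+w_7+w_8)\partial_{z_2}-(2z_1z_8-2z_2z_7-2z_4z_5)\partial_{z_3}-(-2z_4z_6+w_3-w_4)\partial_{z_4}+2z_5z_6\partial_{z_5}+(2z_6^2+2w_2)\partial_{z_6}+2z_6z_7\partial_{z_7}+2z_6z_8\partial_{z_8}+(w_3z_4+w_4z_4-w_5z_1+w_6z_1-w_7z_2+w_8z_2)\partial_{w_1}+2z_6w_2\partial_{w_2}-(2w_2z_4-w_3z_6-w_4z_6-w_5z_7+w_6z_7-w_7z_8+w_8z_8)\partial_{w_3}+(2w_2z_4+w_3z_6+w_4z_6-w_5z_7+w_6z_7-w_7z_8+w_8z_8)\partial_{w_4}+(2w_2z_1-w_3z_7-w_4z_7+w_5z_6-w_6z_6-w_7z_5+w_8z_5)\partial_{w_5}+(2w_2z_1-w_3z_7-w_4z_7-w_5z_6+w_6z_6-w_7z_5+w_8z_5)\partial_{w_6}+(2w_2z_2-w_3z_8-w_4z_8+w_5z_5-w_6z_5+w_7z_6-w_8z_6)\partial_{w_7}+(2w_2z_2-w_3z_8-w_4z_8+w_5z_5-w_6z_5-w_7z_6+w_8z_6)\partial_{w_8})$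 - $IL_{z_7z_7}^1=i((2z_1z_7+w_3+w_4)\partial_{z_1}+(2z_1z_8+2z_3z_6-2z_4z_5)\partial_{z_2}+(2z_3z_7+w_7+w_8)\partial_{z_3}+(2z_4z_7+w_5-w_6)\partial_{z_4}+2z_5z_7\partial_{z_5}+2z_6z_7\partial_{z_6}+(2z_7^2+2w_2)\partial_{z_7}+2z_7z_8\partial_{z_8}-(w_3z_1-w_4z_1+w_5z_4+w_6z_4+w_7z_3-w_8z_3)\partial_{w_1}+2z_7w_2\partial_{w_2}+(2w_2z_1+w_3z_7-w_4z_7-w_5z_6-w_6z_6-w_7z_5+w_8z_5)\partial_{w_3}+(2w_2z_1-w_3z_7+w_4z_7-w_5z_6-w_6z_6-w_7z_5+w_8z_5)\partial_{w_4}+(2w_2z_4+w_3z_6-w_4z_6+w_5z_7+w_6z_7-w_7z_8+w_8z_8)\partial_{w_5}-(2w_2z_4+w_3z_6-w_4z_6-w_5z_7-w_6z_7-w_7z_8+w_8z_8)\partial_{w_6}+(2w_2z_3+w_3z_5-w_4z_5+w_5z_8+w_6z_8+w_7z_7-w_8z_7)\partial_{w_7}+(2w_2z_3+w_3z_5-w_4z_5+w_5z_8+w_6z_8-w_7z_7+w_8z_7)\partial_{w_8})$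 - $IL_{z_8z_8}^1=i((2z_2z_7-2z_3z_6+2z_4z_5)\partial_{z_1}+(2z_2z_8+w_3+w_4)\partial_{z_2}-(-2z_3z_8+w_5+w_6)\partial_{z_3}+(2z_4z_8+w_7-w_8)\partial_{z_4}+2z_5z_8\partial_{z_5}+2z_6z_8\partial_{z_6}+2z_7z_8\partial_{z_7}+(2z_8^2+2w_2)\partial_{z_8}-(w_3z_2-w_4z_2-w_5z_3+w_6z_3+w_7z_4+w_8z_4)\partial_{w_1}+2z_8w_2\partial_{w_2}+(2w_2z_2+w_3z_8-w_4z_8+w_5z_5-w_6z_5-w_7z_6-w_8z_6)\partial_{w_3}+(2w_2z_2-w_3z_8+w_4z_8+w_5z_5-w_6z_5-w_7z_6-w_8z_6)\partial_{w_4}-(2w_2z_3+w_3z_5-w_4z_5-w_5z_8+w_6z_8-w_7z_7-w_8z_7)\partial_{w_5}-(2w_2z_3+w_3z_5-w_4z_5+w_5z_8-w_6z_8-w_7z_7-w_8z_7)\partial_{w_6}+(2w_2z_4+w_3z_6-w_4z_6-w_5z_7+w_6z_7+w_7z_8+w_8z_8)\partial_{w_7}-(2w_2z_4+w_3z_6-w_4z_6-w_5z_7+w_6z_7-w_7z_8-w_8z_8)\partial_{w_8})$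 Weight $2$ (8 vector fields): - $L_{w_3w_3}^2=(2w_1z_7-w_3z_1-w_4z_1+w_5z_4+w_6z_4+w_7z_3-w_8z_3)\partial_{z_1}+(2w_1z_8-w_3z_2-w_4z_2-w_5z_3+w_6z_3+w_7z_4+w_8z_4)\partial_{z_2}-(2w_1z_5+w_3z_3-w_4z_3-w_5z_2-w_6z_2+w_7z_1+w_8z_1)\partial_{z_3}-(2w_1z_6+w_3z_4-w_4z_4+w_5z_1-w_6z_1+w_7z_2-w_8z_2)\partial_{z_4}+(2w_2z_3-w_3z_5-w_4z_5+w_5z_8+w_6z_8-w_7z_7-w_8z_7)\partial_{z_5}+(2w_2z_4-w_3z_6-w_4z_6-w_5z_7+w_6z_7-w_7z_8+w_8z_8)\partial_{z_6}-(2w_2z_1+w_3z_7-w_4z_7-w_5z_6-w_6z_6-w_7z_5+w_8z_5)\partial_{z_7}-(2w_2z_2+w_3z_8-w_4z_8+w_5z_5-w_6z_5-w_7z_6-w_8z_6)\partial_{z_8}-2w_1w_3\partial_{w_1}-2w_2w_3\partial_{w_2}+(4w_1w_2-w_3^2-w_4^2+w_5^2-w_6^2+w_7^2-w_8^2)\partial_{w_3}-2w_3w_4\partial_{w_4}-2w_3w_5\partial_{w_5}-2w_3w_6\partial_{w_6}-2w_3w_7\partial_{w_7}-2w_3w_8\partial_{w_8}$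 - $L_{w_5w_5}^2=(2w_1z_6-w_3z_4-w_4z_4-w_5z_1-w_6z_1+w_7z_2-w_8z_2)\partial_{z_1}-(2w_1z_5-w_3z_3-w_4z_3+w_5z_2-w_6z_2+w_7z_1+w_8z_1)\partial_{z_2}-(2w_1z_8+w_3z_2-w_4z_2+w_5z_3+w_6z_3+w_7z_4+w_8z_4)\partial_{z_3}+(2w_1z_7+w_3z_1-w_4z_1-w_5z_4+w_6z_4+w_7z_3-w_8z_3)\partial_{z_4}+(2w_2z_2-w_3z_8-w_4z_8-w_5z_5-w_6z_5-w_7z_6-w_8z_6)\partial_{z_5}-(2w_2z_1-w_3z_7-w_4z_7+w_5z_6-w_6z_6-w_7z_5+w_8z_5)\partial_{z_6}-(2w_2z_4+w_3z_6-w_4z_6+w_5z_7+w_6z_7-w_7z_8+w_8z_8)\partial_{z_7}+(2w_2z_3+w_3z_5-w_4z_5-w_5z_8+w_6z_8-w_7z_7-w_8z_7)\partial_{z_8}-2w_1w_5\partial_{w_1}-2w_2w_5\partial_{w_2}-2w_3w_5\partial_{w_3}-2w_4w_5\partial_{w_4}+(4w_1w_2+w_3^2-w_4^2-w_5^2-w_6^2+w_7^2-w_8^2)\partial_{w_5}-2w_5w_6\partial_{w_6}-2w_5w_7\partial_{w_7}-2w_5w_8\partial_{w_8}$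 - $L_{w_7w_7}^2=(2w_1z_5-w_3z_3-w_4z_3-w_5z_2-w_6z_2-w_7z_1+w_8z_1)\partial_{z_1}+(2w_1z_6-w_3z_4-w_4z_4+w_5z_1-w_6z_1-w_7z_2-w_8z_2)\partial_{z_2}+(2w_1z_7+w_3z_1-w_4z_1+w_5z_4+w_6z_4-w_7z_3-w_8z_3)\partial_{z_3}+(2w_1z_8+w_3z_2-w_4z_2-w_5z_3+w_6z_3-w_7z_4+w_8z_4)\partial_{z_4}-(2w_2z_1-w_3z_7-w_4z_7-w_5z_6-w_6z_6+w_7z_5+w_8z_5)\partial_{z_5}-(2w_2z_2-w_3z_8-w_4z_8+w_5z_5-w_6z_5+w_7z_6-w_8z_6)\partial_{z_6}-(2w_2z_3+w_3z_5-w_4z_5+w_5z_8+w_6z_8+w_7z_7-w_8z_7)\partial_{z_7}-(2w_2z_4+w_3z_6-w_4z_6-w_5z_7+w_6z_7+w_7z_8+w_8z_8)\partial_{z_8}-2w_1w_7\partial_{w_1}-2w_2w_7\partial_{w_2}-2w_3w_7\partial_{w_3}-2w_4w_7\partial_{w_4}-2w_5w_7\partial_{w_5}-2w_6w_7\partial_{w_6}+(4w_1w_2+w_3^2-w_4^2+w_5^2-w_6^2-w_7^2-w_8^2)\partial_{w_7}-2w_7w_8\partial_{w_8}$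 - $IL_{w_1w_1}^2=i(4w_1z_1\partial_{z_1}+4w_1z_2\partial_{z_2}+4w_1z_3\partial_{z_3}+4w_1z_4\partial_{z_4}+(2w_3z_3+2w_4z_3+2w_5z_2+2w_6z_2-2w_7z_1-2w_8z_1)\partial_{z_5}+(2w_3z_4+2w_4z_4-2w_5z_1+2w_6z_1-2w_7z_2+2w_8z_2)\partial_{z_6}-(2w_3z_1-2w_4z_1+2w_5z_4+2w_6z_4+2w_7z_3-2w_8z_3)\partial_{z_7}-(2w_3z_2-2w_4z_2-2w_5z_3+2w_6z_3+2w_7z_4+2w_8z_4)\partial_{z_8}+4w_1^2\partial_{w_1}-(w_3^2-w_4^2+w_5^2-w_6^2+w_7^2-w_8^2)\partial_{w_2}+4w_1w_3\partial_{w_3}+4w_1w_4\partial_{w_4}+4w_1w_5\partial_{w_5}+4w_1w_6\partial_{w_6}+4w_1w_7\partial_{w_7}+4w_1w_8\partial_{w_8})$ - $IL_{w_2w_2}^2=i((2w_3z_7+2w_4z_7+2w_5z_6+2w_6z_6+2w_7z_5-2w_8z_5)\partial_{z_1}+(2w_3z_8+2w_4z_8-2w_5z_5+2w_6z_5+2w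_7z_6+2w_8z_6)\partial_{z_2}-(2w_3z_5-2w_4z_5+2w_5z_8+2w_6z_8-2w_7z_7-2w_8z_7)\partial_{z_3}-(2w_3z_6-2w_4z_6-2w_5z_7+2w_6z_7-2w_7z_8+2w_8z_8)\partial_{z_4}+4w_2z_5\partial_{z_5}+4w_2z_6\partial_{z_6}+4w_2z_7\partial_{z_7}+4w_2z_8\partial_{z_8}-(w_3^2-w_4^2+w_5^2-w_6^2+w_7^2-w_8^2)\partial_{w_1}+4w_2^2\partial_{w_2}+4w_2w_3\partial_{w_3}+4w_2w_4\partial_{w_4}+4w_2w_5\partial_{w_5}+4w_2w_6\partial_{w_6}+4w_2w_7\partial_{w_7}+4w_2w_8\partial_{w_8})$ - $IL_{w_4w_4}^2=i((2w_1z_7+w_3z_1+w_4z_1+w_5z_4+w_6z_4+w_7z_3-w_8z_3)\partial_{z_1}+(2w_1z_8+w_3z_2+w_4z_2-w_5z_3+w_6z_3+w_7z_4+w_8z_4)\partial_{z_2}+(2w_1z_5-w_3z_3+w_4z_3-w_5z_2-w_6z_2+w_7z_1+w_8z_1)\partial_{z_3}+(2w_1z_6-w_3z_4+w_4z_4+w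_5z_1-w_6z_1+w_7z_2-w_8z_2)\partial_{z_4}+(2w_2z_3+w_3z_5+w_4z_5+w_5z_8+w_6z_8-w_7z_7-w_8z_7)\partial_{z_5}+(2w_2z_4+w_3z_6+w_4z_6-w_5z_7+w_6z_7-w_7z_8+w_8z_8)\partial_{z_6}+(2w_2z_1-w_3z_7+w_4z_7-w_5z_6-w_6z_6-w_7z_5+w_8z_5)\partial_{z_7}+(2w_2z_2-w_3z_8+w_4z_8+w_5z_5-w_6z_5-w_7z_6-w_8z_6)\partial_{z_8}+2w_1w_4\partial_{w_1}+2w_2w_4\partial_{w_2}+2w_3w_4\partial_{w_3}+(4w_1w_2+w_3^2+w_4^2+w_5^2-w_6^2+w_7^2-w_8^2)\partial_{w_4}+2w_4w_5\partial_{w_5}+2w_4w_6\partial_{w_6}+2w_4w_7\partial_{w_7}+2w_4w_8\partial_{w_8})$ - $IL_{w_6w_6}^2=i((2w_1z_6-w_3z_4-w_4z_4+w_5z_1+w_6z_1+w_7z_2-w_8z_2)\partial_{z_1}+(2w_1z_5-w_3z_3-w_4z_3-w_5z_2+w_6z_2+w_7z_1+w_8z_1)\partial_{z_2}-(2w_1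z_8+w_3z_2-w_4z_2-w_5z_3-w_6z_3+w_7z_4+w_8z_4)\partial_{z_3}-(2w_1z_7+w_3z_1-w_4z_1+w_5z_4-w_6z_4+w_7z_3-w_8z_3)\partial_{z_4}+(2w_2z_2-w_3z_8-w_4z_8+w_5z_5+w_6z_5-w_7z_6-w_8z_6)\partial_{z_5}+(2w_2z_1-w_3z_7-w_4z_7-w_5z_6+w_6z_6-w_7z_5+w_8z_5)\partial_{z_6}-(2w_2z_4+w_3z_6-w_4z_6-w_5z_7-w_6z_7-w_7z_8+w_8z_8)\partial_{z_7}-(2w_2z_3+w_3z_5-w_4z_5+w_5z_8-w_6z_8-w_7z_7-w_8z_7)\partial_{z_8}+2w_1w_6\partial_{w_1}+2w_2w_6\partial_{w_2}+2w_3w_6\partial_{w_3}+2w_4w_6\partial_{w_4}+2w_5w_6\partial_{w_5}+(4w_1w_2+w_3^2-w_4^2+w_5^2+w_6^2+w_7^2-w_8^2)\partial_{w_6}+2w_6w_7\partial_{w_7}+2w_6w_8\partial_{w_8})$ - $IL_{w_8w_8}^2=i((2w_1z_5-w_3z_3-w_4z_3-w_5z_2-w_6z_2+w_7z_1-w_8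z_1)\partial_{z_1}-(2w_1z_6-w_3z_4-w_4z_4+w_5z_1-w_6z_1+w_7z_2+w_8z_2)\partial_{z_2}-(2w_1z_7+w_3z_1-w_4z_1+w_5z_4+w_6z_4+w_7z_3+w_8z_3)\partial_{z_3}+(2w_1z_8+w_3z_2-w_4z_2-w_5z_3+w_6z_3+w_7z_4-w_8z_4)\partial_{z_4}+(2w_2z_1-w_3z_7-w_4z_7-w_5z_6-w_6z_6-w_7z_5-w_8z_5)\partial_{z_5}-(2w_2z_2-w_3z_8-w_4z_8+w_5z_5-w_6z_5-w_7z_6+w_8z_6)\partial_{z_6}-(2w_2z_3+w_3z_5-w_4z_5+w_5z_8+w_6z_8-w_7z_7+w_8z_7)\partial_{z_7}+(2w_2z_4+w_3z_6-w_4z_6-w_5z_7+w_6z_7-w_7z_8-w_8z_8)\partial_{z_8}-2w_1w_8\partial_{w_1}-2w_2w_8\partial_{w_2}-2w_3w_8\partial_{w_3}-2w_4w_8\partial_{w_4}-2w_5w_8\partial_{w_5}-2w_6w_8\partial_{w_6}-2w_7w_8\partial_{w_7}-(4w_1w_2+w_3^2-w_4^2+w_5^2-w_6^2+w_7^2+w_8^2)\partial_{w_8})$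 -/

import Mathlib

noncomputable section

set_option linter.unusedVariables false

namespace EIIIModel

open Complex ComplexConjugate VectorField MvPolynomial
open scoped TensorProduct

/-! ### The quadric in `ℂ⁸⁺⁸` -/

/-- Labels of the coordinates `(z₁, …, z₈, w₁, …, w₈)`: `inl i` stands for the coordinate
`z_{i+1}` and `inr j` for `w_{j+1}`. -/
abbrev Coord : Type := Fin 8 ⊕ Fin 8

/-- The space `ℂ⁸⁺⁸`. -/
abbrev E : Type := Coord → ℂ

/-- A function of the sixteen coordinates `z₁, …, z₈, w₁, …, w₈`, seen as a function on `ℂ⁸⁺⁸`. -/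
def onCoords {β : Type}
    (F : ℂ → ℂ → ℂ → ℂ → ℂ → ℂ → ℂ → ℂ → ℂ → ℂ → ℂ → ℂ → ℂ → ℂ → ℂ → ℂ → β) (x : E) : β :=
  F (x (.inl 0)) (x (.inl 1)) (x (.inl 2)) (x (.inl 3))
    (x (.inl 4)) (x (.inl 5)) (x (.inl 6)) (x (.inl 7))
    (x (.inr 0)) (x (.inr 1)) (x (.inr 2)) (x (.inr 3))
    (x (.inr 4)) (x (.inr 5)) (x (.inr 6)) (x (.inr 7))

/-- The eight real defining functions of the quadric: left-hand side minus right-hand side of its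
equations. -/
def rho : E → Fin 8 → ℝ :=
  onCoords fun z1 z2 z3 z4 z5 z6 z7 z8 w1 w2 w3 w4 w5 w6 w7 w8 => ![
    w1.re - (‖z1‖ ^ 2 + ‖z2‖ ^ 2 + ‖z3‖ ^ 2 + ‖z4‖ ^ 2) / 2,
    w2.re - (‖z5‖ ^ 2 + ‖z6‖ ^ 2 + ‖z7‖ ^ 2 + ‖z8‖ ^ 2) / 2,
    w3.im - (z1 * conj z7 + z2 * conj z8 + z5 * conj z3 + z6 * conj z4).im,
    w4.re - (z1 * conj z7 + z2 * conj z8 + z5 * conj z3 + z6 * conj z4).re,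
    w5.im - (z1 * conj z6 - z3 * conj z8 + z5 * conj z2 - z7 * conj z4).im,
    w6.re - (z1 * conj z6 - z3 * conj z8 + z5 * conj z2 - z7 * conj z4).re,
    w7.im - (z2 * conj z6 + z3 * conj z7 - z5 * conj z1 - z8 * conj z4).im,
    w8.re - (z2 * conj z6 + z3 * conj z7 - z5 * conj z1 - z8 * conj z4).re]

/-- The quadric `M²⁴ ⊂ ℂ⁸⁺⁸`. -/
def M : Set E := {x | rho x = 0}

/-- The real tangent space `T_p M`, the kernel of the differential of the defining functions; a
real tangent vector of `ℂ⁸⁺⁸` is identified with an element of `ℂ⁸⁺⁸`.  See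
`mem_tangentSpace_iff` for the description by curves in `M`. -/
def tangentSpace (p : E) : Submodule ℝ E := LinearMap.ker (fderiv ℝ rho p : E →ₗ[ℝ] Fin 8 → ℝ)

lemma contDiff_rho : ContDiff ℝ 2 rho := by
  have hc : ∀ c : Coord, ContDiff ℝ 2 fun x : E => x c := fun c => contDiff_apply ℝ ℂ c
  have hn : ∀ c : Coord, ContDiff ℝ 2 fun x : E => ‖x c‖ ^ 2 := fun c => (hc c).norm_sq ℝ
  have hm : ∀ c d : Coord, ContDiff ℝ 2 fun x : E => x c * conj (x d) := fun c d =>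
    (hc c).mul (conjCLE.contDiff.comp (hc d))
  have hre : ∀ f : E → ℂ, ContDiff ℝ 2 f → ContDiff ℝ 2 fun x => (f x).re := fun f hf =>
    reCLM.contDiff.comp hf
  have him : ∀ f : E → ℂ, ContDiff ℝ 2 f → ContDiff ℝ 2 fun x => (f x).im := fun f hf =>
    imCLM.contDiff.comp hf
  rw [contDiff_pi]
  intro j
  fin_cases j
  · exact (hre _ (hc _)).sub (((((hn _).add (hn _)).add (hn _)).add (hn _)).div_const _)
  · exact (hre _ (hc _)).sub (((((hn _).add (hn _)).add (hn _)).add (hn _)).div_const _)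
  · exact (him _ (hc _)).sub (him _ ((((hm _ _).add (hm _ _)).add (hm _ _)).add (hm _ _)))
  · exact (hre _ (hc _)).sub (hre _ ((((hm _ _).add (hm _ _)).add (hm _ _)).add (hm _ _)))
  · exact (him _ (hc _)).sub (him _ ((((hm _ _).sub (hm _ _)).add (hm _ _)).sub (hm _ _)))
  · exact (hre _ (hc _)).sub (hre _ ((((hm _ _).sub (hm _ _)).add (hm _ _)).sub (hm _ _)))
  · exact (him _ (hc _)).sub (him _ ((((hm _ _).add (hm _ _)).sub (hm _ _)).sub (hm _ _)))
  · exact (hre _ (hc _)).sub (hre _ ((((hm _ _).add (hm _ _)).sub (hm _ _)).sub (hm _ _)))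

/-- The part of `rho` that is quadratic in `z`. -/
def rhoQuad (x : E) : Fin 8 → ℝ := rho (Sum.elim (fun i => x (.inl i)) 0)

/-- The vector `(0, c)` on which the part of `rho` that is linear in `w` takes the value `c`. -/
def lift (c : Fin 8 → ℝ) : E := Sum.elim 0 ![c 0, c 1, c 2 * I, c 3, c 4 * I, c 5, c 6 * I, c 7]

lemma rho_line (p v : E) (t : ℝ) (c : Fin 8 → ℝ) :
    rho (p + t • v + lift c) =
      rho p + t • (rho (p + v) - rho p - rhoQuad v) + t ^ 2 • rhoQuad v + c := by
  ext j
  fin_cases j <;>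
    simp [rho, rhoQuad, lift, onCoords, ← normSq_eq_norm_sq, normSq_apply] <;> ring

lemma hasDerivAt_quadratic {F : Type} [NormedAddCommGroup F] [NormedSpace ℝ F] (a b c : F) :
    HasDerivAt (fun t : ℝ => a + t • b + t ^ 2 • c) b 0 := by
  simpa using (((hasDerivAt_id' (0 : ℝ)).smul_const b).const_add a).fun_add
    ((hasDerivAt_pow 2 (0 : ℝ)).smul_const c)

lemma fderiv_rho (p v : E) : fderiv ℝ rho p v = rho (p + v) - rho p - rhoQuad v := by
  have h1 : HasDerivAt (fun t : ℝ => p + t • v) v 0 := by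
    simpa using ((hasDerivAt_id (0 : ℝ)).smul_const v).const_add p
  have h2 : HasFDerivAt rho (fderiv ℝ rho p) (p + (0 : ℝ) • v) := by
    simpa using (contDiff_rho.differentiable (by norm_num) p).hasFDerivAt
  have h3 := h2.comp_hasDerivAt (0 : ℝ) h1
  have h4 : (rho ∘ fun t : ℝ => p + t • v) = fun t : ℝ =>
      rho p + t • (rho (p + v) - rho p - rhoQuad v) + t ^ 2 • rhoQuad v := by
    funext t
    have := rho_line p v t 0
    have h0 : lift 0 = 0 := by ext (i | i) <;> fin_cases i <;> simp [lift]
    simpa [h0] using this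
  rw [h4] at h3
  have h5 : HasDerivAt (fun t : ℝ => rho p + t • (rho (p + v) - rho p - rhoQuad v)
      + t ^ 2 • rhoQuad v) (rho (p + v) - rho p - rhoQuad v) 0 :=
    hasDerivAt_quadratic _ _ _
  exact h3.unique h5

/-- The eight defining functions have independent differentials, so that `M` is a real submanifold
of dimension `32 - 8 = 24`. -/
lemma fderiv_rho_surjective (p : E) : Function.Surjective (fderiv ℝ rho p) := by
  intro c
  refine ⟨lift c, ?_⟩
  have h0 : rhoQuad (lift c) = 0 := by
    ext j; fin_cases j <;> simp [rhoQuad, rho, lift, onCoords]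
  have h1 : rhoQuad 0 = 0 := by
    ext j; fin_cases j <;> simp [rhoQuad, rho, onCoords]
  have := rho_line p 0 0 c
  simp only [smul_zero, add_zero, sub_self, h1] at this
  rw [fderiv_rho, h0, this]
  simp

/-- At a point of `M`, the tangent space consists of the velocities of the curves in `M`. -/
lemma mem_tangentSpace_iff {p : E} (hp : p ∈ M) (v : E) :
    v ∈ tangentSpace p ↔ ∃ γ : ℝ → E, (∀ t, γ t ∈ M) ∧ γ 0 = p ∧ HasDerivAt γ v 0 := by
  have hker : v ∈ tangentSpace p ↔ fderiv ℝ rho p v = 0 := Iff.rfl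
  have hM : rho p = 0 := hp
  constructor
  · intro hv
    rw [hker, fderiv_rho] at hv
    refine ⟨fun t => p + t • v + t ^ 2 • lift (-rhoQuad v), fun t => ?_, by simp, ?_⟩
    · have hl : t ^ 2 • lift (-rhoQuad v) = lift (t ^ 2 • -rhoQuad v) := by
        ext (i | i) <;> fin_cases i <;> simp [lift, mul_assoc]
      change rho (p + t • v + t ^ 2 • lift (-rhoQuad v)) = 0
      rw [hl, rho_line, hv, hM]
      simp
    · exact hasDerivAt_quadratic p v (lift (-rhoQuad v))
  · rintro ⟨γ, hγ, h0, hd⟩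
    rw [hker]
    have h2 : HasFDerivAt rho (fderiv ℝ rho p) (γ 0) := by
      rw [h0]; exact (contDiff_rho.differentiable (by norm_num) p).hasFDerivAt
    have h3 := h2.comp_hasDerivAt (0 : ℝ) hd
    have h4 : rho ∘ γ = fun _ => 0 := funext hγ
    rw [h4] at h3
    exact h3.unique (hasDerivAt_const _ _)

/-! ### Holomorphic vector fields and the Lie algebra `hol(M)` -/

/-- The holomorphic vector fields `L = ∑ Z_i ∂/∂z_i + ∑ W_j ∂/∂w_j` on `ℂ⁸⁺⁸`, given by their
coefficients `(Z₁, …, Z₈, W₁, …, W₈)`. -/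
def HolVF : Submodule ℝ (E → E) where
  carrier := {L | AnalyticOnNhd ℂ L Set.univ}
  zero_mem' := analyticOnNhd_const
  add_mem' hV hW := hV.add hW
  smul_mem' c V hV := by
    have h : c • V = fun x => (c : ℂ) • V x := by ext x i; simp
    change AnalyticOnNhd ℂ (c • V) Set.univ
    rw [h]
    exact analyticOnNhd_const.smul hV

lemma holVF_analytic (V : HolVF) : AnalyticOnNhd ℂ (V : E → E) Set.univ := V.2

lemma holVF_contDiff (V : HolVF) (n : WithTop ℕ∞) : ContDiff ℂ n (V : E → E) := by
  rw [contDiff_iff_contDiffAt]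
  exact fun x => ((holVF_analytic V) x trivial).contDiffAt

lemma holVF_differentiable (V : HolVF) : Differentiable ℂ (V : E → E) :=
  ((holVF_contDiff V) 1).differentiable (by norm_num)

/-- The bracket of holomorphic vector fields. -/
instance : Bracket HolVF HolVF where
  bracket V W := ⟨lieBracket ℂ (V : E → E) W, by
    change AnalyticOnNhd ℂ _ Set.univ
    have h : ∀ A B : HolVF, AnalyticOnNhd ℂ (fun x => fderiv ℂ (A : E → E) x ((B : E → E) x))
        Set.univ := fun A B x hx =>
      ((ContinuousLinearMap.apply ℂ E).flip.analyticAt_bilinear _).comp₂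
        ((holVF_analytic A).fderiv x hx) ((holVF_analytic B) x hx)
    exact (h W V).sub (h V W)⟩

lemma holVF_coe_bracket (V W : HolVF) : ((⁅V, W⁆ : HolVF) : E → E) = lieBracket ℂ (V : E → E) W := rfl

instance : LieRing HolVF where
  add_lie U V W := by
    ext1; funext x
    exact lieBracket_add_left ((holVF_differentiable U) x) ((holVF_differentiable V) x)
  lie_add U V W := by
    ext1; funext x
    exact lieBracket_add_right ((holVF_differentiable V) x) ((holVF_differentiable W) x)
  lie_self V := by
    ext1
    exact lieBracket_self
  leibniz_lie U V W := by
    ext1; funext x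
    exact leibniz_identity_lieBracket (n := minSmoothness ℂ 2) le_rfl
      ((holVF_contDiff U) _).contDiffAt ((holVF_contDiff V) _).contDiffAt ((holVF_contDiff W) _).contDiffAt

instance : LieAlgebra ℝ HolVF where
  lie_smul c V W := by
    ext1; funext x
    have h : ((c • W : HolVF) : E → E) = (c : ℂ) • (W : E → E) := by ext x i; simp
    change lieBracket ℂ (V : E → E) ((c • W : HolVF) : E → E) x
      = (c • lieBracket ℂ (V : E → E) W) x
    rw [h, lieBracket_const_smul_right ((holVF_differentiable W) x)]
    ext i; simp

/-- The real vector field `L + L̄` is tangent to `M` at all points of the set `S`.  Its value at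
`p`, read in `ℂ⁸⁺⁸`, is the vector of the coefficients of `L` at `p`. -/
def TangentOn (L : E → E) (S : Set E) : Prop := ∀ p ∈ S, L p ∈ tangentSpace p

lemma TangentOn.bracket {V W : HolVF} (hV : TangentOn V M) (hW : TangentOn W M) :
    TangentOn (⁅V, W⁆ : HolVF) M := by
  have key : ∀ A B : HolVF, TangentOn A M → TangentOn B M → ∀ p ∈ M,
      fderiv ℝ (fun x => fderiv ℝ rho x ((A : E → E) x)) p ((B : E → E) p) = 0 := by
    intro A B hA hB p hp
    obtain ⟨γ, hγ, h0, hd⟩ := (mem_tangentSpace_iff hp _).1 (hB p hp)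
    have hdiff : DifferentiableAt ℝ (fun x => fderiv ℝ rho x ((A : E → E) x)) p :=
      ((contDiff_rho.fderiv_right (m := 1) (by norm_num)).differentiable (by norm_num) p).clm_apply
        (((holVF_differentiable A) p).restrictScalars ℝ)
    have h2 := hdiff.hasFDerivAt
    rw [← h0] at h2
    have h3 := h2.comp_hasDerivAt (0 : ℝ) hd
    have h4 : ((fun x => fderiv ℝ rho x ((A : E → E) x)) ∘ γ) = fun _ => 0 :=
      funext fun t => hA _ (hγ t)
    rw [h4] at h3
    have h5 := h3.unique (hasDerivAt_const _ _)
    rwa [h0] at h5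
  intro p hp
  have hb : ((⁅V, W⁆ : HolVF) : E → E) p = lieBracket ℝ (V : E → E) W p := by
    rw [holVF_coe_bracket, lieBracket_eq, lieBracket_eq]
    simp only [((holVF_differentiable W) p).fderiv_restrictScalars ℝ,
      ((holVF_differentiable V) p).fderiv_restrictScalars ℝ]
    rfl
  change fderiv ℝ rho p (((⁅V, W⁆ : HolVF) : E → E) p) = 0
  rw [hb, fderiv_apply_lieBracket contDiff_rho.contDiffAt (by simp)
    (((holVF_differentiable W) p).restrictScalars ℝ) (((holVF_differentiable V) p).restrictScalars ℝ),
    key W V hW hV p hp, key V W hV hW p hp, sub_zero]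

/-- The real Lie algebra `hol(M)` of the holomorphic vector fields `L` such that `L + L̄` is tangent
to `M` along `M`. -/
def hol : LieSubalgebra ℝ HolVF where
  carrier := {L | TangentOn L M}
  zero_mem' := fun p _ => (tangentSpace p).zero_mem
  add_mem' hV hW := fun p hp => (tangentSpace p).add_mem (hV p hp) (hW p hp)
  smul_mem' c _ hV := fun p hp => (tangentSpace p).smul_mem c (hV p hp)
  lie_mem' hV hW := TangentOn.bracket hV hW

/-! ### The grading -/

/-- The weights `[z_i] = 1` and `[w_j] = 2`. -/
def wt : Coord → ℤ := Sum.elim (fun _ => 1) (fun _ => 2)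

/-- A vector field of constant weight `k` (where `[∂/∂z_i] = -1` and `[∂/∂w_j] = -2`): the
coefficients are polynomials, those of `∂/∂z_i` weighted homogeneous of weight `k + 1` and those of
`∂/∂w_j` weighted homogeneous of weight `k + 2`. -/
def HasWeight (L : E → E) (k : ℤ) : Prop :=
  ∃ P : Coord → MvPolynomial Coord ℂ,
    (∀ a, IsWeightedHomogeneous wt (P a) (k + wt a)) ∧ ∀ x a, L x a = eval x (P a)

/-- The graded piece `𝔤_k` of `hol(M)`. -/
def gradedPiece (k : ℤ) : Submodule ℝ hol where
  carrier := {L | HasWeight L.1.1 k}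
  zero_mem' := ⟨0, fun _ => isWeightedHomogeneous_zero ℂ wt _, fun x a => by simp⟩
  add_mem' := by
    rintro V W ⟨P, hP, hV⟩ ⟨Q, hQ, hW⟩
    exact ⟨P + Q, fun a => (hP a).add (hQ a), fun x a => by simp [← hV, ← hW]⟩
  smul_mem' := by
    rintro c V ⟨P, hP, hV⟩
    refine ⟨fun a => MvPolynomial.C (c : ℂ) * P a, fun a => ?_, fun x a => by simp [← hV]⟩
    simpa using (isWeightedHomogeneous_C wt (c : ℂ)).mul (hP a)

/-! ### The explicit generators -/

/-- The vector fields with the given coefficients, the first entry of a pair listing those of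
`∂/∂z₁, …, ∂/∂z₈` and the second those of `∂/∂w₁, …, ∂/∂w₈`. -/
def ofCoords {n : ℕ} (F : ℂ → ℂ → ℂ → ℂ → ℂ → ℂ → ℂ → ℂ → ℂ → ℂ → ℂ → ℂ → ℂ → ℂ → ℂ → ℂ →
    Fin n → (Fin 8 → ℂ) × (Fin 8 → ℂ)) (i : Fin n) (x : E) : E :=
  Sum.elim (onCoords F x i).1 (onCoords F x i).2

/-- The 8 generators of weight -2, in the order
`Lw3^(-2)`, `Lw5^(-2)`, `Lw7^(-2)`, `ILw1^(-2)`, `ILw2^(-2)`, `ILw4^(-2)`, `ILw6^(-2)`,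
`ILw8^(-2)`. -/
def genNegTwo : Fin 8 → E → E :=
  ofCoords fun z1 z2 z3 z4 z5 z6 z7 z8 w1 w2 w3 w4 w5 w6 w7 w8 => ![
    (![0, 0, 0, 0, 0, 0, 0, 0],
      ![0, 0, 1, 0, 0, 0, 0, 0]),
    (![0, 0, 0, 0, 0, 0, 0, 0],
      ![0, 0, 0, 0, 1, 0, 0, 0]),
    (![0, 0, 0, 0, 0, 0, 0, 0],
      ![0, 0, 0, 0, 0, 0, 1, 0]),
    I • (![0, 0, 0, 0, 0, 0, 0, 0],
      ![1, 0, 0, 0, 0, 0, 0, 0]),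
    I • (![0, 0, 0, 0, 0, 0, 0, 0],
      ![0, 1, 0, 0, 0, 0, 0, 0]),
    I • (![0, 0, 0, 0, 0, 0, 0, 0],
      ![0, 0, 0, 1, 0, 0, 0, 0]),
    I • (![0, 0, 0, 0, 0, 0, 0, 0],
      ![0, 0, 0, 0, 0, 1, 0, 0]),
    I • (![0, 0, 0, 0, 0, 0, 0, 0],
      ![0, 0, 0, 0, 0, 0, 0, 1])]

/-- The 16 generators of weight -1, in the order
`Lz1^(-1)`, `Lz2^(-1)`, `Lz3^(-1)`, `Lz4^(-1)`, `Lz5^(-1)`, `Lz6^(-1)`, `Lz7^(-1)`, `Lz8^(-1)`,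
`ILz1^(-1)`, `ILz2^(-1)`, `ILz3^(-1)`, `ILz4^(-1)`, `ILz5^(-1)`, `ILz6^(-1)`, `ILz7^(-1)`,
`ILz8^(-1)`. -/
def genNegOne : Fin 16 → E → E :=
  ofCoords fun z1 z2 z3 z4 z5 z6 z7 z8 w1 w2 w3 w4 w5 w6 w7 w8 => ![
    (![1, 0, 0, 0, 0, 0, 0, 0],
      ![z1, 0, -z7, z7, -z6, z6, -z5, -z5]),
    (![0, 1, 0, 0, 0, 0, 0, 0],
      ![z2, 0, -z8, z8, z5, z5, -z6, z6]),
    (![0, 0, 1, 0, 0, 0, 0, 0],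
      ![z3, 0, z5, z5, z8, -z8, -z7, z7]),
    (![0, 0, 0, 1, 0, 0, 0, 0],
      ![z4, 0, z6, z6, -z7, -z7, -z8, -z8]),
    (![0, 0, 0, 0, 1, 0, 0, 0],
      ![0, z5, -z3, z3, -z2, z2, z1, -z1]),
    (![0, 0, 0, 0, 0, 1, 0, 0],
      ![0, z6, -z4, z4, z1, z1, z2, z2]),
    (![0, 0, 0, 0, 0, 0, 1, 0],
      ![0, z7, z1, z1, z4, -z4, z3, z3]),
    (![0, 0, 0, 0, 0, 0, 0, 1],
      ![0, z8, z2, z2, -z3, -z3, z4, -z4]),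
    I • (![1, 0, 0, 0, 0, 0, 0, 0],
      ![-z1, 0, z7, -z7, z6, -z6, z5, z5]),
    I • (![0, 1, 0, 0, 0, 0, 0, 0],
      ![-z2, 0, z8, -z8, -z5, -z5, z6, -z6]),
    I • (![0, 0, 1, 0, 0, 0, 0, 0],
      ![-z3, 0, -z5, -z5, -z8, z8, z7, -z7]),
    I • (![0, 0, 0, 1, 0, 0, 0, 0],
      ![-z4, 0, -z6, -z6, z7, z7, z8, z8]),
    I • (![0, 0, 0, 0, 1, 0, 0, 0],
      ![0, -z5, z3, -z3, z2, -z2, -z1, z1]),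
    I • (![0, 0, 0, 0, 0, 1, 0, 0],
      ![0, -z6, z4, -z4, -z1, -z1, -z2, -z2]),
    I • (![0, 0, 0, 0, 0, 0, 1, 0],
      ![0, -z7, -z1, -z1, -z4, z4, -z3, -z3]),
    I • (![0, 0, 0, 0, 0, 0, 0, 1],
      ![0, -z8, -z2, -z2, z3, z3, -z4, z4])]

/-- The 30 generators of weight 0, in the order
`L1^0`, `L2^0`, `L3^0`, `L4^0`, `L5^0`, `L6^0`, `L7^0`, `L8^0`, `L9^0`, `L10^0`, `L11^0`, `L12^0`,
`L13^0`, `L14^0`, `IL1^0`, `IL2^0`, `IL3^0`, `IL4^0`, `IL5^0`, `IL6^0`, `IL7^0`, `IL8^0`, `IL9^0`,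
`IL10^0`, `IL11^0`, `IL12^0`, `IL13^0`, `IL14^0`, `IL15^0`, `IL16^0`. -/
def genZero : Fin 30 → E → E :=
  ofCoords fun z1 z2 z3 z4 z5 z6 z7 z8 w1 w2 w3 w4 w5 w6 w7 w8 => ![
    (![z7, z8, z5, z6, 0, 0, 0, 0],
      ![w4, 0, 0, 2*w2, 0, 0, 0, 0]),
    (![z6, z5, -z8, -z7, 0, 0, 0, 0],
      ![w6, 0, 0, 0, 0, 2*w2, 0, 0]),
    (![-z5, z6, z7, -z8, 0, 0, 0, 0],
      ![w8, 0, 0, 0, 0, 0, 0, 2*w2]),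
    (![0, 0, 0, 0, z3, z4, z1, z2],
      ![0, w4, 0, 2*w1, 0, 0, 0, 0]),
    (![0, 0, 0, 0, z2, z1, -z4, -z3],
      ![0, w6, 0, 0, 0, 2*w1, 0, 0]),
    (![0, 0, 0, 0, -z1, z2, z3, -z4],
      ![0, w8, 0, 0, 0, 0, 0, 2*w1]),
    (![z1, z2, z3, z4, 0, 0, 0, 0],
      ![2*w1, 0, w3, w4, w5, w6, w7, w8]),
    (![z4, 0, 0, -z1, z8, 0, 0, -z5],
      ![0, 0, w5, -w6, -w3, w4, 0, 0]),
    (![0, 0, -z4, z3, -z6, z5, 0, 0],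
      ![0, 0, 0, 0, w7, -w8, -w5, w6]),
    (![0, z3, -z2, 0, 0, z7, -z6, 0],
      ![0, 0, -w5, -w6, w3, w4, 0, 0]),
    (![0, z4, 0, -z2, -z7, 0, z5, 0],
      ![0, 0, w7, -w8, 0, 0, -w3, w4]),
    (![z3, 0, -z1, 0, 0, -z8, 0, z6],
      ![0, 0, w7, w8, 0, 0, -w3, -w4]),
    (![-z2, z1, 0, 0, 0, 0, -z8, z7],
      ![0, 0, 0, 0, -w7, -w8, w5, w6]),
    (![0, 0, 0, 0, z5, z6, z7, z8],
      ![0, 2*w2, w3, w4, w5, w6, w7, w8]),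
    I • (![z7, z8, -z5, -z6, 0, 0, 0, 0],
      ![-w3, 0, 2*w2, 0, 0, 0, 0, 0]),
    I • (![z6, -z5, -z8, z7, 0, 0, 0, 0],
      ![-w5, 0, 0, 0, 2*w2, 0, 0, 0]),
    I • (![z5, z6, z7, z8, 0, 0, 0, 0],
      ![-w7, 0, 0, 0, 0, 0, 2*w2, 0]),
    I • (![0, 0, 0, 0, z3, z4, -z1, -z2],
      ![0, -w3, 2*w1, 0, 0, 0, 0, 0]),
    I • (![0, 0, 0, 0, z2, -z1, -z4, z3],
      ![0, -w5, 0, 0, 2*w1, 0, 0, 0]),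
    I • (![0, 0, 0, 0, z1, z2, z3, z4],
      ![0, w7, 0, 0, 0, 0, -2*w1, 0]),
    I • (![z1, 0, 0, -z4, z5, 0, 0, -z8],
      ![0, 0, w4, w3, w6, w5, 0, 0]),
    I • (![0, z2, 0, z4, 0, z6, 0, z8],
      ![0, 0, 0, 0, -w6, -w5, 0, 0]),
    I • (![0, 0, z3, -z4, z5, -z6, 0, 0],
      ![0, 0, 0, 0, w6, w5, w8, w7]),
    I • (![0, 0, z4, z3, z6, z5, 0, 0],
      ![0, 0, 0, 0, w8, -w7, -w6, w5]),
    I • (![0, z4, 0, z2, -z7, 0, -z5, 0],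
      ![0, 0, -w8, w7, 0, 0, w4, -w3]),
    I • (![z4, 0, 0, z1, z8, 0, 0, z5],
      ![0, 0, -w6, w5, w4, -w3, 0, 0]),
    I • (![z3, 0, z1, 0, 0, -z8, 0, -z6],
      ![0, 0, w8, w7, 0, 0, w4, w3]),
    I • (![0, z3, z2, 0, 0, z7, z6, 0],
      ![0, 0, -w6, -w5, -w4, -w3, 0, 0]),
    I • (![0, 0, 0, 2*z4, -z5, z6, z7, z8],
      ![0, 0, -w4, -w3, -w6, -w5, -w8, -w7]),
    I • (![z2, z1, 0, 0, 0, 0, z8, z7],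
      ![0, 0, 0, 0, w8, w7, w6, w5])]

/-- The 16 generators of weight 1, in the order
`Lz1z1^1`, `Lz2z2^1`, `Lz3z3^1`, `Lz4z4^1`, `Lz5z5^1`, `Lz6z6^1`, `Lz7z7^1`, `Lz8z8^1`,
`ILz1z1^1`, `ILz2z2^1`, `ILz3z3^1`, `ILz4z4^1`, `ILz5z5^1`, `ILz6z6^1`, `ILz7z7^1`, `ILz8z8^1`. -/
def genOne : Fin 16 → E → E :=
  ofCoords fun z1 z2 z3 z4 z5 z6 z7 z8 w1 w2 w3 w4 w5 w6 w7 w8 => ![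
    (![-(-2*z1^2 + 2*w1), 2*z1*z2, 2*z1*z3, 2*z1*z4, 2*z1*z5 + w7 + w8, 2*z1*z6 + w5 - w6,
        2*z1*z7 + w3 - w4, 2*z2*z7 - 2*z3*z6 + 2*z4*z5],
      ![2*z1*w1, w3*z7 + w4*z7 + w5*z6 + w6*z6 + w7*z5 - w8*z5,
        -(2*w1*z7 - w3*z1 - w4*z1 + w5*z4 + w6*z4 + w7*z3 - w8*z3),
        2*w1*z7 + w3*z1 + w4*z1 + w5*z4 + w6*z4 + w7*z3 - w8*z3,
        -(2*w1*z6 - w3*z4 - w4*z4 - w5*z1 - w6*z1 + w7*z2 - w8*z2),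
        2*w1*z6 - w3*z4 - w4*z4 + w5*z1 + w6*z1 + w7*z2 - w8*z2,
        -(2*w1*z5 - w3*z3 - w4*z3 - w5*z2 - w6*z2 - w7*z1 + w8*z1),
        -(2*w1*z5 - w3*z3 - w4*z3 - w5*z2 - w6*z2 + w7*z1 - w8*z1)]),
    (![2*z1*z2, -(-2*z2^2 + 2*w1), 2*z2*z3, 2*z2*z4, -(-2*z2*z5 + w5 + w6), 2*z2*z6 + w7 - w8,
        2*z1*z8 + 2*z3*z6 - 2*z4*z5, 2*z2*z8 + w3 - w4],
      ![2*z2*w1, w3*z8 + w4*z8 - w5*z5 + w6*z5 + w7*z6 + w8*z6,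
        -(2*w1*z8 - w3*z2 - w4*z2 - w5*z3 + w6*z3 + w7*z4 + w8*z4),
        2*w1*z8 + w3*z2 + w4*z2 - w5*z3 + w6*z3 + w7*z4 + w8*z4,
        2*w1*z5 - w3*z3 - w4*z3 + w5*z2 - w6*z2 + w7*z1 + w8*z1,
        2*w1*z5 - w3*z3 - w4*z3 - w5*z2 + w6*z2 + w7*z1 + w8*z1,
        -(2*w1*z6 - w3*z4 - w4*z4 + w5*z1 - w6*z1 - w7*z2 - w8*z2),
        2*w1*z6 - w3*z4 - w4*z4 + w5*z1 - w6*z1 + w7*z2 + w8*z2]),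
    (![2*z1*z3, 2*z2*z3, -(-2*z3^2 + 2*w1), 2*z3*z4, -(-2*z3*z5 + w3 + w4),
        -(2*z1*z8 - 2*z2*z7 - 2*z4*z5), 2*z3*z7 + w7 - w8, -(-2*z3*z8 + w5 - w6)],
      ![2*z3*w1, -(w3*z5 - w4*z5 + w5*z8 + w6*z8 - w7*z7 - w8*z7),
        2*w1*z5 + w3*z3 - w4*z3 - w5*z2 - w6*z2 + w7*z1 + w8*z1,
        2*w1*z5 - w3*z3 + w4*z3 - w5*z2 - w6*z2 + w7*z1 + w8*z1,
        2*w1*z8 + w3*z2 - w4*z2 + w5*z3 + w6*z3 + w7*z4 + w8*z4,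
        -(2*w1*z8 + w3*z2 - w4*z2 - w5*z3 - w6*z3 + w7*z4 + w8*z4),
        -(2*w1*z7 + w3*z1 - w4*z1 + w5*z4 + w6*z4 - w7*z3 - w8*z3),
        2*w1*z7 + w3*z1 - w4*z1 + w5*z4 + w6*z4 + w7*z3 + w8*z3]),
    (![2*z1*z4, 2*z2*z4, 2*z3*z4, -(-2*z4^2 + 2*w1), 2*z1*z8 - 2*z2*z7 + 2*z3*z6,
        -(-2*z4*z6 + w3 + w4), 2*z4*z7 + w5 + w6, 2*z4*z8 + w7 + w8],
      ![2*z4*w1, -(w3*z6 - w4*z6 - w5*z7 + w6*z7 - w7*z8 + w8*z8),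
        2*w1*z6 + w3*z4 - w4*z4 + w5*z1 - w6*z1 + w7*z2 - w8*z2,
        2*w1*z6 - w3*z4 + w4*z4 + w5*z1 - w6*z1 + w7*z2 - w8*z2,
        -(2*w1*z7 + w3*z1 - w4*z1 - w5*z4 + w6*z4 + w7*z3 - w8*z3),
        -(2*w1*z7 + w3*z1 - w4*z1 + w5*z4 - w6*z4 + w7*z3 - w8*z3),
        -(2*w1*z8 + w3*z2 - w4*z2 - w5*z3 + w6*z3 - w7*z4 + w8*z4),
        -(2*w1*z8 + w3*z2 - w4*z2 - w5*z3 + w6*z3 + w7*z4 - w8*z4)]),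
    (![-(-2*z1*z5 + w7 - w8), 2*z2*z5 + w5 - w6, 2*z3*z5 + w3 - w4, 2*z1*z8 - 2*z2*z7 + 2*z3*z6,
        -(-2*z5^2 + 2*w2), 2*z5*z6, 2*z5*z7, 2*z5*z8],
      ![w3*z3 + w4*z3 + w5*z2 + w6*z2 - w7*z1 - w8*z1, 2*w2*z5,
        -(2*w2*z3 - w3*z5 - w4*z5 + w5*z8 + w6*z8 - w7*z7 - w8*z7),
        2*w2*z3 + w3*z5 + w4*z5 + w5*z8 + w6*z8 - w7*z7 - w8*z7,
        -(2*w2*z2 - w3*z8 - w4*z8 - w5*z5 - w6*z5 - w7*z6 - w8*z6),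
        2*w2*z2 - w3*z8 - w4*z8 + w5*z5 + w6*z5 - w7*z6 - w8*z6,
        2*w2*z1 - w3*z7 - w4*z7 - w5*z6 - w6*z6 + w7*z5 + w8*z5,
        -(2*w2*z1 - w3*z7 - w4*z7 - w5*z6 - w6*z6 - w7*z5 - w8*z5)]),
    (![-(-2*z1*z6 + w5 + w6), -(-2*z2*z6 + w7 + w8), -(2*z1*z8 - 2*z2*z7 - 2*z4*z5),
        2*z4*z6 + w3 - w4, 2*z5*z6, -(-2*z6^2 + 2*w2), 2*z6*z7, 2*z6*z8],
      ![w3*z4 + w4*z4 - w5*z1 + w6*z1 - w7*z2 + w8*z2, 2*w2*z6,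
        -(2*w2*z4 - w3*z6 - w4*z6 - w5*z7 + w6*z7 - w7*z8 + w8*z8),
        2*w2*z4 + w3*z6 + w4*z6 - w5*z7 + w6*z7 - w7*z8 + w8*z8,
        2*w2*z1 - w3*z7 - w4*z7 + w5*z6 - w6*z6 - w7*z5 + w8*z5,
        2*w2*z1 - w3*z7 - w4*z7 - w5*z6 + w6*z6 - w7*z5 + w8*z5,
        2*w2*z2 - w3*z8 - w4*z8 + w5*z5 - w6*z5 + w7*z6 - w8*z6,
        2*w2*z2 - w3*z8 - w4*z8 + w5*z5 - w6*z5 - w7*z6 + w8*z6]),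
    (![-(-2*z1*z7 + w3 + w4), 2*z1*z8 + 2*z3*z6 - 2*z4*z5, -(-2*z3*z7 + w7 + w8),
        -(-2*z4*z7 + w5 - w6), 2*z5*z7, 2*z6*z7, -(-2*z7^2 + 2*w2), 2*z7*z8],
      ![-(w3*z1 - w4*z1 + w5*z4 + w6*z4 + w7*z3 - w8*z3), 2*w2*z7,
        2*w2*z1 + w3*z7 - w4*z7 - w5*z6 - w6*z6 - w7*z5 + w8*z5,
        2*w2*z1 - w3*z7 + w4*z7 - w5*z6 - w6*z6 - w7*z5 + w8*z5,
        2*w2*z4 + w3*z6 - w4*z6 + w5*z7 + w6*z7 - w7*z8 + w8*z8,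
        -(2*w2*z4 + w3*z6 - w4*z6 - w5*z7 - w6*z7 - w7*z8 + w8*z8),
        2*w2*z3 + w3*z5 - w4*z5 + w5*z8 + w6*z8 + w7*z7 - w8*z7,
        2*w2*z3 + w3*z5 - w4*z5 + w5*z8 + w6*z8 - w7*z7 + w8*z7]),
    (![2*z2*z7 - 2*z3*z6 + 2*z4*z5, -(-2*z2*z8 + w3 + w4), 2*z3*z8 + w5 + w6,
        -(-2*z4*z8 + w7 - w8), 2*z5*z8, 2*z6*z8, 2*z7*z8, -(-2*z8^2 + 2*w2)],
      ![-(w3*z2 - w4*z2 - w5*z3 + w6*z3 + w7*z4 + w8*z4), 2*w2*z8,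
        2*w2*z2 + w3*z8 - w4*z8 + w5*z5 - w6*z5 - w7*z6 - w8*z6,
        2*w2*z2 - w3*z8 + w4*z8 + w5*z5 - w6*z5 - w7*z6 - w8*z6,
        -(2*w2*z3 + w3*z5 - w4*z5 - w5*z8 + w6*z8 - w7*z7 - w8*z7),
        -(2*w2*z3 + w3*z5 - w4*z5 + w5*z8 - w6*z8 - w7*z7 - w8*z7),
        2*w2*z4 + w3*z6 - w4*z6 - w5*z7 + w6*z7 + w7*z8 + w8*z8,
        -(2*w2*z4 + w3*z6 - w4*z6 - w5*z7 + w6*z7 - w7*z8 - w8*z8)]),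
    I • (![2*z1^2 + 2*w1, 2*z1*z2, 2*z1*z3, 2*z1*z4, -(-2*z1*z5 + w7 + w8), -(-2*z1*z6 + w5 - w6),
        -(-2*z1*z7 + w3 - w4), 2*z2*z7 - 2*z3*z6 + 2*z4*z5],
      ![2*z1*w1, w3*z7 + w4*z7 + w5*z6 + w6*z6 + w7*z5 - w8*z5,
        -(2*w1*z7 - w3*z1 - w4*z1 + w5*z4 + w6*z4 + w7*z3 - w8*z3),
        2*w1*z7 + w3*z1 + w4*z1 + w5*z4 + w6*z4 + w7*z3 - w8*z3,
        -(2*w1*z6 - w3*z4 - w4*z4 - w5*z1 - w6*z1 + w7*z2 - w8*z2),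
        2*w1*z6 - w3*z4 - w4*z4 + w5*z1 + w6*z1 + w7*z2 - w8*z2,
        -(2*w1*z5 - w3*z3 - w4*z3 - w5*z2 - w6*z2 - w7*z1 + w8*z1),
        -(2*w1*z5 - w3*z3 - w4*z3 - w5*z2 - w6*z2 + w7*z1 - w8*z1)]),
    I • (![2*z1*z2, 2*z2^2 + 2*w1, 2*z2*z3, 2*z2*z4, 2*z2*z5 + w5 + w6, -(-2*z2*z6 + w7 - w8),
        2*z1*z8 + 2*z3*z6 - 2*z4*z5, -(-2*z2*z8 + w3 - w4)],
      ![2*z2*w1, w3*z8 + w4*z8 - w5*z5 + w6*z5 + w7*z6 + w8*z6,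
        -(2*w1*z8 - w3*z2 - w4*z2 - w5*z3 + w6*z3 + w7*z4 + w8*z4),
        2*w1*z8 + w3*z2 + w4*z2 - w5*z3 + w6*z3 + w7*z4 + w8*z4,
        2*w1*z5 - w3*z3 - w4*z3 + w5*z2 - w6*z2 + w7*z1 + w8*z1,
        2*w1*z5 - w3*z3 - w4*z3 - w5*z2 + w6*z2 + w7*z1 + w8*z1,
        -(2*w1*z6 - w3*z4 - w4*z4 + w5*z1 - w6*z1 - w7*z2 - w8*z2),
        2*w1*z6 - w3*z4 - w4*z4 + w5*z1 - w6*z1 + w7*z2 + w8*z2]),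
    I • (![2*z1*z3, 2*z2*z3, 2*z3^2 + 2*w1, 2*z3*z4, 2*z3*z5 + w3 + w4,
        -(2*z1*z8 - 2*z2*z7 - 2*z4*z5), -(-2*z3*z7 + w7 - w8), 2*z3*z8 + w5 - w6],
      ![2*z3*w1, -(w3*z5 - w4*z5 + w5*z8 + w6*z8 - w7*z7 - w8*z7),
        2*w1*z5 + w3*z3 - w4*z3 - w5*z2 - w6*z2 + w7*z1 + w8*z1,
        2*w1*z5 - w3*z3 + w4*z3 - w5*z2 - w6*z2 + w7*z1 + w8*z1,
        2*w1*z8 + w3*z2 - w4*z2 + w5*z3 + w6*z3 + w7*z4 + w8*z4,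
        -(2*w1*z8 + w3*z2 - w4*z2 - w5*z3 - w6*z3 + w7*z4 + w8*z4),
        -(2*w1*z7 + w3*z1 - w4*z1 + w5*z4 + w6*z4 - w7*z3 - w8*z3),
        2*w1*z7 + w3*z1 - w4*z1 + w5*z4 + w6*z4 + w7*z3 + w8*z3]),
    I • (![2*z1*z4, 2*z2*z4, 2*z3*z4, 2*z4^2 + 2*w1, 2*z1*z8 - 2*z2*z7 + 2*z3*z6, 2*z4*z6 + w3 + w4,
        -(-2*z4*z7 + w5 + w6), -(-2*z4*z8 + w7 + w8)],
      ![2*z4*w1, -(w3*z6 - w4*z6 - w5*z7 + w6*z7 - w7*z8 + w8*z8),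
        2*w1*z6 + w3*z4 - w4*z4 + w5*z1 - w6*z1 + w7*z2 - w8*z2,
        2*w1*z6 - w3*z4 + w4*z4 + w5*z1 - w6*z1 + w7*z2 - w8*z2,
        -(2*w1*z7 + w3*z1 - w4*z1 - w5*z4 + w6*z4 + w7*z3 - w8*z3),
        -(2*w1*z7 + w3*z1 - w4*z1 + w5*z4 - w6*z4 + w7*z3 - w8*z3),
        -(2*w1*z8 + w3*z2 - w4*z2 - w5*z3 + w6*z3 - w7*z4 + w8*z4),
        -(2*w1*z8 + w3*z2 - w4*z2 - w5*z3 + w6*z3 + w7*z4 - w8*z4)]),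
    I • (![2*z1*z5 + w7 - w8, -(-2*z2*z5 + w5 - w6), -(-2*z3*z5 + w3 - w4),
        2*z1*z8 - 2*z2*z7 + 2*z3*z6, 2*z5^2 + 2*w2, 2*z5*z6, 2*z5*z7, 2*z5*z8],
      ![w3*z3 + w4*z3 + w5*z2 + w6*z2 - w7*z1 - w8*z1, 2*z5*w2,
        -(2*w2*z3 - w3*z5 - w4*z5 + w5*z8 + w6*z8 - w7*z7 - w8*z7),
        2*w2*z3 + w3*z5 + w4*z5 + w5*z8 + w6*z8 - w7*z7 - w8*z7,
        -(2*w2*z2 - w3*z8 - w4*z8 - w5*z5 - w6*z5 - w7*z6 - w8*z6),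
        2*w2*z2 - w3*z8 - w4*z8 + w5*z5 + w6*z5 - w7*z6 - w8*z6,
        2*w2*z1 - w3*z7 - w4*z7 - w5*z6 - w6*z6 + w7*z5 + w8*z5,
        -(2*w2*z1 - w3*z7 - w4*z7 - w5*z6 - w6*z6 - w7*z5 - w8*z5)]),
    I • (![2*z1*z6 + w5 + w6, 2*z2*z6 + w7 + w8, -(2*z1*z8 - 2*z2*z7 - 2*z4*z5),
        -(-2*z4*z6 + w3 - w4), 2*z5*z6, 2*z6^2 + 2*w2, 2*z6*z7, 2*z6*z8],
      ![w3*z4 + w4*z4 - w5*z1 + w6*z1 - w7*z2 + w8*z2, 2*z6*w2,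
        -(2*w2*z4 - w3*z6 - w4*z6 - w5*z7 + w6*z7 - w7*z8 + w8*z8),
        2*w2*z4 + w3*z6 + w4*z6 - w5*z7 + w6*z7 - w7*z8 + w8*z8,
        2*w2*z1 - w3*z7 - w4*z7 + w5*z6 - w6*z6 - w7*z5 + w8*z5,
        2*w2*z1 - w3*z7 - w4*z7 - w5*z6 + w6*z6 - w7*z5 + w8*z5,
        2*w2*z2 - w3*z8 - w4*z8 + w5*z5 - w6*z5 + w7*z6 - w8*z6,
        2*w2*z2 - w3*z8 - w4*z8 + w5*z5 - w6*z5 - w7*z6 + w8*z6]),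
    I • (![2*z1*z7 + w3 + w4, 2*z1*z8 + 2*z3*z6 - 2*z4*z5, 2*z3*z7 + w7 + w8, 2*z4*z7 + w5 - w6,
        2*z5*z7, 2*z6*z7, 2*z7^2 + 2*w2, 2*z7*z8],
      ![-(w3*z1 - w4*z1 + w5*z4 + w6*z4 + w7*z3 - w8*z3), 2*z7*w2,
        2*w2*z1 + w3*z7 - w4*z7 - w5*z6 - w6*z6 - w7*z5 + w8*z5,
        2*w2*z1 - w3*z7 + w4*z7 - w5*z6 - w6*z6 - w7*z5 + w8*z5,
        2*w2*z4 + w3*z6 - w4*z6 + w5*z7 + w6*z7 - w7*z8 + w8*z8,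
        -(2*w2*z4 + w3*z6 - w4*z6 - w5*z7 - w6*z7 - w7*z8 + w8*z8),
        2*w2*z3 + w3*z5 - w4*z5 + w5*z8 + w6*z8 + w7*z7 - w8*z7,
        2*w2*z3 + w3*z5 - w4*z5 + w5*z8 + w6*z8 - w7*z7 + w8*z7]),
    I • (![2*z2*z7 - 2*z3*z6 + 2*z4*z5, 2*z2*z8 + w3 + w4, -(-2*z3*z8 + w5 + w6), 2*z4*z8 + w7 - w8,
        2*z5*z8, 2*z6*z8, 2*z7*z8, 2*z8^2 + 2*w2],
      ![-(w3*z2 - w4*z2 - w5*z3 + w6*z3 + w7*z4 + w8*z4), 2*z8*w2,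
        2*w2*z2 + w3*z8 - w4*z8 + w5*z5 - w6*z5 - w7*z6 - w8*z6,
        2*w2*z2 - w3*z8 + w4*z8 + w5*z5 - w6*z5 - w7*z6 - w8*z6,
        -(2*w2*z3 + w3*z5 - w4*z5 - w5*z8 + w6*z8 - w7*z7 - w8*z7),
        -(2*w2*z3 + w3*z5 - w4*z5 + w5*z8 - w6*z8 - w7*z7 - w8*z7),
        2*w2*z4 + w3*z6 - w4*z6 - w5*z7 + w6*z7 + w7*z8 + w8*z8,
        -(2*w2*z4 + w3*z6 - w4*z6 - w5*z7 + w6*z7 - w7*z8 - w8*z8)])]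

/-- The 8 generators of weight 2, in the order
`Lw3w3^2`, `Lw5w5^2`, `Lw7w7^2`, `ILw1w1^2`, `ILw2w2^2`, `ILw4w4^2`, `ILw6w6^2`, `ILw8w8^2`. -/
def genTwo : Fin 8 → E → E :=
  ofCoords fun z1 z2 z3 z4 z5 z6 z7 z8 w1 w2 w3 w4 w5 w6 w7 w8 => ![
    (![2*w1*z7 - w3*z1 - w4*z1 + w5*z4 + w6*z4 + w7*z3 - w8*z3,
        2*w1*z8 - w3*z2 - w4*z2 - w5*z3 + w6*z3 + w7*z4 + w8*z4,
        -(2*w1*z5 + w3*z3 - w4*z3 - w5*z2 - w6*z2 + w7*z1 + w8*z1),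
        -(2*w1*z6 + w3*z4 - w4*z4 + w5*z1 - w6*z1 + w7*z2 - w8*z2),
        2*w2*z3 - w3*z5 - w4*z5 + w5*z8 + w6*z8 - w7*z7 - w8*z7,
        2*w2*z4 - w3*z6 - w4*z6 - w5*z7 + w6*z7 - w7*z8 + w8*z8,
        -(2*w2*z1 + w3*z7 - w4*z7 - w5*z6 - w6*z6 - w7*z5 + w8*z5),
        -(2*w2*z2 + w3*z8 - w4*z8 + w5*z5 - w6*z5 - w7*z6 - w8*z6)],
      ![-2*w1*w3, -2*w2*w3, 4*w1*w2 - w3^2 - w4^2 + w5^2 - w6^2 + w7^2 - w8^2, -2*w3*w4,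
        -2*w3*w5, -2*w3*w6, -2*w3*w7, -2*w3*w8]),
    (![2*w1*z6 - w3*z4 - w4*z4 - w5*z1 - w6*z1 + w7*z2 - w8*z2,
        -(2*w1*z5 - w3*z3 - w4*z3 + w5*z2 - w6*z2 + w7*z1 + w8*z1),
        -(2*w1*z8 + w3*z2 - w4*z2 + w5*z3 + w6*z3 + w7*z4 + w8*z4),
        2*w1*z7 + w3*z1 - w4*z1 - w5*z4 + w6*z4 + w7*z3 - w8*z3,
        2*w2*z2 - w3*z8 - w4*z8 - w5*z5 - w6*z5 - w7*z6 - w8*z6,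
        -(2*w2*z1 - w3*z7 - w4*z7 + w5*z6 - w6*z6 - w7*z5 + w8*z5),
        -(2*w2*z4 + w3*z6 - w4*z6 + w5*z7 + w6*z7 - w7*z8 + w8*z8),
        2*w2*z3 + w3*z5 - w4*z5 - w5*z8 + w6*z8 - w7*z7 - w8*z7],
      ![-2*w1*w5, -2*w2*w5, -2*w3*w5, -2*w4*w5,
        4*w1*w2 + w3^2 - w4^2 - w5^2 - w6^2 + w7^2 - w8^2, -2*w5*w6, -2*w5*w7, -2*w5*w8]),
    (![2*w1*z5 - w3*z3 - w4*z3 - w5*z2 - w6*z2 - w7*z1 + w8*z1,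
        2*w1*z6 - w3*z4 - w4*z4 + w5*z1 - w6*z1 - w7*z2 - w8*z2,
        2*w1*z7 + w3*z1 - w4*z1 + w5*z4 + w6*z4 - w7*z3 - w8*z3,
        2*w1*z8 + w3*z2 - w4*z2 - w5*z3 + w6*z3 - w7*z4 + w8*z4,
        -(2*w2*z1 - w3*z7 - w4*z7 - w5*z6 - w6*z6 + w7*z5 + w8*z5),
        -(2*w2*z2 - w3*z8 - w4*z8 + w5*z5 - w6*z5 + w7*z6 - w8*z6),
        -(2*w2*z3 + w3*z5 - w4*z5 + w5*z8 + w6*z8 + w7*z7 - w8*z7),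
        -(2*w2*z4 + w3*z6 - w4*z6 - w5*z7 + w6*z7 + w7*z8 + w8*z8)],
      ![-2*w1*w7, -2*w2*w7, -2*w3*w7, -2*w4*w7, -2*w5*w7, -2*w6*w7,
        4*w1*w2 + w3^2 - w4^2 + w5^2 - w6^2 - w7^2 - w8^2, -2*w7*w8]),
    I • (![4*w1*z1, 4*w1*z2, 4*w1*z3, 4*w1*z4,
        2*w3*z3 + 2*w4*z3 + 2*w5*z2 + 2*w6*z2 - 2*w7*z1 - 2*w8*z1,
        2*w3*z4 + 2*w4*z4 - 2*w5*z1 + 2*w6*z1 - 2*w7*z2 + 2*w8*z2,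
        -(2*w3*z1 - 2*w4*z1 + 2*w5*z4 + 2*w6*z4 + 2*w7*z3 - 2*w8*z3),
        -(2*w3*z2 - 2*w4*z2 - 2*w5*z3 + 2*w6*z3 + 2*w7*z4 + 2*w8*z4)],
      ![4*w1^2, -(w3^2 - w4^2 + w5^2 - w6^2 + w7^2 - w8^2), 4*w1*w3, 4*w1*w4, 4*w1*w5, 4*w1*w6,
        4*w1*w7, 4*w1*w8]),
    I • (![2*w3*z7 + 2*w4*z7 + 2*w5*z6 + 2*w6*z6 + 2*w7*z5 - 2*w8*z5,
        2*w3*z8 + 2*w4*z8 - 2*w5*z5 + 2*w6*z5 + 2*w7*z6 + 2*w8*z6,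
        -(2*w3*z5 - 2*w4*z5 + 2*w5*z8 + 2*w6*z8 - 2*w7*z7 - 2*w8*z7),
        -(2*w3*z6 - 2*w4*z6 - 2*w5*z7 + 2*w6*z7 - 2*w7*z8 + 2*w8*z8), 4*w2*z5, 4*w2*z6, 4*w2*z7,
        4*w2*z8],
      ![-(w3^2 - w4^2 + w5^2 - w6^2 + w7^2 - w8^2), 4*w2^2, 4*w2*w3, 4*w2*w4, 4*w2*w5, 4*w2*w6,
        4*w2*w7, 4*w2*w8]),
    I • (![2*w1*z7 + w3*z1 + w4*z1 + w5*z4 + w6*z4 + w7*z3 - w8*z3,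
        2*w1*z8 + w3*z2 + w4*z2 - w5*z3 + w6*z3 + w7*z4 + w8*z4,
        2*w1*z5 - w3*z3 + w4*z3 - w5*z2 - w6*z2 + w7*z1 + w8*z1,
        2*w1*z6 - w3*z4 + w4*z4 + w5*z1 - w6*z1 + w7*z2 - w8*z2,
        2*w2*z3 + w3*z5 + w4*z5 + w5*z8 + w6*z8 - w7*z7 - w8*z7,
        2*w2*z4 + w3*z6 + w4*z6 - w5*z7 + w6*z7 - w7*z8 + w8*z8,
        2*w2*z1 - w3*z7 + w4*z7 - w5*z6 - w6*z6 - w7*z5 + w8*z5,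
        2*w2*z2 - w3*z8 + w4*z8 + w5*z5 - w6*z5 - w7*z6 - w8*z6],
      ![2*w1*w4, 2*w2*w4, 2*w3*w4, 4*w1*w2 + w3^2 + w4^2 + w5^2 - w6^2 + w7^2 - w8^2, 2*w4*w5,
        2*w4*w6, 2*w4*w7, 2*w4*w8]),
    I • (![2*w1*z6 - w3*z4 - w4*z4 + w5*z1 + w6*z1 + w7*z2 - w8*z2,
        2*w1*z5 - w3*z3 - w4*z3 - w5*z2 + w6*z2 + w7*z1 + w8*z1,
        -(2*w1*z8 + w3*z2 - w4*z2 - w5*z3 - w6*z3 + w7*z4 + w8*z4),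
        -(2*w1*z7 + w3*z1 - w4*z1 + w5*z4 - w6*z4 + w7*z3 - w8*z3),
        2*w2*z2 - w3*z8 - w4*z8 + w5*z5 + w6*z5 - w7*z6 - w8*z6,
        2*w2*z1 - w3*z7 - w4*z7 - w5*z6 + w6*z6 - w7*z5 + w8*z5,
        -(2*w2*z4 + w3*z6 - w4*z6 - w5*z7 - w6*z7 - w7*z8 + w8*z8),
        -(2*w2*z3 + w3*z5 - w4*z5 + w5*z8 - w6*z8 - w7*z7 - w8*z7)],
      ![2*w1*w6, 2*w2*w6, 2*w3*w6, 2*w4*w6, 2*w5*w6,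
        4*w1*w2 + w3^2 - w4^2 + w5^2 + w6^2 + w7^2 - w8^2, 2*w6*w7, 2*w6*w8]),
    I • (![2*w1*z5 - w3*z3 - w4*z3 - w5*z2 - w6*z2 + w7*z1 - w8*z1,
        -(2*w1*z6 - w3*z4 - w4*z4 + w5*z1 - w6*z1 + w7*z2 + w8*z2),
        -(2*w1*z7 + w3*z1 - w4*z1 + w5*z4 + w6*z4 + w7*z3 + w8*z3),
        2*w1*z8 + w3*z2 - w4*z2 - w5*z3 + w6*z3 + w7*z4 - w8*z4,
        2*w2*z1 - w3*z7 - w4*z7 - w5*z6 - w6*z6 - w7*z5 - w8*z5,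
        -(2*w2*z2 - w3*z8 - w4*z8 + w5*z5 - w6*z5 - w7*z6 + w8*z6),
        -(2*w2*z3 + w3*z5 - w4*z5 + w5*z8 + w6*z8 - w7*z7 + w8*z7),
        2*w2*z4 + w3*z6 - w4*z6 - w5*z7 + w6*z7 - w7*z8 - w8*z8],
      ![-2*w1*w8, -2*w2*w8, -2*w3*w8, -2*w4*w8, -2*w5*w8, -2*w6*w8, -2*w7*w8,
        -(4*w1*w2 + w3^2 - w4^2 + w5^2 - w6^2 + w7^2 + w8^2)])]

/-- Labels of the `8 + 16 + 30 + 16 + 8` generators. -/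
abbrev GenIndex : Type := Fin 8 ⊕ Fin 16 ⊕ Fin 30 ⊕ Fin 16 ⊕ Fin 8

/-- The complete list of generators. -/
def generator : GenIndex → E → E :=
  Sum.elim genNegTwo (Sum.elim genNegOne (Sum.elim genZero (Sum.elim genOne genTwo)))

/-- The weights of the generators. -/
def genWeight : GenIndex → ℤ :=
  Sum.elim (fun _ => -2) (Sum.elim (fun _ => -1) (Sum.elim (fun _ => 0)
    (Sum.elim (fun _ => 1) (fun _ => 2))))

/-! ### The real form `E_III` of `E₆` -/

/-- A complex Lie algebra is (simple) of type `E₆`: it is finite-dimensional with nondegenerate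
Killing form, and the root system of some Cartan subalgebra has a base with Cartan matrix `E₆`. -/
def IsTypeE6 (L : Type*) [LieRing L] [LieAlgebra ℂ L] : Prop :=
  ∃ (_ : FiniteDimensional ℂ L) (_ : LieAlgebra.IsKilling ℂ L) (H : LieSubalgebra ℂ L)
    (_ : H.IsCartanSubalgebra) (b : (LieAlgebra.IsKilling.rootSystem H).Base)
    (e : b.support ≃ Fin 6), ∀ i j, b.cartanMatrix i j = CartanMatrix.E₆ (e i) (e j)

/-- The Killing form `X ↦ tr (ad X ∘ ad X)` as a quadratic form. -/
def killingQuadratic (𝔤 : Type*) [LieRing 𝔤] [LieAlgebra ℝ 𝔤] : QuadraticForm ℝ 𝔤 :=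
  LinearMap.BilinMap.toQuadraticMap (killingForm ℝ 𝔤)

/-- A real Lie algebra is isomorphic to `E_III = 𝔢₆₍₋₁₄₎`, the real form of `E₆` of character
`-14`: its complexification is of type `E₆` and its Killing form has signature `(32, 46)`. -/
def IsEIII (𝔤 : Type*) [LieRing 𝔤] [LieAlgebra ℝ 𝔤] : Prop :=
  IsTypeE6 (ℂ ⊗[ℝ] 𝔤) ∧ sigPos (killingQuadratic 𝔤) = 32 ∧
    sigNeg (killingQuadratic 𝔤) = 46

end EIIIModel

end

open EIIIModel

/-!
In the light-cone coordinates `v = om w` the equations of `M` become `v + sg v = herm z z`, where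
`sg` is an antilinear involution and `herm` is sesquilinear. Since `M` is generic, tangency
polarizes: a field `(Z, W)` of `hol` satisfies `W(p) + sg W(q) = herm (Z p) z_q + herm z_p (Z q)`
at all pairs of points with `v_p + sg v_q = herm z_p z_q` (`polarized_tangency`).

*The graded pieces.* The dilations `(z, w) ↦ (s z, s² w)` preserve `M`, and `𝔤_k` consists of the
fields whose components are entire and homogeneous for them, hence polynomial; it is an eigenspace
of the Euler field. Polarized tangency with one of the points in `z = 0` shows how much of a field
is determined by its restriction to `z = 0`. Fields of weight `-2` and `-1` are determined by
their values at the origin. Fields of positive weight that commute with the constant fields in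
`𝔤₋₂` vanish (`eq_zero_of_lie_tauField`). A field of weight `0` is a derivation of `herm`, and the
equations for such a derivation leave only the parameters read off by `coordZero`
(`derivation_herm_eq_zero`). For weight `1` the restriction to `z = 0` solves a linear system
whose solutions are the maps `cliff b` (`linear_eq_cliff`); their shape rules out weight `3`, and
therefore all higher weights. A field of weight `2` is determined by its value at one point by the
theory of an `sl₂`-triple that contains the Euler field (`eq_zero_of_weight_two`). In every weight
the coordinates that determine a field are dual to the listed fields, which are checked to be
tangent, so that these form a basis.

*Local symmetries.* At the origin, which lies in `M`, the Taylor expansion of a local field `L`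
along the orbits of the dilations has coefficients that extend to elements of the `𝔤_k`; hence
only five of them are nonzero, and `L` is the restriction of their sum. Other points of `M` are
moved to the origin by affine automorphisms of `M`, and the identity theorem covers connected open
sets (`existsUnique_eqOn`). Applied to global fields this gives the decomposition of `hol`.

*Type `E₆`.* The Killing form of `hol` is nondegenerate because a nonzero ideal meets `𝔤₋₂`
nontrivially, which is impossible for an abelian one. The complexification is again a Lie algebra
of holomorphic vector fields, as `hol` is totally real. In suitable coordinates of `ℂ¹⁶` the
Chevalley generators are linear fields given by signed partial permutation matrices, except for
those of one simple root, which are a quadratic field and a constant field; this realizes the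
grading of `E₆` with abelian part of dimension `16`. The relations are verified directly. The
generated subalgebra contains all constant fields, so an element orthogonal to it for the Killing
form can be lowered to a constant field, which must vanish (`rootSpan_eq_top`).

*Signature.* For a suitable Hermitian form on `ℂ⁸⁺⁸`, `𝔤₀` is closed under adjoints, and every
`𝔤_k` carries a Euclidean form for which (skew-)Hermitian elements of `𝔤₀` act by (skew-)symmetric
endomorphisms (`exists_isAdapted`). So the Killing form is positive semidefinite on the sum of the
Hermitian part of `𝔤₀` and `𝔤₁ ⊕ 𝔤₂`, of dimension at least `32`, and negative semidefinite on the
sum of the skew-Hermitian part and `𝔤₁ ⊕ 𝔤₂`, of dimension at least `46`. As it is nondegenerate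
and `32 + 46 = 78`, its signature is `(32, 46)`.
-/

noncomputable section

namespace EIIIModel

open Complex ComplexConjugate VectorField MvPolynomial
open scoped TensorProduct

set_option linter.unusedSimpArgs false

section

/-! ### Light-cone coordinates -/

lemma ext_fin_eight {α : Type*} {f g : Fin 8 → α} (h0 : f 0 = g 0) (h1 : f 1 = g 1)
    (h2 : f 2 = g 2) (h3 : f 3 = g 3) (h4 : f 4 = g 4) (h5 : f 5 = g 5) (h6 : f 6 = g 6)
    (h7 : f 7 = g 7) : f = g := by
  funext j
  fin_cases j <;> assumption

/-- The `z`-coordinates of a point (or of a vector). -/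
def zc (x : E) : Fin 8 → ℂ := fun i => x (.inl i)

/-- Light-cone coordinates `(w₁, w₂, w₄ + w₃, w₄ - w₃, w₆ + w₅, w₆ - w₅, w₈ + w₇, w₈ - w₇)` in the
`w`-space. -/
def om (x : E) : Fin 8 → ℂ :=
  ![x (.inr 0), x (.inr 1), x (.inr 3) + x (.inr 2), x (.inr 3) - x (.inr 2),
    x (.inr 5) + x (.inr 4), x (.inr 5) - x (.inr 4), x (.inr 7) + x (.inr 6),
    x (.inr 7) - x (.inr 6)]

/-- The point with given `z`-coordinates and light-cone coordinates. -/
def pt (z v : Fin 8 → ℂ) : E :=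
  Sum.elim z ![v 0, v 1, (v 2 - v 3) / 2, (v 2 + v 3) / 2, (v 4 - v 5) / 2, (v 4 + v 5) / 2,
    (v 6 - v 7) / 2, (v 6 + v 7) / 2]

/-- The antilinear involution of the `w`-space, in light-cone coordinates, for which
`v + sg v` is twice the part of `v` that is constrained by the equations of `M`. -/
def sg (v : Fin 8 → ℂ) : Fin 8 → ℂ :=
  ![conj (v 0), conj (v 1), conj (v 3), conj (v 2), conj (v 5), conj (v 4), conj (v 7), conj (v 6)]

/-- The sesquilinear map on the `z`-space, linear in `z` and antilinear in `y`, for which `M` has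
the equation `v + sg v = herm z z` in light-cone coordinates. -/
def herm (z y : Fin 8 → ℂ) : Fin 8 → ℂ :=
  ![z 0 * conj (y 0) + z 1 * conj (y 1) + z 2 * conj (y 2) + z 3 * conj (y 3),
    z 4 * conj (y 4) + z 5 * conj (y 5) + z 6 * conj (y 6) + z 7 * conj (y 7),
    2 * (z 0 * conj (y 6) + z 1 * conj (y 7) + z 4 * conj (y 2) + z 5 * conj (y 3)),
    2 * (z 6 * conj (y 0) + z 7 * conj (y 1) + z 2 * conj (y 4) + z 3 * conj (y 5)),
    2 * (z 0 * conj (y 5) - z 2 * conj (y 7) + z 4 * conj (y 1) - z 6 * conj (y 3)),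
    2 * (z 5 * conj (y 0) - z 7 * conj (y 2) + z 1 * conj (y 4) - z 3 * conj (y 6)),
    2 * (z 1 * conj (y 5) + z 2 * conj (y 6) - z 4 * conj (y 0) - z 7 * conj (y 3)),
    2 * (z 5 * conj (y 1) + z 6 * conj (y 2) - z 0 * conj (y 4) - z 3 * conj (y 7))]

@[simp] lemma zc_pt (z v : Fin 8 → ℂ) : zc (pt z v) = z := rfl

@[simp] lemma om_pt (z v : Fin 8 → ℂ) : om (pt z v) = v := by
  apply ext_fin_eight <;> simp [om, pt] <;> ring

@[simp] lemma pt_zc_om (x : E) : pt (zc x) (om x) = x := by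
  ext (j | j)
  · rfl
  · revert j
    rw [← funext_iff]
    apply ext_fin_eight <;> simp [om, pt]

lemma om_add (x y : E) : om (x + y) = om x + om y := by
  apply ext_fin_eight <;> simp [om] <;> ring

lemma om_sub (x y : E) : om (x - y) = om x - om y := by
  apply ext_fin_eight <;> simp [om] <;> ring

lemma om_smul (c : ℂ) (x : E) : om (c • x) = c • om x := by
  apply ext_fin_eight <;> simp [om] <;> ring

lemma ext_zc_om {x y : E} (hz : zc x = zc y) (hw : om x = om y) : x = y := by
  rw [← pt_zc_om x, ← pt_zc_om y, hz, hw]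

lemma sg_sg (v : Fin 8 → ℂ) : sg (sg v) = v := by
  apply ext_fin_eight <;> simp [sg]

lemma sg_add (u v : Fin 8 → ℂ) : sg (u + v) = sg u + sg v := by
  apply ext_fin_eight <;> simp [sg]

lemma sg_sub (u v : Fin 8 → ℂ) : sg (u - v) = sg u - sg v := by
  apply ext_fin_eight <;> simp [sg]

lemma sg_neg (v : Fin 8 → ℂ) : sg (-v) = -sg v := by
  apply ext_fin_eight <;> simp [sg]

lemma sg_smul (c : ℂ) (v : Fin 8 → ℂ) : sg (c • v) = conj c • sg v := by
  apply ext_fin_eight <;> simp [sg]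

@[simp] lemma sg_zero : sg 0 = 0 := by
  apply ext_fin_eight <;> simp [sg]

lemma sg_herm (z y : Fin 8 → ℂ) : sg (herm z y) = herm y z := by
  apply ext_fin_eight <;> simp [sg, herm, map_ofNat] <;> ring

lemma herm_add_left (z z' y : Fin 8 → ℂ) : herm (z + z') y = herm z y + herm z' y := by
  apply ext_fin_eight <;> simp [herm] <;> ring

lemma herm_add_right (z y y' : Fin 8 → ℂ) : herm z (y + y') = herm z y + herm z y' := by
  apply ext_fin_eight <;> simp [herm] <;> ring

lemma herm_smul_left (c : ℂ) (z y : Fin 8 → ℂ) : herm (c • z) y = c • herm z y := by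
  apply ext_fin_eight <;> simp [herm] <;> ring

lemma herm_smul_right (c : ℂ) (z y : Fin 8 → ℂ) : herm z (c • y) = conj c • herm z y := by
  apply ext_fin_eight <;> simp [herm] <;> ring

@[simp] lemma herm_zero_left (y : Fin 8 → ℂ) : herm 0 y = 0 := by
  apply ext_fin_eight <;> simp [herm]

@[simp] lemma herm_zero_right (z : Fin 8 → ℂ) : herm z 0 = 0 := by
  apply ext_fin_eight <;> simp [herm]

lemma eq_zero_of_herm_eq_zero {z : Fin 8 → ℂ} (h : ∀ y, herm z y = 0) : z = 0 := by
  ext i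
  have h0 := congrFun (h (Pi.single i 1)) 0
  have h1 := congrFun (h (Pi.single i 1)) 1
  have e0 : ∀ y, herm z y 0 =
    z 0 * conj (y 0) + z 1 * conj (y 1) + z 2 * conj (y 2) + z 3 * conj (y 3) := fun _ => rfl
  have e1 : ∀ y, herm z y 1 =
    z 4 * conj (y 4) + z 5 * conj (y 5) + z 6 * conj (y 6) + z 7 * conj (y 7) := fun _ => rfl
  rw [e0] at h0
  rw [e1] at h1
  clear h e0 e1
  fin_cases i <;> simp_all

/-- The real defining functions of `M`, combined into complex ones in light-cone coordinates. -/
def cx (r : Fin 8 → ℝ) : Fin 8 → ℂ :=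
  ![2 * r 0, 2 * r 1, 2 * (r 3 + r 2 * I), 2 * (r 3 - r 2 * I), 2 * (r 5 + r 4 * I),
    2 * (r 5 - r 4 * I), 2 * (r 7 + r 6 * I), 2 * (r 7 - r 6 * I)]

lemma cx_sub (r s : Fin 8 → ℝ) : cx (r - s) = cx r - cx s := by
  apply ext_fin_eight <;> simp [cx] <;> ring

lemma cx_eq_zero {r : Fin 8 → ℝ} : cx r = 0 ↔ r = 0 := by
  constructor
  · intro h
    have key : ∀ a b : ℝ, 2 * ((a : ℂ) + b * I) = 0 → a = 0 ∧ b = 0 := fun a b h => by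
      simpa [Complex.ext_iff] using h
    have h0 : r 0 = 0 := by simpa [cx] using congrFun h 0
    have h1 : r 1 = 0 := by simpa [cx] using congrFun h 1
    obtain ⟨h3, h2⟩ := key _ _ (congrFun h 2)
    obtain ⟨h5, h4⟩ := key _ _ (congrFun h 4)
    obtain ⟨h7, h6⟩ := key _ _ (congrFun h 6)
    exact ext_fin_eight h0 h1 h2 h3 h4 h5 h6 h7
  · rintro rfl
    apply ext_fin_eight <;> simp [cx]

lemma om_add_sg_sub_herm (x : E) : om x + sg (om x) - herm (zc x) (zc x) = cx (rho x) := by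
  apply ext_fin_eight <;>
  · simp only [Pi.add_apply, Pi.sub_apply, rho, onCoords, om, sg, herm, zc, cx, Matrix.cons_val]
    apply Complex.ext <;> simp [← normSq_eq_norm_sq, normSq_apply] <;> ring

lemma mem_M_iff (x : E) : x ∈ M ↔ om x + sg (om x) = herm (zc x) (zc x) := by
  have h : x ∈ M ↔ rho x = 0 := Iff.rfl
  rw [h, ← cx_eq_zero, ← om_add_sg_sub_herm, sub_eq_zero]

lemma mem_tangentSpace_iff_herm (p v : E) : v ∈ tangentSpace p ↔
    om v + sg (om v) = herm (zc v) (zc p) + herm (zc p) (zc v) := by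
  have h : v ∈ tangentSpace p ↔ fderiv ℝ rho p v = 0 := Iff.rfl
  have h0 : om (Sum.elim (fun i => v (.inl i)) 0) = 0 := by
    apply ext_fin_eight <;> simp [om]
  have h1 : zc (Sum.elim (fun i => v (.inl i)) 0) = zc v := rfl
  have h2 : zc (p + v) = zc p + zc v := rfl
  rw [h, fderiv_rho, ← cx_eq_zero, cx_sub, cx_sub, rhoQuad, ← om_add_sg_sub_herm,
    ← om_add_sg_sub_herm, ← om_add_sg_sub_herm, h0, h1, h2, om_add, sg_add, herm_add_left,
    herm_add_right, herm_add_right, sg_zero, ← sub_eq_zero (a := om v + sg (om v))]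
  constructor <;> intro h3 <;> linear_combination h3

end

section

/-! ### Weighted homogeneous entire functions -/

/-- The dilation `(z, w) ↦ (s z, s² w)`. -/
def dil (s : ℂ) (x : E) : E := Sum.elim (fun i => s * x (.inl i)) fun j => s ^ 2 * x (.inr j)

lemma dil_apply (s : ℂ) (x : E) (c : Coord) : dil s x c = s ^ (wt c).toNat * x c := by
  rcases c with c | c <;> simp [dil, wt]

@[simp] lemma dil_zero_left (x : E) : dil 0 x = 0 := by
  ext (j | j) <;> simp [dil]

@[simp] lemma dil_one (x : E) : dil 1 x = x := by
  ext (j | j) <;> simp [dil]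

lemma dil_eq_zpow {s : ℂ} (x : E) (c : Coord) : dil s x c = s ^ wt c * x c := by
  rcases c with c | c
  · simp [dil, wt]
  · simp only [dil, wt, Sum.elim_inr]
    norm_cast

/-- The dilation by `s` as a continuous linear map. -/
def dilL (s : ℂ) : E →L[ℂ] E :=
  ContinuousLinearMap.pi fun c => s ^ (wt c).toNat • ContinuousLinearMap.proj c

@[simp] lemma dilL_apply (s : ℂ) (x : E) : dilL s x = dil s x := by
  ext c; simp [dilL, dil_apply]

lemma dil_single (s : ℂ) (c : Coord) : dil s (Pi.single c 1) = s ^ wt c • Pi.single c 1 := by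
  ext d
  rw [dil_eq_zpow]
  by_cases h : d = c
  · subst h; simp
  · simp [h]

lemma contDiff_dil {n : WithTop ℕ∞} : ContDiff ℂ n fun p : ℂ × E => dil p.1 p.2 := by
  rw [contDiff_pi]
  intro c
  simp only [dil_apply]
  exact (contDiff_fst.pow _).mul ((contDiff_apply ℂ ℂ c).comp contDiff_snd)

lemma continuous_dil (x : E) : Continuous fun s : ℂ => dil s x :=
  (contDiff_dil (n := 0)).continuous.comp (by fun_prop : Continuous fun s : ℂ => (s, x))

/-- The entire functions on `ℂ⁸⁺⁸` that are homogeneous of degree `k` for the weights `[z_i] = 1`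
and `[w_j] = 2`. -/
structure HomFun (f : E → ℂ) (k : ℤ) : Prop where
  contDiff : ContDiff ℂ ⊤ f
  apply_dil : ∀ s : ℂ, s ≠ 0 → ∀ x, f (dil s x) = s ^ k * f x

namespace HomFun

variable {f g : E → ℂ} {k l : ℤ}

lemma differentiable (hf : HomFun f k) : Differentiable ℂ f := hf.1.differentiable (by simp)

lemma zero (k : ℤ) : HomFun (fun _ => 0) k := ⟨contDiff_const, by simp⟩

lemma add (hf : HomFun f k) (hg : HomFun g k) : HomFun (fun x => f x + g x) k :=
  ⟨hf.1.add hg.1, fun s hs x => by rw [hf.2 s hs, hg.2 s hs]; ring⟩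

lemma sub (hf : HomFun f k) (hg : HomFun g k) : HomFun (fun x => f x - g x) k :=
  ⟨hf.1.sub hg.1, fun s hs x => by rw [hf.2 s hs, hg.2 s hs]; ring⟩

lemma mul (hf : HomFun f k) (hg : HomFun g l) : HomFun (fun x => f x * g x) (k + l) :=
  ⟨hf.1.mul hg.1, fun s hs x => by rw [hf.2 s hs, hg.2 s hs, zpow_add₀ hs]; ring⟩

lemma sum {ι : Type*} (t : Finset ι) {F : ι → E → ℂ} (h : ∀ i ∈ t, HomFun (F i) k) :
    HomFun (fun x => ∑ i ∈ t, F i x) k := by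
  refine ⟨ContDiff.sum fun i hi => (h i hi).1, fun s hs x => ?_⟩
  rw [Finset.mul_sum]
  exact Finset.sum_congr rfl fun i hi => (h i hi).2 s hs x

lemma eq_zero_of_neg (hf : HomFun f k) (hk : k < 0) (x : E) : f x = 0 := by
  obtain ⟨n, rfl⟩ : ∃ n : ℕ, k = -(n + 1 : ℕ) := ⟨(-k - 1).toNat, by omega⟩
  -- `f x = s ^ (n + 1) * f (dil s x)` tends to `0` with `s`
  have h1 : ∀ s : ℂ, s ≠ 0 → s ^ (n + 1) * f (dil s x) = f x := fun s hs => by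
    rw [hf.2 s hs, zpow_neg, zpow_natCast]
    field_simp
  have h2 : Continuous fun s : ℂ => s ^ (n + 1) * f (dil s x) :=
    (continuous_id.pow _).mul (hf.1.continuous.comp (continuous_dil x))
  have h3 := (h2.tendsto 0).mono_left (nhdsWithin_le_nhds (s := ({0}ᶜ : Set ℂ)))
  have h4 : Filter.Tendsto (fun _ => f x) (nhdsWithin (0 : ℂ) {0}ᶜ) _ := h3.congr'
    (Filter.eventually_of_mem self_mem_nhdsWithin fun s hs => h1 s hs)
  simpa using tendsto_nhds_unique tendsto_const_nhds h4

lemma eq_const (hf : HomFun f 0) (x : E) : f x = f 0 := by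
  have h1 : ∀ s : ℂ, s ≠ 0 → f (dil s x) = f x := fun s hs => by simp [hf.2 s hs]
  have h2 : Continuous fun s : ℂ => f (dil s x) := hf.1.continuous.comp (continuous_dil x)
  have h3 := (h2.tendsto 0).mono_left (nhdsWithin_le_nhds (s := ({0}ᶜ : Set ℂ)))
  have h4 : Filter.Tendsto (fun _ => f x) (nhdsWithin (0 : ℂ) {0}ᶜ) _ := h3.congr'
    (Filter.eventually_of_mem self_mem_nhdsWithin fun s hs => h1 s hs)
  simpa using tendsto_nhds_unique tendsto_const_nhds h4

lemma apply_zero (hf : HomFun f k) (hk : k ≠ 0) : f 0 = 0 := by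
  have h := hf.2 2 two_ne_zero 0
  have h0 : dil 2 0 = 0 := by ext (j | j) <;> simp [dil]
  rw [h0] at h
  have h2 : (2 : ℂ) ^ k ≠ 1 := by
    intro h3
    have h4 := congrArg norm h3
    rw [norm_zpow, norm_one, Complex.norm_ofNat] at h4
    exact hk ((zpow_eq_one_iff_right₀ (by norm_num) (by norm_num)).1 h4)
  have h5 : ((2 : ℂ) ^ k - 1) * f 0 = 0 := by linear_combination -h
  exact (mul_eq_zero.1 h5).resolve_left (sub_ne_zero.2 h2)

lemma contDiff_partial (hf : HomFun f k) (v : E) : ContDiff ℂ ⊤ fun x => fderiv ℂ f x v :=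
  (hf.1.fderiv_right (m := ⊤) le_rfl).clm_apply contDiff_const

lemma fderiv_dil (hf : HomFun f k) {s : ℂ} (hs : s ≠ 0) (x v : E) :
    fderiv ℂ f (dil s x) (dil s v) = s ^ k * fderiv ℂ f x v := by
  have h1 : (f ∘ dilL s) = fun x => s ^ k * f x := by
    ext x; simp [hf.2 s hs]
  have h2 := fderiv_comp x (hf.differentiable (dilL s x)) (dilL s).differentiableAt
  rw [h1, fderiv_const_mul (hf.differentiable x), ContinuousLinearMap.fderiv] at h2
  have h3 := DFunLike.congr_fun h2 v
  simpa using h3.symm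

lemma partial_deriv (hf : HomFun f k) (c : Coord) :
    HomFun (fun x => fderiv ℂ f x (Pi.single c 1)) (k - wt c) := by
  refine ⟨hf.contDiff_partial _, fun s hs x => ?_⟩
  have h := hf.fderiv_dil hs x (Pi.single c 1)
  rw [dil_single, map_smul, smul_eq_mul] at h
  have h2 : s ^ wt c ≠ 0 := zpow_ne_zero _ hs
  rw [zpow_sub₀ hs]
  field_simp
  linear_combination h

/-- Euler's identity. -/
lemma euler (hf : HomFun f k) (x : E) :
    ∑ c, (wt c : ℂ) * x c * fderiv ℂ f x (Pi.single c 1) = k * f x := by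
  have h1 : HasDerivAt (fun s : ℂ => dil s x) (fun c => (wt c : ℂ) * x c) 1 := by
    rw [hasDerivAt_pi]
    intro c
    have := ((hasDerivAt_pow (wt c).toNat (1 : ℂ))).mul_const (x c)
    refine (this.congr_of_eventuallyEq (Filter.Eventually.of_forall fun s => ?_)).congr_deriv ?_
    · exact dil_apply s x c
    · rcases c with c | c <;> simp [wt]
  have h2 : HasFDerivAt f (fderiv ℂ f x) (dil 1 x) := by simpa using (hf.differentiable x).hasFDerivAt
  have h3 := h2.comp_hasDerivAt (1 : ℂ) h1
  have h4 : HasDerivAt (fun s : ℂ => s ^ k * f x) (k * f x) 1 := by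
    simpa using (hasDerivAt_zpow k (1 : ℂ) (Or.inl one_ne_zero)).mul_const (f x)
  have h5 : (f ∘ fun s : ℂ => dil s x) =ᶠ[nhds 1] fun s : ℂ => s ^ k * f x := by
    filter_upwards [isOpen_ne.mem_nhds (one_ne_zero : (1 : ℂ) ≠ 0)] with s hs
    exact hf.2 s hs x
  have h6 := h3.unique (h4.congr_of_eventuallyEq h5)
  rw [← h6, ← (fderiv ℂ f x).coe_coe, LinearMap.pi_apply_eq_sum_univ]
  refine Finset.sum_congr rfl fun c _ => ?_
  have h7 : (Pi.single c 1 : E) = fun j => if c = j then 1 else 0 := by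
    ext d; simp [Pi.single_apply, eq_comm]
  rw [h7, smul_eq_mul]

/-- Weighted homogeneous entire functions are polynomials. -/
lemma exists_polynomial : ∀ (n : ℕ) {f : E → ℂ} {k : ℤ}, k < n → HomFun f k →
    ∃ P : MvPolynomial Coord ℂ, IsWeightedHomogeneous wt P k ∧ ∀ x, f x = eval x P := by
  intro n
  induction n with
  | zero =>
    intro f k hk hf
    exact ⟨0, isWeightedHomogeneous_zero _ _ _, fun x => by
      simpa using hf.eq_zero_of_neg (by simpa using hk) x⟩
  | succ n ih =>
    intro f k hk hf
    rcases lt_or_ge k 0 with h0 | h0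
    · exact ⟨0, isWeightedHomogeneous_zero _ _ _, fun x => by simpa using hf.eq_zero_of_neg h0 x⟩
    rcases eq_or_ne k 0 with rfl | h1
    · exact ⟨MvPolynomial.C (f 0), isWeightedHomogeneous_C _ _, fun x => by simpa using hf.eq_const x⟩
    have h2 : ∀ c, k - wt c < n := fun c => by
      rcases c with c | c <;> simp only [wt, Sum.elim_inl, Sum.elim_inr] <;> push_cast at hk <;> omega
    choose P hP hPe using fun c => ih (h2 c) (hf.partial_deriv c)
    refine ⟨∑ c, MvPolynomial.C ((k : ℂ)⁻¹ * wt c) * (X c * P c), ?_, fun x => ?_⟩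
    · refine IsWeightedHomogeneous.sum _ _ _ fun c _ => ?_
      have := (isWeightedHomogeneous_C wt ((k : ℂ)⁻¹ * wt c)).mul
        ((isWeightedHomogeneous_X ℂ wt c).mul (hP c))
      simpa using this
    · have h3 := hf.euler x
      have h4 : (k : ℂ) ≠ 0 := by exact_mod_cast h1
      rw [← mul_right_inj' h4, ← h3, map_sum, Finset.mul_sum]
      refine Finset.sum_congr rfl fun c _ => ?_
      simp only [map_mul, eval_C, eval_X, ← hPe c x]
      field_simp

end HomFun

lemma homFun_eval {P : MvPolynomial Coord ℂ} {k : ℤ} (hP : IsWeightedHomogeneous wt P k) :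
    HomFun (fun x => eval x P) k := by
  refine ⟨?_, fun s hs x => ?_⟩
  · exact (AnalyticOnNhd.eval_mvPolynomial P).contDiff
  · simp only [eval_eq, Finset.mul_sum]
    refine Finset.sum_congr rfl fun d hd => ?_
    have h1 := hP (mem_support_iff.1 hd)
    have h2 : ∏ c ∈ d.support, dil s x c ^ d c = s ^ k * ∏ c ∈ d.support, x c ^ d c := by
      have h3 : ∀ t : Finset Coord, ∏ c ∈ t, (s ^ wt c) ^ d c = s ^ ∑ c ∈ t, d c • wt c := by
        intro t
        induction t using Finset.induction_on with
        | empty => simp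
        | insert c t hc ih =>
          rw [Finset.prod_insert hc, Finset.sum_insert hc, zpow_add₀ hs, ih, nsmul_eq_mul,
            mul_comm (d c : ℤ), zpow_mul, zpow_natCast]
      simp only [dil_eq_zpow, mul_pow, Finset.prod_mul_distrib]
      rw [← h1, Finsupp.weight_apply, Finsupp.sum, h3]
    rw [h2]; ring

/-- A vector field has constant weight `k` if and only if its coefficients are entire and
weighted homogeneous of the right degrees. -/
lemma hasWeight_iff (L : E → E) (k : ℤ) :
    HasWeight L k ↔ ∀ a, HomFun (fun x => L x a) (k + wt a) := by
  constructor
  · rintro ⟨P, hP, hL⟩ a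
    simp only [hL]
    exact homFun_eval (hP a)
  · intro h
    choose P hP hPe using fun a =>
      HomFun.exists_polynomial (k + wt a + 1).toNat (by omega) (h a)
    exact ⟨P, hP, fun x a => hPe a x⟩

end

section

/-! ### The bracket and the grading -/

lemma fderiv_holVF_apply (V : HolVF) (x v : E) (a : Coord) :
    fderiv ℂ (V : E → E) x v a = fderiv ℂ (fun y => (V : E → E) y a) x v := by
  have h := hasFDerivAt_pi'.1 ((holVF_differentiable V) x).hasFDerivAt a
  rw [h.fderiv]; rfl

lemma lie_apply (V W : HolVF) (x : E) : ((⁅V, W⁆ : HolVF) : E → E) x =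
    fderiv ℂ (W : E → E) x ((V : E → E) x) - fderiv ℂ (V : E → E) x ((W : E → E) x) := rfl

lemma fderiv_eq_sum (f : E → ℂ) (x v : E) :
    fderiv ℂ f x v = ∑ c, v c * fderiv ℂ f x (Pi.single c 1) := by
  rw [← (fderiv ℂ f x).coe_coe, LinearMap.pi_apply_eq_sum_univ]
  refine Finset.sum_congr rfl fun c _ => ?_
  have h : (Pi.single c 1 : E) = fun j => if c = j then 1 else 0 := by
    ext d; simp [Pi.single_apply, eq_comm]
  rw [h, smul_eq_mul]

lemma hasWeight_of_mem {k : ℤ} {X : hol} (hX : X ∈ gradedPiece k) (a : Coord) :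
    HomFun (fun x => X.1.1 x a) (k + wt a) := (hasWeight_iff _ _).1 hX a

lemma lie_mem_gradedPiece {j k : ℤ} {X Y : hol} (hX : X ∈ gradedPiece j) (hY : Y ∈ gradedPiece k) :
    ⁅X, Y⁆ ∈ gradedPiece (j + k) := by
  refine (hasWeight_iff _ _).2 fun a => ?_
  have key : ∀ {i l : ℤ} {V W : hol}, V ∈ gradedPiece i → W ∈ gradedPiece l →
      HomFun (fun x => ∑ c, V.1.1 x c * fderiv ℂ (fun y => W.1.1 y a) x (Pi.single c 1))
        (i + l + wt a) := by
    intro i l V W hV hW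
    refine HomFun.sum _ fun c _ => ?_
    have := (hasWeight_of_mem hV c).mul ((hasWeight_of_mem hW a).partial_deriv c)
    convert this using 1
    ring
  have h := (key hX hY).sub (add_comm j k ▸ key hY hX)
  convert h using 2 with x
  have h1 : (⁅X, Y⁆ : hol).1.1 x = ((⁅X.1, Y.1⁆ : HolVF) : E → E) x := rfl
  rw [h1, lie_apply, Pi.sub_apply, fderiv_holVF_apply, fderiv_holVF_apply, fderiv_eq_sum,
    fderiv_eq_sum _ _ (Y.1.1 x)]

/-- The Euler field `∑ z_i ∂/∂z_i + 2 ∑ w_j ∂/∂w_j`, whose flow consists of the dilations. -/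
def eulerField : hol :=
  ⟨⟨fun x c => (wt c : ℂ) * x c,
    (contDiff_pi.2 fun c => contDiff_const.mul (contDiff_apply ℂ ℂ c)).analyticOnNhd⟩, by
    intro p hp
    rw [mem_tangentSpace_iff_herm]
    have h1 : zc (fun c => (wt c : ℂ) * p c) = zc p := by ext i; simp [zc, wt]
    have h2 : om (fun c => (wt c : ℂ) * p c) = (2 : ℂ) • om p := by
      apply ext_fin_eight <;> simp [om, wt] <;> ring
    change om (fun c => (wt c : ℂ) * p c) + sg (om (fun c => (wt c : ℂ) * p c)) =
      herm (zc (fun c => (wt c : ℂ) * p c)) (zc p) + herm (zc p) (zc (fun c => (wt c : ℂ) * p c))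
    rw [h1, h2, sg_smul, map_ofNat, ← smul_add, (mem_M_iff p).1 hp, two_smul]⟩

lemma eulerField_apply (x : E) (c : Coord) : eulerField.1.1 x c = wt c * x c := rfl

lemma hol_ext {X Y : hol} (h : ∀ x, X.1.1 x = Y.1.1 x) : X = Y :=
  Subtype.ext (Subtype.ext (funext h))

/-- Euler's identity for weighted homogeneous functions. -/
lemma lie_euler {k : ℤ} {X : hol} (hX : X ∈ gradedPiece k) : ⁅eulerField, X⁆ = (k : ℝ) • X := by
  refine hol_ext fun x => funext fun a => ?_
  have h1 : (⁅eulerField, X⁆ : hol).1.1 x = ((⁅eulerField.1, X.1⁆ : HolVF) : E → E) x := rfl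
  have h2 : ((k : ℝ) • X).1.1 x a = k * X.1.1 x a := by
    change ((k : ℝ) • (X.1.1 x a)) = _
    simp
  have h3 : HasFDerivAt (eulerField.1.1 : E → E)
      (ContinuousLinearMap.pi fun c => (wt c : ℂ) • ContinuousLinearMap.proj c : E →L[ℂ] E) x := by
    exact ContinuousLinearMap.hasFDerivAt
      (ContinuousLinearMap.pi fun c => (wt c : ℂ) • ContinuousLinearMap.proj c : E →L[ℂ] E)
  have h4 := (hasWeight_of_mem hX a).euler x
  rw [h1, lie_apply, Pi.sub_apply, fderiv_holVF_apply, fderiv_eq_sum, h3.fderiv, h2]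
  simp only [eulerField_apply, h4]
  simp
  ring

/-- The graded pieces are eigenspaces of the Euler field. -/
lemma iSupIndep_gradedPiece : iSupIndep gradedPiece := by
  have h := (Module.End.eigenspaces_iSupIndep (LieAlgebra.ad ℝ hol eulerField)).comp
    (f := fun k : ℤ => (k : ℝ)) Int.cast_injective
  refine h.mono fun k X hX => ?_
  rw [Function.comp_apply, Module.End.mem_eigenspace_iff, LieAlgebra.ad_apply, lie_euler hX]

/-! ### Polarization of the tangency condition -/

lemma differentiable_conj_comp_conj {f : ℂ → ℂ} (hf : Differentiable ℂ f) :
    Differentiable ℂ fun s => conj (f (conj s)) := fun s => by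
  have := (hf (conj s)).conj_conj
  simpa [Function.comp_def] using this

lemma differentiable_sg {u : ℂ → Fin 8 → ℂ} (hu : ∀ i, Differentiable ℂ fun s => u s i) (j : Fin 8) :
    Differentiable ℂ fun s => sg (u (conj s)) j := by
  have h := fun i => differentiable_conj_comp_conj (hu i)
  fin_cases j
  exacts [h 0, h 1, h 3, h 2, h 5, h 4, h 7, h 6]

lemma differentiable_herm {u v : ℂ → Fin 8 → ℂ} (hu : ∀ i, Differentiable ℂ fun s => u s i)
    (hv : ∀ i, Differentiable ℂ fun s => v s i) (j : Fin 8) :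
    Differentiable ℂ fun s => herm (u s) (v (conj s)) j := by
  have h := fun i l => (hu i).mul (differentiable_conj_comp_conj (hv l))
  fin_cases j
  · exact (((h 0 0).add (h 1 1)).add (h 2 2)).add (h 3 3)
  · exact (((h 4 4).add (h 5 5)).add (h 6 6)).add (h 7 7)
  · exact ((((h 0 6).add (h 1 7)).add (h 4 2)).add (h 5 3)).const_mul 2
  · exact ((((h 6 0).add (h 7 1)).add (h 2 4)).add (h 3 5)).const_mul 2
  · exact ((((h 0 5).sub (h 2 7)).add (h 4 1)).sub (h 6 3)).const_mul 2
  · exact ((((h 5 0).sub (h 7 2)).add (h 1 4)).sub (h 3 6)).const_mul 2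
  · exact ((((h 1 5).add (h 2 6)).sub (h 4 0)).sub (h 7 3)).const_mul 2
  · exact ((((h 5 1).add (h 6 2)).sub (h 0 4)).sub (h 3 7)).const_mul 2

lemma differentiable_pt {u v : ℂ → Fin 8 → ℂ} (hu : ∀ i, Differentiable ℂ fun s => u s i)
    (hv : ∀ i, Differentiable ℂ fun s => v s i) : Differentiable ℂ fun s => pt (u s) (v s) := by
  rw [differentiable_pi]
  rintro (i | j)
  · exact hu i
  · fin_cases j
    exacts [hv 0, hv 1, ((hv 2).sub (hv 3)).div_const 2, ((hv 2).add (hv 3)).div_const 2,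
      ((hv 4).sub (hv 5)).div_const 2, ((hv 4).add (hv 5)).div_const 2,
      ((hv 6).sub (hv 7)).div_const 2, ((hv 6).add (hv 7)).div_const 2]

lemma differentiable_om {g : ℂ → E} (hg : Differentiable ℂ g) (j : Fin 8) :
    Differentiable ℂ fun s => om (g s) j := by
  have h := fun i => differentiable_pi.1 hg (.inr i)
  fin_cases j
  exacts [h 0, h 1, (h 3).add (h 2), (h 3).sub (h 2), (h 5).add (h 4), (h 5).sub (h 4),
    (h 7).add (h 6), (h 7).sub (h 6)]

lemma eq_zero_of_eq_zero_on_reals {f : ℂ → ℂ} (hf : Differentiable ℂ f) (h : ∀ t : ℝ, f t = 0)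
    (s : ℂ) : f s = 0 := by
  have h1 : AnalyticOnNhd ℂ f Set.univ := fun x _ => hf.analyticAt x
  have h2 : ∃ᶠ z in nhdsWithin (0 : ℂ) {0}ᶜ, f z = 0 := by
    have h3 : Filter.Tendsto (fun t : ℝ => (t : ℂ)) (nhdsWithin 0 {0}ᶜ)
        (nhdsWithin (0 : ℂ) {0}ᶜ) := by
      refine tendsto_nhdsWithin_iff.2 ⟨?_, ?_⟩
      · exact (Complex.continuous_ofReal.tendsto' 0 0 rfl).mono_left nhdsWithin_le_nhds
      · filter_upwards [self_mem_nhdsWithin] with t ht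
        simpa using ht
    exact h3.frequently (Filter.Frequently.of_forall h)
  have h4 := h1.eqOn_zero_of_preconnected_of_frequently_eq_zero isPreconnected_univ
    (Set.mem_univ 0) h2
  exact h4 (Set.mem_univ s)

/-- The tangency condition extends from `M` to the pairs of points `p`, `q` on the complexification
of `M`: such a pair is `(γ I, γ (-I))` for a holomorphic curve `γ` that maps the real line to `M`,
and the difference of the two sides of the tangency condition along `γ` is holomorphic. -/
lemma polarized_tangency (X : hol) {p q : E} (h : om p + sg (om q) = herm (zc p) (zc q)) :
    om (X.1.1 p) + sg (om (X.1.1 q)) =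
      herm (zc (X.1.1 p)) (zc q) + herm (zc p) (zc (X.1.1 q)) := by
  obtain ⟨z1, hz1⟩ : ∃ z1, z1 = (1 / 2 : ℂ) • (zc p + zc q) := ⟨_, rfl⟩
  obtain ⟨z2, hz2⟩ : ∃ z2, z2 = (-I / 2 : ℂ) • (zc p - zc q) := ⟨_, rfl⟩
  obtain ⟨T, hT⟩ : ∃ T, T = om p - (1 / 2 : ℂ) • herm (zc p) (zc q) := ⟨_, rfl⟩
  obtain ⟨t1, ht1⟩ : ∃ t1, t1 = (1 / 2 : ℂ) • (T - sg T) := ⟨_, rfl⟩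
  obtain ⟨t2, ht2⟩ : ∃ t2, t2 = (-I / 2 : ℂ) • (T + sg T) := ⟨_, rfl⟩
  have hst1 : sg t1 = -t1 := by
    rw [ht1, sg_smul, sg_sub, sg_sg, ← smul_neg, neg_sub]; simp [map_ofNat]
  have hst2 : sg t2 = -t2 := by
    rw [ht2, sg_smul, sg_add, sg_sg, ← neg_smul, add_comm]; simp [map_ofNat, neg_div]
  let zs : ℂ → Fin 8 → ℂ := fun s => z1 + s • z2
  let ws : ℂ → Fin 8 → ℂ := fun s =>
    (1 / 2 : ℂ) • (herm z1 z1 + s • (herm z1 z2 + herm z2 z1) + s ^ 2 • herm z2 z2) + (t1 + s • t2)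
  let γ : ℂ → E := fun s => pt (zs s) (ws s)
  have h11 : herm z1 z1 = (1 / 4 : ℂ) • (herm (zc p) (zc p) + herm (zc p) (zc q) +
      herm (zc q) (zc p) + herm (zc q) (zc q)) := by
    rw [hz1]
    simp only [herm_smul_left, herm_smul_right, herm_add_left, herm_add_right, map_div₀, map_one,
      map_ofNat]
    module
  have h22 : herm z2 z2 = (1 / 4 : ℂ) • (herm (zc p) (zc p) - herm (zc p) (zc q) -
      herm (zc q) (zc p) + herm (zc q) (zc q)) := by
    rw [hz2]
    simp only [sub_eq_add_neg, ← neg_one_smul ℂ (zc q), herm_smul_left, herm_smul_right,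
      herm_add_left, herm_add_right, map_div₀, map_one, map_ofNat, map_neg, conj_I]
    ext j
    simp
    linear_combination (-1 / 4 : ℂ) * (herm (zc p) (zc p) j - herm (zc p) (zc q) j -
      herm (zc q) (zc p) j + herm (zc q) (zc q) j) * I_sq
  have h12 : herm z1 z2 + herm z2 z1 =
      (I / 2 : ℂ) • (herm (zc q) (zc p) - herm (zc p) (zc q)) := by
    rw [hz1, hz2]
    simp only [sub_eq_add_neg, ← neg_one_smul ℂ (zc q), herm_smul_left, herm_smul_right,
      herm_add_left, herm_add_right, map_div₀, map_one, map_ofNat, map_neg, conj_I]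
    module
  have hγp : γ I = p := by
    refine ext_zc_om ?_ ?_
    · simp only [γ, zs, zc_pt, hz1, hz2]
      ext i; simp; linear_combination (-(1 : ℂ) / 2) * (zc p i - zc q i) * I_sq
    · simp only [γ, ws, om_pt, h11, h22, h12, ht1, ht2, hT, sg_sub, sg_smul, sg_herm]
      ext j; simp [map_ofNat]
      linear_combination ((1 : ℂ) / 2 * (herm (zc q) (zc p) j - om p j - sg (om p) j)) * I_sq
  have hγq : γ (-I) = q := by
    have hq : om q = herm (zc q) (zc p) - sg (om p) := by
      rw [← sg_herm, ← h, sg_add, sg_sg]; abel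
    refine ext_zc_om ?_ ?_
    · simp only [γ, zs, zc_pt, hz1, hz2]
      ext i; simp; linear_combination ((1 : ℂ) / 2) * (zc p i - zc q i) * I_sq
    · simp only [γ, ws, om_pt, h11, h22, h12, ht1, ht2, hT, sg_sub, sg_smul, sg_herm, hq]
      ext j; simp [map_ofNat]
      linear_combination ((1 : ℂ) / 2 * (om p j + sg (om p) j - herm (zc q) (zc p) j)) * I_sq
  have hM : ∀ t : ℝ, γ t ∈ M := by
    intro t
    rw [mem_M_iff]
    simp only [γ, zs, ws, zc_pt, om_pt, sg_add, sg_smul, hst1, hst2, sg_herm, herm_add_left,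
      herm_add_right, herm_smul_left, herm_smul_right, map_pow, conj_ofReal, map_div₀, map_one,
      map_ofNat]
    ext j
    simp
    ring
  have hzs : ∀ i, Differentiable ℂ fun s => zs s i := fun i => by simp only [zs]; fun_prop
  have hws : ∀ i, Differentiable ℂ fun s => ws s i := fun i => by simp [ws]; fun_prop
  have hg : Differentiable ℂ fun s => X.1.1 (γ s) :=
    (holVF_differentiable X.1).comp (differentiable_pt hzs hws)
  have hgz : ∀ i, Differentiable ℂ fun s => zc (X.1.1 (γ s)) i := fun i =>
    differentiable_pi.1 hg (.inl i)
  ext j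
  have hF : Differentiable ℂ fun s => om (X.1.1 (γ s)) j + sg (om (X.1.1 (γ (conj s)))) j -
      (herm (zc (X.1.1 (γ s))) (zs (conj s)) j + herm (zs s) (zc (X.1.1 (γ (conj s)))) j) :=
    ((differentiable_om hg j).add (differentiable_sg (differentiable_om hg) j)).sub
      ((differentiable_herm hgz hzs j).add (differentiable_herm hzs hgz j))
  have h0 := eq_zero_of_eq_zero_on_reals hF (fun t => by
    have h1 := congrFun ((mem_tangentSpace_iff_herm _ _).1 (X.2 (γ t) (hM t))) j
    simp only [conj_ofReal]
    rw [sub_eq_zero]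
    exact h1) I
  simp only [conj_I, hγp, hγq] at h0
  have hzp : zs I = zc p := by rw [← hγp]; rfl
  have hzq : zs (-I) = zc q := by rw [← hγq]; rfl
  rw [hzp, hzq, sub_eq_zero] at h0
  exact h0

end

section

/-! ### The listed vector fields are tangent and homogeneous -/

/-- The vector field with coefficients `(A x).1` of the `∂/∂z_i` and `(A x).2` of the `∂/∂w_j` is
tangent to `M` and homogeneous of weight `k`. -/
structure IsGradedSymmetry (k : ℤ) (A : E → (Fin 8 → ℂ) × (Fin 8 → ℂ)) : Prop where
  tangentOn : TangentOn (fun x => Sum.elim (A x).1 (A x).2) M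
  homFun_fst : ∀ i, HomFun (fun x => (A x).1 i) (k + 1)
  homFun_snd : ∀ i, HomFun (fun x => (A x).2 i) (k + 2)

/-- A lemma that, applied repeatedly, reduces a statement about the rows of an explicit list of
vector fields to one statement for each row. -/
lemma forall_isGradedSymmetry_cons {k : ℤ} {n : ℕ} {A : E → (Fin 8 → ℂ) × (Fin 8 → ℂ)}
    {v : E → Fin n → (Fin 8 → ℂ) × (Fin 8 → ℂ)} (hA : IsGradedSymmetry k A)
    (hv : ∀ i, IsGradedSymmetry k fun x => v x i) :
    ∀ i, IsGradedSymmetry k fun x => Matrix.vecCons (A x) (v x) i :=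
  Fin.cases hA hv

lemma forall_isGradedSymmetry_empty {k : ℤ} {v : E → Fin 0 → (Fin 8 → ℂ) × (Fin 8 → ℂ)} :
    ∀ i, IsGradedSymmetry k fun x => v x i :=
  fun i => i.elim0

lemma forall_homFun_cons {k : ℤ} {n : ℕ} {f : E → ℂ} {v : E → Fin n → ℂ} (hf : HomFun f k)
    (hv : ∀ i, HomFun (fun x => v x i) k) :
    ∀ i, HomFun (fun x => Matrix.vecCons (f x) (v x) i) k :=
  Fin.cases hf hv

lemma forall_homFun_empty {k : ℤ} {v : E → Fin 0 → ℂ} : ∀ i, HomFun (fun x => v x i) k :=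
  fun i => i.elim0

lemma HomFun.const_mul {k : ℤ} {f : E → ℂ} (hf : HomFun f k) (c : ℂ) :
    HomFun (fun x => c * f x) k :=
  ⟨contDiff_const.mul hf.contDiff, fun s hs x => by rw [hf.apply_dil s hs]; ring⟩

/-- Tangency in coordinates.  The conjugates of the `w_j` at a point of `M` are polynomials in the
other coordinates and their conjugates; three of the eight equations are the conjugates of others
and have been omitted. -/
lemma isGradedSymmetry_of_eqs {k : ℤ} {c : ℂ} {a0 a1 a2 a3 a4 a5 a6 a7 b0 b1 b2 b3 b4 b5 b6 b7 : E → ℂ}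
    (ha : ∀ i, HomFun (fun x => ![a0 x, a1 x, a2 x, a3 x, a4 x, a5 x, a6 x, a7 x] i) (k + 1))
    (hb : ∀ i, HomFun (fun x => ![b0 x, b1 x, b2 x, b3 x, b4 x, b5 x, b6 x, b7 x] i) (k + 2))
    (h : ∀ x, ∀ y1 y2 y3 y4 y5 y6 y7 y8,
      conj (x (.inl 0)) = y1 → conj (x (.inl 1)) = y2 → conj (x (.inl 2)) = y3 →
      conj (x (.inl 3)) = y4 → conj (x (.inl 4)) = y5 → conj (x (.inl 5)) = y6 →
      conj (x (.inl 6)) = y7 → conj (x (.inl 7)) = y8 →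
      conj (x (.inr 0)) = x (.inl 0) * y1 + x (.inl 1) * y2 + x (.inl 2) * y3 + x (.inl 3) * y4
        - x (.inr 0) →
      conj (x (.inr 1)) = x (.inl 4) * y5 + x (.inl 5) * y6 + x (.inl 6) * y7 + x (.inl 7) * y8
        - x (.inr 1) →
      conj (x (.inr 2)) = x (.inr 2) -
        (x (.inl 0) * y7 + x (.inl 1) * y8 + x (.inl 4) * y3 + x (.inl 5) * y4 -
        (x (.inl 6) * y1 + x (.inl 7) * y2 + x (.inl 2) * y5 + x (.inl 3) * y6)) →
      conj (x (.inr 3)) =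
        (x (.inl 0) * y7 + x (.inl 1) * y8 + x (.inl 4) * y3 + x (.inl 5) * y4 +
        (x (.inl 6) * y1 + x (.inl 7) * y2 + x (.inl 2) * y5 + x (.inl 3) * y6)) - x (.inr 3) →
      conj (x (.inr 4)) = x (.inr 4) -
        (x (.inl 0) * y6 - x (.inl 2) * y8 + x (.inl 4) * y2 - x (.inl 6) * y4 -
        (x (.inl 5) * y1 - x (.inl 7) * y3 + x (.inl 1) * y5 - x (.inl 3) * y7)) →
      conj (x (.inr 5)) =
        (x (.inl 0) * y6 - x (.inl 2) * y8 + x (.inl 4) * y2 - x (.inl 6) * y4 +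
        (x (.inl 5) * y1 - x (.inl 7) * y3 + x (.inl 1) * y5 - x (.inl 3) * y7)) - x (.inr 5) →
      conj (x (.inr 6)) = x (.inr 6) -
        (x (.inl 1) * y6 + x (.inl 2) * y7 - x (.inl 4) * y1 - x (.inl 7) * y4 -
        (x (.inl 5) * y2 + x (.inl 6) * y3 - x (.inl 0) * y5 - x (.inl 3) * y8)) →
      conj (x (.inr 7)) =
        (x (.inl 1) * y6 + x (.inl 2) * y7 - x (.inl 4) * y1 - x (.inl 7) * y4 +
        (x (.inl 5) * y2 + x (.inl 6) * y3 - x (.inl 0) * y5 - x (.inl 3) * y8)) - x (.inr 7) →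
      c * b0 x + conj c * conj (b0 x) =
        c * (a0 x * y1 + a1 x * y2 + a2 x * y3 + a3 x * y4) +
        conj c * (x (.inl 0) * conj (a0 x) + x (.inl 1) * conj (a1 x) + x (.inl 2) * conj (a2 x) +
          x (.inl 3) * conj (a3 x)) ∧
      c * b1 x + conj c * conj (b1 x) =
        c * (a4 x * y5 + a5 x * y6 + a6 x * y7 + a7 x * y8) +
        conj c * (x (.inl 4) * conj (a4 x) + x (.inl 5) * conj (a5 x) + x (.inl 6) * conj (a6 x) +
          x (.inl 7) * conj (a7 x)) ∧
      c * (b3 x + b2 x) + conj c * (conj (b3 x) - conj (b2 x)) =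
        2 * (c * (a0 x * y7 + a1 x * y8 + a4 x * y3 + a5 x * y4) +
        conj c * (x (.inl 0) * conj (a6 x) + x (.inl 1) * conj (a7 x) + x (.inl 4) * conj (a2 x) +
          x (.inl 5) * conj (a3 x))) ∧
      c * (b5 x + b4 x) + conj c * (conj (b5 x) - conj (b4 x)) =
        2 * (c * (a0 x * y6 - a2 x * y8 + a4 x * y2 - a6 x * y4) +
        conj c * (x (.inl 0) * conj (a5 x) - x (.inl 2) * conj (a7 x) + x (.inl 4) * conj (a1 x) -
          x (.inl 6) * conj (a3 x))) ∧
      c * (b7 x + b6 x) + conj c * (conj (b7 x) - conj (b6 x)) =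
        2 * (c * (a1 x * y6 + a2 x * y7 - a4 x * y1 - a7 x * y4) +
        conj c * (x (.inl 1) * conj (a5 x) + x (.inl 2) * conj (a6 x) - x (.inl 4) * conj (a0 x) -
          x (.inl 7) * conj (a3 x)))) :
    IsGradedSymmetry k fun x => c • (![a0 x, a1 x, a2 x, a3 x, a4 x, a5 x, a6 x, a7 x],
      ![b0 x, b1 x, b2 x, b3 x, b4 x, b5 x, b6 x, b7 x]) := by
  refine ⟨fun p hp => ?_, fun i => (ha i).const_mul c, fun i => (hb i).const_mul c⟩
  rw [mem_tangentSpace_iff_herm]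
  have hM := (mem_M_iff p).1 hp
  have hM0 := congrFun hM 0
  have hM1 := congrFun hM 1
  have hM2 := congrFun hM 2
  have hM3 := congrFun hM 3
  have hM4 := congrFun hM 4
  have hM5 := congrFun hM 5
  have hM6 := congrFun hM 6
  have hM7 := congrFun hM 7
  simp [om, sg, herm, zc] at hM0 hM1 hM2 hM3 hM4 hM5 hM6 hM7
  obtain ⟨e0, e1, e2, e4, e6⟩ := h p _ _ _ _ _ _ _ _ rfl rfl rfl rfl rfl rfl rfl rfl
    (by linear_combination hM0) (by linear_combination hM1)
    (by linear_combination (hM3 - hM2) / 2) (by linear_combination (hM3 + hM2) / 2)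
    (by linear_combination (hM5 - hM4) / 2) (by linear_combination (hM5 + hM4) / 2)
    (by linear_combination (hM7 - hM6) / 2) (by linear_combination (hM7 + hM6) / 2)
  have e3 := congrArg conj e2
  have e5 := congrArg conj e4
  have e7 := congrArg conj e6
  simp [map_ofNat] at e3 e5 e7
  apply ext_fin_eight
  · simp [om, sg, herm, zc]; linear_combination e0
  · simp [om, sg, herm, zc]; linear_combination e1
  · simp [om, sg, herm, zc]; linear_combination e2
  · simp [om, sg, herm, zc]; linear_combination e3
  · simp [om, sg, herm, zc]; linear_combination e4
  · simp [om, sg, herm, zc]; linear_combination e5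
  · simp [om, sg, herm, zc]; linear_combination e6
  · simp [om, sg, herm, zc]; linear_combination e7

lemma isGradedSymmetry_of_eqs_one {k : ℤ} {A : E → (Fin 8 → ℂ) × (Fin 8 → ℂ)}
    (h : IsGradedSymmetry k fun x => (1 : ℂ) • A x) : IsGradedSymmetry k A := by
  simpa only [one_smul] using h

lemma dil_inl (s : ℂ) (x : E) (i : Fin 8) : dil s x (.inl i) = s * x (.inl i) := by
  simp [dil_apply, wt]

lemma dil_inr (s : ℂ) (x : E) (j : Fin 8) : dil s x (.inr j) = s ^ 2 * x (.inr j) := by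
  simp [dil_apply, wt]

lemma homFun_of_toNat {k : ℤ} {f : E → ℂ} (hk : 0 ≤ k) (hf : ContDiff ℂ ⊤ f)
    (h : ∀ s x, f (dil s x) = s ^ k.toNat * f x) : HomFun f k :=
  ⟨hf, fun s _ x => by rw [h, ← zpow_natCast, Int.toNat_of_nonneg hk]⟩

lemma isGradedSymmetry_ofCoords {k : ℤ} {n : ℕ} {F : ℂ → ℂ → ℂ → ℂ → ℂ → ℂ → ℂ → ℂ → ℂ → ℂ → ℂ →
    ℂ → ℂ → ℂ → ℂ → ℂ → Fin n → (Fin 8 → ℂ) × (Fin 8 → ℂ)}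
    (h : ∀ i, IsGradedSymmetry k fun x => onCoords F x i) (i : Fin n) :
    TangentOn (ofCoords F i) M ∧ ∀ a, HomFun (fun x => ofCoords F i x a) (k + wt a) :=
  ⟨(h i).tangentOn, fun a => by
    rcases a with a | a
    exacts [(h i).homFun_fst a, (h i).homFun_snd a]⟩

lemma homFun_zero' {k : ℤ} : HomFun (fun _ => (0 : ℂ)) k := ⟨contDiff_const, by simp⟩

set_option maxHeartbeats 0 in
lemma genNegTwo_tangentOn_and_homFun : ∀ i, TangentOn (genNegTwo i) M ∧
    ∀ a, HomFun (fun x => genNegTwo i x a) ((-2) + wt a) := by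
  refine isGradedSymmetry_ofCoords ?_
  dsimp only [onCoords]
  repeat' first | exact forall_isGradedSymmetry_empty | apply forall_isGradedSymmetry_cons
  all_goals
    first
    | refine isGradedSymmetry_of_eqs ?_ ?_ ?_
    | refine isGradedSymmetry_of_eqs_one (isGradedSymmetry_of_eqs ?_ ?_ ?_)
    rotate_right
    · intro x y1 y2 y3 y4 y5 y6 y7 y8 hy1 hy2 hy3 hy4 hy5 hy6 hy7 hy8 hw1 hw2 hw3 hw4 hw5 hw6 hw7 hw8
      simp only [map_add, map_mul, map_sub, map_neg, map_pow, map_ofNat, map_one, map_zero, conj_I,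
        hy1, hy2, hy3, hy4, hy5, hy6, hy7, hy8, hw1, hw2, hw3, hw4, hw5, hw6, hw7, hw8]
      refine ⟨?_, ?_, ?_, ?_, ?_⟩ <;> ring
    all_goals
      repeat' first | exact forall_homFun_empty | exact homFun_zero' | apply forall_homFun_cons
      all_goals
        refine homFun_of_toNat (by norm_num) (by fun_prop) fun s x => ?_
        simp only [dil_inl, dil_inr, Int.reduceAdd, Int.reduceNeg, Int.reduceToNat]
        try ring

set_option maxHeartbeats 0 in
lemma genNegOne_tangentOn_and_homFun : ∀ i, TangentOn (genNegOne i) M ∧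
    ∀ a, HomFun (fun x => genNegOne i x a) ((-1) + wt a) := by
  refine isGradedSymmetry_ofCoords ?_
  dsimp only [onCoords]
  repeat' first | exact forall_isGradedSymmetry_empty | apply forall_isGradedSymmetry_cons
  all_goals
    first
    | refine isGradedSymmetry_of_eqs ?_ ?_ ?_
    | refine isGradedSymmetry_of_eqs_one (isGradedSymmetry_of_eqs ?_ ?_ ?_)
    rotate_right
    · intro x y1 y2 y3 y4 y5 y6 y7 y8 hy1 hy2 hy3 hy4 hy5 hy6 hy7 hy8 hw1 hw2 hw3 hw4 hw5 hw6 hw7 hw8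
      simp only [map_add, map_mul, map_sub, map_neg, map_pow, map_ofNat, map_one, map_zero, conj_I,
        hy1, hy2, hy3, hy4, hy5, hy6, hy7, hy8, hw1, hw2, hw3, hw4, hw5, hw6, hw7, hw8]
      refine ⟨?_, ?_, ?_, ?_, ?_⟩ <;> ring
    all_goals
      repeat' first | exact forall_homFun_empty | exact homFun_zero' | apply forall_homFun_cons
      all_goals
        refine homFun_of_toNat (by norm_num) (by fun_prop) fun s x => ?_
        simp only [dil_inl, dil_inr, Int.reduceAdd, Int.reduceNeg, Int.reduceToNat]
        try ring

set_option maxHeartbeats 0 in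
lemma genZero_tangentOn_and_homFun : ∀ i, TangentOn (genZero i) M ∧
    ∀ a, HomFun (fun x => genZero i x a) (0 + wt a) := by
  refine isGradedSymmetry_ofCoords ?_
  dsimp only [onCoords]
  repeat' first | exact forall_isGradedSymmetry_empty | apply forall_isGradedSymmetry_cons
  all_goals
    first
    | refine isGradedSymmetry_of_eqs ?_ ?_ ?_
    | refine isGradedSymmetry_of_eqs_one (isGradedSymmetry_of_eqs ?_ ?_ ?_)
    rotate_right
    · intro x y1 y2 y3 y4 y5 y6 y7 y8 hy1 hy2 hy3 hy4 hy5 hy6 hy7 hy8 hw1 hw2 hw3 hw4 hw5 hw6 hw7 hw8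
      simp only [map_add, map_mul, map_sub, map_neg, map_pow, map_ofNat, map_one, map_zero, conj_I,
        hy1, hy2, hy3, hy4, hy5, hy6, hy7, hy8, hw1, hw2, hw3, hw4, hw5, hw6, hw7, hw8]
      refine ⟨?_, ?_, ?_, ?_, ?_⟩ <;> ring
    all_goals
      repeat' first | exact forall_homFun_empty | exact homFun_zero' | apply forall_homFun_cons
      all_goals
        refine homFun_of_toNat (by norm_num) (by fun_prop) fun s x => ?_
        simp only [dil_inl, dil_inr, Int.reduceAdd, Int.reduceNeg, Int.reduceToNat]
        try ring

set_option maxHeartbeats 0 in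
lemma genOne_tangentOn_and_homFun : ∀ i, TangentOn (genOne i) M ∧
    ∀ a, HomFun (fun x => genOne i x a) (1 + wt a) := by
  refine isGradedSymmetry_ofCoords ?_
  dsimp only [onCoords]
  repeat' first | exact forall_isGradedSymmetry_empty | apply forall_isGradedSymmetry_cons
  all_goals
    first
    | refine isGradedSymmetry_of_eqs ?_ ?_ ?_
    | refine isGradedSymmetry_of_eqs_one (isGradedSymmetry_of_eqs ?_ ?_ ?_)
    rotate_right
    · intro x y1 y2 y3 y4 y5 y6 y7 y8 hy1 hy2 hy3 hy4 hy5 hy6 hy7 hy8 hw1 hw2 hw3 hw4 hw5 hw6 hw7 hw8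
      simp only [map_add, map_mul, map_sub, map_neg, map_pow, map_ofNat, map_one, map_zero, conj_I,
        hy1, hy2, hy3, hy4, hy5, hy6, hy7, hy8, hw1, hw2, hw3, hw4, hw5, hw6, hw7, hw8]
      refine ⟨?_, ?_, ?_, ?_, ?_⟩ <;> ring
    all_goals
      repeat' first | exact forall_homFun_empty | exact homFun_zero' | apply forall_homFun_cons
      all_goals
        refine homFun_of_toNat (by norm_num) (by fun_prop) fun s x => ?_
        simp only [dil_inl, dil_inr, Int.reduceAdd, Int.reduceNeg, Int.reduceToNat]
        try ring

set_option maxHeartbeats 0 in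
lemma genTwo_tangentOn_and_homFun : ∀ i, TangentOn (genTwo i) M ∧
    ∀ a, HomFun (fun x => genTwo i x a) (2 + wt a) := by
  refine isGradedSymmetry_ofCoords ?_
  dsimp only [onCoords]
  repeat' first | exact forall_isGradedSymmetry_empty | apply forall_isGradedSymmetry_cons
  all_goals
    first
    | refine isGradedSymmetry_of_eqs ?_ ?_ ?_
    | refine isGradedSymmetry_of_eqs_one (isGradedSymmetry_of_eqs ?_ ?_ ?_)
    rotate_right
    · intro x y1 y2 y3 y4 y5 y6 y7 y8 hy1 hy2 hy3 hy4 hy5 hy6 hy7 hy8 hw1 hw2 hw3 hw4 hw5 hw6 hw7 hw8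
      simp only [map_add, map_mul, map_sub, map_neg, map_pow, map_ofNat, map_one, map_zero, conj_I,
        hy1, hy2, hy3, hy4, hy5, hy6, hy7, hy8, hw1, hw2, hw3, hw4, hw5, hw6, hw7, hw8]
      refine ⟨?_, ?_, ?_, ?_, ?_⟩ <;> ring
    all_goals
      repeat' first | exact forall_homFun_empty | exact homFun_zero' | apply forall_homFun_cons
      all_goals
        refine homFun_of_toNat (by norm_num) (by fun_prop) fun s x => ?_
        simp only [dil_inl, dil_inr, Int.reduceAdd, Int.reduceNeg, Int.reduceToNat]
        try ring

lemma generator_tangentOn_and_homFun : ∀ i, TangentOn (generator i) M ∧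
    ∀ a, HomFun (fun x => generator i x a) (genWeight i + wt a) := by
  rintro (i | i | i | i | i)
  exacts [genNegTwo_tangentOn_and_homFun i, genNegOne_tangentOn_and_homFun i,
    genZero_tangentOn_and_homFun i, genOne_tangentOn_and_homFun i, genTwo_tangentOn_and_homFun i]

/-- The listed vector fields as elements of `hol`. -/
def genHol (i : GenIndex) : hol :=
  ⟨⟨generator i, (contDiff_pi.2 fun a =>
    ((generator_tangentOn_and_homFun i).2 a).contDiff).analyticOnNhd⟩,
    (generator_tangentOn_and_homFun i).1⟩

@[simp] lemma genHol_coe (i : GenIndex) : (genHol i).1.1 = generator i := rfl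

lemma genHol_mem (i : GenIndex) : genHol i ∈ gradedPiece (genWeight i) :=
  (hasWeight_iff _ _).2 (generator_tangentOn_and_homFun i).2

end

section

/-! ### The structure of the graded pieces -/

/-- The `z`-part of a vector field, in light-cone coordinates. -/
def zp (X : hol) (z v : Fin 8 → ℂ) : Fin 8 → ℂ := zc (X.1.1 (pt z v))

/-- The `w`-part of a vector field, in light-cone coordinates. -/
def wp (X : hol) (z v : Fin 8 → ℂ) : Fin 8 → ℂ := om (X.1.1 (pt z v))

lemma hol_ext_zp_wp {X Y : hol} (hz : ∀ z v, zp X z v = zp Y z v)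
    (hw : ∀ z v, wp X z v = wp Y z v) : X = Y :=
  hol_ext fun x => by
    rw [← pt_zc_om x]
    exact ext_zc_om (hz _ _) (hw _ _)

@[simp] lemma zp_zero (z v : Fin 8 → ℂ) : zp 0 z v = 0 := rfl

@[simp] lemma wp_zero (z v : Fin 8 → ℂ) : wp 0 z v = 0 := by
  apply ext_fin_eight <;> simp [wp, om]

/-- The polarized tangency condition in light-cone coordinates: tangency is used at pairs of points
of the complexification of `M`, not only at the points of `M` itself. -/
lemma wp_add_sg_wp (X : hol) {z v y u : Fin 8 → ℂ} (h : v + sg u = herm z y) :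
    wp X z v + sg (wp X y u) = herm (zp X z v) y + herm z (zp X y u) := by
  have := polarized_tangency X (p := pt z v) (q := pt y u) (by simpa using h)
  rwa [zc_pt, zc_pt] at this

/-- The `w`-part of a field is determined by the restriction of the field to `z = 0`. -/
lemma wp_eq (X : hol) (z v : Fin 8 → ℂ) :
    wp X z v = herm z (zp X 0 (-sg v)) - sg (wp X 0 (-sg v)) := by
  have := wp_add_sg_wp X (z := z) (v := v) (y := 0) (u := -sg v) (by simp [sg_neg, sg_sg])
  rw [herm_zero_right, zero_add] at this
  rw [← this]; abel

lemma dil_pt (s : ℂ) (z v : Fin 8 → ℂ) : dil s (pt z v) = pt (s • z) (s ^ 2 • v) := by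
  refine ext_zc_om ?_ ?_
  · ext i; simp [zc, dil_inl, pt]
  · rw [om_pt]
    conv_rhs => rw [← om_pt z v, ← om_smul]
    apply ext_fin_eight <;> simp [om, dil_inr]

variable {k : ℤ} {X : hol}

lemma homFun_zc (hX : X ∈ gradedPiece k) (i : Fin 8) : HomFun (fun x => zc (X.1.1 x) i) (k + 1) :=
  hasWeight_of_mem hX (.inl i)

lemma homFun_om (hX : X ∈ gradedPiece k) (j : Fin 8) : HomFun (fun x => om (X.1.1 x) j) (k + 2) := by
  have h := fun i => hasWeight_of_mem hX (.inr i)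
  fin_cases j
  exacts [h 0, h 1, (h 3).add (h 2), (h 3).sub (h 2), (h 5).add (h 4), (h 5).sub (h 4),
    (h 7).add (h 6), (h 7).sub (h 6)]

lemma zp_dil (hX : X ∈ gradedPiece k) {s : ℂ} (hs : s ≠ 0) (z v : Fin 8 → ℂ) :
    zp X (s • z) (s ^ 2 • v) = s ^ (k + 1) • zp X z v := by
  ext i
  have := (homFun_zc hX i).2 s hs (pt z v)
  rwa [dil_pt] at this

lemma wp_dil (hX : X ∈ gradedPiece k) {s : ℂ} (hs : s ≠ 0) (z v : Fin 8 → ℂ) :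
    wp X (s • z) (s ^ 2 • v) = s ^ (k + 2) • wp X z v := by
  ext i
  have := (homFun_om hX i).2 s hs (pt z v)
  rwa [dil_pt] at this

lemma zp_zero_eq_zero (hX : X ∈ gradedPiece k) (hk : Odd (k + 1)) (v : Fin 8 → ℂ) :
    zp X 0 v = 0 := by
  have := zp_dil hX (s := -1) (by simp) 0 v
  rw [hk.neg_one_zpow] at this
  simp at this
  exact self_eq_neg.1 this

lemma wp_zero_eq_zero (hX : X ∈ gradedPiece k) (hk : Odd (k + 2)) (v : Fin 8 → ℂ) :
    wp X 0 v = 0 := by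
  have := wp_dil hX (s := -1) (by simp) 0 v
  rw [hk.neg_one_zpow] at this
  simp at this
  exact self_eq_neg.1 this

lemma eq_zero_of_le_neg_three (hX : X ∈ gradedPiece k) (hk : k ≤ -3) : X = 0 :=
  hol_ext_zp_wp (fun z v => funext fun i => (homFun_zc hX i).eq_zero_of_neg (by omega) _)
    (fun z v => (funext fun i => (homFun_om hX i).eq_zero_of_neg (by omega) _ : wp X z v = 0).trans
      (wp_zero z v).symm)

lemma continuous_zp (X : hol) {α : Type*} [TopologicalSpace α] {f g : α → Fin 8 → ℂ}
    (hf : Continuous f) (hg : Continuous g) : Continuous fun t => zp X (f t) (g t) := by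
  have h1 : Continuous (X.1.1 : E → E) := (holVF_differentiable X.1).continuous
  have h2 : Continuous fun p : (Fin 8 → ℂ) × (Fin 8 → ℂ) => pt p.1 p.2 := by
    refine continuous_pi ?_
    rintro (i | j)
    · exact (continuous_apply i).comp continuous_fst
    · have h := fun i : Fin 8 => (continuous_apply i).comp
        (continuous_snd (X := Fin 8 → ℂ) (Y := Fin 8 → ℂ))
      fin_cases j
      exacts [h 0, h 1, ((h 2).sub (h 3)).div_const 2, ((h 2).add (h 3)).div_const 2,
        ((h 4).sub (h 5)).div_const 2, ((h 4).add (h 5)).div_const 2,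
        ((h 6).sub (h 7)).div_const 2, ((h 6).add (h 7)).div_const 2]
  have h3 : Continuous (zc : E → Fin 8 → ℂ) := continuous_pi fun i => continuous_apply (Sum.inl i)
  exact h3.comp (h1.comp (h2.comp (hf.prodMk hg)))

/-! ### Fields of negative weight -/

lemma pt_add (z z' v v' : Fin 8 → ℂ) : pt (z + z') (v + v') = pt z v + pt z' v' :=
  ext_zc_om (by rfl) (by simp [om_add])

lemma pt_smul (c : ℂ) (z v : Fin 8 → ℂ) : pt (c • z) (c • v) = c • pt z v :=
  ext_zc_om (by rfl) (by simp [om_smul])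

/-- The constant field on the `w`-space with value `t` in light-cone coordinates; the condition on
`t` says that `M` is invariant under translation by it. -/
def tauField (t : Fin 8 → ℂ) (ht : t + sg t = 0) : hol :=
  ⟨⟨fun _ => pt 0 t, analyticOnNhd_const⟩, fun p _ => by
    rw [mem_tangentSpace_iff_herm]
    simp [ht]⟩

lemma tauField_apply (t : Fin 8 → ℂ) (ht : t + sg t = 0) (x : E) :
    (tauField t ht).1.1 x = pt 0 t := rfl

lemma tauField_mem (t : Fin 8 → ℂ) (ht : t + sg t = 0) : tauField t ht ∈ gradedPiece (-2) := by
  refine (hasWeight_iff _ _).2 ?_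
  rintro (a | a)
  · exact homFun_zero'
  · exact ⟨contDiff_const, fun s _ x => by simp [wt, tauField_apply]⟩

/-- The linear map `(z, w) ↦ (0, herm z c)`. -/
def hermL (c : Fin 8 → ℂ) : E →L[ℂ] E :=
  LinearMap.toContinuousLinearMap
    { toFun := fun x => pt 0 (herm (zc x) c)
      map_add' := fun x y => by
        rw [← pt_add, add_zero, ← herm_add_left]; rfl
      map_smul' := fun a x => by
        rw [RingHom.id_apply, ← pt_smul, smul_zero, ← herm_smul_left]; rfl }

lemma hermL_apply (c : Fin 8 → ℂ) (x : E) : hermL c x = pt 0 (herm (zc x) c) := rfl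

/-- The field of weight `-1` with value `c` at the origin. These fields and the fields `tauField`
generate a Heisenberg-like group of affine automorphisms that is transitive on `M`. -/
def heisField (c : Fin 8 → ℂ) : hol :=
  ⟨⟨fun x => pt c 0 + hermL c x,
    (contDiff_const.add (hermL c).contDiff).analyticOnNhd⟩, fun p _ => by
    rw [mem_tangentSpace_iff_herm]
    simp only [hermL_apply, ← pt_add, add_zero, zero_add, om_pt, zc_pt, sg_herm]
    abel⟩

lemma heisField_apply (c : Fin 8 → ℂ) (x : E) :
    (heisField c).1.1 x = pt c (herm (zc x) c) := by
  change pt c 0 + hermL c x = _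
  rw [hermL_apply, ← pt_add, add_zero, zero_add]

lemma zp_heisField (c z v : Fin 8 → ℂ) : zp (heisField c) z v = c := by
  rw [zp, heisField_apply, zc_pt]

lemma wp_heisField (c z v : Fin 8 → ℂ) : wp (heisField c) z v = herm z c := by
  rw [wp, heisField_apply, om_pt, zc_pt]

lemma heisField_mem (c : Fin 8 → ℂ) : heisField c ∈ gradedPiece (-1) := by
  have h : ContDiff ℂ ⊤ ((heisField c).1.1) := holVF_contDiff _ _
  refine (hasWeight_iff _ _).2 fun a => ⟨contDiff_pi.1 h a, fun s hs x => ?_⟩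
  simp only [heisField_apply]
  have hz : zc (dil s x) = s • zc x := by ext i; simp [zc, dil_inl]
  rw [hz, herm_smul_left]
  rcases a with a | a
  · simp [wt, pt]
  · have : pt c (s • herm (zc x) c) = pt ((1 - s) • c) 0 + s • pt c (herm (zc x) c) := by
      rw [← pt_smul, ← pt_add, ← add_smul]; simp
    rw [this]
    revert a
    have h2 : (-1 : ℤ) + 2 = 1 := by norm_num
    simp only [wt, Sum.elim_inr, h2, zpow_one, Pi.add_apply, Pi.smul_apply, smul_eq_mul]
    intro a
    have h3 : pt ((1 - s) • c) 0 (.inr a) = 0 := by fin_cases a <;> simp [pt]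
    rw [h3, zero_add]

lemma lie_tauField (t : Fin 8 → ℂ) (ht : t + sg t = 0) (X : hol) (x : E) :
    (⁅tauField t ht, X⁆ : hol).1.1 x = fderiv ℂ X.1.1 x (pt 0 t) := by
  have h1 : (⁅tauField t ht, X⁆ : hol).1.1 x = ((⁅(tauField t ht).1, X.1⁆ : HolVF) : E → E) x := rfl
  have h2 : fderiv ℂ (tauField t ht).1.1 x = 0 := fderiv_const_apply _
  rw [h1, lie_apply, h2, tauField_apply]
  simp

lemma fderiv_heisField (c : Fin 8 → ℂ) (x : E) : fderiv ℂ (heisField c).1.1 x = hermL c :=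
  ((hermL c).hasFDerivAt.const_add (pt c 0)).fderiv

lemma lie_heisField (c : Fin 8 → ℂ) (X : hol) (x : E) :
    (⁅heisField c, X⁆ : hol).1.1 x =
      fderiv ℂ X.1.1 x (pt c (herm (zc x) c)) - pt 0 (herm (zc (X.1.1 x)) c) := by
  have h1 : (⁅heisField c, X⁆ : hol).1.1 x = ((⁅(heisField c).1, X.1⁆ : HolVF) : E → E) x := rfl
  rw [h1, lie_apply, fderiv_heisField, heisField_apply, hermL_apply]

lemma herm_sub_herm_add_sg (c d : Fin 8 → ℂ) :
    (herm c d - herm d c) + sg (herm c d - herm d c) = 0 := by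
  rw [sg_sub, sg_herm, sg_herm]; abel

lemma lie_heisField_heisField (c d : Fin 8 → ℂ) :
    ⁅heisField c, heisField d⁆ = tauField (herm c d - herm d c) (herm_sub_herm_add_sg c d) := by
  refine hol_ext fun x => ?_
  rw [lie_heisField, fderiv_heisField, hermL_apply, heisField_apply, tauField_apply, zc_pt, zc_pt]
  refine ext_zc_om ?_ ?_
  · ext; simp [zc, pt]
  · rw [om_sub, om_pt, om_pt, om_pt]

/-- The elements of `𝔤₋₂` are the constant fields on the `w`-space. -/
lemma eq_tauField (hX : X ∈ gradedPiece (-2)) : ∃ t ht, X = tauField t ht := by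
  have hz : ∀ z v, zp X z v = 0 := fun z v => funext fun i =>
    (homFun_zc hX i).eq_zero_of_neg (by norm_num) _
  have hw : ∀ z v, wp X z v = wp X 0 0 := fun z v => funext fun i =>
    ((homFun_om hX i).eq_const _).trans ((homFun_om hX i).eq_const _).symm
  have h := wp_add_sg_wp X (z := 0) (v := 0) (y := 0) (u := 0) (by simp)
  refine ⟨wp X 0 0, by simpa [hz] using h, hol_ext_zp_wp (fun z v => ?_) fun z v => ?_⟩
  · rw [hz]; rfl
  · rw [hw]; exact (om_pt _ _).symm

/-- A field of weight `-1` is determined by its value at the origin. -/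
lemma eq_heisField (hX : X ∈ gradedPiece (-1)) : X = heisField (zp X 0 0) := by
  have hz : ∀ z v, zp X z v = zp X 0 0 := fun z v => funext fun i =>
    ((homFun_zc hX i).eq_const _).trans ((homFun_zc hX i).eq_const _).symm
  refine hol_ext_zp_wp (fun z v => ?_) fun z v => ?_
  · rw [hz, zp_heisField]
  · rw [wp_heisField, wp_eq, wp_zero_eq_zero hX ⟨0, by norm_num⟩, hz, sg_zero, sub_zero]

end

section

/-! ### Linear maps compatible with `herm` -/

/-- The standard basis vectors. -/
def ev (i : Fin 8) : Fin 8 → ℂ := Pi.single i 1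

lemma ev_apply (i j : Fin 8) : ev i j = if j = i then 1 else 0 := Pi.single_apply i 1 j

lemma exists_matrix (a : (Fin 8 → ℂ) →ₗ[ℂ] (Fin 8 → ℂ)) :
    ∃ A : Fin 8 → Fin 8 → ℂ, ∀ v m, a v m = ∑ l, v l * A l m := by
  refine ⟨fun l => a fun j => if l = j then 1 else 0, fun v m => ?_⟩
  rw [LinearMap.pi_apply_eq_sum_univ]
  simp

lemma herm_ev_left_0 (u : Fin 8 → ℂ) : herm (ev 0) u =
    ![conj (u 0), 0, 2 * conj (u 6), 0, 2 * conj (u 5), 0, 0, -(2 * conj (u 4))] := by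
  apply ext_fin_eight <;> simp [herm, ev_apply]

lemma herm_ev_left_1 (u : Fin 8 → ℂ) : herm (ev 1) u =
    ![conj (u 1), 0, 2 * conj (u 7), 0, 0, 2 * conj (u 4), 2 * conj (u 5), 0] := by
  apply ext_fin_eight <;> simp [herm, ev_apply]

lemma herm_ev_left_2 (u : Fin 8 → ℂ) : herm (ev 2) u =
    ![conj (u 2), 0, 0, 2 * conj (u 4), -(2 * conj (u 7)), 0, 2 * conj (u 6), 0] := by
  apply ext_fin_eight <;> simp [herm, ev_apply]

lemma herm_ev_left_3 (u : Fin 8 → ℂ) : herm (ev 3) u =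
    ![conj (u 3), 0, 0, 2 * conj (u 5), 0, -(2 * conj (u 6)), 0, -(2 * conj (u 7))] := by
  apply ext_fin_eight <;> simp [herm, ev_apply]

lemma herm_ev_left_4 (u : Fin 8 → ℂ) : herm (ev 4) u =
    ![0, conj (u 4), 2 * conj (u 2), 0, 2 * conj (u 1), 0, -(2 * conj (u 0)), 0] := by
  apply ext_fin_eight <;> simp [herm, ev_apply]

lemma herm_ev_left_5 (u : Fin 8 → ℂ) : herm (ev 5) u =
    ![0, conj (u 5), 2 * conj (u 3), 0, 0, 2 * conj (u 0), 0, 2 * conj (u 1)] := by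
  apply ext_fin_eight <;> simp [herm, ev_apply]

lemma herm_ev_left_6 (u : Fin 8 → ℂ) : herm (ev 6) u =
    ![0, conj (u 6), 0, 2 * conj (u 0), -(2 * conj (u 3)), 0, 0, 2 * conj (u 2)] := by
  apply ext_fin_eight <;> simp [herm, ev_apply]

lemma herm_ev_left_7 (u : Fin 8 → ℂ) : herm (ev 7) u =
    ![0, conj (u 7), 0, 2 * conj (u 1), 0, -(2 * conj (u 2)), -(2 * conj (u 3)), 0] := by
  apply ext_fin_eight <;> simp [herm, ev_apply]

lemma herm_ev_right_0 (u : Fin 8 → ℂ) : herm u (ev 0) =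
    ![u 0, 0, 0, 2 * u 6, 0, 2 * u 5, -(2 * u 4), 0] := by
  apply ext_fin_eight <;> simp [herm, ev_apply]

lemma herm_ev_right_1 (u : Fin 8 → ℂ) : herm u (ev 1) =
    ![u 1, 0, 0, 2 * u 7, 2 * u 4, 0, 0, 2 * u 5] := by
  apply ext_fin_eight <;> simp [herm, ev_apply]

lemma herm_ev_right_2 (u : Fin 8 → ℂ) : herm u (ev 2) =
    ![u 2, 0, 2 * u 4, 0, 0, -(2 * u 7), 0, 2 * u 6] := by
  apply ext_fin_eight <;> simp [herm, ev_apply]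

lemma herm_ev_right_3 (u : Fin 8 → ℂ) : herm u (ev 3) =
    ![u 3, 0, 2 * u 5, 0, -(2 * u 6), 0, -(2 * u 7), 0] := by
  apply ext_fin_eight <;> simp [herm, ev_apply]

lemma herm_ev_right_4 (u : Fin 8 → ℂ) : herm u (ev 4) =
    ![0, u 4, 0, 2 * u 2, 0, 2 * u 1, 0, -(2 * u 0)] := by
  apply ext_fin_eight <;> simp [herm, ev_apply]

lemma herm_ev_right_5 (u : Fin 8 → ℂ) : herm u (ev 5) =
    ![0, u 5, 0, 2 * u 3, 2 * u 0, 0, 2 * u 1, 0] := by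
  apply ext_fin_eight <;> simp [herm, ev_apply]

lemma herm_ev_right_6 (u : Fin 8 → ℂ) : herm u (ev 6) =
    ![0, u 6, 2 * u 0, 0, 0, -(2 * u 3), 2 * u 2, 0] := by
  apply ext_fin_eight <;> simp [herm, ev_apply]

lemma herm_ev_right_7 (u : Fin 8 → ℂ) : herm u (ev 7) =
    ![0, u 7, 2 * u 1, 0, -(2 * u 2), 0, 0, -(2 * u 3)] := by
  apply ext_fin_eight <;> simp [herm, ev_apply]

/-- The linear map `v ↦ cliff b v` on the `w`-space (in light-cone coordinates): the restriction to
`z = 0` of the `z`-part of the field of weight `1` with parameter `b`. -/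
def cliff (b v : Fin 8 → ℂ) : Fin 8 → ℂ :=
  ![b 0 * v 0 + (b 6 * v 2 + b 5 * v 4 - b 4 * v 7) / 2,
    b 1 * v 0 + (b 7 * v 2 + b 4 * v 5 + b 5 * v 6) / 2,
    b 2 * v 0 + (b 4 * v 3 - b 7 * v 4 + b 6 * v 6) / 2,
    b 3 * v 0 + (b 5 * v 3 - b 6 * v 5 - b 7 * v 7) / 2,
    b 4 * v 1 + (b 2 * v 2 + b 1 * v 4 - b 0 * v 6) / 2,
    b 5 * v 1 + (b 3 * v 2 + b 0 * v 5 + b 1 * v 7) / 2,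
    b 6 * v 1 + (b 0 * v 3 - b 3 * v 4 + b 2 * v 7) / 2,
    b 7 * v 1 + (b 1 * v 3 - b 2 * v 5 - b 3 * v 6) / 2]

/-- A linear map `a` for which the symmetrization of `herm z (a (herm y z'))` in `z` and `z'` is of
the form `herm (Q z z') y` is given by `cliff`. Each component of `Q` occurs in several components
of the hypothesis, and eliminating it leaves linear equations for the matrix entries of `a`. -/
lemma linear_eq_cliff (a : (Fin 8 → ℂ) →ₗ[ℂ] (Fin 8 → ℂ))
    (Q : (Fin 8 → ℂ) → (Fin 8 → ℂ) → (Fin 8 → ℂ))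
    (h : ∀ z z' y, herm (Q z z') y = -(herm z (a (herm y z')) + herm z' (a (herm y z))))
    (v : Fin 8 → ℂ) : a v = cliff (a ![1, 1, 0, 0, 0, 0, 0, 0]) v := by
  obtain ⟨A, hA⟩ := exists_matrix a
  suffices H : ∀ v m, ∑ l, v l * A l m = cliff (fun m => A 0 m + A 1 m) v m by
    ext m
    rw [hA, H]
    congr 2
    ext m
    simp [hA, Fin.sum_univ_eight]
  have conj_zero : ∀ x : ℂ, conj x = 0 → x = 0 := fun x hx => by simpa using hx
  have conj_half : ∀ x y : ℂ, conj x = 1 / 2 * conj y → x = 1 / 2 * y := fun x y hx =>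
    (starRingEnd ℂ).injective (by simpa [map_ofNat] using hx)
  have conj_neg_half : ∀ x y : ℂ, conj x = -(1 / 2 * conj y) → x = -(1 / 2 * y) := fun x y hx =>
    (starRingEnd ℂ).injective (by simpa [map_ofNat] using hx)
  -- `eijkc` is the `c`-th component of the hypothesis at the basis vectors `ev i`, `ev j`, `ev k`
  have R := fun i j k c => congrFun (h (ev i) (ev j) (ev k)) c
  have e0000 := R 0 0 0 0
  have e0047 := R 0 0 4 7
  have e0054 := R 0 0 5 4
  have e0062 := R 0 0 6 2
  have e0100 := R 0 1 0 0
  have e0105 := R 0 1 0 5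
  have e0106 := R 0 1 0 6
  have e0114 := R 0 1 1 4
  have e0117 := R 0 1 1 7
  have e0120 := R 0 1 2 0
  have e0130 := R 0 1 3 0
  have e0147 := R 0 1 4 7
  have e0154 := R 0 1 5 4
  have e0162 := R 0 1 6 2
  have e0165 := R 0 1 6 5
  have e0166 := R 0 1 6 6
  have e0200 := R 0 2 0 0
  have e0206 := R 0 2 0 6
  have e0210 := R 0 2 1 0
  have e0214 := R 0 2 1 4
  have e0230 := R 0 2 3 0
  have e0247 := R 0 2 4 7
  have e0253 := R 0 2 5 3
  have e0254 := R 0 2 5 4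
  have e0256 := R 0 2 5 6
  have e0262 := R 0 2 6 2
  have e0300 := R 0 3 0 0
  have e0310 := R 0 3 1 0
  have e0320 := R 0 3 2 0
  have e0343 := R 0 3 4 3
  have e0345 := R 0 3 4 5
  have e0347 := R 0 3 4 7
  have e0354 := R 0 3 5 4
  have e0362 := R 0 3 6 2
  have e0400 := R 0 4 0 0
  have e0410 := R 0 4 1 0
  have e0420 := R 0 4 2 0
  have e0443 := R 0 4 4 3
  have e0445 := R 0 4 4 5
  have e0447 := R 0 4 4 7
  have e0454 := R 0 4 5 4
  have e0462 := R 0 4 6 2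
  have e0500 := R 0 5 0 0
  have e0510 := R 0 5 1 0
  have e0545 := R 0 5 4 5
  have e0547 := R 0 5 4 7
  have e0554 := R 0 5 5 4
  have e0562 := R 0 5 6 2
  have e0600 := R 0 6 0 0
  have e0647 := R 0 6 4 7
  have e0654 := R 0 6 5 4
  have e0662 := R 0 6 6 2
  have e1200 := R 1 2 0 0
  have e1206 := R 1 2 0 6
  have e1214 := R 1 2 1 4
  have e1230 := R 1 2 3 0
  have e1253 := R 1 2 5 3
  have e1254 := R 1 2 5 4
  have e1300 := R 1 3 0 0
  have e1320 := R 1 3 2 0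
  have e1343 := R 1 3 4 3
  have e1347 := R 1 3 4 7
  have e1400 := R 1 4 0 0
  have e1420 := R 1 4 2 0
  have e1443 := R 1 4 4 3
  have e1447 := R 1 4 4 7
  have e1500 := R 1 5 0 0
  have e1547 := R 1 5 4 7
  have e1600 := R 1 6 0 0
  have e1647 := R 1 6 4 7
  have e1654 := R 1 6 5 4
  have e1662 := R 1 6 6 2
  have e2300 := R 2 3 0 0
  have e2310 := R 2 3 1 0
  have e2345 := R 2 3 4 5
  have e2347 := R 2 3 4 7
  have e2400 := R 2 4 0 0
  have e2410 := R 2 4 1 0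
  have e2445 := R 2 4 4 5
  have e2447 := R 2 4 4 7
  have e2600 := R 2 6 0 0
  have e2647 := R 2 6 4 7
  have e3500 := R 3 5 0 0
  have e3510 := R 3 5 1 0
  have e3545 := R 3 5 4 5
  have e3547 := R 3 5 4 7
  have e3600 := R 3 6 0 0
  have e3647 := R 3 6 4 7
  have e4500 := R 4 5 0 0
  have e4510 := R 4 5 1 0
  have e4545 := R 4 5 4 5
  have e4547 := R 4 5 4 7
  have e4600 := R 4 6 0 0
  have e4647 := R 4 6 4 7
  have e5600 := R 5 6 0 0
  have e5654 := R 5 6 5 4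
  clear R h
  simp only [herm_ev_left_0, herm_ev_left_1, herm_ev_left_2, herm_ev_left_3,
    herm_ev_left_4, herm_ev_left_5, herm_ev_left_6, herm_ev_left_7,
    herm_ev_right_0, herm_ev_right_1, herm_ev_right_2, herm_ev_right_3,
    herm_ev_right_4, herm_ev_right_5, herm_ev_right_6, herm_ev_right_7,
    Pi.neg_apply, Pi.add_apply, Matrix.cons_val] at *
  simp only [hA, Fin.sum_univ_eight, Matrix.cons_val, ev_apply] at *
  simp only [Fin.isValue, Fin.reduceEq, if_true, if_false, map_zero, map_one, mul_zero, mul_one,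
    zero_mul, one_mul, zero_add, add_zero, neg_zero, map_neg, map_mul, map_add, map_ofNat] at *
  -- the entries `A l m` that vanish, then those that are up to sign half of an entry in the rows
  -- `0` and `1`
  have r04 : A 0 4 = 0 := conj_zero _ (by
      linear_combination (1 / 4 : ℂ) * e0105 + (-1 / 4 : ℂ) * e0117)
  have r05 : A 0 5 = 0 := conj_zero _ (by
      linear_combination (1 / 4 : ℂ) * e0106 + (1 / 4 : ℂ) * e0114)
  have r06 : A 0 6 = 0 := conj_zero _ (by
      linear_combination (1 / 2 : ℂ) * e0206 + (1 / 2 : ℂ) * e0214)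
  have r07 : A 0 7 = 0 := conj_zero _ (by
      linear_combination (-1 / 2 : ℂ) * e1206 + (-1 / 2 : ℂ) * e1214)
  have r10 : A 1 0 = 0 := conj_zero _ (by
      linear_combination (-1 : ℂ) * e4510 + (1 / 2 : ℂ) * e4545)
  have r11 : A 1 1 = 0 := conj_zero _ (by
      linear_combination (1 : ℂ) * e4500 + (1 / 2 : ℂ) * e4547)
  have r12 : A 1 2 = 0 := conj_zero _ (by
      linear_combination (1 : ℂ) * e4600 + (1 / 2 : ℂ) * e4647)
  have r13 : A 1 3 = 0 := conj_zero _ (by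
      linear_combination (1 : ℂ) * e5600 + (-1 / 2 : ℂ) * e5654)
  have r22 : A 2 2 = 0 := conj_zero _ (by
      linear_combination (1 / 4 : ℂ) * e2600 + (1 / 8 : ℂ) * e2647)
  have r23 : A 2 3 = 0 := conj_zero _ (by
      linear_combination (1 / 2 : ℂ) * e3600 + (1 / 4 : ℂ) * e3647)
  have r26 : A 2 6 = 0 := conj_zero _ (by
      linear_combination (1 / 2 : ℂ) * e2310 + (-1 / 4 : ℂ) * e2345)
  have r27 : A 2 7 = 0 := conj_zero _ (by
      linear_combination (-1 / 2 : ℂ) * e2300 + (-1 / 4 : ℂ) * e2347)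
  have r30 : A 3 0 = 0 := conj_zero _ (by
      linear_combination (1 / 2 : ℂ) * e0420 + (-1 / 4 : ℂ) * e0443)
  have r31 : A 3 1 = 0 := conj_zero _ (by
      linear_combination (1 / 2 : ℂ) * e1420 + (-1 / 4 : ℂ) * e1443)
  have r34 : A 3 4 = 0 := conj_zero _ (by
      linear_combination (1 / 2 : ℂ) * e0130 + (1 / 4 : ℂ) * e0165)
  have r35 : A 3 5 = 0 := conj_zero _ (by
      linear_combination (-1 / 2 : ℂ) * e0120 + (1 / 4 : ℂ) * e0166)
  have r41 : A 4 1 = 0 := conj_zero _ (by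
      linear_combination (1 / 4 : ℂ) * e1500 + (1 / 8 : ℂ) * e1547)
  have r43 : A 4 3 = 0 := conj_zero _ (by
      linear_combination (1 / 2 : ℂ) * e3500 + (1 / 4 : ℂ) * e3547)
  have r45 : A 4 5 = 0 := conj_zero _ (by
      linear_combination (-1 / 2 : ℂ) * e1320 + (1 / 4 : ℂ) * e1343)
  have r47 : A 4 7 = 0 := conj_zero _ (by
      linear_combination (-1 / 2 : ℂ) * e1300 + (-1 / 4 : ℂ) * e1347)
  have r50 : A 5 0 = 0 := conj_zero _ (by
      linear_combination (1 / 2 : ℂ) * e0410 + (-1 / 4 : ℂ) * e0445)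
  have r52 : A 5 2 = 0 := conj_zero _ (by
      linear_combination (1 / 2 : ℂ) * e2410 + (-1 / 4 : ℂ) * e2445)
  have r54 : A 5 4 = 0 := conj_zero _ (by
      linear_combination (-1 / 2 : ℂ) * e0230 + (1 / 4 : ℂ) * e0253)
  have r56 : A 5 6 = 0 := conj_zero _ (by
      linear_combination (-1 / 2 : ℂ) * e0210 + (1 / 4 : ℂ) * e0256)
  have r60 : A 6 0 = 0 := conj_zero _ (by
      linear_combination (1 / 4 : ℂ) * e0510 + (-1 / 8 : ℂ) * e0545)
  have r63 : A 6 3 = 0 := conj_zero _ (by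
      linear_combination (1 / 2 : ℂ) * e3510 + (-1 / 4 : ℂ) * e3545)
  have r65 : A 6 5 = 0 := conj_zero _ (by
      linear_combination (1 / 2 : ℂ) * e0320 + (-1 / 4 : ℂ) * e0343)
  have r66 : A 6 6 = 0 := conj_zero _ (by
      linear_combination (-1 / 2 : ℂ) * e0310 + (1 / 4 : ℂ) * e0345)
  have r71 : A 7 1 = 0 := conj_zero _ (by
      linear_combination (-1 / 2 : ℂ) * e1400 + (-1 / 4 : ℂ) * e1447)
  have r72 : A 7 2 = 0 := conj_zero _ (by
      linear_combination (-1 / 2 : ℂ) * e2400 + (-1 / 4 : ℂ) * e2447)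
  have r74 : A 7 4 = 0 := conj_zero _ (by
      linear_combination (-1 / 2 : ℂ) * e1230 + (1 / 4 : ℂ) * e1253)
  have r77 : A 7 7 = 0 := conj_zero _ (by
      linear_combination (1 / 2 : ℂ) * e1200 + (-1 / 4 : ℂ) * e1254)
  have r20 : A 2 0 = 1 / 2 * A 1 6 := conj_half _ _ (by
      linear_combination (1 / 2 : ℂ) * e0600 + (-1 / 4 : ℂ) * e0662)
  have r21 : A 2 1 = 1 / 2 * A 1 7 := conj_half _ _ (by
      linear_combination (1 / 2 : ℂ) * e1600 + (-1 / 4 : ℂ) * e1662)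
  have r24 : A 2 4 = 1 / 2 * A 0 2 := conj_half _ _ (by
      linear_combination (-1 / 2 : ℂ) * e0200 + (-1 / 4 : ℂ) * e0247)
  have r25 : A 2 5 = 1 / 2 * A 0 3 := conj_half _ _ (by
      linear_combination (-1 / 2 : ℂ) * e0300 + (1 / 4 : ℂ) * e0354)
  have r32 : A 3 2 = 1 / 2 * A 1 4 := conj_half _ _ (by
      linear_combination (1 / 4 : ℂ) * e0447 + (1 / 4 : ℂ) * e0462)
  have r33 : A 3 3 = 1 / 2 * A 1 5 := conj_half _ _ (by
      linear_combination (-1 / 4 : ℂ) * e0554 + (1 / 4 : ℂ) * e0562)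
  have r36 : A 3 6 = 1 / 2 * A 0 0 := conj_half _ _ (by
      linear_combination (-1 / 4 : ℂ) * e0000 + (1 / 8 : ℂ) * e0062)
  have r37 : A 3 7 = 1 / 2 * A 0 1 := conj_half _ _ (by
      linear_combination (-1 / 2 : ℂ) * e0100 + (1 / 4 : ℂ) * e0162)
  have r40 : A 4 0 = 1 / 2 * A 1 5 := conj_half _ _ (by
      linear_combination (1 / 2 : ℂ) * e0500 + (-1 / 4 : ℂ) * e0554)
  have r42 : A 4 2 = -(1 / 2 * A 1 7) := conj_neg_half _ _ (by
      linear_combination (1 / 4 : ℂ) * e1647 + (1 / 4 : ℂ) * e1662)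
  have r44 : A 4 4 = 1 / 2 * A 0 1 := conj_half _ _ (by
      linear_combination (-1 / 2 : ℂ) * e0100 + (-1 / 4 : ℂ) * e0147)
  have r46 : A 4 6 = -(1 / 2 * A 0 3) := conj_neg_half _ _ (by
      linear_combination (1 / 2 : ℂ) * e0300 + (-1 / 4 : ℂ) * e0362)
  have r51 : A 5 1 = 1 / 2 * A 1 4 := conj_half _ _ (by
      linear_combination (1 / 4 : ℂ) * e0447 + (1 / 4 : ℂ) * e0454)
  have r53 : A 5 3 = -(1 / 2 * A 1 6) := conj_neg_half _ _ (by
      linear_combination (-1 / 4 : ℂ) * e0654 + (1 / 4 : ℂ) * e0662)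
  have r55 : A 5 5 = 1 / 2 * A 0 0 := conj_half _ _ (by
      linear_combination (-1 / 4 : ℂ) * e0000 + (1 / 8 : ℂ) * e0054)
  have r57 : A 5 7 = -(1 / 2 * A 0 2) := conj_neg_half _ _ (by
      linear_combination (1 / 2 : ℂ) * e0200 + (-1 / 4 : ℂ) * e0254)
  have r61 : A 6 1 = 1 / 2 * A 1 5 := conj_half _ _ (by
      linear_combination (-1 / 4 : ℂ) * e0547 + (-1 / 4 : ℂ) * e0554)
  have r62 : A 6 2 = 1 / 2 * A 1 6 := conj_half _ _ (by
      linear_combination (-1 / 4 : ℂ) * e0647 + (-1 / 4 : ℂ) * e0662)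
  have r64 : A 6 4 = -(1 / 2 * A 0 0) := conj_neg_half _ _ (by
      linear_combination (1 / 4 : ℂ) * e0000 + (1 / 8 : ℂ) * e0047)
  have r67 : A 6 7 = -(1 / 2 * A 0 3) := conj_neg_half _ _ (by
      linear_combination (1 / 2 : ℂ) * e0300 + (1 / 4 : ℂ) * e0347)
  have r70 : A 7 0 = -(1 / 2 * A 1 4) := conj_neg_half _ _ (by
      linear_combination (-1 / 2 : ℂ) * e0400 + (-1 / 4 : ℂ) * e0447)
  have r73 : A 7 3 = -(1 / 2 * A 1 7) := conj_neg_half _ _ (by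
      linear_combination (-1 / 4 : ℂ) * e1654 + (1 / 4 : ℂ) * e1662)
  have r75 : A 7 5 = 1 / 2 * A 0 1 := conj_half _ _ (by
      linear_combination (-1 / 2 : ℂ) * e0100 + (1 / 4 : ℂ) * e0154)
  have r76 : A 7 6 = 1 / 2 * A 0 2 := conj_half _ _ (by
      linear_combination (-1 / 2 : ℂ) * e0200 + (1 / 4 : ℂ) * e0262)
  intro v m
  fin_cases m <;>
  · simp only [cliff, Fin.isValue, Fin.mk_zero, Fin.zero_eta, Fin.mk_one, Fin.reduceFinMk,
      Fin.sum_univ_eight, Matrix.cons_val,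
      r04, r05, r06, r07, r10, r11, r12, r13, r22, r23, r26, r27, r30, r31, r34, r35,
      r41, r43, r45, r47, r50, r52, r54, r56, r60, r63, r65, r66, r71, r72, r74, r77,
      r20, r21, r24, r25, r32, r33, r36, r37, r40, r42, r44, r46, r51, r53, r55, r57,
      r61, r62, r64, r67, r70, r73, r75, r76]
    ring

end

section

variable {k : ℤ} {X : hol}

/-! ### Fields of weight one -/

/-- The vectors `t` with `t + sg t = 0` form a real form of the `w`-space. -/
lemma exists_eq_add_I_smul (v : Fin 8 → ℂ) :
    ∃ t t', t + sg t = 0 ∧ t' + sg t' = 0 ∧ v = t + I • t' := by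
  refine ⟨(1 / 2 : ℂ) • (v - sg v), (-I / 2 : ℂ) • (v + sg v), ?_, ?_, ?_⟩
  · rw [sg_smul, sg_sub, sg_sg]; simp [map_ofNat]; module
  · rw [sg_smul, sg_add, sg_sg]; simp [map_ofNat]; module
  · rw [smul_smul, mul_div_assoc', mul_neg, I_mul_I]; module

lemma pt_zero_add (u v : Fin 8 → ℂ) : pt 0 (u + v) = pt 0 u + pt 0 v := by
  rw [← pt_add, add_zero]

lemma pt_zero_smul (c : ℂ) (v : Fin 8 → ℂ) : pt 0 (c • v) = c • pt 0 v := by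
  rw [← pt_smul, smul_zero]

lemma fderiv_eq_zero_of_lie_tauField (h : ∀ t ht, ⁅tauField t ht, X⁆ = 0) (x : E)
    (v : Fin 8 → ℂ) : fderiv ℂ X.1.1 x (pt 0 v) = 0 := by
  have h1 : ∀ t, t + sg t = 0 → fderiv ℂ X.1.1 x (pt 0 t) = 0 := fun t ht => by
    rw [← lie_tauField t ht, h t ht]; rfl
  obtain ⟨t, t', ht, ht', rfl⟩ := exists_eq_add_I_smul v
  have : pt 0 (t + I • t') = pt 0 t + I • pt 0 t' := by rw [← pt_smul, ← pt_add]; simp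
  rw [this, map_add, map_smul, h1 t ht, h1 t' ht', smul_zero, add_zero]

lemma apply_pt_eq_of_lie_tauField (h : ∀ t ht, ⁅tauField t ht, X⁆ = 0) (z v : Fin 8 → ℂ) :
    X.1.1 (pt z v) = X.1.1 (pt z 0) := by
  have h1 : ∀ s : ℂ, HasDerivAt (fun s : ℂ => X.1.1 (pt z 0 + s • pt 0 v)) 0 s := fun s => by
    have h2 : HasDerivAt (fun s : ℂ => pt z 0 + s • pt 0 v) (pt 0 v) s := by
      simpa using ((hasDerivAt_id s).smul_const (pt 0 v)).const_add (pt z 0)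
    have h3 := ((holVF_differentiable X.1) (pt z 0 + s • pt 0 v)).hasFDerivAt.comp_hasDerivAt s h2
    rw [fderiv_eq_zero_of_lie_tauField h] at h3
    exact h3
  have h4 := is_const_of_deriv_eq_zero (fun s => (h1 s).differentiableAt) (fun s => (h1 s).deriv) 1 0
  simpa [← pt_add] using h4

/-- A field of positive weight is zero if it commutes with all fields of weight `-2`. -/
lemma eq_zero_of_lie_tauField (hk : 1 ≤ k) (hX : X ∈ gradedPiece k)
    (h : ∀ t ht, ⁅tauField t ht, X⁆ = 0) : X = 0 := by
  have hz : ∀ z v, zp X z v = zp X z 0 := fun z v => by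
    rw [zp, zp, apply_pt_eq_of_lie_tauField h]
  have hw : ∀ z v, wp X z v = wp X z 0 := fun z v => by
    rw [wp, wp, apply_pt_eq_of_lie_tauField h]
  have hp0 : pt 0 0 = 0 := by rw [← zero_smul ℂ (pt 0 0), ← pt_smul]; simp
  have hz0 : ∀ v, zp X 0 v = 0 := fun v => by
    rw [hz, zp, hp0]
    exact funext fun i => (homFun_zc hX i).apply_zero (by omega)
  have hw0 : ∀ v, wp X 0 v = 0 := fun v => by
    rw [hw, wp, hp0]
    exact funext fun i => (homFun_om hX i).apply_zero (by omega)
  have hW : ∀ z v, wp X z v = 0 := fun z v => by rw [wp_eq, hz0, hw0]; simp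
  have hZ : ∀ z, zp X z 0 = 0 := fun z => eq_zero_of_herm_eq_zero fun y => by
    have h1 : ∀ y, herm (zp X z 0) y + herm z (zp X y 0) = 0 := fun y => by
      have := wp_add_sg_wp X (z := z) (v := herm z y) (y := y) (u := 0) (by simp)
      rw [hW, hW, hz z] at this
      rw [← this]; simp
    have h2 := h1 ((2 : ℂ) • y)
    have h3 := zp_dil hX (s := 2) two_ne_zero y 0
    rw [smul_zero] at h3
    have h5 := h1 y
    rw [h3, herm_smul_right, herm_smul_right, map_zpow₀, map_ofNat,
      eq_neg_of_add_eq_zero_right h5, smul_neg, ← sub_eq_add_neg, ← sub_smul] at h2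
    refine (smul_eq_zero.1 h2).resolve_left ?_
    obtain ⟨n, hn⟩ : ∃ n : ℕ, k + 1 = (n + 2 : ℕ) := ⟨(k - 1).toNat, by omega⟩
    rw [hn, zpow_natCast, pow_add]
    intro h6
    have h7 : ((2 : ℕ) : ℂ) = ((2 ^ n * 2 ^ 2 : ℕ) : ℂ) := by
      push_cast; linear_combination h6
    have h8 : 2 = 2 ^ n * 2 ^ 2 := Nat.cast_injective h7
    have h9 : 0 < 2 ^ n := by positivity
    omega
  refine hol_ext_zp_wp (fun z v => ?_) fun z v => ?_
  · rw [hz, hZ, zp_zero]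
  · rw [hW, wp_zero]

lemma HomFun.apply_pt_zero {f : E → ℂ} (hf : HomFun f 2) (v : Fin 8 → ℂ) :
    f (pt 0 v) = fderiv ℂ f 0 (pt 0 v) := by
  have hs : ∀ s : ℂ, f (s • pt 0 v) = s * f (pt 0 v) := fun s => by
    rcases eq_or_ne s 0 with rfl | h
    · simp [hf.apply_zero]
    obtain ⟨r, rfl⟩ := IsAlgClosed.exists_pow_nat_eq s (n := 2) two_pos
    have hr : r ≠ 0 := by rintro rfl; simp at h
    have := hf.2 r hr (pt 0 v)
    rw [dil_pt, smul_zero] at this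
    rw [← pt_smul, smul_zero, this]
    norm_cast
  have h1 : HasDerivAt (fun s : ℂ => f (s • pt 0 v)) (f (pt 0 v)) 0 := by
    simp_rw [hs]
    simpa using (hasDerivAt_id (0 : ℂ)).mul_const (f (pt 0 v))
  have h2 : HasDerivAt (fun s : ℂ => s • pt 0 v) (pt 0 v) 0 := by
    simpa using (hasDerivAt_id (0 : ℂ)).smul_const (pt 0 v)
  have h3 : HasFDerivAt f (fderiv ℂ f 0) ((0 : ℂ) • pt 0 v) := by
    rw [zero_smul]; exact (hf.differentiable 0).hasFDerivAt
  exact h1.unique (h3.comp_hasDerivAt (0 : ℂ) h2)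

lemma HomFun.eq_fderiv {f : E → ℂ} (hf : HomFun f 1) (x : E) :
    f x = fderiv ℂ f 0 (pt (zc x) 0) := by
  have hs : ∀ s : ℂ, f (dil s x) = s * f x := fun s => by
    rcases eq_or_ne s 0 with rfl | h
    · simp [hf.apply_zero]
    · simpa using hf.2 s h x
  have h1 : HasDerivAt (fun s : ℂ => f (dil s x)) (f x) 0 := by
    simp_rw [hs]
    simpa using (hasDerivAt_id (0 : ℂ)).mul_const (f x)
  have h2 : HasDerivAt (fun s : ℂ => dil s x) (pt (zc x) 0) 0 := by
    have : (fun s : ℂ => dil s x) = fun s => s • pt (zc x) 0 + s ^ 2 • pt 0 (om x) := by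
      funext s
      rw [← pt_smul, ← pt_smul, ← pt_add, smul_zero, smul_zero, add_zero, zero_add, ← dil_pt,
        pt_zc_om]
    rw [this]
    have h4 : HasDerivAt (fun s : ℂ => s ^ 2) 0 0 := by simpa using hasDerivAt_pow 2 (0 : ℂ)
    simpa using ((hasDerivAt_id (0 : ℂ)).smul_const (pt (zc x) 0)).fun_add (h4.smul_const (pt 0 (om x)))
  have h3 : HasFDerivAt f (fderiv ℂ f 0) (dil 0 x) := by
    rw [dil_zero_left]; exact (hf.differentiable 0).hasFDerivAt
  exact h1.unique (h3.comp_hasDerivAt (0 : ℂ) h2)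

/-- The `z`-part of the derivative of a field at the origin in the direction `(0, v)`. -/
def fderivW (X : hol) : (Fin 8 → ℂ) →ₗ[ℂ] (Fin 8 → ℂ) where
  toFun v := zc (fderiv ℂ X.1.1 0 (pt 0 v))
  map_add' u v := by
    rw [pt_zero_add, map_add]; rfl
  map_smul' c v := by
    rw [pt_zero_smul, map_smul]; rfl

lemma zp_eq_fderivW (hX : X ∈ gradedPiece 1) (v : Fin 8 → ℂ) : zp X 0 v = fderivW X v := by
  ext i
  have h := (homFun_zc hX i).apply_pt_zero v
  rw [zp, h]
  change _ = fderiv ℂ X.1.1 0 (pt 0 v) (.inl i)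
  rw [fderiv_holVF_apply]
  rfl

/-- The quadratic `z`-part of a field of weight `1` is determined by its restriction to `z = 0`:
this is the lowest order term in `y` of the polarized tangency condition. -/
lemma herm_zp_of_weight_one (hX : X ∈ gradedPiece 1) (z y : Fin 8 → ℂ) :
    herm (zp X z 0) y = -herm z (zp X 0 (herm y z)) := by
  have hp : ∀ v, wp X 0 v = 0 := wp_zero_eq_zero hX ⟨1, by norm_num⟩
  have hW : ∀ z v, wp X z v = -herm z (fderivW X (sg v)) := fun z v => by
    rw [wp_eq, hp, zp_eq_fderivW hX, map_neg, sg_zero, sub_zero, ← neg_one_smul ℂ (fderivW X _),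
      herm_smul_right]
    simp
  -- the polarized tangency condition at `(z, 0)` and `s ^ 2 (y, herm y z)`, divided by `s ^ 2`
  have h1 : ∀ s : ℝ, s ≠ 0 → herm (zp X z 0) y + herm z (zp X ((s : ℂ) • y) (herm y z)) +
      ((s : ℂ) ^ 2) • sg (herm y (fderivW X (herm z y))) = 0 := fun s hs => by
    have hs' : (s : ℂ) ≠ 0 := by simpa using hs
    have h2 := wp_add_sg_wp X (z := z) (v := 0) (y := ((s : ℂ) ^ 2) • y)
      (u := ((s : ℂ) ^ 2) • herm y z) (by
        rw [sg_smul, sg_herm, herm_smul_right, zero_add])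
    have h3 := zp_dil hX hs' ((s : ℂ) • y) (herm y z)
    rw [smul_smul, ← sq] at h3
    rw [hW, hW, sg_zero, map_zero, herm_zero_right, neg_zero, zero_add, h3, sg_smul, sg_herm,
      map_smul, herm_smul_right, herm_smul_left, sg_neg, sg_smul, sg_smul, herm_smul_right,
      herm_smul_right] at h2
    simp only [map_pow, conj_ofReal] at h2
    have h4 : (((s : ℂ) ^ 2)) ≠ 0 := pow_ne_zero 2 hs'
    refine smul_right_injective _ h4 ?_
    simp only [smul_add, smul_zero]
    have h5 : (s : ℂ) ^ (1 + 1 : ℤ) = (s : ℂ) ^ 2 := by norm_cast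
    rw [h5] at h2
    simp only [map_pow, conj_ofReal] at h2
    rw [← h2]
    abel
  have h2 : Continuous fun s : ℝ => herm (zp X z 0) y +
      herm z (zp X ((s : ℂ) • y) (herm y z)) +
      ((s : ℂ) ^ 2) • sg (herm y (fderivW X (herm z y))) := by
    have h3 : Continuous fun s : ℝ => zp X ((s : ℂ) • y) (herm y z) :=
      continuous_zp X (by fun_prop) continuous_const
    have h4 : ∀ z, Continuous (herm z) := fun z => by
      refine continuous_pi fun j => ?_
      have h6 : ∀ i, Continuous fun y : Fin 8 → ℂ => conj (y i) := fun i =>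
        continuous_conj.comp (continuous_apply i)
      fin_cases j <;> simp only [herm] <;> fun_prop
    have h5 := (h4 z).comp h3
    simp only [Function.comp_def] at h5
    fun_prop
  have h3 := (h2.tendsto 0).mono_left (nhdsWithin_le_nhds (s := ({0}ᶜ : Set ℝ)))
  have h4 := tendsto_nhds_unique h3 (tendsto_const_nhds.congr'
    (Filter.eventually_of_mem self_mem_nhdsWithin fun s hs => (h1 s hs).symm))
  simp only [ofReal_zero, zero_smul, ne_eq, OfNat.ofNat_ne_zero, not_false_eq_true, zero_pow,
    add_zero] at h4
  exact eq_neg_of_add_eq_zero_left h4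

/-- The parameter of a field of weight `1`: its `z`-part at the point `w = (1, 1, 0, …, 0)`. -/
def param (X : hol) : Fin 8 → ℂ := zp X 0 ![1, 1, 0, 0, 0, 0, 0, 0]

/-- On `z = 0` a field of weight `1` is determined by its parameter. -/
lemma zp_eq_cliff (hX : X ∈ gradedPiece 1) (v : Fin 8 → ℂ) : zp X 0 v = cliff (param X) v := by
  rw [param, zp_eq_fderivW hX, zp_eq_fderivW hX]
  refine linear_eq_cliff (fderivW X)
    (fun z z' => zp X (z + z') 0 - zp X z 0 - zp X z' 0) (fun z z' y => ?_) v
  have h := fun z => herm_zp_of_weight_one hX z y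
  simp only [zp_eq_fderivW hX] at h
  simp only [sub_eq_add_neg, ← neg_one_smul ℂ (zp X _ _), herm_add_left, herm_smul_left, h,
    herm_add_right, map_add]
  module

/-- A field of weight `1` with parameter `0` commutes with `𝔤₋₂`, because its brackets with constant
fields have weight `-1` and value `0` at the origin. -/
lemma eq_zero_of_param_eq_zero (hX : X ∈ gradedPiece 1) (h : param X = 0) : X = 0 := by
  refine eq_zero_of_lie_tauField le_rfl hX fun t ht => ?_
  have h1 : ⁅tauField t ht, X⁆ ∈ gradedPiece (-1) := by
    simpa using lie_mem_gradedPiece (tauField_mem t ht) hX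
  have hp0 : pt 0 0 = 0 := by rw [← zero_smul ℂ (pt 0 0), ← pt_smul]; simp
  have h2 : zp ⁅tauField t ht, X⁆ 0 0 = 0 := by
    rw [zp, lie_tauField, hp0]
    change fderivW X t = 0
    rw [← zp_eq_fderivW hX, zp_eq_cliff hX, h]
    apply ext_fin_eight <;> simp [cliff]
  rw [eq_heisField h1, h2]
  refine hol_ext_zp_wp (fun z v => ?_) fun z v => ?_
  · rw [zp_heisField, zp_zero]
  · rw [wp_heisField, wp_zero, herm_zero_right]

end

section

/-! ### Fields of weight at least three -/

variable {k : ℤ} {X : hol}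

lemma pt_zero_zero : pt 0 0 = 0 := by rw [← zero_smul ℂ (pt 0 0), ← pt_smul]; simp

lemma zp_lie_tauField (hX : X ∈ gradedPiece 1) (t : Fin 8 → ℂ) (ht : t + sg t = 0) :
    zp ⁅tauField t ht, X⁆ 0 0 = cliff (param X) t := by
  rw [← zp_eq_cliff hX, zp_eq_fderivW hX, zp, lie_tauField, pt_zero_zero]
  rfl

lemma lie_tauField_tauField (t u : Fin 8 → ℂ) (ht : t + sg t = 0) (hu : u + sg u = 0) :
    ⁅tauField t ht, tauField u hu⁆ = 0 := by
  refine hol_ext fun x => ?_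
  rw [lie_tauField]
  have : fderiv ℂ (tauField u hu).1.1 x = 0 := fderiv_const_apply _
  rw [this]
  rfl

/-- Since the fields of weight `-2` commute, `cliff (b t) u` is symmetric in `t` and `u`, where `b
t` is the parameter of the bracket of a field of weight `3` with the constant field `t`. The shape
of `cliff` forces `b = 0`. -/
lemma eq_zero_of_weight_three (hX : X ∈ gradedPiece 3) : X = 0 := by
  have hm : ∀ t ht, ⁅tauField t ht, X⁆ ∈ gradedPiece 1 := fun t ht => by
    simpa using lie_mem_gradedPiece (tauField_mem t ht) hX
  have hsymm : ∀ t ht u hu, cliff (param ⁅tauField t ht, X⁆) u =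
      cliff (param ⁅tauField u hu, X⁆) t := fun t ht u hu => by
    rw [← zp_lie_tauField (hm t ht) u hu, ← zp_lie_tauField (hm u hu) t ht, leibniz_lie,
      lie_tauField_tauField, zero_lie, zero_add]
  have ht0 : ![I, 0, 0, 0, 0, 0, 0, 0] + sg ![I, 0, 0, 0, 0, 0, 0, 0] = 0 := by
    apply ext_fin_eight <;> simp [sg]
  have ht1 : ![0, I, 0, 0, 0, 0, 0, 0] + sg ![0, I, 0, 0, 0, 0, 0, 0] = 0 := by
    apply ext_fin_eight <;> simp [sg]
  have ht2 : ![0, 0, 1, -1, 0, 0, 0, 0] + sg ![0, 0, 1, -1, 0, 0, 0, 0] = 0 := by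
    apply ext_fin_eight <;> simp [sg]
  have h01 := hsymm _ ht0 _ ht1
  have h02 := hsymm _ ht0 _ ht2
  have h12 := hsymm _ ht1 _ ht2
  have h0 : param ⁅tauField _ ht0, X⁆ = 0 := by
    have e := fun i => congrFun h01 i
    have e' := fun i => congrFun h02 i
    have e4 := e 4
    have e5 := e 5
    have e6 := e 6
    have e7 := e 7
    have f4 := e' 4
    have f5 := e' 5
    have f6 := e' 6
    have f7 := e' 7
    simp [cliff] at e4 e5 e6 e7 f4 f5 f6 f7
    apply ext_fin_eight <;> assumption
  have h1 : param ⁅tauField _ ht1, X⁆ = 0 := by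
    have e := fun i => congrFun h01 i
    have e' := fun i => congrFun h12 i
    have e4 := (e 0).symm
    have e5 := (e 1).symm
    have e6 := (e 2).symm
    have e7 := (e 3).symm
    have f4 := e' 0
    have f5 := e' 1
    have f6 := e' 2
    have f7 := e' 3
    simp [cliff] at e4 e5 e6 e7 f4 f5 f6 f7
    apply ext_fin_eight <;> assumption
  refine eq_zero_of_lie_tauField (by norm_num) hX fun t ht => ?_
  refine eq_zero_of_param_eq_zero (hm t ht) ?_
  have e := hsymm t ht _ ht0
  have e' := hsymm t ht _ ht1
  rw [h0] at e
  rw [h1] at e'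
  have e0 := congrFun e 0
  have e1 := congrFun e 1
  have e2 := congrFun e 2
  have e3 := congrFun e 3
  have e4 := congrFun e' 4
  have e5 := congrFun e' 5
  have e6 := congrFun e' 6
  have e7 := congrFun e' 7
  simp [cliff] at e0 e1 e2 e3 e4 e5 e6 e7
  apply ext_fin_eight <;> assumption

/-- The fields of weight `-2` are generated by those of weight `-1`. -/
lemma lie_tauField_eq_zero (h : ∀ c, ⁅heisField c, X⁆ = 0) (t : Fin 8 → ℂ) (ht : t + sg t = 0) :
    ⁅tauField t ht, X⁆ = 0 := by
  have h1 : ∀ x c d, fderiv ℂ X.1.1 x (pt 0 (herm c d - herm d c)) = 0 := fun x c d => by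
    rw [← lie_tauField _ (herm_sub_herm_add_sg c d), ← lie_heisField_heisField, lie_lie, h, h,
      lie_zero, lie_zero, sub_zero]
    rfl
  refine hol_ext fun x => ?_
  have e := fun i => congrFun ht i
  have e0 := e 0
  have e1 := e 1
  have e2 := e 2
  have e4 := e 4
  have e6 := e 6
  simp [sg] at e0 e1 e2 e4 e6
  have h3 : t = (herm ((t 0 / 2) • ev 0) (ev 0) - herm (ev 0) ((t 0 / 2) • ev 0)) +
      (herm ((t 1 / 2) • ev 4) (ev 4) - herm (ev 4) ((t 1 / 2) • ev 4)) +
      (herm ((t 2 / 2) • ev 0) (ev 6) - herm (ev 6) ((t 2 / 2) • ev 0)) +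
      (herm ((t 4 / 2) • ev 0) (ev 5) - herm (ev 5) ((t 4 / 2) • ev 0)) +
      (herm ((t 6 / 2) • ev 1) (ev 5) - herm (ev 5) ((t 6 / 2) • ev 1)) := by
    have e3 := e 3
    have e5 := e 5
    have e7 := e 7
    simp [sg] at e3 e5 e7
    apply ext_fin_eight
    · simp [herm, ev_apply, map_ofNat]; linear_combination e0 / 2
    · simp [herm, ev_apply, map_ofNat]; linear_combination e1 / 2
    · simp [herm, ev_apply, map_ofNat]; ring
    · simp [herm, ev_apply, map_ofNat]; linear_combination e3
    · simp [herm, ev_apply, map_ofNat]; ring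
    · simp [herm, ev_apply, map_ofNat]; linear_combination e5
    · simp [herm, ev_apply, map_ofNat]; ring
    · simp [herm, ev_apply, map_ofNat]; linear_combination e7
  rw [lie_tauField, h3]
  simp only [pt_zero_add, map_add, h1, add_zero]
  rfl

/-- By induction: the brackets of `X` with `𝔤₋₁` have smaller weight, hence vanish, and `𝔤₋₁`
generates `𝔤₋₂`. -/
lemma eq_zero_of_three_le (hk : 3 ≤ k) (hX : X ∈ gradedPiece k) : X = 0 := by
  obtain ⟨n, rfl⟩ : ∃ n : ℕ, k = n + 3 := ⟨(k - 3).toNat, by omega⟩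
  clear hk
  induction n generalizing X with
  | zero => exact eq_zero_of_weight_three (by simpa using hX)
  | succ n ih =>
    refine eq_zero_of_lie_tauField (by push_cast; omega) hX fun t ht => ?_
    refine lie_tauField_eq_zero (fun c => ih ?_) t ht
    have := lie_mem_gradedPiece (heisField_mem c) hX
    convert this using 2
    push_cast; ring

end

section

variable {k : ℤ} {X : hol}

/-! ### Fields of weight zero -/

/-- The `z`-part of the derivative of a field at the origin, restricted to `w = 0`. -/
def fderivZ (X : hol) : (Fin 8 → ℂ) →ₗ[ℂ] (Fin 8 → ℂ) where
  toFun z := zc (fderiv ℂ X.1.1 0 (pt z 0))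
  map_add' u v := by
    have : pt (u + v) 0 = pt u 0 + pt v 0 := by rw [← pt_add, add_zero]
    rw [this, map_add]; rfl
  map_smul' c v := by
    have : pt (c • v) 0 = c • pt v 0 := by rw [← pt_smul, smul_zero]
    rw [this, map_smul]; rfl

/-- The `w`-part of the derivative of a field at the origin, restricted to `z = 0`. -/
def fderivWW (X : hol) : (Fin 8 → ℂ) →ₗ[ℂ] (Fin 8 → ℂ) where
  toFun v := om (fderiv ℂ X.1.1 0 (pt 0 v))
  map_add' u v := by
    rw [pt_zero_add, map_add, om_add]
  map_smul' c v := by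
    rw [pt_zero_smul, map_smul, om_smul]; rfl

lemma zp_eq_fderivZ (hX : X ∈ gradedPiece 0) (z v : Fin 8 → ℂ) : zp X z v = fderivZ X z := by
  ext i
  have h := (homFun_zc hX i).eq_fderiv (pt z v)
  rw [zp, h, zc_pt]
  change _ = fderiv ℂ X.1.1 0 (pt z 0) (.inl i)
  rw [fderiv_holVF_apply]
  rfl

/-- `om` as a continuous linear map. -/
def omL : E →L[ℂ] (Fin 8 → ℂ) :=
  LinearMap.toContinuousLinearMap { toFun := om, map_add' := om_add, map_smul' := om_smul }

lemma omL_apply (x : E) : omL x = om x := rfl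

lemma om_fderiv (X : hol) (x v : E) (j : Fin 8) :
    om (fderiv ℂ X.1.1 x v) j = fderiv ℂ (fun y => om (X.1.1 y) j) x v := by
  have h := (omL.hasFDerivAt (x := X.1.1 x)).comp x (holVF_differentiable X.1 x).hasFDerivAt
  exact (DFunLike.congr_fun (hasFDerivAt_pi'.1 h j).fderiv v).symm

lemma wp_eq_fderivWW (hX : X ∈ gradedPiece 0) (z v : Fin 8 → ℂ) : wp X z v = fderivWW X v := by
  have h0 : ∀ v, wp X 0 v = fderivWW X v := fun v => by
    ext i
    have h := (homFun_om hX i).apply_pt_zero v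
    rw [wp, h]
    exact (om_fderiv X 0 _ i).symm
  have h1 : ∀ v, zp X 0 v = 0 := zp_zero_eq_zero hX ⟨0, by norm_num⟩
  rw [wp_eq, h1, ← h0, wp_eq X 0 v, h1]
  simp

lemma fderivWW_herm (hX : X ∈ gradedPiece 0) (z y : Fin 8 → ℂ) :
    fderivWW X (herm z y) = herm (fderivZ X z) y + herm z (fderivZ X y) := by
  have := wp_add_sg_wp X (z := z) (v := herm z y) (y := y) (u := 0) (by simp)
  rw [wp_eq_fderivWW hX, wp_eq_fderivWW hX, zp_eq_fderivZ hX, zp_eq_fderivZ hX] at this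
  simpa using this

/-- A derivation of `herm` vanishes if it vanishes on two basis vectors and if enough entries of
its `z`-part do. -/
lemma derivation_herm_eq_zero (C G : (Fin 8 → ℂ) →ₗ[ℂ] (Fin 8 → ℂ))
    (h : ∀ z y, G (herm z y) = herm (C z) y + herm z (C y))
    (h0 : (G (ev 0) 0).re = 0) (h02 : G (ev 0) 2 = 0) (h04 : G (ev 0) 4 = 0)
    (h06 : G (ev 0) 6 = 0) (h1 : (G (ev 1) 1).re = 0) (h12 : G (ev 1) 2 = 0)
    (h14 : G (ev 1) 4 = 0) (h16 : G (ev 1) 6 = 0)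
    (c01 : C (ev 1) 0 = 0) (c02 : C (ev 2) 0 = 0) (c03 : C (ev 3) 0 = 0) (c12 : C (ev 2) 1 = 0)
    (c13 : C (ev 3) 1 = 0) (c23 : C (ev 3) 2 = 0) (c00 : (C (ev 0) 0).im = 0)
    (c11 : (C (ev 1) 1).im = 0) (c22 : (C (ev 2) 2).im = 0) (c33 : (C (ev 3) 3).im = 0) :
    C = 0 ∧ G = 0 := by
  obtain ⟨A, hA⟩ := exists_matrix C
  obtain ⟨B, hB⟩ := exists_matrix G
  -- `ejkc` is the `c`-th component of the hypothesis at the basis vectors `ev j`, `ev k`; from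
  -- these equations all matrix entries of `C` are found to vanish one after the other
  have R := fun j k c => congrFun (h (ev j) (ev k)) c
  suffices H : ∀ l m, A l m = 0 by
    have hC : C = 0 := LinearMap.ext fun v => funext fun m => by simp [hA, H]
    refine ⟨hC, ?_⟩
    have h' : ∀ z y, G (herm z y) = 0 := fun z y => by simp [h, hC]
    have hG : ∀ l, G (ev l) = 0 := by
      intro l
      obtain ⟨c, z, y, hl⟩ : ∃ (c : ℂ) (z y : Fin 8 → ℂ), ev l = c • herm z y := by
        fin_cases l
        · exact ⟨1, ev 0, ev 0, by apply ext_fin_eight <;> simp [herm, ev_apply]⟩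
        · exact ⟨1, ev 4, ev 4, by apply ext_fin_eight <;> simp [herm, ev_apply]⟩
        · exact ⟨1 / 2, ev 0, ev 6, by apply ext_fin_eight <;> simp [herm, ev_apply]⟩
        · exact ⟨1 / 2, ev 6, ev 0, by apply ext_fin_eight <;> simp [herm, ev_apply]⟩
        · exact ⟨1 / 2, ev 0, ev 5, by apply ext_fin_eight <;> simp [herm, ev_apply]⟩
        · exact ⟨1 / 2, ev 5, ev 0, by apply ext_fin_eight <;> simp [herm, ev_apply]⟩
        · exact ⟨1 / 2, ev 1, ev 5, by apply ext_fin_eight <;> simp [herm, ev_apply]⟩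
        · exact ⟨1 / 2, ev 5, ev 1, by apply ext_fin_eight <;> simp [herm, ev_apply]⟩
      rw [hl, map_smul, h', smul_zero]
    refine LinearMap.ext fun v => ?_
    have hv : v = ∑ l, v l • ev l := by
      ext m
      simp [ev_apply]
    rw [hv, map_sum]
    simp [hG]
  have e002 := R 0 0 2
  have e004 := R 0 0 4
  have e006 := R 0 0 6
  have e112 := R 1 1 2
  have e114 := R 1 1 4
  have e116 := R 1 1 6
  have e222 := R 2 2 2
  have e224 := R 2 2 4
  have e226 := R 2 2 6
  have e332 := R 3 3 2
  have e334 := R 3 3 4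
  have e336 := R 3 3 6
  have e442 := R 4 4 2
  have e444 := R 4 4 4
  have e446 := R 4 4 6
  have e552 := R 5 5 2
  have e554 := R 5 5 4
  have e556 := R 5 5 6
  have e662 := R 6 6 2
  have e664 := R 6 6 4
  have e666 := R 6 6 6
  have e772 := R 7 7 2
  have e774 := R 7 7 4
  have e776 := R 7 7 6
  have e010 := R 0 1 0
  have e020 := R 0 2 0
  have e030 := R 0 3 0
  have e120 := R 1 2 0
  have e130 := R 1 3 0
  have e230 := R 2 3 0
  have e070 := R 0 7 0
  have e071 := R 0 7 1
  have e072 := R 0 7 2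
  have e074 := R 0 7 4
  have e077 := R 0 7 7
  have e160 := R 1 6 0
  have e161 := R 1 6 1
  have e162 := R 1 6 2
  have e165 := R 1 6 5
  have e166 := R 1 6 6
  have e250 := R 2 5 0
  have e251 := R 2 5 1
  have e253 := R 2 5 3
  have e254 := R 2 5 4
  have e256 := R 2 5 6
  have e340 := R 3 4 0
  have e341 := R 3 4 1
  have e343 := R 3 4 3
  have e345 := R 3 4 5
  have e347 := R 3 4 7
  have e000 := R 0 0 0
  have e110 := R 1 1 0
  have e220 := R 2 2 0
  have e330 := R 3 3 0
  have e062 := R 0 6 2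
  have e172 := R 1 7 2
  have e422 := R 4 2 2
  have e532 := R 5 3 2
  have e054 := R 0 5 4
  have e414 := R 4 1 4
  have e551 := R 5 5 1
  clear R h
  simp only [herm_ev_left_0, herm_ev_left_1, herm_ev_left_2, herm_ev_left_3, herm_ev_left_4,
    herm_ev_left_5, herm_ev_left_6, herm_ev_left_7, herm_ev_right_0, herm_ev_right_1,
    herm_ev_right_2, herm_ev_right_3, herm_ev_right_4, herm_ev_right_5, herm_ev_right_6,
    herm_ev_right_7, Pi.add_apply, Matrix.cons_val] at *
  simp only [hA, hB, Fin.sum_univ_eight, Matrix.cons_val, ev_apply] at *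
  simp only [Fin.isValue, Fin.reduceEq, if_true, if_false, map_zero, map_one, mul_zero, mul_one,
    zero_mul, one_mul, zero_add, add_zero, neg_zero, map_neg, map_mul, map_add, map_ofNat] at *
  have a06 : A 0 6 = 0 := by
    simpa [h02, eq_comm (a := (0 : ℂ))] using e002
  have a05 : A 0 5 = 0 := by
    simpa [h04, eq_comm (a := (0 : ℂ))] using e004
  have a04 : A 0 4 = 0 := by
    simpa [h06, eq_comm (a := (0 : ℂ))] using e006
  have a17 : A 1 7 = 0 := by
    simpa [h02, eq_comm (a := (0 : ℂ))] using e112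
  have a14 : A 1 4 = 0 := by
    simpa [h04, eq_comm (a := (0 : ℂ))] using e114
  have a15 : A 1 5 = 0 := by
    simpa [h06, eq_comm (a := (0 : ℂ))] using e116
  have a24 : A 2 4 = 0 := by
    simpa [h02, eq_comm (a := (0 : ℂ))] using e222
  have a27 : A 2 7 = 0 := by
    simpa [h04, eq_comm (a := (0 : ℂ))] using e224
  have a26 : A 2 6 = 0 := by
    simpa [h06, eq_comm (a := (0 : ℂ))] using e226
  have a35 : A 3 5 = 0 := by
    simpa [h02, eq_comm (a := (0 : ℂ))] using e332
  have a36 : A 3 6 = 0 := by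
    simpa [h04, eq_comm (a := (0 : ℂ))] using e334
  have a37 : A 3 7 = 0 := by
    simpa [h06, eq_comm (a := (0 : ℂ))] using e336
  have a42 : A 4 2 = 0 := by
    simpa [h12, eq_comm (a := (0 : ℂ))] using e442
  have a41 : A 4 1 = 0 := by
    simpa [h14, eq_comm (a := (0 : ℂ))] using e444
  have a40 : A 4 0 = 0 := by
    simpa [h16, eq_comm (a := (0 : ℂ))] using e446
  have a53 : A 5 3 = 0 := by
    simpa [h12, eq_comm (a := (0 : ℂ))] using e552
  have a50 : A 5 0 = 0 := by
    simpa [h14, eq_comm (a := (0 : ℂ))] using e554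
  have a51 : A 5 1 = 0 := by
    simpa [h16, eq_comm (a := (0 : ℂ))] using e556
  have a60 : A 6 0 = 0 := by
    simpa [h12, eq_comm (a := (0 : ℂ))] using e662
  have a63 : A 6 3 = 0 := by
    simpa [h14, eq_comm (a := (0 : ℂ))] using e664
  have a62 : A 6 2 = 0 := by
    simpa [h16, eq_comm (a := (0 : ℂ))] using e666
  have a71 : A 7 1 = 0 := by
    simpa [h12, eq_comm (a := (0 : ℂ))] using e772
  have a72 : A 7 2 = 0 := by
    simpa [h14, eq_comm (a := (0 : ℂ))] using e774
  have a73 : A 7 3 = 0 := by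
    simpa [h16, eq_comm (a := (0 : ℂ))] using e776
  have a01 : A 0 1 = 0 := by
    simpa [c01, eq_comm (a := (0 : ℂ))] using e010
  have a02 : A 0 2 = 0 := by
    simpa [c02, eq_comm (a := (0 : ℂ))] using e020
  have a03 : A 0 3 = 0 := by
    simpa [c03, eq_comm (a := (0 : ℂ))] using e030
  have a12 : A 1 2 = 0 := by
    simpa [c12, eq_comm (a := (0 : ℂ))] using e120
  have a13 : A 1 3 = 0 := by
    simpa [c13, eq_comm (a := (0 : ℂ))] using e130
  have a23 : A 2 3 = 0 := by
    simpa [c23, eq_comm (a := (0 : ℂ))] using e230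
  have a70 : A 7 0 = 0 := by
    simpa [eq_comm (a := (0 : ℂ))] using e070
  have a07 : A 0 7 = 0 := by
    simpa [eq_comm (a := (0 : ℂ))] using e071
  have a76 : A 7 6 = 0 := by
    simpa [a01, eq_comm (a := (0 : ℂ))] using e072
  have a75 : A 7 5 = 0 := by
    simpa [a02, eq_comm (a := (0 : ℂ))] using e074
  have a74 : A 7 4 = 0 := by
    simpa [a03, eq_comm (a := (0 : ℂ))] using e077
  have a61 : A 6 1 = 0 := by
    simpa [eq_comm (a := (0 : ℂ))] using e160
  have a16 : A 1 6 = 0 := by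
    simpa [eq_comm (a := (0 : ℂ))] using e161
  have a67 : A 6 7 = 0 := by
    simpa [c01, eq_comm (a := (0 : ℂ))] using e162
  have a64 : A 6 4 = 0 := by
    simpa [a13, eq_comm (a := (0 : ℂ))] using e165
  have a65 : A 6 5 = 0 := by
    simpa [a12, eq_comm (a := (0 : ℂ))] using e166
  have a52 : A 5 2 = 0 := by
    simpa [eq_comm (a := (0 : ℂ))] using e250
  have a25 : A 2 5 = 0 := by
    simpa [eq_comm (a := (0 : ℂ))] using e251
  have a54 : A 5 4 = 0 := by
    simpa [a23, eq_comm (a := (0 : ℂ))] using e253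
  have a57 : A 5 7 = 0 := by
    simpa [c02, eq_comm (a := (0 : ℂ))] using e254
  have a56 : A 5 6 = 0 := by
    simpa [c12, eq_comm (a := (0 : ℂ))] using e256
  have a43 : A 4 3 = 0 := by
    simpa [eq_comm (a := (0 : ℂ))] using e340
  have a34 : A 3 4 = 0 := by
    simpa [eq_comm (a := (0 : ℂ))] using e341
  have a45 : A 4 5 = 0 := by
    simpa [c23, eq_comm (a := (0 : ℂ))] using e343
  have a46 : A 4 6 = 0 := by
    simpa [c13, eq_comm (a := (0 : ℂ))] using e345
  have a47 : A 4 7 = 0 := by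
    simpa [c03, eq_comm (a := (0 : ℂ))] using e347
  have a00 : A 0 0 = 0 := Complex.ext (by
      have := congrArg re e000
      simp [h0] at this
      rw [zero_re]; linarith) c00
  have a11 : A 1 1 = 0 := Complex.ext (by
      have := congrArg re e110
      simp [h0] at this
      rw [zero_re]; linarith) c11
  have a22 : A 2 2 = 0 := Complex.ext (by
      have := congrArg re e220
      simp [h0] at this
      rw [zero_re]; linarith) c22
  have a33 : A 3 3 = 0 := Complex.ext (by
      have := congrArg re e330
      simp [h0] at this
      rw [zero_re]; linarith) c33
  have f1 : conj (A 5 5) = A 4 4 := by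
    rw [a00] at e054
    rw [a11, map_zero] at e414
    linear_combination (e414 - e054) / 2
  have f2 : A 5 5 = A 4 4 := by
    rw [a22, map_zero] at e422
    rw [a33, map_zero] at e532
    linear_combination (e422 - e532) / 2
  have a55 : A 5 5 = 0 := by
    have f3 : conj (A 5 5) = A 5 5 := f1.trans f2.symm
    refine Complex.ext ?_ (conj_eq_iff_im.1 f3)
    have := congrArg re e551
    simp [h1] at this
    rw [zero_re]; linarith
  have a44 : A 4 4 = 0 := f2.symm.trans a55
  have b22 : B 2 2 = 0 := by
    rw [a44, a22, map_zero] at e422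
    simpa using e422
  have a66 : A 6 6 = 0 := by
    rw [a00, b22] at e062
    simpa [eq_comm (a := (0 : ℂ))] using e062
  have a77 : A 7 7 = 0 := by
    rw [a11, b22] at e172
    simpa [eq_comm (a := (0 : ℂ))] using e172
  intro l m
  fin_cases l <;> fin_cases m <;> assumption

/-- The entries of a field of weight `0` that determine it. -/
lemma eq_zero_of_weight_zero (hX : X ∈ gradedPiece 0)
    (h0 : (wp X 0 (ev 0) 0).re = 0) (h02 : wp X 0 (ev 0) 2 = 0) (h04 : wp X 0 (ev 0) 4 = 0)
    (h06 : wp X 0 (ev 0) 6 = 0) (h1 : (wp X 0 (ev 1) 1).re = 0) (h12 : wp X 0 (ev 1) 2 = 0)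
    (h14 : wp X 0 (ev 1) 4 = 0) (h16 : wp X 0 (ev 1) 6 = 0)
    (c01 : zp X (ev 1) 0 0 = 0) (c02 : zp X (ev 2) 0 0 = 0) (c03 : zp X (ev 3) 0 0 = 0)
    (c12 : zp X (ev 2) 0 1 = 0) (c13 : zp X (ev 3) 0 1 = 0) (c23 : zp X (ev 3) 0 2 = 0)
    (c00 : (zp X (ev 0) 0 0).im = 0) (c11 : (zp X (ev 1) 0 1).im = 0)
    (c22 : (zp X (ev 2) 0 2).im = 0) (c33 : (zp X (ev 3) 0 3).im = 0) : X = 0 := by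
  simp only [zp_eq_fderivZ hX, wp_eq_fderivWW hX] at *
  obtain ⟨hC, hG⟩ := derivation_herm_eq_zero (fderivZ X) (fderivWW X) (fderivWW_herm hX)
    h0 h02 h04 h06 h1 h12 h14 h16 c01 c02 c03 c12 c13 c23 c00 c11 c22 c33
  refine hol_ext_zp_wp (fun z v => ?_) fun z v => ?_
  · rw [zp_eq_fderivZ hX, hC]; rfl
  · rw [wp_eq_fderivWW hX, hG, wp_zero]; rfl

end

section

set_option linter.unusedVariables false

variable {k : ℤ} {X : hol}

/-! ### Fields of weight two -/

/-- The derivative of a function that is quadratic along a line. -/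
lemma fderiv_of_line {V : Type*} [NormedAddCommGroup V] [NormedSpace ℂ V] {F : V → V}
    (hF : Differentiable ℂ F) {x v B C : V}
    (h : ∀ s : ℂ, F (x + s • v) = F x + s • B + s ^ 2 • C) : fderiv ℂ F x v = B := by
  have h1 : HasDerivAt (fun s : ℂ => F x + s • B + s ^ 2 • C) B 0 := by
    simpa using (((hasDerivAt_id' (0 : ℂ)).smul_const B).const_add (F x)).fun_add
      ((hasDerivAt_pow 2 (0 : ℂ)).smul_const C)
  have h2 : HasDerivAt (fun s : ℂ => x + s • v) v 0 := by
    simpa using ((hasDerivAt_id (0 : ℂ)).smul_const v).const_add x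
  have h3 : HasFDerivAt F (fderiv ℂ F x) (x + (0 : ℂ) • v) := by
    simpa using (hF x).hasFDerivAt
  have h4 := h3.comp_hasDerivAt (0 : ℂ) h2
  have h5 : (F ∘ fun s : ℂ => x + s • v) = fun s : ℂ => F x + s • B + s ^ 2 • C := funext h
  rw [h5] at h4
  exact h4.unique h1

/-- The direction of the lowering operator of an `sl₂`-triple whose semisimple element is the Euler
field. -/
def lowVec : Fin 8 → ℂ := ![I, I, 0, 0, 0, 0, 0, 0]

lemma lowVec_add_sg : lowVec + sg lowVec = 0 := by
  apply ext_fin_eight <;> simp [lowVec, sg]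

/-- The lowering operator. -/
def lowField : hol := tauField lowVec lowVec_add_sg

/-- The raising operator. -/
def raiseField : hol := genHol (.inr (.inr (.inr (.inr 3)))) + genHol (.inr (.inr (.inr (.inr 4))))

lemma raiseField_mem : raiseField ∈ gradedPiece 2 :=
  add_mem (genHol_mem (.inr (.inr (.inr (.inr 3))))) (genHol_mem (.inr (.inr (.inr (.inr 4)))))

lemma raiseField_apply (x : E) : raiseField.1.1 x = genTwo 3 x + genTwo 4 x := rfl

lemma genTwo_three (x : E) : genTwo 3 x = Sum.elim (onCoords (fun z1 z2 z3 z4 z5 z6 z7 z8 w1 w2 w3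
    w4 w5 w6 w7 w8 => I • ![4*w1*z1, 4*w1*z2, 4*w1*z3, 4*w1*z4,
        2*w3*z3 + 2*w4*z3 + 2*w5*z2 + 2*w6*z2 - 2*w7*z1 - 2*w8*z1,
        2*w3*z4 + 2*w4*z4 - 2*w5*z1 + 2*w6*z1 - 2*w7*z2 + 2*w8*z2,
        -(2*w3*z1 - 2*w4*z1 + 2*w5*z4 + 2*w6*z4 + 2*w7*z3 - 2*w8*z3),
        -(2*w3*z2 - 2*w4*z2 - 2*w5*z3 + 2*w6*z3 + 2*w7*z4 + 2*w8*z4)]) x)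
      (onCoords (fun z1 z2 z3 z4 z5 z6 z7 z8 w1 w2 w3 w4 w5 w6 w7 w8 =>
        I • ![4*w1^2, -(w3^2 - w4^2 + w5^2 - w6^2 + w7^2 - w8^2), 4*w1*w3, 4*w1*w4, 4*w1*w5, 4*w1*w6,
        4*w1*w7, 4*w1*w8]) x) := rfl

lemma genTwo_four (x : E) : genTwo 4 x = Sum.elim (onCoords (fun z1 z2 z3 z4 z5 z6 z7 z8 w1 w2 w3
    w4 w5 w6 w7 w8 => I • ![2*w3*z7 + 2*w4*z7 + 2*w5*z6 + 2*w6*z6 + 2*w7*z5 - 2*w8*z5,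
        2*w3*z8 + 2*w4*z8 - 2*w5*z5 + 2*w6*z5 + 2*w7*z6 + 2*w8*z6,
        -(2*w3*z5 - 2*w4*z5 + 2*w5*z8 + 2*w6*z8 - 2*w7*z7 - 2*w8*z7),
        -(2*w3*z6 - 2*w4*z6 - 2*w5*z7 + 2*w6*z7 - 2*w7*z8 + 2*w8*z8), 4*w2*z5, 4*w2*z6, 4*w2*z7,
        4*w2*z8]) x)
      (onCoords (fun z1 z2 z3 z4 z5 z6 z7 z8 w1 w2 w3 w4 w5 w6 w7 w8 =>
        I • ![-(w3^2 - w4^2 + w5^2 - w6^2 + w7^2 - w8^2), 4*w2^2, 4*w2*w3, 4*w2*w4, 4*w2*w5, 4*w2*w6,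
        4*w2*w7, 4*w2*w8]) x) := rfl

/-- The `sl₂`-relation, up to normalization of the raising operator. -/
lemma lie_lowField_raiseField : ⁅lowField, raiseField⁆ = (-4 : ℝ) • eulerField := by
  refine hol_ext fun x => ?_
  rw [lowField, lie_tauField]
  have h : ((-4 : ℝ) • eulerField).1.1 x = (-4 : ℂ) • fun c => (wt c : ℂ) * x c := by
    funext c
    change (-4 : ℝ) • eulerField.1.1 x c = _
    rw [eulerField_apply]
    simp
  rw [h]
  refine fderiv_of_line (C := raiseField.1.1 (pt 0 lowVec)) (holVF_differentiable raiseField.1)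
    fun s => ?_
  simp only [raiseField_apply, genTwo_three, genTwo_four]
  ext (j | j)
  · fin_cases j <;> simp [onCoords, wt, pt, lowVec] <;> ring_nf <;> simp <;> ring
  · fin_cases j <;> simp [onCoords, wt, pt, lowVec] <;> ring_nf <;> simp <;> ring

/-- On `z = 0` the `w`-part of a field of weight `2` is quadratic in `w`; its second derivative in
the direction `t` is twice its value at `t`. -/
lemma wp_lie_tauField_lie_tauField (hX : X ∈ gradedPiece 2) (t : Fin 8 → ℂ) (ht : t + sg t = 0) :
    wp ⁅tauField t ht, ⁅tauField t ht, X⁆⁆ 0 0 = (2 : ℂ) • wp X 0 t := by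
  have hd : ∀ Y : hol, ∀ s : ℂ, HasDerivAt (fun s : ℂ => wp Y 0 (s • t))
      (wp ⁅tauField t ht, Y⁆ 0 (s • t)) s := fun Y s => by
    have h1 : HasDerivAt (fun s : ℂ => pt 0 (s • t)) (pt 0 t) s := by
      simp_rw [pt_zero_smul]
      simpa using (hasDerivAt_id s).smul_const (pt 0 t)
    have h2 := (omL.hasFDerivAt (x := Y.1.1 (pt 0 (s • t)))).comp_hasDerivAt s
      ((holVF_differentiable Y.1 _).hasFDerivAt.comp_hasDerivAt s h1)
    rw [wp, lie_tauField]
    exact h2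
  have h0 : ∀ s : ℂ, wp X 0 (s • t) = s ^ 2 • wp X 0 t := fun s => by
    rcases eq_or_ne s 0 with rfl | hs
    · rw [zero_smul, wp, pt_zero_zero]
      simp only [ne_eq, OfNat.ofNat_ne_zero, not_false_eq_true, zero_pow, zero_smul]
      exact funext fun i => (homFun_om hX i).apply_zero (by norm_num)
    obtain ⟨r, rfl⟩ := IsAlgClosed.exists_pow_nat_eq s (n := 2) two_pos
    have hr : r ≠ 0 := by rintro rfl; simp at hs
    have := wp_dil hX hr 0 t
    rw [smul_zero] at this
    rw [this, ← pow_mul]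
    norm_cast
  have h1 : ∀ s : ℂ, wp ⁅tauField t ht, X⁆ 0 (s • t) = (2 * s) • wp X 0 t := fun s => by
    have h2 := hd X s
    simp_rw [h0] at h2
    refine h2.unique ?_
    simpa using (hasDerivAt_pow 2 s).smul_const (wp X 0 t)
  have h2 := hd ⁅tauField t ht, X⁆ 0
  simp_rw [h1] at h2
  rw [zero_smul] at h2
  refine h2.unique ?_
  simpa using ((hasDerivAt_id (0 : ℂ)).const_mul 2).smul_const (wp X 0 t)

/-- A field of weight `2` is determined by its value at a single point, by `sl₂`-theory: if that
value vanishes then the square of the lowering operator annihilates `X`. -/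
lemma eq_zero_of_weight_two (hX : X ∈ gradedPiece 2)
    (h : wp X 0 ![1, 1, 0, 0, 0, 0, 0, 0] = 0) : X = 0 := by
  have hf : lowField ∈ gradedPiece (-2) := tauField_mem _ _
  have h1 : ⁅lowField, X⁆ ∈ gradedPiece 0 := by simpa using lie_mem_gradedPiece hf hX
  have h2 : ⁅lowField, ⁅lowField, X⁆⁆ ∈ gradedPiece (-2) := by
    simpa using lie_mem_gradedPiece hf h1
  have h3 : ⁅lowField, ⁅lowField, X⁆⁆ = 0 := by
    obtain ⟨t, ht, hX'⟩ := eq_tauField h2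
    have h4 : t = 0 := by
      have h5 := wp_lie_tauField_lie_tauField hX lowVec lowVec_add_sg
      change wp ⁅lowField, ⁅lowField, X⁆⁆ 0 0 = _ at h5
      rw [hX'] at h5
      have h6 : wp (tauField t ht) 0 0 = t := om_pt _ _
      obtain ⟨r, hr⟩ := IsAlgClosed.exists_pow_nat_eq I (n := 2) two_pos
      have hr0 : r ≠ 0 := by rintro rfl; exact I_ne_zero (by rw [← hr]; simp)
      have h9 := wp_dil hX hr0 0 ![1, 1, 0, 0, 0, 0, 0, 0]
      have h10 : r ^ 2 • (![1, 1, 0, 0, 0, 0, 0, 0] : Fin 8 → ℂ) = lowVec := by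
        rw [hr]; apply ext_fin_eight <;> simp [lowVec]
      rw [h, smul_zero, smul_zero, h10] at h9
      rw [← h6, h5, h9, smul_zero]
    subst h4
    rw [hX']
    exact hol_ext fun x => pt_zero_zero
  have h4 : ⁅raiseField, X⁆ = 0 :=
    eq_zero_of_three_le (k := 4) (by norm_num) (by simpa using lie_mem_gradedPiece raiseField_mem hX)
  have h5 : ⁅eulerField, X⁆ = (2 : ℝ) • X := by simpa using lie_euler hX
  have h6 : ⁅eulerField, ⁅lowField, X⁆⁆ = 0 := by simpa using lie_euler h1
  have h7 : ⁅raiseField, ⁅lowField, X⁆⁆ = (8 : ℝ) • X := by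
    have := leibniz_lie lowField raiseField X
    rw [h4, lie_zero, lie_lowField_raiseField, smul_lie, h5, smul_smul] at this
    rw [eq_neg_of_add_eq_zero_right this.symm, ← neg_smul]
    norm_num
  have h8 : ⁅lowField, X⁆ = 0 := by
    have := leibniz_lie lowField raiseField ⁅lowField, X⁆
    rw [h3, h7, lie_zero, lie_lowField_raiseField, smul_lie, h6, smul_zero, add_zero, lie_smul]
      at this
    exact (smul_eq_zero.1 this).resolve_left (by norm_num)
  rw [h8, lie_zero] at h7
  exact (smul_eq_zero.1 h7.symm).resolve_left (by norm_num)

end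

section

set_option linter.unusedVariables false

/-! ### Coordinates on the graded pieces -/

/-- The coordinates of a field of weight `-2` with respect to the generators. -/
def coordNegTwo (L : E → E) : Fin 8 → ℝ :=
  ![(L 0 (.inr 2)).re, (L 0 (.inr 4)).re, (L 0 (.inr 6)).re, (L 0 (.inr 0)).im, (L 0 (.inr 1)).im,
    (L 0 (.inr 3)).im, (L 0 (.inr 5)).im, (L 0 (.inr 7)).im]

/-- The coordinates of a field of weight `-1` with respect to the generators. -/
def coordNegOne (L : E → E) : Fin 16 → ℝ :=
  ![(L 0 (.inl 0)).re, (L 0 (.inl 1)).re, (L 0 (.inl 2)).re, (L 0 (.inl 3)).re, (L 0 (.inl 4)).re,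
    (L 0 (.inl 5)).re, (L 0 (.inl 6)).re, (L 0 (.inl 7)).re, (L 0 (.inl 0)).im, (L 0 (.inl 1)).im,
    (L 0 (.inl 2)).im, (L 0 (.inl 3)).im, (L 0 (.inl 4)).im, (L 0 (.inl 5)).im, (L 0 (.inl 6)).im,
    (L 0 (.inl 7)).im]

/-- The coordinates of a field of weight `0` with respect to the generators, in terms of its values
at coordinate vectors. -/
def coordZero (L : E → E) : Fin 30 → ℝ :=
  ![(L (pt 0 (ev 1)) (.inr 3)).re / 2, (L (pt 0 (ev 1)) (.inr 5)).re / 2,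
    (L (pt 0 (ev 1)) (.inr 7)).re / 2, (L (pt 0 (ev 0)) (.inr 3)).re / 2,
    (L (pt 0 (ev 0)) (.inr 5)).re / 2, (L (pt 0 (ev 0)) (.inr 7)).re / 2,
    (L (pt 0 (ev 0)) (.inr 0)).re / 2, (L (pt (ev 3) 0) (.inl 0)).re,
    -(L (pt (ev 3) 0) (.inl 2)).re, (L (pt (ev 2) 0) (.inl 1)).re,
    (L (pt (ev 3) 0) (.inl 1)).re, (L (pt (ev 2) 0) (.inl 0)).re,
    -(L (pt (ev 1) 0) (.inl 0)).re, (L (pt 0 (ev 1)) (.inr 1)).re / 2,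
    (L (pt 0 (ev 1)) (.inr 2)).im / 2, (L (pt 0 (ev 1)) (.inr 4)).im / 2,
    (L (pt 0 (ev 1)) (.inr 6)).im / 2, (L (pt 0 (ev 0)) (.inr 2)).im / 2,
    (L (pt 0 (ev 0)) (.inr 4)).im / 2, -(L (pt 0 (ev 0)) (.inr 6)).im / 2,
    (L (pt (ev 0) 0) (.inl 0)).im, (L (pt (ev 1) 0) (.inl 1)).im, (L (pt (ev 2) 0) (.inl 2)).im,
    (L (pt (ev 3) 0) (.inl 2)).im, (L (pt (ev 3) 0) (.inl 1)).im, (L (pt (ev 3) 0) (.inl 0)).im,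
    (L (pt (ev 2) 0) (.inl 0)).im, (L (pt (ev 2) 0) (.inl 1)).im,
    ((L (pt (ev 3) 0) (.inl 3)).im + (L (pt (ev 0) 0) (.inl 0)).im -
      (L (pt (ev 1) 0) (.inl 1)).im + (L (pt (ev 2) 0) (.inl 2)).im) / 2,
    (L (pt (ev 1) 0) (.inl 0)).im]

/-- The point `w = (1, 1, 0, …, 0)`, at which fields of positive weight are evaluated. -/
def baseVec : Fin 8 → ℂ := ![1, 1, 0, 0, 0, 0, 0, 0]

/-- The coordinates of a field of weight `1` with respect to the generators. -/
def coordOne (L : E → E) : Fin 16 → ℝ :=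
  ![-(L (pt 0 baseVec) (.inl 0)).re / 2, -(L (pt 0 baseVec) (.inl 1)).re / 2,
    -(L (pt 0 baseVec) (.inl 2)).re / 2, -(L (pt 0 baseVec) (.inl 3)).re / 2,
    -(L (pt 0 baseVec) (.inl 4)).re / 2, -(L (pt 0 baseVec) (.inl 5)).re / 2,
    -(L (pt 0 baseVec) (.inl 6)).re / 2, -(L (pt 0 baseVec) (.inl 7)).re / 2,
    (L (pt 0 baseVec) (.inl 0)).im / 2, (L (pt 0 baseVec) (.inl 1)).im / 2,
    (L (pt 0 baseVec) (.inl 2)).im / 2, (L (pt 0 baseVec) (.inl 3)).im / 2,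
    (L (pt 0 baseVec) (.inl 4)).im / 2, (L (pt 0 baseVec) (.inl 5)).im / 2,
    (L (pt 0 baseVec) (.inl 6)).im / 2, (L (pt 0 baseVec) (.inl 7)).im / 2]

/-- The coordinates of a field of weight `2` with respect to the generators. -/
def coordTwo (L : E → E) : Fin 8 → ℝ :=
  ![(L (pt 0 baseVec) (.inr 2)).re / 4, (L (pt 0 baseVec) (.inr 4)).re / 4,
    (L (pt 0 baseVec) (.inr 6)).re / 4, (L (pt 0 baseVec) (.inr 0)).im / 4,
    (L (pt 0 baseVec) (.inr 1)).im / 4, (L (pt 0 baseVec) (.inr 3)).im / 4,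
    (L (pt 0 baseVec) (.inr 5)).im / 4, -(L (pt 0 baseVec) (.inr 7)).im / 4]

/-- The values of the coordinate functions `φ` at the field with coefficients `A` are those of the
`m`-th unit vector. -/
def IsDualTo {N : ℕ} (φ : (E → E) → Fin N → ℝ) (m : ℕ) (A : E → (Fin 8 → ℂ) × (Fin 8 → ℂ)) : Prop :=
  ∀ i, φ (fun x => Sum.elim (A x).1 (A x).2) i = if (i : ℕ) = m then 1 else 0

/-- A lemma that, applied repeatedly, reduces the duality of coordinates and an explicit list of
vector fields to one statement for each row of the list. -/
lemma forall_isDualTo_cons {N : ℕ} {φ : (E → E) → Fin N → ℝ} {m n : ℕ}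
    {A : E → (Fin 8 → ℂ) × (Fin 8 → ℂ)} {v : E → Fin n → (Fin 8 → ℂ) × (Fin 8 → ℂ)}
    (hA : IsDualTo φ m A) (hv : ∀ j : Fin n, IsDualTo φ (m + 1 + j) fun x => v x j) :
    ∀ j : Fin (n + 1), IsDualTo φ (m + j) fun x => Matrix.vecCons (A x) (v x) j :=
  Fin.cases hA fun j => by
    have := hv j
    rwa [add_assoc, add_comm 1] at this

lemma forall_isDualTo_empty {N : ℕ} {φ : (E → E) → Fin N → ℝ} {m : ℕ}
    {v : E → Fin 0 → (Fin 8 → ℂ) × (Fin 8 → ℂ)} :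
    ∀ j : Fin 0, IsDualTo φ (m + j) fun x => v x j := fun j => j.elim0

lemma forall_eq_ite_cons {n l m : ℕ} {a : ℝ} {v : Fin n → ℝ} (ha : a = if l = m then 1 else 0)
    (hv : ∀ i : Fin n, v i = if l + 1 + i = m then 1 else 0) :
    ∀ i : Fin (n + 1), Matrix.vecCons a v i = if l + i = m then 1 else 0 :=
  Fin.cases ha fun i => by
    have := hv i
    rwa [add_assoc, add_comm 1] at this

lemma forall_eq_ite_empty {l m : ℕ} {v : Fin 0 → ℝ} :
    ∀ i : Fin 0, v i = if l + i = m then 1 else 0 := fun i => i.elim0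

lemma isDualTo_ofCoords {N n : ℕ} {φ : (E → E) → Fin N → ℝ} {F : ℂ → ℂ → ℂ → ℂ → ℂ → ℂ → ℂ → ℂ → ℂ →
    ℂ → ℂ → ℂ → ℂ → ℂ → ℂ → ℂ → Fin n → (Fin 8 → ℂ) × (Fin 8 → ℂ)}
    (h : ∀ j : Fin n, IsDualTo φ (0 + j) fun x => onCoords F x j) (j : Fin n) (i : Fin N) :
    φ (ofCoords F j) i = if (i : ℕ) = j then 1 else 0 := by
  have := h j i
  rw [zero_add] at this
  exact this

lemma isDualTo_of_zero_add {N m : ℕ} {φ : (E → E) → Fin N → ℝ}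
    {A : E → (Fin 8 → ℂ) × (Fin 8 → ℂ)}
    (h : ∀ i : Fin N, φ (fun x => Sum.elim (A x).1 (A x).2) i = if 0 + (i : ℕ) = m then 1 else 0) :
    IsDualTo φ m A := by
  simpa [IsDualTo] using h

lemma coordNegTwo_gen : ∀ j i, coordNegTwo (genNegTwo j) i = if (i : ℕ) = j then 1 else 0 := by
  refine isDualTo_ofCoords ?_
  dsimp only [onCoords]
  repeat' first | exact forall_isDualTo_empty | apply forall_isDualTo_cons
  all_goals
    refine isDualTo_of_zero_add ?_
    dsimp only [coordNegTwo]
    repeat' first | exact forall_eq_ite_empty | apply forall_eq_ite_cons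
    all_goals simp

lemma coordNegOne_gen : ∀ j i, coordNegOne (genNegOne j) i = if (i : ℕ) = j then 1 else 0 := by
  refine isDualTo_ofCoords ?_
  dsimp only [onCoords]
  repeat' first | exact forall_isDualTo_empty | apply forall_isDualTo_cons
  all_goals
    refine isDualTo_of_zero_add ?_
    dsimp only [coordNegOne]
    repeat' first | exact forall_eq_ite_empty | apply forall_eq_ite_cons
    all_goals simp

set_option maxHeartbeats 0 in
lemma coordZero_gen : ∀ j i, coordZero (genZero j) i = if (i : ℕ) = j then 1 else 0 := by
  refine isDualTo_ofCoords ?_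
  dsimp only [onCoords]
  repeat' first | exact forall_isDualTo_empty | apply forall_isDualTo_cons
  all_goals
    refine isDualTo_of_zero_add ?_
    dsimp only [coordZero]
    repeat' first | exact forall_eq_ite_empty | apply forall_eq_ite_cons
    all_goals
      dsimp only [Sum.elim_inl, Sum.elim_inr, Prod.smul_fst, Prod.smul_snd, Pi.smul_apply,
        Matrix.cons_val]
      simp [pt, ev_apply]

set_option maxHeartbeats 0 in
lemma coordOne_gen : ∀ j i, coordOne (genOne j) i = if (i : ℕ) = j then 1 else 0 := by
  refine isDualTo_ofCoords ?_
  dsimp only [onCoords]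
  repeat' first | exact forall_isDualTo_empty | apply forall_isDualTo_cons
  all_goals
    refine isDualTo_of_zero_add ?_
    dsimp only [coordOne]
    repeat' first | exact forall_eq_ite_empty | apply forall_eq_ite_cons
    all_goals
      dsimp only [Sum.elim_inl, Sum.elim_inr, Prod.smul_fst, Prod.smul_snd, Pi.smul_apply,
        Matrix.cons_val]
      simp [pt, baseVec]

set_option maxHeartbeats 0 in
lemma coordTwo_gen : ∀ j i, coordTwo (genTwo j) i = if (i : ℕ) = j then 1 else 0 := by
  refine isDualTo_ofCoords ?_
  dsimp only [onCoords]
  repeat' first | exact forall_isDualTo_empty | apply forall_isDualTo_cons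
  all_goals
    refine isDualTo_of_zero_add ?_
    dsimp only [coordTwo]
    repeat' first | exact forall_eq_ite_empty | apply forall_eq_ite_cons
    all_goals
      dsimp only [Sum.elim_inl, Sum.elim_inr, Prod.smul_fst, Prod.smul_snd, Pi.smul_apply,
        Matrix.cons_val]
      simp [pt, baseVec]

end

section

/-! ### Bases of the graded pieces -/

/-- Linearity of all the entries of a vector of functionals. -/
lemma isLinearMap_of_forall {V : Type*} [AddCommGroup V] [Module ℝ V] {n : ℕ} {φ : V → Fin n → ℝ}
    (h : ∀ i, IsLinearMap ℝ fun x => φ x i) : IsLinearMap ℝ φ where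
  map_add x y := funext fun i => (h i).map_add x y
  map_smul c x := funext fun i => (h i).map_smul c x

lemma forall_isLinearMap_cons {V : Type*} [AddCommGroup V] [Module ℝ V] {n : ℕ} {f : V → ℝ}
    {φ : V → Fin n → ℝ} (hf : IsLinearMap ℝ f) (h : ∀ i, IsLinearMap ℝ fun x => φ x i) :
    ∀ i, IsLinearMap ℝ fun x => Matrix.vecCons (f x) (φ x) i :=
  Fin.cases hf h

lemma forall_isLinearMap_empty {V : Type*} [AddCommGroup V] [Module ℝ V] {φ : V → Fin 0 → ℝ} :
    ∀ i, IsLinearMap ℝ fun x => φ x i := fun i => i.elim0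

lemma isLinearMap_re (p : E) (a : Coord) : IsLinearMap ℝ fun L : E → E => (L p a).re :=
  ⟨fun _ _ => by simp, fun _ _ => by simp⟩

lemma isLinearMap_im (p : E) (a : Coord) : IsLinearMap ℝ fun L : E → E => (L p a).im :=
  ⟨fun _ _ => by simp, fun _ _ => by simp⟩

section
variable {V : Type*} [AddCommGroup V] [Module ℝ V] {f g : V → ℝ}

lemma isLinearMap_neg (hf : IsLinearMap ℝ f) : IsLinearMap ℝ fun x => -f x :=
  ⟨fun x y => by rw [hf.map_add]; ring, fun c x => by rw [hf.map_smul]; simp⟩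

lemma isLinearMap_add (hf : IsLinearMap ℝ f) (hg : IsLinearMap ℝ g) :
    IsLinearMap ℝ fun x => f x + g x :=
  ⟨fun x y => by rw [hf.map_add, hg.map_add]; ring,
    fun c x => by rw [hf.map_smul, hg.map_smul, smul_add]⟩

lemma isLinearMap_div (hf : IsLinearMap ℝ f) (r : ℝ) : IsLinearMap ℝ fun x => f x / r :=
  ⟨fun x y => by rw [hf.map_add]; ring, fun c x => by rw [hf.map_smul]; simp [mul_div_assoc]⟩

end

lemma isLinearMap_coordNegTwo : IsLinearMap ℝ coordNegTwo := by
  refine isLinearMap_of_forall ?_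
  dsimp only [coordNegTwo]
  repeat' first | exact forall_isLinearMap_empty | apply forall_isLinearMap_cons
  all_goals first | exact isLinearMap_re _ _ | exact isLinearMap_im _ _

lemma isLinearMap_coordNegOne : IsLinearMap ℝ coordNegOne := by
  refine isLinearMap_of_forall ?_
  dsimp only [coordNegOne]
  repeat' first | exact forall_isLinearMap_empty | apply forall_isLinearMap_cons
  all_goals first | exact isLinearMap_re _ _ | exact isLinearMap_im _ _

lemma isLinearMap_coordZero : IsLinearMap ℝ coordZero := by
  refine isLinearMap_of_forall ?_
  dsimp only [coordZero]
  repeat' first | exact forall_isLinearMap_empty | apply forall_isLinearMap_cons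
  all_goals
    repeat' first | exact isLinearMap_re _ _ | exact isLinearMap_im _ _ | apply isLinearMap_div |
      apply isLinearMap_neg |
      apply isLinearMap_add

lemma isLinearMap_coordOne : IsLinearMap ℝ coordOne := by
  refine isLinearMap_of_forall ?_
  dsimp only [coordOne]
  repeat' first | exact forall_isLinearMap_empty | apply forall_isLinearMap_cons
  all_goals
    repeat' first | exact isLinearMap_re _ _ | exact isLinearMap_im _ _ | apply isLinearMap_div |
      apply isLinearMap_neg

lemma isLinearMap_coordTwo : IsLinearMap ℝ coordTwo := by
  refine isLinearMap_of_forall ?_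
  dsimp only [coordTwo]
  repeat' first | exact forall_isLinearMap_empty | apply forall_isLinearMap_cons
  all_goals
    repeat' first | exact isLinearMap_re _ _ | exact isLinearMap_im _ _ | apply isLinearMap_div |
      apply isLinearMap_neg

/-- A family of fields of weight `k` is a basis of `𝔤_k` if there are dual linear functionals that
separate the elements of `𝔤_k`. -/
lemma exists_basis_gradedPiece {k : ℤ} {n : ℕ} {φ : (E → E) → Fin n → ℝ} (hφ : IsLinearMap ℝ φ)
    (g : Fin n → hol) (hg : ∀ j, g j ∈ gradedPiece k)
    (hdual : ∀ j i, φ (g j).1.1 i = if (i : ℕ) = j then 1 else 0)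
    (hinj : ∀ X ∈ gradedPiece k, φ X.1.1 = 0 → X = 0) :
    ∃ b : Module.Basis (Fin n) ℝ (gradedPiece k), ∀ j, (b j).1 = g j := by
  let ψ : gradedPiece k →ₗ[ℝ] Fin n → ℝ :=
    { toFun := fun X => φ X.1.1.1
      map_add' := fun X Y => hφ.map_add _ _
      map_smul' := fun c X => hφ.map_smul _ _ }
  have h1 : ∀ j, ψ ⟨g j, hg j⟩ = Pi.single j 1 := fun j => by
    ext i
    rw [Pi.single_apply]
    refine (hdual j i).trans ?_
    simp only [Fin.ext_iff]
  have h2 : Function.Injective ψ := (injective_iff_map_eq_zero ψ).2 fun X hX =>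
    Subtype.ext (hinj X.1 X.2 hX)
  have h3 : Function.Surjective ψ := by
    intro c
    refine ⟨∑ j, c j • ⟨g j, hg j⟩, ?_⟩
    simp only [map_sum, map_smul, h1]
    ext i
    simp [Finset.sum_apply, Pi.single_apply]
  let e := LinearEquiv.ofBijective ψ ⟨h2, h3⟩
  refine ⟨Module.Basis.ofEquivFun e, fun j => ?_⟩
  have h4 : e.symm (Pi.single j 1) = ⟨g j, hg j⟩ := by
    rw [LinearEquiv.symm_apply_eq, ← h1]; rfl
  exact congrArg Subtype.val ((congrFun (Module.Basis.coe_ofEquivFun e) j).trans h4)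

lemma coordNegTwo_injective (X : hol) (hX : X ∈ gradedPiece (-2)) (h : coordNegTwo X.1.1 = 0) :
    X = 0 := by
  obtain ⟨t, ht, rfl⟩ := eq_tauField hX
  have h' : ∀ i, coordNegTwo (tauField t ht).1.1 i = 0 := fun i => congrFun h i
  have hs : ∀ i, (t + sg t) i = 0 := fun i => congrFun ht i
  have k0 := h' 0; have k1 := h' 1; have k2 := h' 2; have k3 := h' 3
  have k4 := h' 4; have k5 := h' 5; have k6 := h' 6; have k7 := h' 7
  have s0 := hs 0; have s1 := hs 1; have s2 := hs 2; have s4 := hs 4; have s6 := hs 6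
  simp [coordNegTwo, tauField_apply, pt] at k0 k1 k2 k3 k4 k5 k6 k7
  simp [sg, Complex.ext_iff] at s0 s1 s2 s4 s6
  have : t = 0 := by
    apply ext_fin_eight <;> refine Complex.ext ?_ ?_ <;> simp <;> linarith
  subst this
  refine hol_ext fun x => ?_
  rw [tauField_apply, pt_zero_zero]; rfl

lemma coordNegOne_injective (X : hol) (hX : X ∈ gradedPiece (-1)) (h : coordNegOne X.1.1 = 0) :
    X = 0 := by
  have h' : ∀ i, coordNegOne X.1.1 i = 0 := fun i => congrFun h i
  have hz : zp X 0 0 = 0 := by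
    rw [zp, pt_zero_zero]
    apply ext_fin_eight
    exacts [Complex.ext (h' 0) (h' 8), Complex.ext (h' 1) (h' 9), Complex.ext (h' 2) (h' 10),
      Complex.ext (h' 3) (h' 11), Complex.ext (h' 4) (h' 12), Complex.ext (h' 5) (h' 13),
      Complex.ext (h' 6) (h' 14), Complex.ext (h' 7) (h' 15)]
  rw [eq_heisField hX, hz]
  refine hol_ext fun x => ?_
  rw [heisField_apply, herm_zero_right, pt_zero_zero]; rfl

/-- The `w`-part of a field of weight `0` is real with respect to `sg`. -/
lemma sg_wp_of_weight_zero {X : hol} (hX : X ∈ gradedPiece 0) (v : Fin 8 → ℂ) (hv : sg v = v) :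
    sg (wp X 0 v) = wp X 0 v := by
  conv_rhs => rw [wp_eq, herm_zero_left, hv, wp_eq_fderivWW hX, map_neg, sg_neg, zero_sub, neg_neg]
  rw [wp_eq_fderivWW hX]

lemma coordZero_injective (X : hol) (hX : X ∈ gradedPiece 0) (h : coordZero X.1.1 = 0) :
    X = 0 := by
  have h' : ∀ i, coordZero X.1.1 i = 0 := fun i => congrFun h i
  have r0 := fun i => congrFun (sg_wp_of_weight_zero hX (ev 0)
    (by apply ext_fin_eight <;> simp [sg, ev_apply])) i
  have r1 := fun i => congrFun (sg_wp_of_weight_zero hX (ev 1)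
    (by apply ext_fin_eight <;> simp [sg, ev_apply])) i
  have r02 := r0 2; have r04 := r0 4; have r06 := r0 6
  have r12 := r1 2; have r14 := r1 4; have r16 := r1 6
  simp [sg, wp, om, Complex.ext_iff] at r02 r04 r06 r12 r14 r16
  have k0 := h' 0; have k1 := h' 1; have k2 := h' 2; have k3 := h' 3; have k4 := h' 4
  have k5 := h' 5; have k6 := h' 6; have k7 := h' 7; have k8 := h' 8; have k9 := h' 9
  have k10 := h' 10; have k11 := h' 11; have k12 := h' 12; have k13 := h' 13; have k14 := h' 14
  have k15 := h' 15; have k16 := h' 16; have k17 := h' 17; have k18 := h' 18; have k19 := h' 19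
  have k20 := h' 20; have k21 := h' 21; have k22 := h' 22; have k23 := h' 23; have k24 := h' 24
  have k25 := h' 25; have k26 := h' 26; have k27 := h' 27; have k28 := h' 28; have k29 := h' 29
  simp [coordZero] at k0 k1 k2 k3 k4 k5 k6 k7 k8 k9 k10 k11 k12 k13 k14 k15 k16 k17 k18
  simp [coordZero] at k19 k20 k21 k22 k23 k24 k25 k26 k27 k28 k29
  rw [k20, k21, k22] at k28
  simp at k28
  refine eq_zero_of_weight_zero hX ?_ ?_ ?_ ?_ ?_ ?_ ?_ ?_ ?_ ?_ ?_ ?_ ?_ ?_ ?_ ?_ ?_ ?_ <;>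
    first
    | (refine Complex.ext ?_ ?_ <;> simp [wp, om, zp, zc] <;> linarith)
    | (simp [wp, om, zp, zc]; linarith)

lemma coordOne_injective (X : hol) (hX : X ∈ gradedPiece 1) (h : coordOne X.1.1 = 0) :
    X = 0 := by
  have h' : ∀ i, coordOne X.1.1 i = 0 := fun i => congrFun h i
  have k0 := h' 0; have k1 := h' 1; have k2 := h' 2; have k3 := h' 3; have k4 := h' 4
  have k5 := h' 5; have k6 := h' 6; have k7 := h' 7; have k8 := h' 8; have k9 := h' 9
  have k10 := h' 10; have k11 := h' 11; have k12 := h' 12; have k13 := h' 13; have k14 := h' 14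
  have k15 := h' 15
  simp [coordOne] at k0 k1 k2 k3 k4 k5 k6 k7 k8 k9 k10 k11 k12 k13 k14 k15
  refine eq_zero_of_param_eq_zero hX ?_
  apply ext_fin_eight
  exacts [Complex.ext k0 k8, Complex.ext k1 k9, Complex.ext k2 k10, Complex.ext k3 k11,
    Complex.ext k4 k12, Complex.ext k5 k13, Complex.ext k6 k14, Complex.ext k7 k15]

/-- At real `w`, a field of weight `2` has imaginary `w`-part on `z = 0`: here homogeneity is used
for the dilation by a square root of `i`, which maps real to imaginary `w`. -/
lemma wp_add_sg_of_weight_two {X : hol} (hX : X ∈ gradedPiece 2) (v : Fin 8 → ℂ) (hv : sg v = v) :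
    wp X 0 v + sg (wp X 0 v) = 0 := by
  obtain ⟨s, hs⟩ := IsAlgClosed.exists_pow_nat_eq I (n := 2) (by norm_num)
  have hs0 : s ≠ 0 := by rintro rfl; simp [eq_comm] at hs
  have h1 := wp_dil hX hs0 0 v
  have h4 : s ^ ((2 : ℤ) + 2) = -1 := by
    rw [show ((2 : ℤ) + 2) = (4 : ℕ) by norm_num, zpow_natCast, show s ^ 4 = (s ^ 2) ^ 2 by ring, hs,
      I_sq]
  rw [smul_zero, hs, h4, neg_one_smul] at h1
  have h2 := wp_eq X 0 (I • v)
  rw [herm_zero_left, sg_smul, hv, conj_I, ← neg_smul, neg_neg, h1, sg_neg] at h2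
  rw [← neg_eq_zero, neg_add, h2]
  abel

lemma coordTwo_injective (X : hol) (hX : X ∈ gradedPiece 2) (h : coordTwo X.1.1 = 0) :
    X = 0 := by
  have h' : ∀ i, coordTwo X.1.1 i = 0 := fun i => congrFun h i
  have hs := fun i => congrFun (wp_add_sg_of_weight_two hX baseVec
    (by apply ext_fin_eight <;> simp [sg, baseVec])) i
  have k0 := h' 0; have k1 := h' 1; have k2 := h' 2; have k3 := h' 3
  have k4 := h' 4; have k5 := h' 5; have k6 := h' 6; have k7 := h' 7
  have s0 := hs 0; have s1 := hs 1; have s2 := hs 2; have s4 := hs 4; have s6 := hs 6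
  simp [coordTwo] at k0 k1 k2 k3 k4 k5 k6 k7
  simp [sg, wp, om, Complex.ext_iff] at s0 s1 s2 s4 s6
  refine eq_zero_of_weight_two hX ?_
  change wp X 0 baseVec = 0
  apply ext_fin_eight <;> refine Complex.ext ?_ ?_ <;> simp [wp, om] <;> linarith

lemma exists_basis_negTwo : ∃ b : Module.Basis (Fin 8) ℝ (gradedPiece (-2)),
    ∀ j, (b j).1 = genHol (.inl j) :=
  exists_basis_gradedPiece isLinearMap_coordNegTwo (fun j => genHol (.inl j))
    (fun j => genHol_mem (.inl j)) coordNegTwo_gen coordNegTwo_injective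

lemma exists_basis_negOne : ∃ b : Module.Basis (Fin 16) ℝ (gradedPiece (-1)),
    ∀ j, (b j).1 = genHol (.inr (.inl j)) :=
  exists_basis_gradedPiece isLinearMap_coordNegOne (fun j => genHol (.inr (.inl j)))
    (fun j => genHol_mem (.inr (.inl j))) coordNegOne_gen coordNegOne_injective

lemma exists_basis_zero : ∃ b : Module.Basis (Fin 30) ℝ (gradedPiece 0),
    ∀ j, (b j).1 = genHol (.inr (.inr (.inl j))) :=
  exists_basis_gradedPiece isLinearMap_coordZero (fun j => genHol (.inr (.inr (.inl j))))
    (fun j => genHol_mem (.inr (.inr (.inl j)))) coordZero_gen coordZero_injective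

lemma exists_basis_one : ∃ b : Module.Basis (Fin 16) ℝ (gradedPiece 1),
    ∀ j, (b j).1 = genHol (.inr (.inr (.inr (.inl j)))) :=
  exists_basis_gradedPiece isLinearMap_coordOne (fun j => genHol (.inr (.inr (.inr (.inl j)))))
    (fun j => genHol_mem (.inr (.inr (.inr (.inl j))))) coordOne_gen coordOne_injective

lemma exists_basis_two : ∃ b : Module.Basis (Fin 8) ℝ (gradedPiece 2),
    ∀ j, (b j).1 = genHol (.inr (.inr (.inr (.inr j)))) :=
  exists_basis_gradedPiece isLinearMap_coordTwo (fun j => genHol (.inr (.inr (.inr (.inr j)))))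
    (fun j => genHol_mem (.inr (.inr (.inr (.inr j))))) coordTwo_gen coordTwo_injective

lemma gradedPiece_eq_bot {k : ℤ} (hk : 2 < |k|) : gradedPiece k = ⊥ := by
  rw [eq_bot_iff]
  intro X hX
  rcases lt_abs.1 hk with h | h
  · exact eq_zero_of_three_le (by omega) hX
  · exact eq_zero_of_le_neg_three hX (by omega)

/-- Reindexing a basis of `𝔤_k` by the generators of weight `k`. -/
lemma exists_basis_of_equiv {k : ℤ} {n : ℕ} (f : Fin n → GenIndex) (hf : Function.Injective f)
    (hr : ∀ i, genWeight i = k ↔ ∃ j, f j = i) (b : Module.Basis (Fin n) ℝ (gradedPiece k))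
    (hb : ∀ j, (b j).1 = genHol (f j)) :
    ∃ b : Module.Basis {i : GenIndex // genWeight i = k} ℝ (gradedPiece k),
      ∀ i, (b i).1 = genHol i.1 := by
  let e : Fin n ≃ {i : GenIndex // genWeight i = k} :=
    Equiv.ofBijective (fun j => ⟨f j, (hr _).2 ⟨j, rfl⟩⟩)
      ⟨fun i j h => hf (congrArg Subtype.val h), fun i => by
        obtain ⟨j, hj⟩ := (hr i.1).1 i.2
        exact ⟨j, Subtype.ext hj⟩⟩
  refine ⟨b.reindex e, fun i => ?_⟩
  obtain ⟨j, rfl⟩ := e.surjective i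
  rw [Module.Basis.reindex_apply, Equiv.symm_apply_apply, hb]
  rfl

/-- The generators of weight `k` form a basis of `𝔤_k`. -/
lemma exists_basis_of_genWeight (k : ℤ) :
    ∃ b : Module.Basis {i : GenIndex // genWeight i = k} ℝ (gradedPiece k),
      ∀ i, (b i).1 = genHol i.1 := by
  by_cases h : 2 < |k|
  · have h1 : IsEmpty {i : GenIndex // genWeight i = k} := by
      refine ⟨fun i => ?_⟩
      obtain ⟨i, rfl⟩ := i
      rcases i with i | i | i | i | i <;> norm_num [genWeight] at h
    have h2 : Subsingleton (gradedPiece k) := by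
      rw [gradedPiece_eq_bot h]; infer_instance
    exact ⟨Module.Basis.empty _, fun i => h1.elim i⟩
  · have h2 : -2 ≤ k ∧ k ≤ 2 := abs_le.1 (not_lt.1 h)
    obtain ⟨h3, h4⟩ := h2
    interval_cases k
    · obtain ⟨b, hb⟩ := exists_basis_negTwo
      refine exists_basis_of_equiv (fun j => .inl j) (fun i j h => by simpa using h) (fun i => ?_) b hb
      rcases i with i | i | i | i | i <;> simp [genWeight]
    · obtain ⟨b, hb⟩ := exists_basis_negOne
      refine exists_basis_of_equiv (fun j => .inr (.inl j)) (fun i j h => by simpa using h)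
        (fun i => ?_) b hb
      rcases i with i | i | i | i | i <;> simp [genWeight]
    · obtain ⟨b, hb⟩ := exists_basis_zero
      refine exists_basis_of_equiv (fun j => .inr (.inr (.inl j))) (fun i j h => by simpa using h)
        (fun i => ?_) b hb
      rcases i with i | i | i | i | i <;> simp [genWeight]
    · obtain ⟨b, hb⟩ := exists_basis_one
      refine exists_basis_of_equiv (fun j => .inr (.inr (.inr (.inl j))))
        (fun i j h => by simpa using h) (fun i => ?_) b hb
      rcases i with i | i | i | i | i <;> simp [genWeight]
    · obtain ⟨b, hb⟩ := exists_basis_two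
      refine exists_basis_of_equiv (fun j => .inr (.inr (.inr (.inr j))))
        (fun i j h => by simpa using h) (fun i => ?_) b hb
      rcases i with i | i | i | i | i <;> simp [genWeight]

lemma finrank_negTwo : Module.finrank ℝ (gradedPiece (-2)) = 8 := by
  obtain ⟨b, -⟩ := exists_basis_negTwo
  simpa using Module.finrank_eq_card_basis b

lemma finrank_negOne : Module.finrank ℝ (gradedPiece (-1)) = 16 := by
  obtain ⟨b, -⟩ := exists_basis_negOne
  simpa using Module.finrank_eq_card_basis b

lemma finrank_zero : Module.finrank ℝ (gradedPiece 0) = 30 := by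
  obtain ⟨b, -⟩ := exists_basis_zero
  simpa using Module.finrank_eq_card_basis b

lemma finrank_one : Module.finrank ℝ (gradedPiece 1) = 16 := by
  obtain ⟨b, -⟩ := exists_basis_one
  simpa using Module.finrank_eq_card_basis b

lemma finrank_two : Module.finrank ℝ (gradedPiece 2) = 8 := by
  obtain ⟨b, -⟩ := exists_basis_two
  simpa using Module.finrank_eq_card_basis b

end

section

/-! ### Local infinitesimal automorphisms -/

/-- The curve `t ↦ (t Z(t z, t² w), W(t z, t² w))` attached to the field `L = (Z, W)` and the point
`x = (z, w)`; its Taylor coefficients are the homogeneous parts of `L`. -/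
def scaled (L : E → E) (t : ℂ) (x : E) : E :=
  Sum.elim (fun i => t * L (dil t x) (.inl i)) fun j => L (dil t x) (.inr j)

/-- The homogeneous part of weight `n - 2` of a vector field that is holomorphic near `0`. -/
def homPart (L : E → E) (n : ℕ) (x : E) : E :=
  (n.factorial : ℂ)⁻¹ • iteratedDeriv n (fun t => scaled L t x) 0

variable {L : E → E} {U : Set E}

lemma isOpen_dil_preimage (hU : IsOpen U) : IsOpen {p : ℂ × E | dil p.1 p.2 ∈ U} :=
  hU.preimage (contDiff_dil (n := 0)).continuous

lemma analyticOnNhd_scaled (hL : AnalyticOnNhd ℂ L U) :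
    AnalyticOnNhd ℂ (fun p : ℂ × E => scaled L p.1 p.2) {p | dil p.1 p.2 ∈ U} := by
  intro p hp
  have h1 : AnalyticAt ℂ (fun p : ℂ × E => dil p.1 p.2) p :=
    (contDiff_dil (n := ⊤)).contDiffAt.analyticAt
  have h2 : AnalyticAt ℂ (fun p : ℂ × E => L (dil p.1 p.2)) p := AnalyticAt.comp (hL _ hp) h1
  have h3 := fun c => (analyticAt_pi_iff.1 h2) c
  refine analyticAt_pi_iff.2 ?_
  rintro (i | j)
  · exact analyticAt_fst.mul (h3 _)
  · exact h3 _

lemma analyticOnNhd_iteratedDeriv_scaled (hU : IsOpen U) (hL : AnalyticOnNhd ℂ L U) (n : ℕ) :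
    AnalyticOnNhd ℂ (fun p : ℂ × E => iteratedDeriv n (fun t => scaled L t p.2) p.1)
      {p | dil p.1 p.2 ∈ U} := by
  induction n with
  | zero => simpa using analyticOnNhd_scaled hL
  | succ n ih =>
    intro p hp
    have h1 : AnalyticAt ℂ (fun q : ℂ × E => fderiv ℂ
        (fun p : ℂ × E => iteratedDeriv n (fun t => scaled L t p.2) p.1) q (1, 0)) p :=
      ((ContinuousLinearMap.apply ℂ E ((1, 0) : ℂ × E)).analyticAt _).comp (ih p hp).fderiv
    refine h1.congr ?_
    filter_upwards [(isOpen_dil_preimage hU).mem_nhds hp] with q hq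
    rw [iteratedDeriv_succ]
    have h2 := (ih q hq).differentiableAt.hasFDerivAt.comp_hasDerivAt q.1
      ((hasDerivAt_id q.1).prodMk (hasDerivAt_const q.1 q.2))
    exact h2.deriv.symm

lemma hasDerivAt_iteratedDeriv_scaled (hU : IsOpen U) (hL : AnalyticOnNhd ℂ L U) (n : ℕ) {t : ℂ}
    {x : E} (h : dil t x ∈ U) : HasDerivAt (iteratedDeriv n fun t => scaled L t x)
      (iteratedDeriv (n + 1) (fun t => scaled L t x) t) t := by
  have h1 : AnalyticAt ℂ (fun s : ℂ => iteratedDeriv n (fun t => scaled L t x) s) t :=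
    AnalyticAt.comp (f := fun s : ℂ => (s, x))
      (analyticOnNhd_iteratedDeriv_scaled hU hL n (t, x) h) (analyticAt_id.prod analyticAt_const)
  rw [iteratedDeriv_succ]
  exact h1.differentiableAt.hasDerivAt

lemma dil_dil (s t : ℂ) (x : E) : dil s (dil t x) = dil (s * t) x := by
  ext (j | j) <;> simp [dil] <;> ring

/-- Replacing `x` by a dilated point reparametrizes the curve `scaled L · x`, up to the weights. -/
lemma iteratedDeriv_scaled_dil (hU : IsOpen U) (hL : AnalyticOnNhd ℂ L U) {s : ℂ} (hs : s ≠ 0)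
    (x : E) (a : Coord) (n : ℕ) : ∀ {t : ℂ}, dil (t * s) x ∈ U →
      iteratedDeriv n (fun t => scaled L t (dil s x)) t a =
        s ^ ((n : ℤ) - 2 + wt a) * iteratedDeriv n (fun t => scaled L t x) (t * s) a := by
  induction n with
  | zero =>
    intro t _
    rcases a with a | a
    · simp only [iteratedDeriv_zero, scaled, dil_dil, wt, Sum.elim_inl]
      norm_num
      field_simp
    · simp [iteratedDeriv_zero, scaled, dil_dil, wt]
  | succ n ih =>
    intro t ht
    have h1 := hasDerivAt_pi.1 (hasDerivAt_iteratedDeriv_scaled hU hL n (x := dil s x) (t := t)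
      (by rwa [dil_dil])) a
    have h2 := hasDerivAt_pi.1 ((hasDerivAt_iteratedDeriv_scaled hU hL n ht).scomp t
      ((hasDerivAt_id t).mul_const s)) a
    have h3 := h2.const_mul (s ^ ((n : ℤ) - 2 + wt a))
    have h4 : ∀ᶠ t in nhds t, dil (t * s) x ∈ U :=
      (((continuous_dil x).comp (continuous_mul_const s)).continuousAt).eventually (hU.mem_nhds ht)
    have h5 := h1.unique (h3.congr_of_eventuallyEq (h4.mono fun t ht => ih ht))
    rw [h5]
    simp only [one_mul, Pi.smul_apply, smul_eq_mul]
    rw [← mul_assoc, ← zpow_add_one₀ hs]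
    congr 2
    push_cast
    ring

/-- The Taylor coefficients of `scaled L · x` at `0` are entire in `x`, because every point is
mapped into `U` by dilations near `0`. -/
lemma homFun_homPart (hU : IsOpen U) (h0 : (0 : E) ∈ U) (hL : AnalyticOnNhd ℂ L U) (n : ℕ)
    (a : Coord) : HomFun (fun x => homPart L n x a) ((n : ℤ) - 2 + wt a) := by
  refine ⟨?_, fun s hs x => ?_⟩
  · have h1 : AnalyticOnNhd ℂ (fun x => iteratedDeriv n (fun t => scaled L t x) 0) Set.univ := by
      intro x _
      exact (analyticOnNhd_iteratedDeriv_scaled hU hL n (0, x) (by simpa using h0)).comp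
        (analyticAt_const.prod analyticAt_id)
    have h2 := contDiff_pi.1 (h1.contDiff (n := ⊤)) a
    exact contDiff_const.mul h2
  · simp only [homPart, Pi.smul_apply, smul_eq_mul]
    rw [iteratedDeriv_scaled_dil hU hL hs x a n (by simpa using h0), zero_mul]
    ring

lemma dil_ofReal_mem_M (t : ℝ) {x : E} (hx : x ∈ M) : dil t x ∈ M := by
  rw [← pt_zc_om x, mem_M_iff, zc_pt, om_pt] at hx
  rw [← pt_zc_om x, dil_pt, mem_M_iff, zc_pt, om_pt, sg_smul, herm_smul_left, herm_smul_right,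
    ← hx]
  simp only [map_pow, conj_ofReal]
  module

lemma scaled_mem_tangentSpace {t : ℝ} {x : E} (h : L (dil t x) ∈ tangentSpace (dil t x)) :
    scaled L t x ∈ tangentSpace x := by
  rw [mem_tangentSpace_iff_herm] at h ⊢
  have h1 : om (scaled L t x) = om (L (dil t x)) := rfl
  have h2 : zc (scaled L t x) = (t : ℂ) • zc (L (dil t x)) := rfl
  have h3 : zc (dil t x) = (t : ℂ) • zc x := rfl
  rw [h1, h, h2, h3, herm_smul_right, herm_smul_left, herm_smul_right, herm_smul_left, conj_ofReal]

/-- Dilations by real numbers preserve `M`, so all Taylor coefficients of `scaled L · x` along the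
real line are tangent to `M` at `x`. -/
lemma homPart_mem_tangentSpace (hU : IsOpen U) (h0 : (0 : E) ∈ U) (hL : AnalyticOnNhd ℂ L U)
    (hT : TangentOn L (U ∩ M)) {x : E} (hx : x ∈ M) (n : ℕ) :
    homPart L n x ∈ tangentSpace x := by
  have h1 : ∀ᶠ t : ℝ in nhds 0, dil t x ∈ U :=
    (((continuous_dil x).comp continuous_ofReal).continuousAt).eventually
      (hU.mem_nhds (by simpa using h0))
  have key : ∀ᶠ t : ℝ in nhds 0, fderiv ℝ rho x (iteratedDeriv n (fun t => scaled L t x) t) = 0 := by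
    induction n with
    | zero =>
      filter_upwards [h1] with t ht
      rw [iteratedDeriv_zero]
      exact scaled_mem_tangentSpace (hT _ ⟨ht, dil_ofReal_mem_M t hx⟩)
    | succ n ih =>
      filter_upwards [h1, ih.eventually_nhds] with t ht hn
      have h2 := HasDerivAt.scomp t (hasDerivAt_iteratedDeriv_scaled hU hL n ht)
        (ofRealCLM.hasDerivAt (x := t))
      simp only [ofRealCLM_apply, ofReal_one, one_smul] at h2
      have h3 := (fderiv ℝ rho x).hasFDerivAt.comp_hasDerivAt t h2
      exact h3.unique ((hasDerivAt_const t 0).congr_of_eventuallyEq hn)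
  have h2 : iteratedDeriv n (fun t => scaled L t x) 0 ∈ tangentSpace x := by
    have := key.self_of_nhds
    rwa [ofReal_zero] at this
  have h3 : homPart L n x = ((n.factorial : ℝ)⁻¹) • iteratedDeriv n (fun t => scaled L t x) 0 := by
    rw [homPart, ← Complex.coe_smul]
    norm_num
  rw [h3]
  exact (tangentSpace x).smul_mem _ h2

/-- The homogeneous parts of a local infinitesimal automorphism are global ones. -/
def homPartHol (hU : IsOpen U) (h0 : (0 : E) ∈ U) (hL : AnalyticOnNhd ℂ L U)
    (hT : TangentOn L (U ∩ M)) (n : ℕ) : hol :=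
  ⟨⟨homPart L n, (contDiff_pi.2 fun a => (homFun_homPart hU h0 hL n a).contDiff).analyticOnNhd⟩,
    fun _ hx => homPart_mem_tangentSpace hU h0 hL hT hx n⟩

lemma homPartHol_mem (hU : IsOpen U) (h0 : (0 : E) ∈ U) (hL : AnalyticOnNhd ℂ L U)
    (hT : TangentOn L (U ∩ M)) (n : ℕ) : homPartHol hU h0 hL hT n ∈ gradedPiece ((n : ℤ) - 2) :=
  (hasWeight_iff _ _).2 (homFun_homPart hU h0 hL n)

lemma homPart_eq_zero (hU : IsOpen U) (h0 : (0 : E) ∈ U) (hL : AnalyticOnNhd ℂ L U)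
    (hT : TangentOn L (U ∩ M)) {n : ℕ} (hn : 5 ≤ n) (x : E) : homPart L n x = 0 := by
  have h := eq_zero_of_three_le (by omega) (homPartHol_mem hU h0 hL hT n)
  exact congrArg (fun X : hol => X.1.1 x) h

lemma norm_dil_le {t : ℂ} (ht : ‖t‖ ≤ 2) (x : E) : ‖dil t x‖ ≤ 4 * ‖x‖ := by
  rw [pi_norm_le_iff_of_nonneg (by positivity)]
  rintro (i | i)
  · have h := norm_le_pi_norm x (.inl i)
    calc ‖t * x (.inl i)‖ = ‖t‖ * ‖x (.inl i)‖ := norm_mul _ _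
      _ ≤ 2 * ‖x‖ := by gcongr
      _ ≤ 4 * ‖x‖ := by linarith [norm_nonneg x]
  · have h := norm_le_pi_norm x (.inr i)
    calc ‖t ^ 2 * x (.inr i)‖ = ‖t‖ ^ 2 * ‖x (.inr i)‖ := by rw [norm_mul, norm_pow]
      _ ≤ 2 ^ 2 * ‖x‖ := by gcongr
      _ = 4 * ‖x‖ := by norm_num

/-- A local infinitesimal automorphism near `0 ∈ M` is the sum of its homogeneous parts of weights
`-2, …, 2`. -/
lemma eventuallyEq_of_zero_mem (hU : IsOpen U) (h0 : (0 : E) ∈ U) (hL : AnalyticOnNhd ℂ L U)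
    (hT : TangentOn L (U ∩ M)) :
    L =ᶠ[nhds 0] (∑ n ∈ Finset.range 5, homPartHol hU h0 hL hT n : hol).1.1 := by
  obtain ⟨r, hr, hrU⟩ := Metric.isOpen_iff.1 hU 0 h0
  filter_upwards [Metric.ball_mem_nhds (0 : E) (by positivity : 0 < r / 4)] with x hx
  have hx' : ‖x‖ < r / 4 := by simpa using hx
  have hd : DifferentiableOn ℂ (fun t => scaled L t x) (Metric.ball 0 2) := fun t ht => by
    have h1 : dil t x ∈ U := hrU (by
      have := norm_dil_le (t := t) (by simpa using (mem_ball_zero_iff.1 ht).le) x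
      rw [mem_ball_zero_iff]
      linarith)
    exact (hasDerivAt_iteratedDeriv_scaled hU hL 0 h1).differentiableAt.differentiableWithinAt.congr
      (fun _ _ => by rw [iteratedDeriv_zero]) (by rw [iteratedDeriv_zero])
  have h1 := hasSum_taylorSeries_on_ball hd (z := 1) (by simp)
  have h2 : ∀ n : ℕ, ((n.factorial : ℂ)⁻¹ • (1 - 0 : ℂ) ^ n •
      iteratedDeriv n (fun t => scaled L t x) 0) = homPart L n x := fun n => by
    simp [homPart]
  have h3 : scaled L 1 x = L x := by
    ext (i | i) <;> simp [scaled]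
  simp only [h2, h3] at h1
  have h4 := hasSum_sum_of_ne_finset_zero (f := fun n => homPart L n x) (s := Finset.range 5)
    (L := SummationFilter.unconditional ℕ) fun n hn => homPart_eq_zero hU h0 hL hT (by simpa using hn) x
  rw [h1.unique h4]
  let ev : hol →+ E := { toFun := fun X => X.1.1 x, map_zero' := rfl, map_add' := fun _ _ => rfl }
  exact (map_sum ev (fun n => homPartHol hU h0 hL hT n) (Finset.range 5)).symm

/-- The affine map with linear part unipotent that takes `0` to `p`; it preserves `M` if `p ∈ M`. -/
def transl (p x : E) : E := p + (x + hermL (zc p) x)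

/-- The point `q` for which `transl q` is inverse to `transl p`. -/
def translInv (p : E) : E := pt (-zc p) (sg (om p))

lemma hermL_hermL (c d : Fin 8 → ℂ) (x : E) : hermL c (hermL d x) = 0 := by
  rw [hermL_apply, hermL_apply, zc_pt, herm_zero_left, pt_zero_zero]

lemma hermL_neg (c : Fin 8 → ℂ) (x : E) : hermL (-c) x = -hermL c x := by
  rw [hermL_apply, hermL_apply, ← neg_one_smul ℂ c, herm_smul_right, pt_zero_smul]
  simp

lemma hermL_translInv {p : E} (x : E) : hermL (zc (translInv p)) x = -hermL (zc p) x := by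
  rw [translInv, zc_pt, hermL_neg]

lemma zc_translInv (p : E) : zc (translInv p) = -zc p := by rw [translInv, zc_pt]

lemma om_transl (p x : E) : om (transl p x) = om p + (om x + herm (zc x) (zc p)) := by
  rw [transl, om_add, om_add, hermL_apply, om_pt]

lemma zc_transl (p x : E) : zc (transl p x) = zc p + zc x := by
  have : zc (transl p x) = zc p + (zc x + 0) := rfl
  rw [this, add_zero]

lemma transl_mem_M {p x : E} (hp : p ∈ M) (hx : x ∈ M) : transl p x ∈ M := by
  rw [mem_M_iff] at *
  rw [om_transl, zc_transl, sg_add, sg_add, sg_herm, herm_add_left, herm_add_right, herm_add_right,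
    ← hp, ← hx]
  abel

lemma translInv_mem_M {p : E} (hp : p ∈ M) : translInv p ∈ M := by
  rw [mem_M_iff] at *
  rw [translInv, om_pt, zc_pt, sg_sg, add_comm, hp, ← neg_one_smul ℂ (zc p), herm_smul_left,
    herm_smul_right]
  simp

lemma translInv_translInv (p : E) : translInv (translInv p) = p := by
  rw [translInv, zc_translInv, neg_neg, translInv, om_pt, sg_sg, pt_zc_om]

lemma translInv_transl {p : E} (hp : p ∈ M) (x : E) : transl (translInv p) (transl p x) = x := by
  refine ext_zc_om ?_ ?_
  · rw [zc_transl, zc_transl, zc_translInv]; abel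
  · rw [mem_M_iff] at hp
    rw [om_transl, om_transl, zc_transl, zc_translInv, translInv, om_pt, ← neg_one_smul ℂ (zc p),
      herm_smul_right, herm_add_left, ← hp]
    simp only [map_neg, map_one]
    module

lemma mem_tangentSpace_transl {p x v : E} (h : v ∈ tangentSpace x) :
    v + hermL (zc p) v ∈ tangentSpace (transl p x) := by
  rw [mem_tangentSpace_iff_herm] at *
  have h1 : zc (v + hermL (zc p) v) = zc v := by
    have : zc (v + hermL (zc p) v) = zc v + 0 := rfl
    rw [this, add_zero]
  rw [h1, om_add, hermL_apply, om_pt, sg_add, sg_herm, zc_transl, herm_add_left, herm_add_right,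
    add_add_add_comm, h]
  abel

lemma analyticAt_transl (p x : E) : AnalyticAt ℂ (transl p) x :=
  analyticAt_const.add (analyticAt_id.add ((hermL (zc p)).analyticAt x))

/-- The push-forward of a vector field under `transl p`. -/
def pushField (p : E) (L : E → E) (x : E) : E :=
  L (transl (translInv p) x) + hermL (zc p) (L (transl (translInv p) x))

lemma analyticAt_pushField {p x : E} (h : AnalyticAt ℂ L (transl (translInv p) x)) :
    AnalyticAt ℂ (pushField p L) x := by
  have h1 : AnalyticAt ℂ (fun x => L (transl (translInv p) x)) x :=
    AnalyticAt.comp h (analyticAt_transl _ x)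
  exact h1.add (((hermL (zc p)).analyticAt _).comp h1)

lemma transl_translInv {p : E} (hp : p ∈ M) (x : E) : transl p (transl (translInv p) x) = x := by
  have := translInv_transl (translInv_mem_M hp) x
  rwa [translInv_translInv] at this

lemma pushField_mem_tangentSpace {p x : E} (hp : p ∈ M)
    (h : L (transl (translInv p) x) ∈ tangentSpace (transl (translInv p) x)) :
    pushField p L x ∈ tangentSpace x := by
  have := mem_tangentSpace_transl (p := p) h
  rwa [transl_translInv hp] at this

/-- Every local infinitesimal automorphism is globally defined. -/
lemma exists_eqOn (hU : IsOpen U) (hc : IsConnected U) (hM : (U ∩ M).Nonempty)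
    (hL : AnalyticOnNhd ℂ L U) (hT : TangentOn L (U ∩ M)) : ∃ X : hol, Set.EqOn L X.1.1 U := by
  obtain ⟨p, hpU, hp⟩ := hM
  have hq : translInv p ∈ M := translInv_mem_M hp
  -- the field `L` transported to a neighbourhood of the origin
  have hU' : IsOpen (transl p ⁻¹' U) := hU.preimage
    (continuous_iff_continuousAt.2 fun x => (analyticAt_transl p x).continuousAt)
  have h0 : (0 : E) ∈ transl p ⁻¹' U := by simpa [transl] using hpU
  have hL' : AnalyticOnNhd ℂ (pushField (translInv p) L) (transl p ⁻¹' U) := fun x hx =>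
    analyticAt_pushField (hL _ (by rwa [translInv_translInv]))
  have hT' : TangentOn (pushField (translInv p) L) (transl p ⁻¹' U ∩ M) := fun x hx =>
    pushField_mem_tangentSpace hq (by
      rw [translInv_translInv]; exact hT _ ⟨hx.1, transl_mem_M hp hx.2⟩)
  have h1 := eventuallyEq_of_zero_mem hU' h0 hL' hT'
  generalize (∑ n ∈ Finset.range 5, homPartHol hU' h0 hL' hT' n : hol) = Y at h1
  refine ⟨⟨⟨pushField p Y.1.1, fun x _ => analyticAt_pushField (Y.1.2 _ trivial)⟩, fun x hx =>
    pushField_mem_tangentSpace hp (Y.2 _ (transl_mem_M hq hx))⟩, ?_⟩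
  refine hL.eqOn_of_preconnected_of_eventuallyEq
    (fun x _ => analyticAt_pushField (Y.1.2 _ trivial)) hc.isPreconnected hpU ?_
  have h2 : Filter.Tendsto (transl (translInv p)) (nhds p) (nhds 0) := by
    have h3 := (analyticAt_transl (translInv p) p).continuousAt.tendsto
    have h4 : transl (translInv p) p = 0 := by
      have := translInv_transl hp 0
      rwa [show transl p 0 = p by simp [transl]] at this
    rwa [h4] at h3
  filter_upwards [h2.eventually h1] with x hx
  rw [pushField, ← hx, pushField, translInv_translInv, transl_translInv hp, hermL_translInv, map_add,
    map_neg, hermL_hermL]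
  simp

lemma existsUnique_eqOn (hU : IsOpen U) (hc : IsConnected U) (hM : (U ∩ M).Nonempty)
    (hL : AnalyticOnNhd ℂ L U) (hT : TangentOn L (U ∩ M)) : ∃! X : hol, Set.EqOn L X.1.1 U := by
  obtain ⟨X, hX⟩ := exists_eqOn hU hc hM hL hT
  refine ⟨X, hX, fun Y hY => ?_⟩
  obtain ⟨p, hpU, -⟩ := hM
  have h := Y.1.2.eqOn_of_preconnected_of_eventuallyEq X.1.2 isPreconnected_univ (Set.mem_univ p)
    (Filter.eventuallyEq_of_mem (hU.mem_nhds hpU) fun x hx => (hY hx).symm.trans (hX hx))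
  exact hol_ext fun x => h (Set.mem_univ x)

/-! ### The decomposition of `hol` -/

/-- The sum of the homogeneous parts of weights `-2, …, 2` of an element of `hol` agrees with it
near the origin, hence everywhere. -/
lemma iSup_gradedPiece : ⨆ k, gradedPiece k = ⊤ := by
  rw [eq_top_iff]
  intro X _
  have hT : TangentOn X.1.1 (Set.univ ∩ M) := by rw [Set.univ_inter]; exact X.2
  have h1 := eventuallyEq_of_zero_mem isOpen_univ (Set.mem_univ 0) X.1.2 hT
  have h2 : X = ∑ n ∈ Finset.range 5, homPartHol isOpen_univ (Set.mem_univ 0) X.1.2 hT n :=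
    hol_ext fun x => X.1.2.eqOn_of_preconnected_of_eventuallyEq (∑ n ∈ Finset.range 5,
      homPartHol isOpen_univ (Set.mem_univ 0) X.1.2 hT n : hol).1.2
      isPreconnected_univ (Set.mem_univ 0) h1 (Set.mem_univ x)
  rw [h2]
  exact Submodule.sum_mem _ fun n _ => Submodule.mem_iSup_of_mem _ (homPartHol_mem _ _ _ _ n)

lemma isInternal_gradedPiece : DirectSum.IsInternal gradedPiece :=
  DirectSum.isInternal_submodule_of_iSupIndep_of_iSup_eq_top iSupIndep_gradedPiece iSup_gradedPiece

/-- The 78 generators form a basis of `hol`. -/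
lemma exists_basis_hol : ∃ b : Module.Basis GenIndex ℝ hol, ∀ i, b i = genHol i := by
  choose b hb using exists_basis_of_genWeight
  refine ⟨(isInternal_gradedPiece.collectedBasis b).reindex (Equiv.sigmaFiberEquiv genWeight),
    fun i => ?_⟩
  rw [Module.Basis.reindex_apply, DirectSum.IsInternal.collectedBasis_coe]
  exact hb _ _

/-- The basis of `hol` consisting of the generators. -/
def holBasis : Module.Basis GenIndex ℝ hol := exists_basis_hol.choose

lemma holBasis_apply (i : GenIndex) : holBasis i = genHol i := exists_basis_hol.choose_spec i

instance : Module.Finite ℝ hol := Module.Finite.of_basis holBasis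

instance : Module.Free ℝ hol := Module.Free.of_basis holBasis

lemma finrank_hol : Module.finrank ℝ hol = 78 := by
  simpa using Module.finrank_eq_card_basis holBasis

end

section

/-! ### The Killing form is nondegenerate -/

/-- The centralizer of `𝔤₋₁` is `𝔤₋₂`. -/
lemma eq_tauField_of_lie_heisField {X : hol} (h : ∀ c, ⁅heisField c, X⁆ = 0) :
    ∃ t ht, X = tauField t ht := by
  have h1 : ∀ z v, X.1.1 (pt z v) = X.1.1 (pt z 0) :=
    apply_pt_eq_of_lie_tauField fun t ht => lie_tauField_eq_zero h t ht
  have hd : ∀ x v, fderiv ℂ X.1.1 x (pt 0 v) = 0 := fun x v =>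
    fderiv_eq_zero_of_lie_tauField (fun t ht => lie_tauField_eq_zero h t ht) x v
  have h2 : ∀ c x, fderiv ℂ X.1.1 x (pt c 0) = pt 0 (herm (zc (X.1.1 x)) c) := fun c x => by
    have h3 := lie_heisField c X x
    rw [h c, show pt c (herm (zc x) c) = pt c 0 + pt 0 (herm (zc x) c) by rw [← pt_add]; simp,
      map_add, hd, add_zero] at h3
    exact (sub_eq_zero.1 h3.symm)
  -- the field is `(ζ, η)` plus a linear field in the `z`-variables
  have hzc : ∀ z v, zp X z v = zp X 0 0 := fun z v => by
    have h3 : ∀ s : ℂ, HasDerivAt (fun s : ℂ => zc (X.1.1 (pt 0 0 + s • pt z 0))) 0 s := fun s => by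
      have h4 : HasDerivAt (fun s : ℂ => pt 0 0 + s • pt z 0) (pt z 0) s := by
        simpa using ((hasDerivAt_id s).smul_const (pt z 0)).const_add (pt 0 0)
      have h5 := ((holVF_differentiable X.1) (pt 0 0 + s • pt z 0)).hasFDerivAt.comp_hasDerivAt s h4
      have h6 := hasDerivAt_pi.1 h5
      refine hasDerivAt_pi.2 fun i => ?_
      have h7 := h6 (.inl i)
      rw [h2] at h7
      exact h7
    have h4 := is_const_of_deriv_eq_zero (fun s => (h3 s).differentiableAt)
      (fun s => (h3 s).deriv) 1 0
    simp only [one_smul, zero_smul, add_zero, ← pt_add, zero_add] at h4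
    rw [zp, h1, h4]
    rfl
  have hw : ∀ z v, wp X z v = herm z (zp X 0 0) - sg (wp X 0 0) := fun z v => by
    have h3 : wp X 0 (-sg v) = wp X 0 0 := by rw [wp, h1]; rfl
    rw [wp_eq, hzc, h3]
  have hζ : zp X 0 0 = 0 := by
    refine eq_zero_of_herm_eq_zero fun c => ?_
    -- the derivative of the `w`-part in the direction `c` is linear and antilinear in `c`
    have h3 : ∀ c, herm c (zp X 0 0) = herm (zp X 0 0) c := fun c => by
      have h4 : HasDerivAt (fun s : ℂ => X.1.1 (pt 0 0 + s • pt c 0))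
          (pt 0 (herm (zc (X.1.1 (pt 0 0))) c)) 0 := by
        have h5 : HasDerivAt (fun s : ℂ => pt 0 0 + s • pt c 0) (pt c 0) 0 := by
          simpa using ((hasDerivAt_id (0 : ℂ)).smul_const (pt c 0)).const_add (pt 0 0)
        have h6 := ((holVF_differentiable X.1) (pt 0 0 + (0 : ℂ) • pt c 0)).hasFDerivAt.comp_hasDerivAt
          0 h5
        rw [zero_smul, add_zero, h2] at h6
        exact h6
      have h5 := (omL.hasFDerivAt (x := X.1.1 (pt 0 0 + (0 : ℂ) • pt c 0))).comp_hasDerivAt 0 h4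
      have h6 : ∀ s : ℂ, (omL ∘ fun s : ℂ => X.1.1 (pt 0 0 + s • pt c 0)) s =
          s • herm c (zp X 0 0) - sg (wp X 0 0) := fun s => by
        have h7 := hw (s • c) 0
        rw [herm_smul_left] at h7
        rw [← h7, Function.comp_apply, omL_apply, ← pt_smul, ← pt_add]
        simp [wp]
      rw [funext h6, omL_apply, om_pt] at h5
      have h7 : HasDerivAt (fun s : ℂ => s • herm c (zp X 0 0) - sg (wp X 0 0))
          (herm c (zp X 0 0)) 0 := by
        simpa using ((hasDerivAt_id (0 : ℂ)).smul_const (herm c (zp X 0 0))).sub_const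
          (sg (wp X 0 0))
      exact h7.unique h5
    have h4 := h3 (I • c)
    rw [herm_smul_left, herm_smul_right, h3 c, conj_I] at h4
    have h5 : (2 * I) • herm (zp X 0 0) c = 0 := by
      rw [two_mul, add_smul]
      nth_rewrite 1 [h4]
      rw [← add_smul, neg_add_cancel, zero_smul]
    exact (smul_eq_zero.1 h5).resolve_left (by simp)
  have ht := wp_add_sg_wp X (z := 0) (v := 0) (y := 0) (u := 0) (by simp)
  rw [hζ, herm_zero_left, add_zero] at ht
  refine ⟨wp X 0 0, ht, hol_ext_zp_wp (fun z v => ?_) fun z v => ?_⟩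
  · rw [hzc, hζ]; rfl
  · rw [hw, hζ, herm_zero_right, zero_sub]
    refine (neg_eq_of_add_eq_zero_left ht).trans ?_
    exact (om_pt _ _).symm

/-- All brackets `⁅c₁, ⁅c₂, …, ⁅cₙ, X⁆⁆⁆` with `c₁, …, cₙ` in `𝔤₋₁` vanish. -/
def HeisNil : ℕ → hol → Prop
  | 0, X => X = 0
  | n + 1, X => ∀ c, HeisNil n ⁅heisField c, X⁆

lemma HeisNil.zero : ∀ n, HeisNil n 0
  | 0 => rfl
  | n + 1 => fun c => by rw [lie_zero]; exact HeisNil.zero n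

lemma HeisNil.add : ∀ {n : ℕ} {X Y : hol}, HeisNil n X → HeisNil n Y → HeisNil n (X + Y)
  | 0, X, Y, hX, hY => by rw [HeisNil] at *; rw [hX, hY, add_zero]
  | n + 1, X, Y, hX, hY => fun c => by rw [lie_add]; exact (hX c).add (hY c)

lemma heisNil_of_mem : ∀ {n : ℕ} {k : ℤ} {X : hol}, X ∈ gradedPiece k → k + 3 ≤ n → HeisNil n X
  | 0, k, X, hX, hk => eq_zero_of_le_neg_three hX (by push_cast at hk; omega)
  | n + 1, k, X, hX, hk => fun c =>
      heisNil_of_mem (lie_mem_gradedPiece (heisField_mem c) hX) (by push_cast at hk; omega)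

/-- The weights of nonzero fields lie between `-2` and `2`, and the bracket with `𝔤₋₁` lowers them.
-/
lemma heisNil_five (X : hol) : HeisNil 5 X := by
  have hX : X ∈ ⨆ k, gradedPiece k := by rw [iSup_gradedPiece]; trivial
  induction hX using Submodule.iSup_induction' with
  | mem k X hX =>
    by_cases hk : 2 < |k|
    · rw [gradedPiece_eq_bot hk] at hX
      rw [(Submodule.mem_bot ℝ).1 hX]
      exact HeisNil.zero 5
    · exact heisNil_of_mem hX (by have := (abs_le.1 (not_lt.1 hk)).2; push_cast; omega)
  | zero => exact HeisNil.zero 5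
  | add X Y _ _ hX hY => exact hX.add hY

/-- A subspace stable under `𝔤₋₁` that meets `𝔤₋₂` trivially is zero. -/
lemma eq_zero_of_stable {p : hol → Prop} (hp : ∀ c X, p X → p ⁅heisField c, X⁆)
    (ht : ∀ t ht, p (tauField t ht) → tauField t ht = 0) {X : hol} (hX : p X) : X = 0 := by
  have key : ∀ n X, HeisNil n X → p X → X = 0 := by
    intro n
    induction n with
    | zero => exact fun X h _ => h
    | succ n ih =>
      intro X h hX
      obtain ⟨t, ht', rfl⟩ := eq_tauField_of_lie_heisField fun c => ih _ (h c) (hp c X hX)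
      exact ht t ht' hX
  exact key 5 X (heisNil_five X) hX

/-- The square of the adjoint action of a nonzero element of `𝔤₋₂` does not vanish: the quadratic
coefficients of `IL²_{w₁w₁} + IL²_{w₂w₂}` have no common imaginary zero. -/
lemma eq_zero_of_lie_tauField_lie_raiseField (t : Fin 8 → ℂ) (ht : t + sg t = 0)
    (h : ⁅tauField t ht, ⁅tauField t ht, raiseField⁆⁆ = 0) : t = 0 := by
  have h1 := wp_lie_tauField_lie_tauField raiseField_mem t ht
  rw [h] at h1
  have h2 : wp raiseField 0 t = 0 := by
    refine (smul_eq_zero.1 (h1.symm.trans ?_)).resolve_left (by norm_num : (2 : ℂ) ≠ 0)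
    exact omL.map_zero
  have c0 : 4 * t 0 ^ 2 + (t 2 * t 3 + t 4 * t 5 + t 6 * t 7) = 0 := by
    refine (mul_eq_zero.1 (Eq.trans ?_ (congrFun h2 0))).resolve_left I_ne_zero
    rw [wp, raiseField_apply, genTwo_three, genTwo_four]
    simp [om, onCoords, pt]
    ring
  have c1 : 4 * t 1 ^ 2 + (t 2 * t 3 + t 4 * t 5 + t 6 * t 7) = 0 := by
    refine (mul_eq_zero.1 (Eq.trans ?_ (congrFun h2 1))).resolve_left I_ne_zero
    rw [wp, raiseField_apply, genTwo_three, genTwo_four]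
    simp [om, onCoords, pt]
    ring
  have hs : ∀ i, t i = -sg t i := fun i => eq_neg_of_add_eq_zero_left (congrFun ht i)
  have hm : ∀ z : ℂ, z * -conj z = -(normSq z : ℂ) := fun z => by rw [mul_neg, mul_conj]
  have e0 : t 0 ^ 2 = -(normSq (t 0) : ℂ) := by
    rw [← hm, pow_two]; nth_rewrite 2 [hs 0]; rfl
  have e1 : t 1 ^ 2 = -(normSq (t 1) : ℂ) := by
    rw [← hm, pow_two]; nth_rewrite 2 [hs 1]; rfl
  have e2 : t 2 * t 3 = -(normSq (t 2) : ℂ) := by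
    rw [← hm]; nth_rewrite 1 [hs 3]; rfl
  have e4 : t 4 * t 5 = -(normSq (t 4) : ℂ) := by
    rw [← hm]; nth_rewrite 1 [hs 5]; rfl
  have e6 : t 6 * t 7 = -(normSq (t 6) : ℂ) := by
    rw [← hm]; nth_rewrite 1 [hs 7]; rfl
  rw [e0, e2, e4, e6] at c0
  rw [e1, e2, e4, e6] at c1
  have r0 : 4 * normSq (t 0) + (normSq (t 2) + normSq (t 4) + normSq (t 6)) = 0 := by
    apply ofReal_injective; push_cast; linear_combination -c0
  have r1 : 4 * normSq (t 1) + (normSq (t 2) + normSq (t 4) + normSq (t 6)) = 0 := by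
    apply ofReal_injective; push_cast; linear_combination -c1
  have n0 := normSq_nonneg (t 0); have n1 := normSq_nonneg (t 1); have n2 := normSq_nonneg (t 2)
  have n4 := normSq_nonneg (t 4); have n6 := normSq_nonneg (t 6)
  have z2 : t 2 = 0 := normSq_eq_zero.1 (by linarith)
  have z4 : t 4 = 0 := normSq_eq_zero.1 (by linarith)
  have z6 : t 6 = 0 := normSq_eq_zero.1 (by linarith)
  refine ext_fin_eight (normSq_eq_zero.1 (by linarith)) (normSq_eq_zero.1 (by linarith)) z2 ?_ z4 ?_
    z6 ?_
  · rw [hs 3]; simp [sg, z2]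
  · rw [hs 5]; simp [sg, z4]
  · rw [hs 7]; simp [sg, z6]

/-- `hol` has no nonzero abelian ideal. -/
lemma eq_bot_of_abelian (J : LieIdeal ℝ hol) [IsLieAbelian J] : J = ⊥ := by
  refine (LieSubmodule.eq_bot_iff _).2 fun X hX => ?_
  refine eq_zero_of_stable (p := (· ∈ J)) (fun c X hX => J.lie_mem hX) (fun t ht h => ?_) hX
  have h1 : ⁅tauField t ht, raiseField⁆ ∈ J := by
    rw [← lie_skew]; exact J.neg_mem (J.lie_mem h)
  have h2 : ⁅tauField t ht, ⁅tauField t ht, raiseField⁆⁆ = 0 := by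
    have := trivial_lie_zero J J ⟨_, h⟩ ⟨_, h1⟩
    exact congrArg Subtype.val this
  have h3 := eq_zero_of_lie_tauField_lie_raiseField t ht h2
  subst h3
  exact hol_ext fun x => pt_zero_zero

instance : LieAlgebra.HasTrivialRadical ℝ hol :=
  (LieAlgebra.hasTrivialRadical_iff_no_abelian_ideals ℝ hol).2 fun J _ => eq_bot_of_abelian J

instance isKilling_hol : LieAlgebra.IsKilling ℝ hol := inferInstance

lemma killingForm_tensor :
    killingForm ℂ (ℂ ⊗[ℝ] hol) = (killingForm ℝ hol).baseChange ℂ :=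
  LieModule.traceForm_baseChange ℝ hol hol ℂ

/-- An element of the complexification is `X + i Y` with real `X` and `Y`. -/
lemma exists_eq_tmul_add (u : ℂ ⊗[ℝ] hol) : ∃ X Y : hol, u = (1 : ℂ) ⊗ₜ X + I ⊗ₜ Y := by
  induction u with
  | zero => exact ⟨0, 0, by simp⟩
  | tmul a X =>
    refine ⟨a.re • X, a.im • X, ?_⟩
    rw [← TensorProduct.smul_tmul, ← TensorProduct.smul_tmul, ← TensorProduct.add_tmul]
    congr 1
    exact Complex.ext (by simp) (by simp)
  | add u v hu hv =>
    obtain ⟨X, Y, rfl⟩ := hu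
    obtain ⟨X', Y', rfl⟩ := hv
    exact ⟨X + X', Y + Y', by rw [TensorProduct.tmul_add, TensorProduct.tmul_add]; abel⟩

/-- Nondegeneracy of the Killing form passes to the complexification. -/
instance : LieAlgebra.IsKilling ℂ (ℂ ⊗[ℝ] hol) := by
  refine ⟨(LieSubmodule.eq_bot_iff _).2 fun u hu => ?_⟩
  have hu' : ∀ v, killingForm ℂ (ℂ ⊗[ℝ] hol) u v = 0 := fun v => by
    rw [LieIdeal.mem_killingCompl] at hu
    rw [LieModule.traceForm_comm]
    exact hu v trivial
  obtain ⟨X, Y, rfl⟩ := exists_eq_tmul_add u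
  have h1 : ∀ Z, killingForm ℝ hol X Z = 0 ∧ killingForm ℝ hol Y Z = 0 := fun Z => by
    have h2 := hu' ((1 : ℂ) ⊗ₜ Z)
    rw [killingForm_tensor, map_add, LinearMap.add_apply,
      LinearMap.BilinForm.baseChange_tmul, LinearMap.BilinForm.baseChange_tmul] at h2
    have h3 := congrArg Complex.re h2
    have h4 := congrArg Complex.im h2
    simp at h3 h4
    exact ⟨h3, h4⟩
  have h5 : ∀ X : hol, (∀ Z, killingForm ℝ hol X Z = 0) → X = 0 := fun X hX =>
    (LieAlgebra.IsKilling.killingForm_nondegenerate ℝ hol).1 X hX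
  rw [h5 X fun Z => (h1 Z).1, h5 Y fun Z => (h1 Z).2]
  simp

end

section

/-! ### The complexification as a Lie algebra of holomorphic vector fields -/

/-- The inclusion of `hol` into the space of all vector fields. -/
def holToFun : hol →ₗ[ℝ] (E → E) where
  toFun X := X.1.1
  map_add' _ _ := rfl
  map_smul' _ _ := rfl

/-- The complexification of `hol`. -/
def CHol : Type := ℂ ⊗[ℝ] hol

instance : LieRing CHol := inferInstanceAs (LieRing (ℂ ⊗[ℝ] hol))

instance : LieAlgebra ℂ CHol := inferInstanceAs (LieAlgebra ℂ (ℂ ⊗[ℝ] hol))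

instance : LieAlgebra.IsKilling ℂ CHol := inferInstanceAs (LieAlgebra.IsKilling ℂ (ℂ ⊗[ℝ] hol))

instance : Module.Finite ℂ CHol := inferInstanceAs (Module.Finite ℂ (ℂ ⊗[ℝ] hol))

/-- The element `a ⊗ X` of the complexification. -/
def cmul (a : ℂ) (X : hol) : CHol := a ⊗ₜ[ℝ] X

lemma lie_cmul (a b : ℂ) (X Y : hol) : ⁅cmul a X, cmul b Y⁆ = cmul (a * b) ⁅X, Y⁆ :=
  LieAlgebra.ExtendScalars.bracket_tmul ℝ ℂ hol hol a b X Y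

lemma induction_cmul {p : CHol → Prop} (u : CHol) (h0 : p 0) (h1 : ∀ a X, p (cmul a X))
    (h2 : ∀ u v, p u → p v → p (u + v)) : p u :=
  TensorProduct.induction_on (motive := p) u h0 h1 h2

/-- The realization of the complexification of `hol` by holomorphic vector fields. -/
def toField : CHol →ₗ[ℂ] (E → E) := holToFun.liftBaseChange ℂ

lemma toField_cmul (a : ℂ) (X : hol) : toField (cmul a X) = a • X.1.1 :=
  LinearMap.liftBaseChange_tmul _ _ _ _

/-- `M` is not complex: if `X` and `i X` are both tangent to `M` then `X = 0`. -/
lemma eq_zero_of_I_smul {X Y : hol} (h : ∀ x, Y.1.1 x = I • X.1.1 x) : X = 0 := by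
  have key : ∀ p y, om (X.1.1 p) = herm (zc (X.1.1 p)) y := fun p y => by
    set q : E := pt y (sg (herm (zc p) y - om p))
    have hq : om p + sg (om q) = herm (zc p) (zc q) := by
      rw [om_pt, sg_sg, zc_pt]; abel
    have h1 := polarized_tangency X hq
    have h2 := polarized_tangency Y hq
    have hz : ∀ x : E, zc (I • x) = I • zc x := fun x => rfl
    rw [h p, h q, om_smul, om_smul, sg_smul, hz, hz, herm_smul_left, herm_smul_right, conj_I,
      neg_smul, neg_smul, ← sub_eq_add_neg, ← sub_eq_add_neg, ← smul_sub, ← smul_sub] at h2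
    have h3 := smul_right_injective _ I_ne_zero h2
    have h4 : (2 : ℂ) • om (X.1.1 p) = (2 : ℂ) • herm (zc (X.1.1 p)) y := by
      rw [two_smul, two_smul]
      calc om (X.1.1 p) + om (X.1.1 p)
          = (om (X.1.1 p) + sg (om (X.1.1 q))) + (om (X.1.1 p) - sg (om (X.1.1 q))) := by abel
        _ = _ := by rw [h1, h3, zc_pt]; abel
    exact smul_right_injective _ (two_ne_zero) h4
  refine hol_ext fun x => ext_zc_om ?_ ?_
  · refine eq_zero_of_herm_eq_zero fun y => ?_
    rw [← key x y, key x 0]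
    simpa only [zero_smul, map_zero] using herm_smul_right 0 (zc (X.1.1 x)) 0
  · rw [key x 0]
    have : herm (zc (X.1.1 x)) 0 = 0 := by
      simpa only [zero_smul, map_zero] using herm_smul_right 0 (zc (X.1.1 x)) 0
    rw [this]
    exact (omL.map_zero).symm

/-- Since `hol` is totally real in the space of all holomorphic fields, its complexification is a
Lie algebra of holomorphic vector fields. -/
lemma toField_injective : Function.Injective toField := by
  refine (injective_iff_map_eq_zero toField).2 fun u hu => ?_
  obtain ⟨X, Y, hXY⟩ := exists_eq_tmul_add u
  replace hXY : u = cmul 1 X + cmul I Y := hXY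
  rw [hXY, map_add, toField_cmul, toField_cmul, one_smul] at hu
  have h1 : ∀ x, X.1.1 x = I • (-Y).1.1 x := fun x => by
    have h2 : X.1.1 x + I • Y.1.1 x = 0 := congrFun hu x
    rw [eq_neg_of_add_eq_zero_left h2]
    exact (smul_neg I (Y.1.1 x)).symm
  have hY : Y = 0 := neg_eq_zero.1 (eq_zero_of_I_smul h1)
  subst hY
  have hX : X = 0 := hol_ext fun x => by
    rw [h1 x, neg_zero]
    exact smul_zero I
  rw [hXY, hX]
  exact (congrArg₂ _ (TensorProduct.tmul_zero _ _) (TensorProduct.tmul_zero _ _)).trans (add_zero 0)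

lemma differentiable_toField (u : CHol) : Differentiable ℂ (toField u) := by
  refine induction_cmul (p := fun u => Differentiable ℂ (toField u)) u ?_ (fun a X => ?_)
    fun u v hu hv => ?_
  · rw [map_zero]; exact differentiable_const 0
  · rw [toField_cmul]; exact (holVF_differentiable X.1).const_smul a
  · rw [map_add]; exact hu.add hv

lemma toField_lie (u v : CHol) : toField ⁅u, v⁆ = lieBracket ℂ (toField u) (toField v) := by
  refine induction_cmul (p := fun u => toField ⁅u, v⁆ = lieBracket ℂ (toField u) (toField v)) u ?_
    (fun a X => ?_) fun u u' hu hu' => ?_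
  · rw [zero_lie, map_zero]
    exact (lieBracket_zero_left).symm
  · refine induction_cmul (p := fun v => toField ⁅cmul a X, v⁆ =
      lieBracket ℂ (toField (cmul a X)) (toField v)) v ?_ (fun b Y => ?_) fun v v' hv hv' => ?_
    · rw [lie_zero, map_zero]
      exact (lieBracket_zero_right).symm
    · rw [lie_cmul, toField_cmul, toField_cmul, toField_cmul]
      have h : (⁅X, Y⁆ : hol).1.1 = lieBracket ℂ X.1.1 Y.1.1 := rfl
      funext x
      rw [h, lieBracket_const_smul_left (holVF_differentiable X.1 x),
        lieBracket_const_smul_right (holVF_differentiable Y.1 x), smul_smul, Pi.smul_apply]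
    · funext x
      rw [lie_add, map_add, map_add, hv, hv', lieBracket_add_right (differentiable_toField _ x)
        (differentiable_toField _ x), Pi.add_apply]
  · funext x
    rw [add_lie, map_add, map_add, hu, hu', lieBracket_add_left (differentiable_toField _ x)
      (differentiable_toField _ x), Pi.add_apply]

/-- The linear coordinates `(z₁, …, z₈, 2v₁, 2v₂, v₃, …, v₈)`, where `v` are the light-cone
coordinates of the `w`-space. -/
def chart : E →L[ℂ] (Fin 16 → ℂ) :=
  LinearMap.toContinuousLinearMap
    { toFun := fun x => ![zc x 0, zc x 1, zc x 2, zc x 3, zc x 4, zc x 5, zc x 6, zc x 7,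
        2 * om x 0, 2 * om x 1, om x 2, om x 3, om x 4, om x 5, om x 6, om x 7]
      map_add' := fun x y => by
        rw [om_add]
        ext a
        fin_cases a <;> simp [zc, mul_add]
      map_smul' := fun c x => by
        rw [om_smul]
        ext a
        fin_cases a <;> simp [zc, mul_left_comm] }

/-- The inverse of `chart`. -/
def chartInv : (Fin 16 → ℂ) →L[ℂ] E :=
  LinearMap.toContinuousLinearMap
    { toFun := fun x => pt ![x 0, x 1, x 2, x 3, x 4, x 5, x 6, x 7]
        ![x 8 / 2, x 9 / 2, x 10, x 11, x 12, x 13, x 14, x 15]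
      map_add' := fun x y => by
        rw [← pt_add]
        congr 1 <;> apply ext_fin_eight <;> simp [add_div]
      map_smul' := fun c x => by
        rw [RingHom.id_apply, ← pt_smul]
        congr 1 <;> apply ext_fin_eight <;> simp [mul_div_assoc] }

lemma chartInv_chart (x : E) : chartInv (chart x) = x := by
  refine ext_zc_om ?_ ?_
  · apply ext_fin_eight <;> rfl
  · change om (pt _ _) = _
    rw [om_pt]
    apply ext_fin_eight <;> simp [chart]

/-- The realization of the complexification of `hol` by vector fields in the coordinates
`chart`. -/
def fld : CHol →ₗ[ℂ] ((Fin 16 → ℂ) → (Fin 16 → ℂ)) where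
  toFun u x := chart (toField u (chartInv x))
  map_add' u v := by funext x; rw [map_add]; exact map_add chart _ _
  map_smul' c u := by funext x; rw [map_smul]; exact map_smul chart _ _

lemma fld_apply (u : CHol) (x : Fin 16 → ℂ) :
    fld u x = chart (toField u (chartInv x)) := rfl

lemma toField_eq (u : CHol) (x : E) : toField u x = chartInv (fld u (chart x)) := by
  rw [fld_apply, chartInv_chart, chartInv_chart]

lemma fld_injective : Function.Injective fld := fun u v h => toField_injective (by
  funext x
  rw [toField_eq, toField_eq, h])

lemma hasFDerivAt_fld (u : CHol) (x : Fin 16 → ℂ) : HasFDerivAt (fld u)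
    (chart ∘L fderiv ℂ (toField u) (chartInv x) ∘L chartInv) x :=
  chart.hasFDerivAt.comp x ((differentiable_toField u _).hasFDerivAt.comp x chartInv.hasFDerivAt)

lemma fld_lie (u v : CHol) (x : Fin 16 → ℂ) :
    fld ⁅u, v⁆ x = fderiv ℂ (fld v) x (fld u x) - fderiv ℂ (fld u) x (fld v x) := by
  rw [(hasFDerivAt_fld u x).fderiv, (hasFDerivAt_fld v x).fderiv, fld_apply, toField_lie,
    lieBracket_eq, map_sub]
  simp [fld_apply, chartInv_chart]

end

section

set_option linter.unnecessarySeqFocus false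

/-! ### Chevalley generators of type `E₆` -/

/-- The weights of the sixteen coordinates under the simple coroots. -/
def corootWt : Fin 6 → Fin 16 → ℤ :=
  ![![2, 1, 1, 1, 1, 1, 1, 0, 1, 0, 1, 0, 1, 0, 0, 1],
    ![0, 0, -1, -1, 1, 1, 0, 0, -1, 1, 1, -1, 0, 0, 0, 0],
    ![-1, 1, 0, 0, 0, 0, -1, 1, 0, 0, 0, 0, -1, 1, 1, -1],
    ![0, -1, 1, 0, 0, -1, 1, 0, 0, 0, -1, 1, 1, -1, 0, 0],
    ![0, 0, -1, 1, -1, 1, 0, 0, 0, 0, 0, 0, -1, 1, -1, 1],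
    ![0, 0, 0, -1, 0, -1, -1, -1, 1, 0, 1, 0, 1, 0, 1, 0]]

/-- The simple reflections as permutations of the sixteen coordinates. The one belonging to the
first root, which is the root of a nonlinear field, is not used. -/
def rootPerm : Fin 6 → Fin 16 → Fin 16 :=
  ![![0, 1, 2, 3, 4, 5, 6, 7, 8, 9, 10, 11, 12, 13, 14, 15],
    ![0, 1, 4, 5, 2, 3, 6, 7, 10, 11, 8, 9, 12, 13, 14, 15],
    ![1, 0, 2, 3, 4, 5, 7, 6, 8, 9, 10, 11, 14, 15, 12, 13],
    ![0, 2, 1, 3, 4, 6, 5, 7, 8, 9, 12, 13, 10, 11, 14, 15],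
    ![0, 1, 3, 2, 5, 4, 6, 7, 8, 9, 10, 11, 15, 14, 13, 12],
    ![0, 1, 2, 8, 4, 10, 12, 14, 3, 9, 5, 11, 6, 13, 7, 15]]

/-- The signs of the matrix entries of the simple root vectors. -/
def rootSign : Fin 6 → Fin 16 → ℤ :=
  ![![1, 1, 1, 1, 1, 1, 1, 1, 1, 1, 1, 1, 1, 1, 1, 1],
    ![1, 1, 1, 1, 1, 1, 1, 1, 1, 1, 1, 1, 1, 1, 1, 1],
    ![-1, -1, 1, 1, 1, 1, -1, -1, 1, 1, 1, 1, -1, 1, -1, 1],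
    ![1, 1, 1, 1, 1, 1, 1, 1, 1, 1, -1, 1, -1, 1, 1, 1],
    ![1, 1, -1, -1, -1, -1, 1, 1, 1, 1, 1, 1, -1, 1, 1, -1],
    ![1, 1, 1, -1, 1, -1, 1, 1, -1, 1, -1, 1, 1, 1, 1, 1]]

/-- The nonzero entries of a positive simple root vector. -/
def eCoef (i : Fin 6) (a : Fin 16) : ℤ := if corootWt i a = -1 then rootSign i a else 0

/-- The nonzero entries of a negative simple root vector. -/
def fCoef (i : Fin 6) (a : Fin 16) : ℤ := if corootWt i a = 1 then rootSign i a else 0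

/-- The linear vector field whose component at `∂ₐ` is `s a • x (σ a)`. -/
def signedPerm (s : Fin 16 → ℤ) (σ : Fin 16 → Fin 16) : (Fin 16 → ℂ) →L[ℂ] (Fin 16 → ℂ) :=
  ContinuousLinearMap.pi fun a => (s a : ℂ) • ContinuousLinearMap.proj (σ a)

lemma signedPerm_apply (s : Fin 16 → ℤ) (σ : Fin 16 → Fin 16) (x : Fin 16 → ℂ) (a : Fin 16) :
    signedPerm s σ x a = s a * x (σ a) := rfl

/-- The quadratic vector field of the root vector of the first simple root. -/
def quad (x : Fin 16 → ℂ) : Fin 16 → ℂ :=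
  ![x 0 * x 0, x 0 * x 1, x 0 * x 2, x 0 * x 3, x 0 * x 4, x 0 * x 5, x 0 * x 6,
    x 1 * x 6 - x 2 * x 5 + x 3 * x 4, x 0 * x 8, x 5 * x 12 + x 6 * x 10 - x 4 * x 15,
    x 0 * x 10, x 3 * x 12 + x 6 * x 8 - x 2 * x 15, x 0 * x 12,
    x 5 * x 8 - x 1 * x 15 - x 3 * x 10, x 1 * x 12 + x 2 * x 10 - x 4 * x 8, x 0 * x 15]

/-- The combination `c (X + i Y)` of two elements of the complexification. -/
def mix (c s : ℂ) (X Y : hol) : CHol := cmul c X + cmul (c * s) Y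

lemma fld_mix (c s : ℂ) (X Y : hol) (x : Fin 16 → ℂ) : fld (mix c s X Y) x =
    c • chart (X.1.1 (chartInv x) + s • Y.1.1 (chartInv x)) := by
  rw [mix, map_add, Pi.add_apply, fld_apply, fld_apply, toField_cmul, toField_cmul,
    ← map_add, ← map_smul]
  congr 1
  simp [mul_smul]

/-- The generator of weight `0` with a given label. -/
def symZero (j : Fin 30) : hol := genHol (.inr (.inr (.inl j)))

/-- The generator of weight `-1` with a given label. -/
def symNegOne (j : Fin 16) : hol := genHol (.inr (.inl j))

/-- The generator of weight `1` with a given label. -/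
def symOne (j : Fin 16) : hol := genHol (.inr (.inr (.inr (.inl j))))

/-- The positive simple root vectors. -/
def rootE : Fin 6 → CHol :=
  ![mix (1 / 4) (-I) (symOne 0) (symOne 8),
    mix (1 / 2) I (symZero 0) (symZero 14),
    mix (1 / 2) I (symZero 12) (symZero 29),
    mix (1 / 2) (-I) (symZero 9) (symZero 27),
    mix (1 / 2) I (symZero 8) (symZero 23),
    mix (1 / 2) I (symOne 3) (symOne 11)]

/-- The negative simple root vectors. -/
def rootF : Fin 6 → CHol :=
  ![mix (-1 / 2) (-I) (symNegOne 0) (symNegOne 8),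
    mix (1 / 2) (-I) (symZero 3) (symZero 17),
    mix (-1 / 2) (-I) (symZero 12) (symZero 29),
    mix (-1 / 2) I (symZero 9) (symZero 27),
    mix (-1 / 2) (-I) (symZero 8) (symZero 23),
    mix (-1 / 4) I (symNegOne 3) (symNegOne 11)]

lemma forall_fin_sixteen {p : Fin 16 → Prop} (h0 : p 0) (h1 : p 1) (h2 : p 2) (h3 : p 3) (h4 : p 4)
    (h5 : p 5) (h6 : p 6) (h7 : p 7) (h8 : p 8) (h9 : p 9) (h10 : p 10) (h11 : p 11) (h12 : p 12)
    (h13 : p 13) (h14 : p 14) (h15 : p 15) : ∀ a, p a := by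
  intro a; fin_cases a <;> assumption

lemma chart_apply (x : E) : chart x = ![zc x 0, zc x 1, zc x 2, zc x 3, zc x 4, zc x 5, zc x 6,
    zc x 7, 2 * om x 0, 2 * om x 1, om x 2, om x 3, om x 4, om x 5, om x 6, om x 7] := rfl

/-- The coordinates in `chart` of `c (A + r C)` and `c (B + r D)`. -/
def mixCoord (c r : ℂ) (A B C D : Fin 8 → ℂ) : Fin 16 → ℂ :=
  ![c * (A 0 + r * C 0), c * (A 1 + r * C 1), c * (A 2 + r * C 2), c * (A 3 + r * C 3),
    c * (A 4 + r * C 4), c * (A 5 + r * C 5), c * (A 6 + r * C 6), c * (A 7 + r * C 7),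
    c * (2 * (B 0 + r * D 0)), c * (2 * (B 1 + r * D 1)),
    c * ((B 3 + r * D 3) + (B 2 + r * D 2)), c * ((B 3 + r * D 3) - (B 2 + r * D 2)),
    c * ((B 5 + r * D 5) + (B 4 + r * D 4)), c * ((B 5 + r * D 5) - (B 4 + r * D 4)),
    c * ((B 7 + r * D 7) + (B 6 + r * D 6)), c * ((B 7 + r * D 7) - (B 6 + r * D 6))]

/-- Computes `c (X + s Y)` in the coordinates `chart` from the coefficients `(A, B)` of `X` and `i
(C, D)` of `Y`. -/
lemma fld_mix_eq {c s r : ℂ} (hs : s * I = r) {X Y : hol} {x y : Fin 16 → ℂ}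
    {A B C D : Fin 8 → ℂ} (hX : X.1.1 (chartInv x) = Sum.elim A B)
    (hY : Y.1.1 (chartInv x) = Sum.elim (I • C) (I • D))
    (h : ∀ a, mixCoord c r A B C D a = y a) : fld (mix c s X Y) x = y := by
  have hr : ∀ a b : ℂ, a + s * (I * b) = a + r * b := fun a b => by rw [← mul_assoc, hs]
  rw [fld_mix, hX, hY, ← funext h]
  funext a
  revert a
  apply forall_fin_sixteen
  all_goals
    simp only [Pi.smul_apply, chart_apply, smul_eq_mul, mixCoord, ← hr]
    rfl

lemma fld_rootE_zero (x : Fin 16 → ℂ) : fld (rootE 0) x = quad x := by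
  refine fld_mix_eq (r := 1) (by simp)
    (A := ![-(-2 * x 0 ^ 2 + 2 * (x 8 / 2)), 2 * x 0 * x 1, 2 * x 0 * x 2, 2 * x 0 * x 3,
    2 * x 0 * x 4 + ((x 14 - x 15) / 2) + ((x 14 + x 15) / 2), 2 * x 0 * x 5 + ((x 12 - x 13) / 2)
    - ((x 12 + x 13) / 2), 2 * x 0 * x 6 + ((x 10 - x 11) / 2) - ((x 10 + x 11) / 2), 2 * x 1 * x 6
    - 2 * x 2 * x 5 + 2 * x 3 * x 4])
    (B := ![2 * x 0 * (x 8 / 2), ((x 10 - x 11) / 2) * x 6 + ((x 10 + x 11) / 2) * x 6 + ((x 12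
    - x 13) / 2) * x 5 + ((x 12 + x 13) / 2) * x 5 + ((x 14 - x 15) / 2) * x 4 - ((x 14
    + x 15) / 2) * x 4, -(2 * (x 8 / 2) * x 6 - ((x 10 - x 11) / 2) * x 0 - ((x 10
    + x 11) / 2) * x 0 + ((x 12 - x 13) / 2) * x 3 + ((x 12 + x 13) / 2) * x 3 + ((x 14
    - x 15) / 2) * x 2 - ((x 14 + x 15) / 2) * x 2), 2 * (x 8 / 2) * x 6 + ((x 10
    - x 11) / 2) * x 0 + ((x 10 + x 11) / 2) * x 0 + ((x 12 - x 13) / 2) * x 3 + ((x 12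
    + x 13) / 2) * x 3 + ((x 14 - x 15) / 2) * x 2 - ((x 14 + x 15) / 2) * x 2,
    -(2 * (x 8 / 2) * x 5 - ((x 10 - x 11) / 2) * x 3 - ((x 10 + x 11) / 2) * x 3 - ((x 12
    - x 13) / 2) * x 0 - ((x 12 + x 13) / 2) * x 0 + ((x 14 - x 15) / 2) * x 1 - ((x 14
    + x 15) / 2) * x 1), 2 * (x 8 / 2) * x 5 - ((x 10 - x 11) / 2) * x 3 - ((x 10
    + x 11) / 2) * x 3 + ((x 12 - x 13) / 2) * x 0 + ((x 12 + x 13) / 2) * x 0 + ((x 14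
    - x 15) / 2) * x 1 - ((x 14 + x 15) / 2) * x 1, -(2 * (x 8 / 2) * x 4 - ((x 10
    - x 11) / 2) * x 2 - ((x 10 + x 11) / 2) * x 2 - ((x 12 - x 13) / 2) * x 1 - ((x 12
    + x 13) / 2) * x 1 - ((x 14 - x 15) / 2) * x 0 + ((x 14 + x 15) / 2) * x 0),
    -(2 * (x 8 / 2) * x 4 - ((x 10 - x 11) / 2) * x 2 - ((x 10 + x 11) / 2) * x 2 - ((x 12
    - x 13) / 2) * x 1 - ((x 12 + x 13) / 2) * x 1 + ((x 14 - x 15) / 2) * x 0 - ((x 14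
    + x 15) / 2) * x 0)])
    (C := ![2 * x 0 ^ 2 + 2 * (x 8 / 2), 2 * x 0 * x 1, 2 * x 0 * x 2, 2 * x 0 * x 3,
    -(-2 * x 0 * x 4 + ((x 14 - x 15) / 2) + ((x 14 + x 15) / 2)), -(-2 * x 0 * x 5 + ((x 12
    - x 13) / 2) - ((x 12 + x 13) / 2)), -(-2 * x 0 * x 6 + ((x 10 - x 11) / 2) - ((x 10
    + x 11) / 2)), 2 * x 1 * x 6 - 2 * x 2 * x 5 + 2 * x 3 * x 4])
    (D := ![2 * x 0 * (x 8 / 2), ((x 10 - x 11) / 2) * x 6 + ((x 10 + x 11) / 2) * x 6 + ((x 12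
    - x 13) / 2) * x 5 + ((x 12 + x 13) / 2) * x 5 + ((x 14 - x 15) / 2) * x 4 - ((x 14
    + x 15) / 2) * x 4, -(2 * (x 8 / 2) * x 6 - ((x 10 - x 11) / 2) * x 0 - ((x 10
    + x 11) / 2) * x 0 + ((x 12 - x 13) / 2) * x 3 + ((x 12 + x 13) / 2) * x 3 + ((x 14
    - x 15) / 2) * x 2 - ((x 14 + x 15) / 2) * x 2), 2 * (x 8 / 2) * x 6 + ((x 10
    - x 11) / 2) * x 0 + ((x 10 + x 11) / 2) * x 0 + ((x 12 - x 13) / 2) * x 3 + ((x 12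
    + x 13) / 2) * x 3 + ((x 14 - x 15) / 2) * x 2 - ((x 14 + x 15) / 2) * x 2,
    -(2 * (x 8 / 2) * x 5 - ((x 10 - x 11) / 2) * x 3 - ((x 10 + x 11) / 2) * x 3 - ((x 12
    - x 13) / 2) * x 0 - ((x 12 + x 13) / 2) * x 0 + ((x 14 - x 15) / 2) * x 1 - ((x 14
    + x 15) / 2) * x 1), 2 * (x 8 / 2) * x 5 - ((x 10 - x 11) / 2) * x 3 - ((x 10
    + x 11) / 2) * x 3 + ((x 12 - x 13) / 2) * x 0 + ((x 12 + x 13) / 2) * x 0 + ((x 14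
    - x 15) / 2) * x 1 - ((x 14 + x 15) / 2) * x 1, -(2 * (x 8 / 2) * x 4 - ((x 10
    - x 11) / 2) * x 2 - ((x 10 + x 11) / 2) * x 2 - ((x 12 - x 13) / 2) * x 1 - ((x 12
    + x 13) / 2) * x 1 - ((x 14 - x 15) / 2) * x 0 + ((x 14 + x 15) / 2) * x 0),
    -(2 * (x 8 / 2) * x 4 - ((x 10 - x 11) / 2) * x 2 - ((x 10 + x 11) / 2) * x 2 - ((x 12
    - x 13) / 2) * x 1 - ((x 12 + x 13) / 2) * x 1 + ((x 14 - x 15) / 2) * x 0 - ((x 14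
    + x 15) / 2) * x 0)])
    rfl rfl ?_
  apply forall_fin_sixteen <;> simp [mixCoord, quad] <;> ring

/-! The simple root vectors other than the first are linear in the coordinates `chart`. The matrix
of each has at most one nonzero entry, equal to `±1`, in every row; it is read off from the
coefficients of the two generators that are combined. -/

lemma fld_rootE_one (x : Fin 16 → ℂ) : fld (rootE 1) x = signedPerm (eCoef 1) (rootPerm 1) x := by
  refine fld_mix_eq (r := (-1)) (by simp)
    (A := ![x 6, x 7, x 4, x 5, 0, 0, 0, 0])
    (B := ![((x 10 + x 11) / 2), 0, 0, 2 * (x 9 / 2), 0, 0, 0, 0])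
    (C := ![x 6, x 7, -x 4, -x 5, 0, 0, 0, 0])
    (D := ![-((x 10 - x 11) / 2), 0, 2 * (x 9 / 2), 0, 0, 0, 0, 0])
    rfl rfl (Eq.trans (b := ![((0 : ℤ) : ℂ) * x 0, ((0 : ℤ) : ℂ) * x 1, ((1 : ℤ) : ℂ) * x 4,
    ((1 : ℤ) : ℂ) * x 5, ((0 : ℤ) : ℂ) * x 2, ((0 : ℤ) : ℂ) * x 3, ((0 : ℤ) : ℂ) * x 6,
    ((0 : ℤ) : ℂ) * x 7, ((1 : ℤ) : ℂ) * x 10, ((0 : ℤ) : ℂ) * x 11, ((0 : ℤ) : ℂ) * x 8,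
    ((1 : ℤ) : ℂ) * x 9, ((0 : ℤ) : ℂ) * x 12, ((0 : ℤ) : ℂ) * x 13, ((0 : ℤ) : ℂ) * x 14,
    ((0 : ℤ) : ℂ) * x 15]) (funext ?_) (funext ?_) |> congrFun)
  · apply forall_fin_sixteen <;> simp only [mixCoord, Matrix.cons_val] <;> push_cast <;> ring
  · apply forall_fin_sixteen <;> rfl

lemma fld_rootE_two (x : Fin 16 → ℂ) : fld (rootE 2) x = signedPerm (eCoef 2) (rootPerm 2) x := by
  refine fld_mix_eq (r := (-1)) (by simp)
    (A := ![-x 1, x 0, 0, 0, 0, 0, -x 7, x 6])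
    (B := ![0, 0, 0, 0, -((x 14 - x 15) / 2), -((x 14 + x 15) / 2), ((x 12 - x 13) / 2), ((x 12
    + x 13) / 2)])
    (C := ![x 1, x 0, 0, 0, 0, 0, x 7, x 6])
    (D := ![0, 0, 0, 0, ((x 14 + x 15) / 2), ((x 14 - x 15) / 2), ((x 12 + x 13) / 2), ((x 12
    - x 13) / 2)])
    rfl rfl (Eq.trans (b := ![((-1 : ℤ) : ℂ) * x 1, ((0 : ℤ) : ℂ) * x 0, ((0 : ℤ) : ℂ) * x 2,
    ((0 : ℤ) : ℂ) * x 3, ((0 : ℤ) : ℂ) * x 4, ((0 : ℤ) : ℂ) * x 5, ((-1 : ℤ) : ℂ) * x 7,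
    ((0 : ℤ) : ℂ) * x 6, ((0 : ℤ) : ℂ) * x 8, ((0 : ℤ) : ℂ) * x 9, ((0 : ℤ) : ℂ) * x 10,
    ((0 : ℤ) : ℂ) * x 11, ((-1 : ℤ) : ℂ) * x 14, ((0 : ℤ) : ℂ) * x 15, ((0 : ℤ) : ℂ) * x 12,
    ((1 : ℤ) : ℂ) * x 13]) (funext ?_) (funext ?_) |> congrFun)
  · apply forall_fin_sixteen <;> simp only [mixCoord, Matrix.cons_val] <;> push_cast <;> ring
  · apply forall_fin_sixteen <;> rfl

lemma fld_rootE_three (x : Fin 16 → ℂ) : fld (rootE 3) x = signedPerm (eCoef 3) (rootPerm 3) x := by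
  refine fld_mix_eq (r := 1) (by simp)
    (A := ![0, x 2, -x 1, 0, 0, x 6, -x 5, 0])
    (B := ![0, 0, -((x 12 - x 13) / 2), -((x 12 + x 13) / 2), ((x 10 - x 11) / 2), ((x 10
    + x 11) / 2), 0, 0])
    (C := ![0, x 2, x 1, 0, 0, x 6, x 5, 0])
    (D := ![0, 0, -((x 12 + x 13) / 2), -((x 12 - x 13) / 2), -((x 10 + x 11) / 2), -((x 10
    - x 11) / 2), 0, 0])
    rfl rfl (Eq.trans (b := ![((0 : ℤ) : ℂ) * x 0, ((1 : ℤ) : ℂ) * x 2, ((0 : ℤ) : ℂ) * x 1,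
    ((0 : ℤ) : ℂ) * x 3, ((0 : ℤ) : ℂ) * x 4, ((1 : ℤ) : ℂ) * x 6, ((0 : ℤ) : ℂ) * x 5,
    ((0 : ℤ) : ℂ) * x 7, ((0 : ℤ) : ℂ) * x 8, ((0 : ℤ) : ℂ) * x 9, ((-1 : ℤ) : ℂ) * x 12,
    ((0 : ℤ) : ℂ) * x 13, ((0 : ℤ) : ℂ) * x 10, ((1 : ℤ) : ℂ) * x 11, ((0 : ℤ) : ℂ) * x 14,
    ((0 : ℤ) : ℂ) * x 15]) (funext ?_) (funext ?_) |> congrFun)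
  · apply forall_fin_sixteen <;> simp only [mixCoord, Matrix.cons_val] <;> push_cast <;> ring
  · apply forall_fin_sixteen <;> rfl

lemma fld_rootE_four (x : Fin 16 → ℂ) : fld (rootE 4) x = signedPerm (eCoef 4) (rootPerm 4) x := by
  refine fld_mix_eq (r := (-1)) (by simp)
    (A := ![0, 0, -x 3, x 2, -x 5, x 4, 0, 0])
    (B := ![0, 0, 0, 0, ((x 14 - x 15) / 2), -((x 14 + x 15) / 2), -((x 12 - x 13) / 2), ((x 12
    + x 13) / 2)])
    (C := ![0, 0, x 3, x 2, x 5, x 4, 0, 0])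
    (D := ![0, 0, 0, 0, ((x 14 + x 15) / 2), -((x 14 - x 15) / 2), -((x 12 + x 13) / 2), ((x 12
    - x 13) / 2)])
    rfl rfl (Eq.trans (b := ![((0 : ℤ) : ℂ) * x 0, ((0 : ℤ) : ℂ) * x 1, ((-1 : ℤ) : ℂ) * x 3,
    ((0 : ℤ) : ℂ) * x 2, ((-1 : ℤ) : ℂ) * x 5, ((0 : ℤ) : ℂ) * x 4, ((0 : ℤ) : ℂ) * x 6,
    ((0 : ℤ) : ℂ) * x 7, ((0 : ℤ) : ℂ) * x 8, ((0 : ℤ) : ℂ) * x 9, ((0 : ℤ) : ℂ) * x 10,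
    ((0 : ℤ) : ℂ) * x 11, ((-1 : ℤ) : ℂ) * x 15, ((0 : ℤ) : ℂ) * x 14, ((1 : ℤ) : ℂ) * x 13,
    ((0 : ℤ) : ℂ) * x 12]) (funext ?_) (funext ?_) |> congrFun)
  · apply forall_fin_sixteen <;> simp only [mixCoord, Matrix.cons_val] <;> push_cast <;> ring
  · apply forall_fin_sixteen <;> rfl

lemma fld_rootE_five (x : Fin 16 → ℂ) : fld (rootE 5) x = signedPerm (eCoef 5) (rootPerm 5) x := by
  refine fld_mix_eq (r := (-1)) (by simp)
    (A := ![2 * x 0 * x 3, 2 * x 1 * x 3, 2 * x 2 * x 3, -(-2 * x 3 ^ 2 + 2 * (x 8 / 2)),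
    2 * x 0 * x 7 - 2 * x 1 * x 6 + 2 * x 2 * x 5, -(-2 * x 3 * x 5 + ((x 10 - x 11) / 2) + ((x 10
    + x 11) / 2)), 2 * x 3 * x 6 + ((x 12 - x 13) / 2) + ((x 12 + x 13) / 2), 2 * x 3 * x 7
    + ((x 14 - x 15) / 2) + ((x 14 + x 15) / 2)])
    (B := ![2 * x 3 * (x 8 / 2), -(((x 10 - x 11) / 2) * x 5 - ((x 10 + x 11) / 2) * x 5 - ((x 12
    - x 13) / 2) * x 6 + ((x 12 + x 13) / 2) * x 6 - ((x 14 - x 15) / 2) * x 7 + ((x 14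
    + x 15) / 2) * x 7), 2 * (x 8 / 2) * x 5 + ((x 10 - x 11) / 2) * x 3 - ((x 10
    + x 11) / 2) * x 3 + ((x 12 - x 13) / 2) * x 0 - ((x 12 + x 13) / 2) * x 0 + ((x 14
    - x 15) / 2) * x 1 - ((x 14 + x 15) / 2) * x 1, 2 * (x 8 / 2) * x 5 - ((x 10 - x 11) / 2) * x 3
    + ((x 10 + x 11) / 2) * x 3 + ((x 12 - x 13) / 2) * x 0 - ((x 12 + x 13) / 2) * x 0 + ((x 14
    - x 15) / 2) * x 1 - ((x 14 + x 15) / 2) * x 1, -(2 * (x 8 / 2) * x 6 + ((x 10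
    - x 11) / 2) * x 0 - ((x 10 + x 11) / 2) * x 0 - ((x 12 - x 13) / 2) * x 3 + ((x 12
    + x 13) / 2) * x 3 + ((x 14 - x 15) / 2) * x 2 - ((x 14 + x 15) / 2) * x 2),
    -(2 * (x 8 / 2) * x 6 + ((x 10 - x 11) / 2) * x 0 - ((x 10 + x 11) / 2) * x 0 + ((x 12
    - x 13) / 2) * x 3 - ((x 12 + x 13) / 2) * x 3 + ((x 14 - x 15) / 2) * x 2 - ((x 14
    + x 15) / 2) * x 2), -(2 * (x 8 / 2) * x 7 + ((x 10 - x 11) / 2) * x 1 - ((x 10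
    + x 11) / 2) * x 1 - ((x 12 - x 13) / 2) * x 2 + ((x 12 + x 13) / 2) * x 2 - ((x 14
    - x 15) / 2) * x 3 + ((x 14 + x 15) / 2) * x 3), -(2 * (x 8 / 2) * x 7 + ((x 10
    - x 11) / 2) * x 1 - ((x 10 + x 11) / 2) * x 1 - ((x 12 - x 13) / 2) * x 2 + ((x 12
    + x 13) / 2) * x 2 + ((x 14 - x 15) / 2) * x 3 - ((x 14 + x 15) / 2) * x 3)])
    (C := ![2 * x 0 * x 3, 2 * x 1 * x 3, 2 * x 2 * x 3, 2 * x 3 ^ 2 + 2 * (x 8 / 2), 2 * x 0 * x 7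
    - 2 * x 1 * x 6 + 2 * x 2 * x 5, 2 * x 3 * x 5 + ((x 10 - x 11) / 2) + ((x 10 + x 11) / 2),
    -(-2 * x 3 * x 6 + ((x 12 - x 13) / 2) + ((x 12 + x 13) / 2)), -(-2 * x 3 * x 7 + ((x 14
    - x 15) / 2) + ((x 14 + x 15) / 2))])
    (D := ![2 * x 3 * (x 8 / 2), -(((x 10 - x 11) / 2) * x 5 - ((x 10 + x 11) / 2) * x 5 - ((x 12
    - x 13) / 2) * x 6 + ((x 12 + x 13) / 2) * x 6 - ((x 14 - x 15) / 2) * x 7 + ((x 14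
    + x 15) / 2) * x 7), 2 * (x 8 / 2) * x 5 + ((x 10 - x 11) / 2) * x 3 - ((x 10
    + x 11) / 2) * x 3 + ((x 12 - x 13) / 2) * x 0 - ((x 12 + x 13) / 2) * x 0 + ((x 14
    - x 15) / 2) * x 1 - ((x 14 + x 15) / 2) * x 1, 2 * (x 8 / 2) * x 5 - ((x 10 - x 11) / 2) * x 3
    + ((x 10 + x 11) / 2) * x 3 + ((x 12 - x 13) / 2) * x 0 - ((x 12 + x 13) / 2) * x 0 + ((x 14
    - x 15) / 2) * x 1 - ((x 14 + x 15) / 2) * x 1, -(2 * (x 8 / 2) * x 6 + ((x 10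
    - x 11) / 2) * x 0 - ((x 10 + x 11) / 2) * x 0 - ((x 12 - x 13) / 2) * x 3 + ((x 12
    + x 13) / 2) * x 3 + ((x 14 - x 15) / 2) * x 2 - ((x 14 + x 15) / 2) * x 2),
    -(2 * (x 8 / 2) * x 6 + ((x 10 - x 11) / 2) * x 0 - ((x 10 + x 11) / 2) * x 0 + ((x 12
    - x 13) / 2) * x 3 - ((x 12 + x 13) / 2) * x 3 + ((x 14 - x 15) / 2) * x 2 - ((x 14
    + x 15) / 2) * x 2), -(2 * (x 8 / 2) * x 7 + ((x 10 - x 11) / 2) * x 1 - ((x 10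
    + x 11) / 2) * x 1 - ((x 12 - x 13) / 2) * x 2 + ((x 12 + x 13) / 2) * x 2 - ((x 14
    - x 15) / 2) * x 3 + ((x 14 + x 15) / 2) * x 3), -(2 * (x 8 / 2) * x 7 + ((x 10
    - x 11) / 2) * x 1 - ((x 10 + x 11) / 2) * x 1 - ((x 12 - x 13) / 2) * x 2 + ((x 12
    + x 13) / 2) * x 2 + ((x 14 - x 15) / 2) * x 3 - ((x 14 + x 15) / 2) * x 3)])
    rfl rfl (Eq.trans (b := ![((0 : ℤ) : ℂ) * x 0, ((0 : ℤ) : ℂ) * x 1, ((0 : ℤ) : ℂ) * x 2,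
    ((-1 : ℤ) : ℂ) * x 8, ((0 : ℤ) : ℂ) * x 4, ((-1 : ℤ) : ℂ) * x 10, ((1 : ℤ) : ℂ) * x 12,
    ((1 : ℤ) : ℂ) * x 14, ((0 : ℤ) : ℂ) * x 3, ((0 : ℤ) : ℂ) * x 9, ((0 : ℤ) : ℂ) * x 5,
    ((0 : ℤ) : ℂ) * x 11, ((0 : ℤ) : ℂ) * x 6, ((0 : ℤ) : ℂ) * x 13, ((0 : ℤ) : ℂ) * x 7,
    ((0 : ℤ) : ℂ) * x 15]) (funext ?_) (funext ?_) |> congrFun)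
  · apply forall_fin_sixteen <;> simp only [mixCoord, Matrix.cons_val] <;> push_cast <;> ring
  · apply forall_fin_sixteen <;> rfl

lemma fld_rootF_zero (x : Fin 16 → ℂ) : fld (rootF 0) x = -Pi.single 0 1 := by
  refine fld_mix_eq (r := 1) (by simp)
    (A := ![1, 0, 0, 0, 0, 0, 0, 0])
    (B := ![x 0, 0, -x 6, x 6, -x 5, x 5, -x 4, -x 4])
    (C := ![1, 0, 0, 0, 0, 0, 0, 0])
    (D := ![-x 0, 0, x 6, -x 6, x 5, -x 5, x 4, x 4])
    rfl rfl ?_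
  apply forall_fin_sixteen <;> simp [mixCoord] <;> ring

lemma fld_rootF_one (x : Fin 16 → ℂ) : fld (rootF 1) x = signedPerm (fCoef 1) (rootPerm 1) x := by
  refine fld_mix_eq (r := 1) (by simp)
    (A := ![0, 0, 0, 0, x 2, x 3, x 0, x 1])
    (B := ![0, ((x 10 + x 11) / 2), 0, 2 * (x 8 / 2), 0, 0, 0, 0])
    (C := ![0, 0, 0, 0, x 2, x 3, -x 0, -x 1])
    (D := ![0, -((x 10 - x 11) / 2), 2 * (x 8 / 2), 0, 0, 0, 0, 0])
    rfl rfl (Eq.trans (b := ![((0 : ℤ) : ℂ) * x 0, ((0 : ℤ) : ℂ) * x 1, ((0 : ℤ) : ℂ) * x 4,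
    ((0 : ℤ) : ℂ) * x 5, ((1 : ℤ) : ℂ) * x 2, ((1 : ℤ) : ℂ) * x 3, ((0 : ℤ) : ℂ) * x 6,
    ((0 : ℤ) : ℂ) * x 7, ((0 : ℤ) : ℂ) * x 10, ((1 : ℤ) : ℂ) * x 11, ((1 : ℤ) : ℂ) * x 8,
    ((0 : ℤ) : ℂ) * x 9, ((0 : ℤ) : ℂ) * x 12, ((0 : ℤ) : ℂ) * x 13, ((0 : ℤ) : ℂ) * x 14,
    ((0 : ℤ) : ℂ) * x 15]) (funext ?_) (funext ?_) |> congrFun)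
  · apply forall_fin_sixteen <;> simp only [mixCoord, Matrix.cons_val] <;> push_cast <;> ring
  · apply forall_fin_sixteen <;> rfl

lemma fld_rootF_two (x : Fin 16 → ℂ) : fld (rootF 2) x = signedPerm (fCoef 2) (rootPerm 2) x := by
  refine fld_mix_eq (r := 1) (by simp)
    (A := ![-x 1, x 0, 0, 0, 0, 0, -x 7, x 6])
    (B := ![0, 0, 0, 0, -((x 14 - x 15) / 2), -((x 14 + x 15) / 2), ((x 12 - x 13) / 2), ((x 12
    + x 13) / 2)])
    (C := ![x 1, x 0, 0, 0, 0, 0, x 7, x 6])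
    (D := ![0, 0, 0, 0, ((x 14 + x 15) / 2), ((x 14 - x 15) / 2), ((x 12 + x 13) / 2), ((x 12
    - x 13) / 2)])
    rfl rfl (Eq.trans (b := ![((0 : ℤ) : ℂ) * x 1, ((-1 : ℤ) : ℂ) * x 0, ((0 : ℤ) : ℂ) * x 2,
    ((0 : ℤ) : ℂ) * x 3, ((0 : ℤ) : ℂ) * x 4, ((0 : ℤ) : ℂ) * x 5, ((0 : ℤ) : ℂ) * x 7,
    ((-1 : ℤ) : ℂ) * x 6, ((0 : ℤ) : ℂ) * x 8, ((0 : ℤ) : ℂ) * x 9, ((0 : ℤ) : ℂ) * x 10,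
    ((0 : ℤ) : ℂ) * x 11, ((0 : ℤ) : ℂ) * x 14, ((1 : ℤ) : ℂ) * x 15, ((-1 : ℤ) : ℂ) * x 12,
    ((0 : ℤ) : ℂ) * x 13]) (funext ?_) (funext ?_) |> congrFun)
  · apply forall_fin_sixteen <;> simp only [mixCoord, Matrix.cons_val] <;> push_cast <;> ring
  · apply forall_fin_sixteen <;> rfl

lemma fld_rootF_three (x : Fin 16 → ℂ) : fld (rootF 3) x = signedPerm (fCoef 3) (rootPerm 3) x := by
  refine fld_mix_eq (r := (-1)) (by simp)
    (A := ![0, x 2, -x 1, 0, 0, x 6, -x 5, 0])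
    (B := ![0, 0, -((x 12 - x 13) / 2), -((x 12 + x 13) / 2), ((x 10 - x 11) / 2), ((x 10
    + x 11) / 2), 0, 0])
    (C := ![0, x 2, x 1, 0, 0, x 6, x 5, 0])
    (D := ![0, 0, -((x 12 + x 13) / 2), -((x 12 - x 13) / 2), -((x 10 + x 11) / 2), -((x 10
    - x 11) / 2), 0, 0])
    rfl rfl (Eq.trans (b := ![((0 : ℤ) : ℂ) * x 0, ((0 : ℤ) : ℂ) * x 2, ((1 : ℤ) : ℂ) * x 1,
    ((0 : ℤ) : ℂ) * x 3, ((0 : ℤ) : ℂ) * x 4, ((0 : ℤ) : ℂ) * x 6, ((1 : ℤ) : ℂ) * x 5,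
    ((0 : ℤ) : ℂ) * x 7, ((0 : ℤ) : ℂ) * x 8, ((0 : ℤ) : ℂ) * x 9, ((0 : ℤ) : ℂ) * x 12,
    ((1 : ℤ) : ℂ) * x 13, ((-1 : ℤ) : ℂ) * x 10, ((0 : ℤ) : ℂ) * x 11, ((0 : ℤ) : ℂ) * x 14,
    ((0 : ℤ) : ℂ) * x 15]) (funext ?_) (funext ?_) |> congrFun)
  · apply forall_fin_sixteen <;> simp only [mixCoord, Matrix.cons_val] <;> push_cast <;> ring
  · apply forall_fin_sixteen <;> rfl

lemma fld_rootF_four (x : Fin 16 → ℂ) : fld (rootF 4) x = signedPerm (fCoef 4) (rootPerm 4) x := by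
  refine fld_mix_eq (r := 1) (by simp)
    (A := ![0, 0, -x 3, x 2, -x 5, x 4, 0, 0])
    (B := ![0, 0, 0, 0, ((x 14 - x 15) / 2), -((x 14 + x 15) / 2), -((x 12 - x 13) / 2), ((x 12
    + x 13) / 2)])
    (C := ![0, 0, x 3, x 2, x 5, x 4, 0, 0])
    (D := ![0, 0, 0, 0, ((x 14 + x 15) / 2), -((x 14 - x 15) / 2), -((x 12 + x 13) / 2), ((x 12
    - x 13) / 2)])
    rfl rfl (Eq.trans (b := ![((0 : ℤ) : ℂ) * x 0, ((0 : ℤ) : ℂ) * x 1, ((0 : ℤ) : ℂ) * x 3,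
    ((-1 : ℤ) : ℂ) * x 2, ((0 : ℤ) : ℂ) * x 5, ((-1 : ℤ) : ℂ) * x 4, ((0 : ℤ) : ℂ) * x 6,
    ((0 : ℤ) : ℂ) * x 7, ((0 : ℤ) : ℂ) * x 8, ((0 : ℤ) : ℂ) * x 9, ((0 : ℤ) : ℂ) * x 10,
    ((0 : ℤ) : ℂ) * x 11, ((0 : ℤ) : ℂ) * x 15, ((1 : ℤ) : ℂ) * x 14, ((0 : ℤ) : ℂ) * x 13,
    ((-1 : ℤ) : ℂ) * x 12]) (funext ?_) (funext ?_) |> congrFun)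
  · apply forall_fin_sixteen <;> simp only [mixCoord, Matrix.cons_val] <;> push_cast <;> ring
  · apply forall_fin_sixteen <;> rfl

lemma fld_rootF_five (x : Fin 16 → ℂ) : fld (rootF 5) x = signedPerm (fCoef 5) (rootPerm 5) x := by
  refine fld_mix_eq (r := (-1)) (by simp)
    (A := ![0, 0, 0, 1, 0, 0, 0, 0])
    (B := ![x 3, 0, x 5, x 5, -x 6, -x 6, -x 7, -x 7])
    (C := ![0, 0, 0, 1, 0, 0, 0, 0])
    (D := ![-x 3, 0, -x 5, -x 5, x 6, x 6, x 7, x 7])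
    rfl rfl (Eq.trans (b := ![((0 : ℤ) : ℂ) * x 0, ((0 : ℤ) : ℂ) * x 1, ((0 : ℤ) : ℂ) * x 2,
    ((0 : ℤ) : ℂ) * x 8, ((0 : ℤ) : ℂ) * x 4, ((0 : ℤ) : ℂ) * x 10, ((0 : ℤ) : ℂ) * x 12,
    ((0 : ℤ) : ℂ) * x 14, ((-1 : ℤ) : ℂ) * x 3, ((0 : ℤ) : ℂ) * x 9, ((-1 : ℤ) : ℂ) * x 5,
    ((0 : ℤ) : ℂ) * x 11, ((1 : ℤ) : ℂ) * x 6, ((0 : ℤ) : ℂ) * x 13, ((1 : ℤ) : ℂ) * x 7,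
    ((0 : ℤ) : ℂ) * x 15]) (funext ?_) (funext ?_) |> congrFun)
  · apply forall_fin_sixteen <;> simp only [mixCoord, Matrix.cons_val] <;> push_cast <;> ring
  · apply forall_fin_sixteen <;> rfl

end

section

set_option linter.unnecessarySeqFocus false
set_option linter.unreachableTactic false

/-! ### The derivative of the quadratic root vector -/

/-- The derivative of `quad` at `x` in the direction `v`. -/
def dquad (x v : Fin 16 → ℂ) : Fin 16 → ℂ :=
  ![2 * x 0 * v 0, x 0 * v 1 + v 0 * x 1, x 0 * v 2 + v 0 * x 2, x 0 * v 3 + v 0 * x 3,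
    x 0 * v 4 + v 0 * x 4, x 0 * v 5 + v 0 * x 5, x 0 * v 6 + v 0 * x 6,
    x 1 * v 6 + v 1 * x 6 - (x 2 * v 5 + v 2 * x 5) + (x 3 * v 4 + v 3 * x 4),
    x 0 * v 8 + v 0 * x 8,
    x 5 * v 12 + v 5 * x 12 + (x 6 * v 10 + v 6 * x 10) - (x 4 * v 15 + v 4 * x 15),
    x 0 * v 10 + v 0 * x 10,
    x 3 * v 12 + v 3 * x 12 + (x 6 * v 8 + v 6 * x 8) - (x 2 * v 15 + v 2 * x 15),
    x 0 * v 12 + v 0 * x 12,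
    x 5 * v 8 + v 5 * x 8 - (x 1 * v 15 + v 1 * x 15) - (x 3 * v 10 + v 3 * x 10),
    x 1 * v 12 + v 1 * x 12 + (x 2 * v 10 + v 2 * x 10) - (x 4 * v 8 + v 4 * x 8),
    x 0 * v 15 + v 0 * x 15]

lemma quad_add_smul (x v : Fin 16 → ℂ) (s : ℂ) :
    quad (x + s • v) = quad x + s • dquad x v + s ^ 2 • quad v := by
  funext a
  revert a
  apply forall_fin_sixteen <;> simp [quad, dquad] <;> ring

lemma fderiv_quad (x v : Fin 16 → ℂ) : fderiv ℂ quad x v = dquad x v := by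
  refine fderiv_of_line (C := quad v) ?_ fun s => quad_add_smul x v s
  rw [← funext fld_rootE_zero]
  exact fun x => (hasFDerivAt_fld _ x).differentiableAt

/-! The linear root vectors for the negatives of the other simple roots commute with `quad`. -/

lemma dquad_signedPerm_f_one (x : Fin 16 → ℂ) :
    dquad x (signedPerm (fCoef 1) (rootPerm 1) x) =
      signedPerm (fCoef 1) (rootPerm 1) (quad x) := by
  have hf : fCoef 1 = ![0, 0, 0, 0, 1, 1, 0, 0, 0, 1, 1, 0, 0, 0, 0, 0] := by
    decide
  have hp : rootPerm 1 = ![0, 1, 4, 5, 2, 3, 6, 7, 10, 11, 8, 9, 12, 13, 14, 15] := rfl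
  funext a
  revert a
  apply forall_fin_sixteen <;>
  · simp only [Pi.sub_apply, Pi.add_apply, Pi.smul_apply, smul_eq_mul, id_eq,
      signedPerm_apply, dquad, quad, hf, hp, Matrix.cons_val]
    push_cast
    ring

lemma dquad_signedPerm_f_two (x : Fin 16 → ℂ) :
    dquad x (signedPerm (fCoef 2) (rootPerm 2) x) =
      signedPerm (fCoef 2) (rootPerm 2) (quad x) := by
  have hf : fCoef 2 = ![0, -1, 0, 0, 0, 0, 0, -1, 0, 0, 0, 0, 0, 1, -1, 0] := by
    decide
  have hp : rootPerm 2 = ![1, 0, 2, 3, 4, 5, 7, 6, 8, 9, 10, 11, 14, 15, 12, 13] := rfl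
  funext a
  revert a
  apply forall_fin_sixteen <;>
  · simp only [Pi.sub_apply, Pi.add_apply, Pi.smul_apply, smul_eq_mul, id_eq,
      signedPerm_apply, dquad, quad, hf, hp, Matrix.cons_val]
    push_cast
    ring

lemma dquad_signedPerm_f_three (x : Fin 16 → ℂ) :
    dquad x (signedPerm (fCoef 3) (rootPerm 3) x) =
      signedPerm (fCoef 3) (rootPerm 3) (quad x) := by
  have hf : fCoef 3 = ![0, 0, 1, 0, 0, 0, 1, 0, 0, 0, 0, 1, -1, 0, 0, 0] := by
    decide
  have hp : rootPerm 3 = ![0, 2, 1, 3, 4, 6, 5, 7, 8, 9, 12, 13, 10, 11, 14, 15] := rfl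
  funext a
  revert a
  apply forall_fin_sixteen <;>
  · simp only [Pi.sub_apply, Pi.add_apply, Pi.smul_apply, smul_eq_mul, id_eq,
      signedPerm_apply, dquad, quad, hf, hp, Matrix.cons_val]
    push_cast
    ring

lemma dquad_signedPerm_f_four (x : Fin 16 → ℂ) :
    dquad x (signedPerm (fCoef 4) (rootPerm 4) x) =
      signedPerm (fCoef 4) (rootPerm 4) (quad x) := by
  have hf : fCoef 4 = ![0, 0, 0, -1, 0, -1, 0, 0, 0, 0, 0, 0, 0, 1, 0, -1] := by
    decide
  have hp : rootPerm 4 = ![0, 1, 3, 2, 5, 4, 6, 7, 8, 9, 10, 11, 15, 14, 13, 12] := rfl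
  funext a
  revert a
  apply forall_fin_sixteen <;>
  · simp only [Pi.sub_apply, Pi.add_apply, Pi.smul_apply, smul_eq_mul, id_eq,
      signedPerm_apply, dquad, quad, hf, hp, Matrix.cons_val]
    push_cast
    ring

lemma dquad_signedPerm_f_five (x : Fin 16 → ℂ) :
    dquad x (signedPerm (fCoef 5) (rootPerm 5) x) =
      signedPerm (fCoef 5) (rootPerm 5) (quad x) := by
  have hf : fCoef 5 = ![0, 0, 0, 0, 0, 0, 0, 0, -1, 0, -1, 0, 1, 0, 1, 0] := by
    decide
  have hp : rootPerm 5 = ![0, 1, 2, 8, 4, 10, 12, 14, 3, 9, 5, 11, 6, 13, 7, 15] := rfl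
  funext a
  revert a
  apply forall_fin_sixteen <;>
  · simp only [Pi.sub_apply, Pi.add_apply, Pi.smul_apply, smul_eq_mul, id_eq,
      signedPerm_apply, dquad, quad, hf, hp, Matrix.cons_val]
    push_cast
    ring

/-! The field `quad` is an eigenvector of the simple coroots, with eigenvalues from the Cartan
matrix. -/

lemma dquad_coroot_zero (x : Fin 16 → ℂ) :
    dquad x (signedPerm (corootWt 0) id x) - signedPerm (corootWt 0) id (quad x) =
      (CartanMatrix.E₆ 0 0 : ℂ) • quad x := by
  have hh : corootWt 0 = ![2, 1, 1, 1, 1, 1, 1, 0, 1, 0, 1, 0, 1, 0, 0, 1] := rfl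
  have hA : CartanMatrix.E₆ 0 0 = 2 := rfl
  funext a
  revert a
  apply forall_fin_sixteen <;>
  · simp only [Pi.sub_apply, Pi.add_apply, Pi.smul_apply, smul_eq_mul, id_eq,
      signedPerm_apply, dquad, quad, hh, hA, Matrix.cons_val]
    push_cast
    ring

lemma dquad_coroot_one (x : Fin 16 → ℂ) :
    dquad x (signedPerm (corootWt 1) id x) - signedPerm (corootWt 1) id (quad x) =
      (CartanMatrix.E₆ 0 1 : ℂ) • quad x := by
  have hh : corootWt 1 = ![0, 0, -1, -1, 1, 1, 0, 0, -1, 1, 1, -1, 0, 0, 0, 0] := rfl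
  have hA : CartanMatrix.E₆ 0 1 = 0 := rfl
  funext a
  revert a
  apply forall_fin_sixteen <;>
  · simp only [Pi.sub_apply, Pi.add_apply, Pi.smul_apply, smul_eq_mul, id_eq,
      signedPerm_apply, dquad, quad, hh, hA, Matrix.cons_val]
    push_cast
    ring

lemma dquad_coroot_two (x : Fin 16 → ℂ) :
    dquad x (signedPerm (corootWt 2) id x) - signedPerm (corootWt 2) id (quad x) =
      (CartanMatrix.E₆ 0 2 : ℂ) • quad x := by
  have hh : corootWt 2 = ![-1, 1, 0, 0, 0, 0, -1, 1, 0, 0, 0, 0, -1, 1, 1, -1] := rfl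
  have hA : CartanMatrix.E₆ 0 2 = -1 := rfl
  funext a
  revert a
  apply forall_fin_sixteen <;>
  · simp only [Pi.sub_apply, Pi.add_apply, Pi.smul_apply, smul_eq_mul, id_eq,
      signedPerm_apply, dquad, quad, hh, hA, Matrix.cons_val]
    push_cast
    ring

lemma dquad_coroot_three (x : Fin 16 → ℂ) :
    dquad x (signedPerm (corootWt 3) id x) - signedPerm (corootWt 3) id (quad x) =
      (CartanMatrix.E₆ 0 3 : ℂ) • quad x := by
  have hh : corootWt 3 = ![0, -1, 1, 0, 0, -1, 1, 0, 0, 0, -1, 1, 1, -1, 0, 0] := rfl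
  have hA : CartanMatrix.E₆ 0 3 = 0 := rfl
  funext a
  revert a
  apply forall_fin_sixteen <;>
  · simp only [Pi.sub_apply, Pi.add_apply, Pi.smul_apply, smul_eq_mul, id_eq,
      signedPerm_apply, dquad, quad, hh, hA, Matrix.cons_val]
    push_cast
    ring

lemma dquad_coroot_four (x : Fin 16 → ℂ) :
    dquad x (signedPerm (corootWt 4) id x) - signedPerm (corootWt 4) id (quad x) =
      (CartanMatrix.E₆ 0 4 : ℂ) • quad x := by
  have hh : corootWt 4 = ![0, 0, -1, 1, -1, 1, 0, 0, 0, 0, 0, 0, -1, 1, -1, 1] := rfl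
  have hA : CartanMatrix.E₆ 0 4 = 0 := rfl
  funext a
  revert a
  apply forall_fin_sixteen <;>
  · simp only [Pi.sub_apply, Pi.add_apply, Pi.smul_apply, smul_eq_mul, id_eq,
      signedPerm_apply, dquad, quad, hh, hA, Matrix.cons_val]
    push_cast
    ring

lemma dquad_coroot_five (x : Fin 16 → ℂ) :
    dquad x (signedPerm (corootWt 5) id x) - signedPerm (corootWt 5) id (quad x) =
      (CartanMatrix.E₆ 0 5 : ℂ) • quad x := by
  have hh : corootWt 5 = ![0, 0, 0, -1, 0, -1, -1, -1, 1, 0, 1, 0, 1, 0, 1, 0] := rfl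
  have hA : CartanMatrix.E₆ 0 5 = 0 := rfl
  funext a
  revert a
  apply forall_fin_sixteen <;>
  · simp only [Pi.sub_apply, Pi.add_apply, Pi.smul_apply, smul_eq_mul, id_eq,
      signedPerm_apply, dquad, quad, hh, hA, Matrix.cons_val]
    push_cast
    ring

end

section

/-! ### The Chevalley relations -/

/-- The simple coroots. -/
def rootH (i : Fin 6) : CHol := ⁅rootE i, rootF i⁆

lemma forall_fin_six_ne {p : Fin 6 → Prop} (h1 : p 1) (h2 : p 2) (h3 : p 3) (h4 : p 4) (h5 : p 5) :
    ∀ i, i ≠ 0 → p i := by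
  intro i hi
  fin_cases i
  · exact absurd rfl hi
  all_goals assumption

lemma fld_rootE : ∀ i, i ≠ 0 → fld (rootE i) = ⇑(signedPerm (eCoef i) (rootPerm i)) :=
  forall_fin_six_ne (funext fld_rootE_one) (funext fld_rootE_two) (funext fld_rootE_three)
    (funext fld_rootE_four) (funext fld_rootE_five)

lemma fld_rootF : ∀ i, i ≠ 0 → fld (rootF i) = ⇑(signedPerm (fCoef i) (rootPerm i)) :=
  forall_fin_six_ne (funext fld_rootF_one) (funext fld_rootF_two) (funext fld_rootF_three)
    (funext fld_rootF_four) (funext fld_rootF_five)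

lemma fld_lie_const {u v : CHol} {c : Fin 16 → ℂ} (hu : fld u = fun _ => c) (x : Fin 16 → ℂ) :
    fld ⁅u, v⁆ x = fderiv ℂ (fld v) x c := by
  rw [fld_lie, hu, fderiv_const_apply, zero_apply, sub_zero]

lemma fld_lie_linear {u v : CHol} {A B : (Fin 16 → ℂ) →L[ℂ] (Fin 16 → ℂ)} (hu : fld u = ⇑A)
    (hv : fld v = ⇑B) (x : Fin 16 → ℂ) : fld ⁅u, v⁆ x = B (A x) - A (B x) := by
  rw [fld_lie, hu, hv, A.fderiv, B.fderiv]

lemma fld_lie_const_linear {u v : CHol} {c : Fin 16 → ℂ} {B : (Fin 16 → ℂ) →L[ℂ] (Fin 16 → ℂ)}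
    (hu : fld u = fun _ => c) (hv : fld v = ⇑B) : fld ⁅u, v⁆ = fun _ => B c := by
  funext x
  rw [fld_lie_const hu, hv, B.fderiv]

lemma fld_lie_linear_const {u v : CHol} {c : Fin 16 → ℂ} {B : (Fin 16 → ℂ) →L[ℂ] (Fin 16 → ℂ)}
    (hu : fld u = fun _ => c) (hv : fld v = ⇑B) : fld ⁅v, u⁆ = fun _ => -B c := by
  rw [← lie_skew, map_neg, fld_lie_const_linear hu hv]
  rfl

lemma corootWt_eq_of_ne : ∀ i, i ≠ 0 → ∀ a, fCoef i a * eCoef i (rootPerm i a) -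
    eCoef i a * fCoef i (rootPerm i a) = corootWt i a ∧ rootPerm i (rootPerm i a) = a := by
  decide

lemma lie_ef_linear : ∀ i, i ≠ 0 → ∀ j, j ≠ 0 → i ≠ j → ∀ a,
    (fCoef j a * eCoef i (rootPerm j a) = 0 ∧ eCoef i a * fCoef j (rootPerm i a) = 0) ∨
    (fCoef j a * eCoef i (rootPerm j a) = eCoef i a * fCoef j (rootPerm i a) ∧
      rootPerm i (rootPerm j a) = rootPerm j (rootPerm i a)) := by
  decide

lemma lie_he_linear : ∀ i, i ≠ 0 → ∀ j a, eCoef i a * (corootWt j (rootPerm i a) - corootWt j a) =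
    CartanMatrix.E₆ i j * eCoef i a := by
  decide

lemma lie_hf_linear : ∀ i, i ≠ 0 → ∀ j a, fCoef i a * (corootWt j (rootPerm i a) - corootWt j a) =
    -CartanMatrix.E₆ i j * fCoef i a := by
  decide

/-- In the coordinates `chart` the coroots are diagonal. -/
lemma fld_rootH (i : Fin 6) : fld (rootH i) = ⇑(signedPerm (corootWt i) id) := by
  funext x
  by_cases hi : i = 0
  · subst hi
    have hF : fld (rootF 0) = fun _ => -Pi.single 0 1 := funext fld_rootF_zero
    rw [rootH, ← lie_skew, map_neg, Pi.neg_apply, fld_lie_const hF, funext fld_rootE_zero,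
      fderiv_quad]
    funext a
    revert a
    apply forall_fin_sixteen <;> simp [signedPerm_apply, dquad, corootWt]
  · rw [rootH, fld_lie_linear (fld_rootE i hi) (fld_rootF i hi)]
    funext a
    obtain ⟨h1, h2⟩ := corootWt_eq_of_ne i hi a
    simp only [Pi.sub_apply, signedPerm_apply, ← h1, h2, id]
    push_cast
    ring

lemma lie_h_h (i j : Fin 6) : ⁅rootH i, rootH j⁆ = 0 := fld_injective (by
  funext x a
  rw [fld_lie_linear (fld_rootH i) (fld_rootH j), map_zero]
  simp only [Pi.sub_apply, signedPerm_apply, id, Pi.zero_apply]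
  ring)

lemma lie_h_e (i j : Fin 6) : ⁅rootH j, rootE i⁆ = CartanMatrix.E₆ i j • rootE i :=
  fld_injective (by
    funext x
    rw [map_zsmul]
    by_cases hi : i = 0
    · subst hi
      have hE : fld (rootE 0) = quad := funext fld_rootE_zero
      rw [fld_lie, hE, fderiv_quad, fld_rootH, ContinuousLinearMap.fderiv]
      refine Eq.trans ?_ (Int.cast_smul_eq_zsmul ℂ _ _)
      revert j
      intro j
      fin_cases j
      exacts [dquad_coroot_zero x, dquad_coroot_one x, dquad_coroot_two x, dquad_coroot_three x,
        dquad_coroot_four x, dquad_coroot_five x]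
    · rw [fld_lie_linear (fld_rootH j) (fld_rootE i hi), fld_rootE i hi]
      funext a
      have h := congrArg (Int.cast : ℤ → ℂ) (lie_he_linear i hi j a)
      push_cast at h
      simp only [Pi.sub_apply, Pi.smul_apply, signedPerm_apply, id, zsmul_eq_mul]
      linear_combination x (rootPerm i a) * h)

lemma lie_h_f (i j : Fin 6) : ⁅rootH j, rootF i⁆ = -CartanMatrix.E₆ i j • rootF i :=
  fld_injective (by
    rw [map_zsmul]
    by_cases hi : i = 0
    · subst hi
      have hF : fld (rootF 0) = fun _ => -Pi.single 0 1 := funext fld_rootF_zero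
      rw [fld_lie_linear_const hF (fld_rootH j), hF]
      funext x a
      have h : ∀ j, corootWt j 0 = CartanMatrix.E₆ 0 j := by decide
      simp only [Pi.smul_apply, Pi.neg_apply, signedPerm_apply, id, zsmul_eq_mul]
      by_cases ha : a = 0
      · subst ha
        rw [h]
        push_cast
        ring
      · simp [ha]
    · funext x
      rw [fld_lie_linear (fld_rootH j) (fld_rootF i hi), fld_rootF i hi]
      funext a
      have h := congrArg (Int.cast : ℤ → ℂ) (lie_hf_linear i hi j a)
      push_cast at h
      simp only [Pi.sub_apply, Pi.smul_apply, signedPerm_apply, id, zsmul_eq_mul]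
      push_cast
      linear_combination x (rootPerm i a) * h)

lemma lie_e_f_ne (i j : Fin 6) (hij : i ≠ j) : ⁅rootE i, rootF j⁆ = 0 := fld_injective (by
  rw [map_zero]
  by_cases hj : j = 0
  · subst hj
    have hF : fld (rootF 0) = fun _ => -Pi.single 0 1 := funext fld_rootF_zero
    rw [fld_lie_linear_const hF (fld_rootE i hij)]
    funext x a
    have h : ∀ i, i ≠ 0 → ∀ a, eCoef i a = 0 ∨ rootPerm i a ≠ 0 := by decide
    rcases h i hij a with h | h <;> simp [signedPerm_apply, h]
  by_cases hi : i = 0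
  · subst hi
    funext x
    have hE : fld (rootE 0) = quad := funext fld_rootE_zero
    rw [fld_lie, hE, fld_rootF j hj, ContinuousLinearMap.fderiv, fderiv_quad]
    refine sub_eq_zero.2 (Eq.symm ?_)
    revert j
    exact forall_fin_six_ne (fun _ => dquad_signedPerm_f_one x) (fun _ => dquad_signedPerm_f_two x)
      (fun _ => dquad_signedPerm_f_three x) (fun _ => dquad_signedPerm_f_four x)
      (fun _ => dquad_signedPerm_f_five x)
  · funext x
    rw [fld_lie_linear (fld_rootE i hi) (fld_rootF j hj)]
    funext a
    simp only [Pi.sub_apply, signedPerm_apply, Pi.zero_apply]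
    rcases lie_ef_linear i hi j hj hij a with ⟨h1, h2⟩ | ⟨h1, h2⟩
    · have h3 := congrArg (Int.cast : ℤ → ℂ) h1
      have h4 := congrArg (Int.cast : ℤ → ℂ) h2
      push_cast at h3 h4
      linear_combination x (rootPerm i (rootPerm j a)) * h3 - x (rootPerm j (rootPerm i a)) * h4
    · have h3 := congrArg (Int.cast : ℤ → ℂ) h1
      push_cast at h3
      rw [h2]
      linear_combination x (rootPerm j (rootPerm i a)) * h3)

lemma rootH_ne_zero (i : Fin 6) : rootH i ≠ 0 := fun h => by
  have h1 := congrArg fld h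
  rw [fld_rootH, map_zero] at h1
  have h2 : ∀ i, ∃ a, corootWt i a ≠ 0 := by decide
  obtain ⟨a, ha⟩ := h2 i
  have h3 := congrFun (congrFun h1 (fun _ => 1)) a
  simp [signedPerm_apply] at h3
  exact ha h3

lemma isSl2Triple (i : Fin 6) : IsSl2Triple (rootH i) (rootE i) (rootF i) where
  h_ne_zero := rootH_ne_zero i
  lie_e_f := rfl
  lie_h_e_nsmul := by
    have h : ∀ i, CartanMatrix.E₆ i i = 2 := by decide
    rw [lie_h_e, h, two_zsmul, two_nsmul]
  lie_h_f_nsmul := by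
    have h : ∀ i, CartanMatrix.E₆ i i = 2 := by decide
    rw [lie_h_f, h, neg_smul, two_zsmul, two_nsmul]

end

section

/-! ### The Chevalley generators generate the complexification -/

/-- The subalgebra generated by the simple root vectors. -/
def rootSpan : LieSubalgebra ℂ CHol :=
  LieSubalgebra.lieSpan ℂ CHol (Set.range rootE ∪ Set.range rootF)

lemma rootE_mem (i : Fin 6) : rootE i ∈ rootSpan :=
  LieSubalgebra.subset_lieSpan (Or.inl ⟨i, rfl⟩)

lemma rootF_mem (i : Fin 6) : rootF i ∈ rootSpan :=
  LieSubalgebra.subset_lieSpan (Or.inr ⟨i, rfl⟩)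

/-- A spanning tree, rooted at `0`, of the graph whose vertices are the sixteen coordinates and
whose edges are given by the simple root vectors: the vertex preceding a given one. -/
def parent : Fin 16 → Fin 16 := ![0, 0, 1, 2, 2, 4, 5, 6, 3, 11, 5, 13, 6, 14, 7, 12]

/-- The simple root along the edge to the preceding vertex. -/
def parentRoot : Fin 16 → Fin 6 := ![1, 2, 3, 4, 1, 4, 3, 2, 5, 1, 5, 3, 5, 4, 5, 4]

lemma parent_spec : ∀ b, b ≠ 0 → parentRoot b ≠ 0 ∧ rootPerm (parentRoot b) (parent b) = b ∧
    fCoef (parentRoot b) b ≠ 0 ∧ eCoef (parentRoot b) (parent b) ≠ 0 := by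
  decide

/-- Induction along the spanning tree. -/
lemma forall_of_parent {p : Fin 16 → Prop} (h0 : p 0) (h : ∀ b, b ≠ 0 → p (parent b) → p b)
    (b : Fin 16) : p b := by
  have h1 : ∀ b, parent^[12] b = 0 := by decide
  have h2 : ∀ n b, p (parent^[n] b) → p b := by
    intro n
    induction n with
    | zero => exact fun b hb => hb
    | succ n ih =>
      intro b hb
      by_cases hb0 : b = 0
      · rw [hb0]; exact h0
      · exact h b hb0 (ih _ hb)
  exact h2 12 b (by rw [h1]; exact h0)

lemma rootPerm_rootPerm : ∀ i a, rootPerm i (rootPerm i a) = a := by decide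

/-- All constant coordinate fields are generated by the simple root vectors: the first negative
simple root vector is a constant field, and the linear ones move it along the spanning tree. -/
lemma exists_const_single (b : Fin 16) :
    ∃ k ∈ rootSpan, fld k = fun _ => Pi.single b (1 : ℂ) := by
  refine forall_of_parent (p := fun b => ∃ k ∈ rootSpan, fld k = fun _ => Pi.single b (1 : ℂ))
    ⟨-rootF 0, neg_mem (rootF_mem 0), ?_⟩ (fun b hb => ?_) b
  · rw [map_neg, funext fld_rootF_zero]
    exact funext fun x => neg_neg _
  · rintro ⟨k, hk, hk'⟩
    obtain ⟨h1, h2, h3, -⟩ := parent_spec b hb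
    set i := parentRoot b
    have h4 : (fCoef i b : ℂ) ≠ 0 := Int.cast_ne_zero.2 h3
    refine ⟨(fCoef i b : ℂ)⁻¹ • ⁅k, rootF i⁆, rootSpan.smul_mem _
      (rootSpan.lie_mem hk (rootF_mem i)), ?_⟩
    rw [map_smul, fld_lie_const_linear hk' (fld_rootF i h1)]
    funext x a
    by_cases ha : a = b
    · subst ha
      have h5 : rootPerm i a = parent a := by
        nth_rewrite 1 [← h2]; rw [rootPerm_rootPerm]
      simp [signedPerm_apply, h5, h4]
    · have h5 : rootPerm i a ≠ parent b := fun h => ha (by rw [← h2, ← h, rootPerm_rootPerm])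
      simp [signedPerm_apply, h5, ha]

/-- The constant vector fields, as elements of the complexification of `hol`. -/
def constField : (Fin 16 → ℂ) →ₗ[ℂ] CHol :=
  Fintype.linearCombination ℂ fun b => (exists_const_single b).choose

lemma constField_mem (c : Fin 16 → ℂ) : constField c ∈ rootSpan := by
  rw [constField, Fintype.linearCombination_apply]
  exact sum_mem fun b _ => rootSpan.smul_mem _ (exists_const_single b).choose_spec.1

lemma fld_constField (c : Fin 16 → ℂ) : fld (constField c) = fun _ => c := by
  rw [constField, Fintype.linearCombination_apply, map_sum]
  funext x a
  simp only [map_smul, (exists_const_single _).choose_spec.2, Finset.sum_apply, Pi.smul_apply]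
  simp [Pi.single_apply]

lemma lie_linear_constField {v : CHol} {B : (Fin 16 → ℂ) →L[ℂ] (Fin 16 → ℂ)} (hv : fld v = ⇑B)
    (c : Fin 16 → ℂ) : ⁅v, constField c⁆ = -constField (B c) := fld_injective (by
  rw [fld_lie_linear_const (fld_constField c) hv, map_neg, fld_constField]
  rfl)

/-- The invariance of the Killing form. -/
lemma killing_lie (u v w : CHol) :
    killingForm ℂ CHol ⁅u, v⁆ w = -killingForm ℂ CHol v ⁅u, w⁆ :=
  LieModule.traceForm_apply_lie_apply' ℂ CHol CHol u v w

/-- The Euler field of the coordinates `chart`. -/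
def chartEuler : CHol := (4 / 3 : ℂ) • rootH 0 + (1 : ℂ) • rootH 1 + (5 / 3 : ℂ) • rootH 2 +
  (2 : ℂ) • rootH 3 + (4 / 3 : ℂ) • rootH 4 + (2 / 3 : ℂ) • rootH 5

lemma fld_chartEuler : fld chartEuler = ⇑(ContinuousLinearMap.id ℂ (Fin 16 → ℂ)) := by
  have h : ∀ a, 4 * corootWt 0 a + 3 * corootWt 1 a + 5 * corootWt 2 a + 6 * corootWt 3 a +
      4 * corootWt 4 a + 2 * corootWt 5 a = 3 := by decide
  funext x a
  have h1 := congrArg (Int.cast : ℤ → ℂ) (h a)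
  push_cast at h1
  simp only [chartEuler, map_add, map_smul, fld_rootH, Pi.add_apply, Pi.smul_apply, signedPerm_apply,
    id, smul_eq_mul, ContinuousLinearMap.coe_id']
  linear_combination (x a / 3) * h1

lemma lie_chartEuler_rootE : ⁅chartEuler, rootE 0⁆ = rootE 0 := by
  have h0 : CartanMatrix.E₆ 0 0 = 2 := rfl
  have h1 : CartanMatrix.E₆ 0 1 = 0 := rfl
  have h2 : CartanMatrix.E₆ 0 2 = -1 := rfl
  have h3 : CartanMatrix.E₆ 0 3 = 0 := rfl
  have h4 : CartanMatrix.E₆ 0 4 = 0 := rfl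
  have h5 : CartanMatrix.E₆ 0 5 = 0 := rfl
  simp only [chartEuler, add_lie, smul_lie, lie_h_e, h0, h1, h2, h3, h4, h5,
    ← Int.cast_smul_eq_zsmul ℂ, smul_smul, ← add_smul]
  norm_num

/-- `rootE 0` is a quadratic vector field, so it is orthogonal to the linear ones. -/
lemma killing_rootE_linear {u : CHol} {B : (Fin 16 → ℂ) →L[ℂ] (Fin 16 → ℂ)} (hu : fld u = ⇑B) :
    killingForm ℂ CHol (rootE 0) u = 0 := by
  have h : ⁅chartEuler, u⁆ = 0 := fld_injective (by
    funext x
    rw [fld_lie_linear fld_chartEuler hu, map_zero]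
    exact sub_self _)
  rw [← lie_chartEuler_rootE, killing_lie, h, map_zero, neg_zero]

lemma smul_cmul (c a : ℂ) (X : hol) : c • cmul a X = cmul (c * a) X :=
  TensorProduct.smul_tmul' c a X

lemma cmul_smul (a : ℂ) (r : ℝ) (X : hol) : cmul a (r • X) = cmul (r * a) X :=
  (TensorProduct.smul_tmul r a X).symm.trans (congrArg (fun b : ℂ => cmul b X) (real_smul))

/-- `rootE 0` is an eigenvector of the Euler field, with eigenvalue `1`, so it can only pair with
`𝔤₋₁`. -/
lemma killing_rootE_of_mem {k : ℤ} (hk : k ≠ -1) (a : ℂ) {X : hol} (hX : X ∈ gradedPiece k) :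
    killingForm ℂ CHol (rootE 0) (cmul a X) = 0 := by
  have hs : ∀ j, symOne j ∈ gradedPiece 1 := fun j => genHol_mem (.inr (.inr (.inr (.inl j))))
  have h1 : ∀ {k : ℤ} (a : ℂ) {X : hol}, X ∈ gradedPiece k →
      ⁅cmul 1 eulerField, cmul a X⁆ = (k : ℂ) • cmul a X := fun {k} a {X} hX => by
    rw [lie_cmul, lie_euler hX, cmul_smul, one_mul, smul_cmul]
    push_cast
    rfl
  have h2 : ⁅cmul 1 eulerField, rootE 0⁆ = rootE 0 := by
    change ⁅_, cmul _ _ + cmul _ _⁆ = cmul _ _ + cmul _ _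
    rw [lie_add, h1 _ (hs 0), h1 _ (hs 8)]
    simp
  have h3 := killing_lie (cmul 1 eulerField) (rootE 0) (cmul a X)
  rw [h2, h1 a hX, map_smul, smul_eq_mul] at h3
  have h4 : (1 + (k : ℂ)) * killingForm ℂ CHol (rootE 0) (cmul a X) = 0 := by
    linear_combination h3
  refine (mul_eq_zero.1 h4).resolve_left fun h => hk ?_
  have : ((1 + k : ℤ) : ℂ) = 0 := by push_cast; exact h
  have := Int.cast_eq_zero.1 this
  omega

lemma rootE_zero_ne_zero : rootE 0 ≠ 0 := (isSl2Triple 0).e_ne_zero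

/-- The root vector of the first simple root is not orthogonal to all constant fields: otherwise it
would be orthogonal to everything, by the weight considerations above. -/
lemma exists_killing_constField_ne_zero :
    ∃ c, killingForm ℂ CHol (rootE 0) (constField c) ≠ 0 := by
  by_contra! h
  refine rootE_zero_ne_zero ((LieAlgebra.IsKilling.killingForm_nondegenerate ℂ CHol).1 _ fun u => ?_)
  refine induction_cmul (p := fun u => killingForm ℂ CHol (rootE 0) u = 0) u (map_zero _)
    (fun a X => ?_) fun u v hu hv => by rw [map_add, hu, hv, add_zero]
  have hX : X ∈ ⨆ k, gradedPiece k := by rw [iSup_gradedPiece]; trivial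
  induction hX using Submodule.iSup_induction' with
  | zero =>
    rw [show cmul a 0 = 0 from TensorProduct.tmul_zero _ _, map_zero]
  | add X Y _ _ hX hY =>
    rw [show cmul a (X + Y) = cmul a X + cmul a Y from TensorProduct.tmul_add _ _ _, map_add, hX, hY,
      add_zero]
  | mem k X hX =>
    by_cases hk : k = -1
    · subst hk
      set c := zp X 0 0
      have h1 : fld (cmul a X - constField (a • chart (pt c 0))) =
          ⇑(a • (chart ∘L hermL c ∘L chartInv)) := by
        funext x
        rw [map_sub, fld_constField, eq_heisField hX]
        simp only [Pi.sub_apply, fld_apply, toField_cmul, Pi.smul_apply, heisField_apply, map_smul]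
        rw [sub_eq_iff_eq_add]
        change _ = a • chart (hermL c (chartInv x)) + a • chart (pt c 0)
        rw [← smul_add, ← map_add, hermL_apply, ← pt_add]
        simp [c]
      have h2 := killing_rootE_linear h1
      rwa [map_sub, h, sub_zero] at h2
    · exact killing_rootE_of_mem hk a hX

/-- The coroots act by different weights on `rootE 0` and on the dual of a constant coordinate field
other than the first. -/
lemma killing_rootE_constField_single (b : Fin 16) (hb : b ≠ 0) :
    killingForm ℂ CHol (rootE 0) (constField (Pi.single b 1)) = 0 := by
  have h : ∀ b, b ≠ 0 → ∃ j, CartanMatrix.E₆ 0 j ≠ corootWt j b := by decide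
  obtain ⟨j, hj⟩ := h b hb
  have h1 := killing_lie (rootH j) (rootE 0) (constField (Pi.single b 1))
  have h2 : signedPerm (corootWt j) id (Pi.single b 1) = (corootWt j b : ℂ) • Pi.single b 1 := by
    funext a
    by_cases ha : a = b
    · subst ha; simp [signedPerm_apply]
    · simp [signedPerm_apply, ha]
  rw [lie_h_e, lie_linear_constField (fld_rootH j), h2, ← Int.cast_smul_eq_zsmul ℂ] at h1
  simp only [map_smul, map_neg, neg_neg, LinearMap.smul_apply, smul_eq_mul] at h1
  have h3 : ((CartanMatrix.E₆ 0 j : ℂ) - corootWt j b) *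
      killingForm ℂ CHol (rootE 0) (constField (Pi.single b 1)) = 0 := by linear_combination h1
  refine (mul_eq_zero.1 h3).resolve_left fun h => hj ?_
  exact_mod_cast sub_eq_zero.1 h

/-- Among the constant coordinate fields, `rootE 0` pairs with the first one only. -/
lemma killing_rootE_constField (c : Fin 16 → ℂ) : killingForm ℂ CHol (rootE 0) (constField c) =
    c 0 * killingForm ℂ CHol (rootE 0) (constField (Pi.single 0 1)) := by
  have h : constField c = ∑ b, c b • constField (Pi.single b 1) := by
    simp_rw [← map_smul, ← map_sum]
    congr 1
    funext a
    simp [Finset.sum_apply, Pi.single_apply]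
  rw [h, map_sum, Finset.sum_eq_single 0]
  · rw [map_smul, smul_eq_mul]
  · intro b _ hb
    rw [map_smul, killing_rootE_constField_single b hb, smul_zero]
  · simp

lemma killing_rootE_constField_zero_ne_zero :
    killingForm ℂ CHol (rootE 0) (constField (Pi.single 0 1)) ≠ 0 := by
  obtain ⟨c, hc⟩ := exists_killing_constField_ne_zero
  rw [killing_rootE_constField] at hc
  exact right_ne_zero_of_mul hc

/-- Being orthogonal to `rootSpan`. -/
def IsPerp (u : CHol) : Prop := ∀ s ∈ rootSpan, killingForm ℂ CHol s u = 0

lemma IsPerp.lie {s u : CHol} (hs : s ∈ rootSpan) (hu : IsPerp u) : IsPerp ⁅s, u⁆ := fun t ht => by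
  have := hu ⁅s, t⁆ (rootSpan.lie_mem hs ht)
  rwa [killing_lie, neg_eq_zero] at this

/-- The pairing with `rootE 0` detects the first coordinate of `c`, and the linear root vectors move
the other coordinates to the first along the spanning tree. -/
lemma eq_zero_of_isPerp_constField {c : Fin 16 → ℂ} (h : IsPerp (constField c)) : c = 0 := by
  funext b
  revert c
  refine forall_of_parent (p := fun b => ∀ {c : Fin 16 → ℂ}, IsPerp (constField c) → c b = 0)
    (fun {c} hc => ?_) (fun b hb ih c hc => ?_) b
  · have h1 := hc _ (rootE_mem 0)
    rw [killing_rootE_constField] at h1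
    exact (mul_eq_zero.1 h1).resolve_right killing_rootE_constField_zero_ne_zero
  · obtain ⟨h1, h2, -, h3⟩ := parent_spec b hb
    have h4 := hc.lie (rootE_mem (parentRoot b))
    rw [lie_linear_constField (fld_rootE _ h1), ← map_neg] at h4
    have h5 := ih h4
    rw [Pi.neg_apply, neg_eq_zero, signedPerm_apply, h2] at h5
    exact (mul_eq_zero.1 h5).resolve_left (Int.cast_ne_zero.2 h3)

/-- Every iterated bracket of `u` with `n` constant coordinate fields vanishes. -/
def ConstNil : ℕ → CHol → Prop
  | 0, u => u = 0
  | n + 1, u => ∀ b : Coord, ConstNil n ⁅constField (chart (Pi.single b 1)), u⁆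

lemma ConstNil.zero : ∀ n, ConstNil n 0
  | 0 => rfl
  | n + 1 => fun c => by rw [lie_zero]; exact ConstNil.zero n

lemma ConstNil.add : ∀ {n : ℕ} {u v : CHol}, ConstNil n u → ConstNil n v → ConstNil n (u + v)
  | 0, u, v, hu, hv => by rw [ConstNil] at *; rw [hu, hv, add_zero]
  | n + 1, u, v, hu, hv => fun c => by rw [lie_add]; exact (hu c).add (hv c)

lemma toField_lie_constField (v : E) (u : CHol) (x : E) :
    toField ⁅constField (chart v), u⁆ x = fderiv ℂ (toField u) x v := by
  have h : ∀ y, toField (constField (chart v)) y = v := fun y => by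
    rw [toField_eq, fld_constField, chartInv_chart]
  rw [toField_lie, lieBracket_eq, funext h]
  simp

lemma constNil_of_homFun : ∀ {n : ℕ} {k : ℤ} {u : CHol},
    (∀ a, HomFun (fun x => toField u x a) (k + wt a)) → k + 3 ≤ n → ConstNil n u
  | 0, k, u, hu, hk => toField_injective (by
      rw [map_zero]
      funext x a
      refine (hu a).eq_zero_of_neg ?_ x
      have : wt a ≤ 2 := by rcases a with a | a <;> simp [wt]
      push_cast at hk
      omega)
  | n + 1, k, u, hu, hk => fun b => by
      refine constNil_of_homFun (k := k - wt b) (fun a => ?_) ?_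
      · have h := (hu a).partial_deriv b
        rw [show k + wt a - wt b = k - wt b + wt a by ring] at h
        refine (funext fun x => ?_ : (fun x => fderiv ℂ (fun x => toField u x a) x (Pi.single b 1)) =
          fun x => toField ⁅constField (chart (Pi.single b 1)), u⁆ x a) ▸ h
        rw [toField_lie_constField]
        have h1 := hasFDerivAt_pi'.1 (differentiable_toField u x).hasFDerivAt a
        rw [h1.fderiv]
        rfl
      · have : 1 ≤ wt b := by rcases b with b | b <;> simp [wt]
        push_cast at hk
        omega

/-- The components of the fields are polynomials, so they are annihilated by enough derivatives. -/
lemma constNil_five (u : CHol) : ConstNil 5 u := by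
  refine induction_cmul (p := ConstNil 5) u (ConstNil.zero 5) (fun a X => ?_) fun u v hu hv =>
    hu.add hv
  have hX : X ∈ ⨆ k, gradedPiece k := by rw [iSup_gradedPiece]; trivial
  induction hX using Submodule.iSup_induction' with
  | zero =>
    rw [show cmul a 0 = 0 from TensorProduct.tmul_zero _ _]
    exact ConstNil.zero 5
  | add X Y _ _ hX hY =>
    rw [show cmul a (X + Y) = cmul a X + cmul a Y from TensorProduct.tmul_add _ _ _]
    exact hX.add hY
  | mem k X hX =>
    by_cases hk : 2 < |k|
    · rw [gradedPiece_eq_bot hk] at hX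
      rw [(Submodule.mem_bot ℝ).1 hX, show cmul a 0 = 0 from TensorProduct.tmul_zero _ _]
      exact ConstNil.zero 5
    · refine constNil_of_homFun (k := k) (fun b => ?_) ?_
      · rw [toField_cmul]
        exact (hasWeight_of_mem hX b).const_mul a
      · have := (abs_le.1 (not_lt.1 hk)).2
        push_cast
        omega

/-- The orthogonal complement of `rootSpan` is stable under brackets with constant fields. Taking
enough of these brackets leads to a constant field, and no nonzero constant field is orthogonal to
`rootSpan`. -/
lemma eq_zero_of_isPerp {u : CHol} (hu : IsPerp u) : u = 0 := by
  have key : ∀ n u, ConstNil n u → IsPerp u → u = 0 := by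
    intro n
    induction n with
    | zero => exact fun u h _ => h
    | succ n ih =>
      intro u h hu
      have h1 : ∀ b : Coord, ⁅constField (chart (Pi.single b 1)), u⁆ = 0 := fun b =>
        ih _ (h b) (hu.lie (constField_mem _))
      have h2 : ∀ x, fderiv ℂ (toField u) x = 0 := fun x => by
        refine ContinuousLinearMap.coe_injective ((Pi.basisFun ℂ Coord).ext fun b => ?_)
        have h3 := toField_lie_constField (Pi.single b 1) u x
        rw [h1, map_zero] at h3
        rw [Pi.basisFun_apply]
        exact h3.symm
      have h3 : u = constField (chart (toField u 0)) := toField_injective (by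
        funext x
        rw [is_const_of_fderiv_eq_zero (differentiable_toField u) h2 x 0, toField_eq (constField _),
          fld_constField, chartInv_chart])
      rw [h3] at hu ⊢
      rw [eq_zero_of_isPerp_constField hu, map_zero]
  exact key 5 u (constNil_five u) hu

/-- The Killing form is nondegenerate, so a subspace with trivial orthogonal complement is
everything. -/
lemma rootSpan_eq_top : rootSpan = ⊤ := by
  have hB := LieAlgebra.IsKilling.killingForm_nondegenerate ℂ CHol
  have h1 : (killingForm ℂ CHol).orthogonal rootSpan.toSubmodule = ⊥ :=
    (Submodule.eq_bot_iff _).2 fun u hu => eq_zero_of_isPerp fun s hs => hu s hs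
  have h2 := LinearMap.BilinForm.finrank_orthogonal hB rootSpan.toSubmodule
  rw [h1, finrank_bot] at h2
  have h3 : rootSpan.toSubmodule = ⊤ := Submodule.eq_top_of_finrank_eq
    (le_antisymm (Submodule.finrank_le _) (Nat.sub_eq_zero_iff_le.1 h2.symm))
  exact LieSubalgebra.toSubmodule_injective h3

lemma linearIndependent_rootH : LinearIndependent ℂ rootH := by
  refine Fintype.linearIndependent_iff.2 fun g hg => ?_
  have h : ∀ a, ∑ i, g i * corootWt i a = 0 := fun a => by
    have h1 := congrFun (congrFun (congrArg fld hg) fun _ => 1) a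
    rw [map_sum, map_zero, Finset.sum_apply, Finset.sum_apply] at h1
    simpa only [map_smul, Pi.smul_apply, fld_rootH, signedPerm_apply, mul_one, smul_eq_mul,
      Pi.zero_apply] using h1
  have h0 := h 0; have h1 := h 1; have h2 := h 2; have h7 := h 7; have h9 := h 9; have h11 := h 11
  simp [Fin.sum_univ_succ, corootWt] at h0 h1 h2 h7 h9 h11
  have e0 : g 0 = 0 := by linear_combination (h0 + h1 + h9 + h11) / 3
  have e2 : g 2 = 0 := by linear_combination -h0 + 2 * e0
  have e3 : g 3 = 0 := by linear_combination h11 + h9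
  have e4 : g 4 = 0 := by linear_combination -h2 + e0 - h9 + e3
  have e5 : g 5 = 0 := by linear_combination -h7 + e2
  intro i
  fin_cases i
  exacts [e0, h9, e2, e3, e4, e5]

/-- The Chevalley generators of the complexification of `hol`. -/
def rootBasis : LieAlgebra.Basis (Fin 6) (LieSubalgebra.lieSpan ℂ CHol (Set.range rootH)) where
  A := CartanMatrix.E₆
  h := rootH
  e := rootE
  f := rootF
  cartan_eq_lieSpan := rfl
  span_ef := rootSpan_eq_top
  linInd := linearIndependent_rootH
  nondegen := Matrix.nondegenerate_of_det_ne_zero (by rw [CartanMatrix.E₆_det]; norm_num)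
  sl2 := isSl2Triple
  lie_h_h := lie_h_h
  lie_h_e := lie_h_e
  lie_h_f := lie_h_f
  lie_e_f_ne := lie_e_f_ne

/-- The simple coroots span a Cartan subalgebra, for which the Chevalley generators give a base with
Cartan matrix `E₆`. -/
lemma isTypeE6_CHol : IsTypeE6 CHol := by
  refine ⟨inferInstance, inferInstance, _, rootBasis.isCartanSubalgebra, rootBasis.base,
    rootBasis.baseSupportEquiv.symm, fun i j => ?_⟩
  rw [rootBasis.cartanMatrix_base_eq]
  rfl

end

section

/-! ### Symmetric and skew-symmetric endomorphisms of a Euclidean space -/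

section Orthogonal

variable {V ι : Type*} [AddCommGroup V] [Module ℝ V] [Fintype ι]
  {B : LinearMap.BilinForm ℝ V} {v : Module.Basis ι ℝ V} {T : V →ₗ[ℝ] V} {ε : ℝ}

lemma repr_of_isOrtho (ho : B.IsOrthoᵢ v) (hp : ∀ i, 0 < B (v i) (v i)) (x : V) (i : ι) :
    v.repr x i = (B (v i) (v i))⁻¹ * B (v i) x := by
  classical
  have h : B (v i) x = v.repr x i * B (v i) (v i) := by
    conv_lhs => rw [← v.sum_repr x]
    rw [map_sum, Finset.sum_eq_single i]
    · simp
    · intro j _ hj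
      rw [map_smul, show B (v i) (v j) = 0 from ho hj.symm, smul_zero]
    · simp
  rw [h]
  field_simp [(hp i).ne']

/-- The square of a symmetric (`ε = 1`) endomorphism of a Euclidean space has nonnegative trace,
the square of a skew-symmetric (`ε = -1`) one nonpositive trace. -/
lemma mul_trace_sq_nonneg (ho : B.IsOrthoᵢ v)
    (hp : ∀ x, x ≠ 0 → 0 < B x x) (hT : ∀ x y, B (T x) y = ε * B x (T y)) :
    0 ≤ ε * LinearMap.trace ℝ V (T ∘ₗ T) := by
  classical
  have hv : ∀ i, 0 < B (v i) (v i) := fun i => hp _ (v.ne_zero i)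
  rw [LinearMap.trace_eq_matrix_trace ℝ v, Matrix.trace, Finset.mul_sum]
  refine Finset.sum_nonneg fun i _ => ?_
  rw [Matrix.diag_apply, LinearMap.toMatrix_apply, repr_of_isOrtho ho hv, LinearMap.comp_apply,
    mul_left_comm, ← hT]
  refine mul_nonneg (inv_nonneg.2 (hv i).le) ?_
  by_cases h : T (v i) = 0
  · simp [h]
  · exact (hp _ h).le

/-- Moving a symmetric or skew-symmetric endomorphism through the contraction of a bilinear form
with the inverse of the Euclidean form. -/
lemma sum_apply_left (hs : ∀ x y, B x y = B y x) (ho : B.IsOrthoᵢ v)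
    (hp : ∀ x, x ≠ 0 → 0 < B x x) (hT : ∀ x y, B (T x) y = ε * B x (T y))
    (β : LinearMap.BilinForm ℝ V) :
    ∑ i, (B (v i) (v i))⁻¹ * β (T (v i)) (v i) =
      ε * ∑ i, (B (v i) (v i))⁻¹ * β (v i) (T (v i)) := by
  have hv : ∀ i, 0 < B (v i) (v i) := fun i => hp _ (v.ne_zero i)
  have hr : ∀ i, T (v i) = ∑ j, ((B (v j) (v j))⁻¹ * B (v j) (T (v i))) • v j := fun i => by
    conv_lhs => rw [← v.sum_repr (T (v i))]
    exact Finset.sum_congr rfl fun j _ => by rw [repr_of_isOrtho ho hv]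
  have h1 : ∀ i, (B (v i) (v i))⁻¹ * β (T (v i)) (v i) = ∑ j, (B (v i) (v i))⁻¹ *
      ((B (v j) (v j))⁻¹ * B (v j) (T (v i)) * β (v j) (v i)) := fun i => by
    conv_lhs => rw [hr i]
    rw [map_sum, LinearMap.sum_apply, Finset.mul_sum]
    simp
  have h2 : ∀ i, (B (v i) (v i))⁻¹ * β (v i) (T (v i)) = ∑ j, (B (v i) (v i))⁻¹ *
      ((B (v j) (v j))⁻¹ * B (v j) (T (v i)) * β (v i) (v j)) := fun i => by
    conv_lhs => rw [hr i]
    rw [map_sum, Finset.mul_sum]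
    simp
  simp only [h1, h2, Finset.mul_sum]
  rw [Finset.sum_comm]
  refine Finset.sum_congr rfl fun i _ => Finset.sum_congr rfl fun j _ => ?_
  rw [hs (v i) (T (v j)), hT]
  ring

end Orthogonal

end

section

/-! ### Euclidean forms adapted to the action of `𝔤₀` -/

/-- A positive definite Hermitian form on `ℂ⁸⁺⁸`.  The factors `2` make the set of fields of weight
zero closed under adjoints. -/
def hip (p q : E) : ℂ :=
  p (.inl 0) * conj (q (.inl 0)) + p (.inl 1) * conj (q (.inl 1)) + p (.inl 2) * conj (q (.inl 2)) +
  p (.inl 3) * conj (q (.inl 3)) + p (.inl 4) * conj (q (.inl 4)) + p (.inl 5) * conj (q (.inl 5)) +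
  p (.inl 6) * conj (q (.inl 6)) + p (.inl 7) * conj (q (.inl 7)) +
  2 * (p (.inr 0) * conj (q (.inr 0))) + 2 * (p (.inr 1) * conj (q (.inr 1))) +
  p (.inr 2) * conj (q (.inr 2)) + p (.inr 3) * conj (q (.inr 3)) + p (.inr 4) * conj (q (.inr 4)) +
  p (.inr 5) * conj (q (.inr 5)) + p (.inr 6) * conj (q (.inr 6)) + p (.inr 7) * conj (q (.inr 7))

lemma hip_add_left (p p' q : E) : hip (p + p') q = hip p q + hip p' q := by
  simp only [hip, Pi.add_apply]; ring

lemma hip_smul_left (c : ℂ) (p q : E) : hip (c • p) q = c * hip p q := by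
  simp only [hip, Pi.smul_apply, smul_eq_mul]; ring

lemma conj_hip (p q : E) : conj (hip p q) = hip q p := by
  simp only [hip, map_add, map_mul, map_ofNat, conj_conj]; ring

lemma hip_add_right (p q q' : E) : hip p (q + q') = hip p q + hip p q' := by
  rw [← conj_hip, hip_add_left, map_add, conj_hip, conj_hip]

lemma hip_smul_right (c : ℂ) (p q : E) : hip p (c • q) = conj c * hip p q := by
  rw [← conj_hip, hip_smul_left, map_mul, conj_hip]

lemma re_hip_self_pos {p : E} (hp : p ≠ 0) : 0 < (hip p p).re := by
  have h1 : (hip p p).re = ∑ i, normSq (p (.inl i)) + ∑ j, normSq (p (.inr j)) +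
      normSq (p (.inr 0)) + normSq (p (.inr 1)) := by
    simp only [Fin.sum_univ_eight, hip, mul_conj, ← ofReal_ofNat, ← ofReal_mul, ← ofReal_add,
      ofReal_re]
    ring
  rw [h1]
  obtain ⟨c, hc⟩ := Function.ne_iff.1 hp
  have h2 : 0 < ∑ i, normSq (p (.inl i)) + ∑ j, normSq (p (.inr j)) := by
    rw [← Fintype.sum_sum_type fun c => normSq (p c)]
    exact Finset.sum_pos' (fun i _ => normSq_nonneg _) ⟨c, Finset.mem_univ _, normSq_pos.2 hc⟩
  linarith [normSq_nonneg (p (.inr 0)), normSq_nonneg (p (.inr 1))]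

/-- For `ε = 1`, the field is a Hermitian endomorphism of `ℂ⁸⁺⁸`; for `ε = -1`, a skew-Hermitian
one. -/
def IsSelfAdj (ε : ℝ) (X : hol) : Prop := ∀ p q, hip (X.1.1 p) q = ε * hip p (X.1.1 q)

/-- The real scalar product of the values of two fields at the origin. -/
def originForm : LinearMap.BilinForm ℝ hol :=
  LinearMap.mk₂ ℝ (fun Y Y' => (hip (Y.1.1 0) (Y'.1.1 0)).re)
    (fun Y Y' Y'' => (congrArg re (hip_add_left (Y.1.1 0) (Y'.1.1 0) (Y''.1.1 0))).trans (add_re _ _))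
    (fun r Y Y' => (congrArg re (hip_smul_left r (Y.1.1 0) (Y'.1.1 0))).trans (re_ofReal_mul _ _))
    (fun Y Y' Y'' => (congrArg re (hip_add_right (Y.1.1 0) (Y'.1.1 0) (Y''.1.1 0))).trans (add_re _ _))
    (fun r Y Y' => (congrArg re (hip_smul_right r (Y.1.1 0) (Y'.1.1 0))).trans (by
      rw [conj_ofReal, re_ofReal_mul]; rfl))

lemma originForm_apply (Y Y' : hol) : originForm Y Y' = (hip (Y.1.1 0) (Y'.1.1 0)).re := rfl

/-- A symmetric form on `hol`, positive definite on `𝔤ₖ`, for which (skew-)Hermitian fields of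
weight zero act by (skew-)symmetric endomorphisms on `𝔤ₖ`. -/
structure IsAdapted (k : ℤ) (B : LinearMap.BilinForm ℝ hol) : Prop where
  symm : ∀ Y Y', B Y Y' = B Y' Y
  pos : ∀ Y ∈ gradedPiece k, Y ≠ 0 → 0 < B Y Y
  adj : ∀ (ε : ℝ) (X : hol), X ∈ gradedPiece 0 → IsSelfAdj ε X → ∀ Y ∈ gradedPiece k,
    ∀ Y' ∈ gradedPiece k, B ⁅X, Y⁆ Y' = ε * B Y ⁅X, Y'⁆

lemma apply_smul_of_weight_zero {X : hol} (hX : X ∈ gradedPiece 0) (s : ℂ) (x : E) :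
    X.1.1 (s • x) = s • X.1.1 x := by
  have h : ∀ x, X.1.1 x = pt (fderivZ X (zc x)) (fderivWW X (om x)) := fun x =>
    ext_zc_om (by rw [zc_pt, ← zp_eq_fderivZ hX _ (om x), zp, pt_zc_om])
      (by rw [om_pt, ← wp_eq_fderivWW hX (zc x), wp, pt_zc_om])
  have hz : zc (s • x) = s • zc x := rfl
  rw [h, h x, ← pt_smul, om_smul, hz, map_smul, map_smul]

lemma apply_zero_of_weight_zero {X : hol} (hX : X ∈ gradedPiece 0) : X.1.1 0 = 0 := by
  simpa using apply_smul_of_weight_zero hX 0 0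

lemma lie_apply_zero {X : hol} (hX : X ∈ gradedPiece 0) (Y : hol) :
    (⁅X, Y⁆ : hol).1.1 0 = -X.1.1 (Y.1.1 0) := by
  have h1 : (⁅X, Y⁆ : hol).1.1 0 = ((⁅X.1, Y.1⁆ : HolVF) : E → E) 0 := rfl
  have h2 : fderiv ℂ X.1.1 0 (Y.1.1 0) = X.1.1 (Y.1.1 0) :=
    fderiv_of_line (C := 0) (holVF_differentiable X.1) fun s => by
      rw [zero_add, apply_smul_of_weight_zero hX, apply_zero_of_weight_zero hX]; simp
  rw [h1, lie_apply, h2, apply_zero_of_weight_zero hX, map_zero, zero_sub]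

lemma isAdapted_originForm {k : ℤ} (hk : ∀ Y ∈ gradedPiece k, Y.1.1 0 = 0 → Y = 0) :
    IsAdapted k originForm where
  symm Y Y' := by rw [originForm_apply, ← conj_hip, conj_re, originForm_apply]
  pos Y hY h := re_hip_self_pos fun h0 => h (hk Y hY h0)
  adj ε X hX h Y _ Y' _ := by
    rw [originForm_apply, originForm_apply, lie_apply_zero hX, lie_apply_zero hX,
      ← neg_one_smul ℂ, ← neg_one_smul ℂ (X.1.1 (Y'.1.1 0)), hip_smul_left, hip_smul_right, h,
      mul_left_comm, re_ofReal_mul]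
    simp

lemma isAdapted_neg_one : IsAdapted (-1) originForm := isAdapted_originForm fun Y hY h => by
  have h2 : zp Y 0 0 = 0 := by rw [zp, pt_zero_zero, h]; rfl
  rw [eq_heisField hY, h2]
  refine hol_ext fun x => ?_
  rw [heisField_apply, ← zero_smul ℂ (0 : Fin 8 → ℂ), herm_smul_right, map_zero, zero_smul,
    zero_smul, pt_zero_zero]
  rfl

lemma isAdapted_neg_two : IsAdapted (-2) originForm := isAdapted_originForm fun Y hY h => by
  obtain ⟨t, ht, rfl⟩ := eq_tauField hY
  exact hol_ext fun x => h

lemma eq_zero_of_mem_of_mem {j k : ℤ} (hjk : j ≠ k) {X : hol} (hj : X ∈ gradedPiece j)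
    (hk : X ∈ gradedPiece k) : X = 0 :=
  Submodule.disjoint_def.1 (iSupIndep_gradedPiece.pairwiseDisjoint hjk) X hj hk

/-- The endomorphism of `𝔤ₖ` given by a field of weight zero. -/
def adPiece (k : ℤ) {X : hol} (hX : X ∈ gradedPiece 0) : gradedPiece k →ₗ[ℝ] gradedPiece k :=
  (LieAlgebra.ad ℝ hol X).restrict fun Y hY => by
    simpa using lie_mem_gradedPiece hX hY

lemma exists_orthogonal_basis_gradedPiece {k : ℤ} {B : LinearMap.BilinForm ℝ hol}
    (hB : IsAdapted k B) : ∃ v : Module.Basis (Fin (Module.finrank ℝ (gradedPiece k))) ℝ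
      (gradedPiece k), (B.restrict (gradedPiece k)).IsOrthoᵢ v :=
  have : Invertible (2 : ℝ) := invertibleOfNonzero two_ne_zero
  LinearMap.BilinForm.exists_orthogonal_basis ⟨fun x y => hB.symm x y⟩

/-- An adapted form on `𝔤ₖ` gives one on `𝔤ₖ₊₁`, seen as a space of maps `𝔤₋₁ → 𝔤ₖ`. -/
lemma IsAdapted.succ {k : ℤ} (hk : -1 ≤ k) {B : LinearMap.BilinForm ℝ hol} (hB : IsAdapted k B) :
    ∃ B', IsAdapted (k + 1) B' := by
  obtain ⟨v, hv⟩ := exists_orthogonal_basis_gradedPiece isAdapted_neg_one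
  set A := originForm.restrict (gradedPiece (-1))
  have hpos : ∀ x, x ≠ 0 → 0 < A x x := fun x hx =>
    isAdapted_neg_one.pos x x.2 fun h => hx (Subtype.ext h)
  have hd : ∀ i, 0 < (A (v i) (v i))⁻¹ := fun i => inv_pos.2 (hpos _ (v.ne_zero i))
  have hmem : ∀ {Y}, Y ∈ gradedPiece (k + 1) → ∀ x : gradedPiece (-1),
      ⁅(x : hol), Y⁆ ∈ gradedPiece k := fun hY x => by
    have := lie_mem_gradedPiece x.2 hY
    rwa [show -1 + (k + 1) = k by ring] at this
  let B' : LinearMap.BilinForm ℝ hol := ∑ i, (A (v i) (v i))⁻¹ •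
    B.compl₁₂ (LieAlgebra.ad ℝ hol (v i : hol)) (LieAlgebra.ad ℝ hol (v i : hol))
  have hB' : ∀ Y Y', B' Y Y' = ∑ i, (A (v i) (v i))⁻¹ * B ⁅(v i : hol), Y⁆ ⁅(v i : hol), Y'⁆ :=
    fun Y Y' => by simp [B']
  refine ⟨B', ⟨fun Y Y' => ?_, fun Y hY h => ?_, fun ε X hX h Y hY Y' hY' => ?_⟩⟩
  · simp only [hB', hB.symm ⁅_, Y⁆]
  · rw [hB']
    have hnn : ∀ i, 0 ≤ (A (v i) (v i))⁻¹ * B ⁅(v i : hol), Y⁆ ⁅(v i : hol), Y⁆ := fun i => by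
      by_cases h0 : ⁅(v i : hol), Y⁆ = 0
      · simp [h0]
      · exact (mul_pos (hd i) (hB.pos _ (hmem hY _) h0)).le
    by_contra hcon
    have h0 := (Finset.sum_eq_zero_iff_of_nonneg fun i _ => hnn i).1
      (le_antisymm (not_lt.1 hcon) (Finset.sum_nonneg fun i _ => hnn i))
    have h1 : ∀ i, ⁅(v i : hol), Y⁆ = 0 := fun i => by
      by_contra h2
      exact (mul_pos (hd i) (hB.pos _ (hmem hY _) h2)).ne' (h0 i (Finset.mem_univ i))
    have h2 : ∀ c, ⁅heisField c, Y⁆ = 0 := fun c => by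
      have h3 := congrArg (fun x : gradedPiece (-1) => ⁅(x : hol), Y⁆)
        (v.sum_repr ⟨heisField c, heisField_mem c⟩)
      simp only at h3
      rw [← h3, Submodule.coe_sum, sum_lie]
      exact Finset.sum_eq_zero fun i _ => by simp [h1]
    obtain ⟨t, ht, rfl⟩ := eq_tauField_of_lie_heisField h2
    exact h (eq_zero_of_mem_of_mem (by omega) (tauField_mem t ht) hY)
  · have hX' : ∀ i, ⁅X, (v i : hol)⁆ = (adPiece (-1) hX (v i) : hol) := fun i => rfl
    -- the bilinear form `(a, b) ↦ B ([a, Y], [b, Y'])` on `𝔤₋₁`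
    let β : LinearMap.BilinForm ℝ (gradedPiece (-1)) := B.compl₁₂
      (-(LieAlgebra.ad ℝ hol Y) ∘ₗ (gradedPiece (-1)).subtype)
      (-(LieAlgebra.ad ℝ hol Y') ∘ₗ (gradedPiece (-1)).subtype)
    have hβ : ∀ a b : gradedPiece (-1), β a b = B ⁅(a : hol), Y⁆ ⁅(b : hol), Y'⁆ := fun a b => by
      simp [β, lie_skew]
    have key := sum_apply_left (fun x y => isAdapted_neg_one.symm x y) hv hpos
      (T := adPiece (-1) hX) (ε := ε)
      (fun x y => isAdapted_neg_one.adj ε X hX h x x.2 y y.2) β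
    simp only [hβ, ← hX'] at key
    have hl : ∀ (i) (Z : hol), ⁅(v i : hol), ⁅X, Z⁆⁆ =
        ⁅X, ⁅(v i : hol), Z⁆⁆ - ⁅⁅X, (v i : hol)⁆, Z⁆ := fun i Z => by
      rw [leibniz_lie X (v i : hol) Z]; abel
    simp only [hB', hl, map_sub, LinearMap.sub_apply, mul_sub, Finset.sum_sub_distrib,
      hB.adj ε X hX h _ (hmem hY _) _ (hmem hY' _)]
    rw [key, Finset.mul_sum, Finset.mul_sum]
    congr 1
    exact Finset.sum_congr rfl fun i _ => by ring

lemma exists_isAdapted (k : ℤ) : ∃ B, IsAdapted k B := by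
  rcases lt_trichotomy k (-2) with hk | rfl | hk
  · have hb : ∀ Y ∈ gradedPiece k, Y = 0 := fun Y hY => by
      rwa [gradedPiece_eq_bot (by rw [abs_of_neg (by omega)]; omega), Submodule.mem_bot] at hY
    exact ⟨_, isAdapted_originForm fun Y hY _ => hb Y hY⟩
  · exact ⟨_, isAdapted_neg_two⟩
  · induction k, (show -1 ≤ k by omega) using Int.leInduction with
    | base => exact ⟨_, isAdapted_neg_one⟩
    | succ n hn ih => exact (ih (by omega)).elim fun B hB => hB.succ hn

/-- The Killing form has a sign on the Hermitian and on the skew-Hermitian fields of weight zero. -/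
lemma mul_killingForm_nonneg {ε : ℝ} {X : hol} (hX : X ∈ gradedPiece 0) (h : IsSelfAdj ε X) :
    0 ≤ ε * killingForm ℝ hol X X := by
  have hfin : {k | gradedPiece k ≠ ⊥}.Finite := (Set.finite_Icc (-2) 2).subset fun k hk => by
    by_contra h2
    exact hk (gradedPiece_eq_bot (not_le.1 fun h3 => h2 (abs_le.1 h3)))
  have hm : ∀ k : ℤ, Set.MapsTo (LieAlgebra.ad ℝ hol X ∘ₗ LieAlgebra.ad ℝ hol X)
      (gradedPiece k) (gradedPiece k) := fun k Y hY => (adPiece k hX (adPiece k hX ⟨Y, hY⟩)).2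
  rw [killingForm_apply_apply, LinearMap.trace_eq_sum_trace_restrict' isInternal_gradedPiece hfin hm,
    Finset.mul_sum]
  refine Finset.sum_nonneg fun k _ => ?_
  obtain ⟨B, hB⟩ := exists_isAdapted k
  obtain ⟨v, hv⟩ := exists_orthogonal_basis_gradedPiece hB
  exact mul_trace_sq_nonneg (B := B.restrict (gradedPiece k)) (T := adPiece k hX)
    hv (fun x hx => hB.pos x x.2 fun h0 => hx (Subtype.ext h0))
    fun x y => hB.adj ε X hX h x x.2 y y.2

end

section

/-! ### The signature of the Killing form -/

/-- The adjoint of the `i`-th generator of weight zero with respect to `hip` is `adjSign i` times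
the generator `adjIndex i`. -/
def adjIndex : Fin 30 → Fin 30 :=
  ![3, 4, 5, 0, 1, 2, 6, 7, 8, 9, 10, 11, 12, 13, 17, 18, 19, 14, 15, 16, 20, 21, 22, 23, 24, 25, 26,
    27, 28, 29]

/-- The signs in the adjoints of the generators of weight zero; see `adjIndex`. -/
def adjSign : Fin 30 → ℤ :=
  ![1, 1, 1, 1, 1, 1, 1, -1, -1, -1, -1, -1, -1, 1, 1, 1, -1, 1, 1, -1, -1, -1, -1, -1, -1, -1, -1,
    -1, -1, -1]

lemma adjIndex_adjIndex : ∀ i, adjIndex (adjIndex i) = i := by decide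

lemma adjSign_mul_adjSign : ∀ i, adjSign i * adjSign (adjIndex i) = 1 := by decide

set_option maxHeartbeats 0 in
/-- The generators of weight zero are linear, and their adjoints with respect to `hip` are again
generators of weight zero up to sign. -/
lemma hip_genZero (i : Fin 30) (p q : E) :
    hip (genZero i p) q = adjSign i * hip p (genZero (adjIndex i) q) := by
  fin_cases i <;>
  · simp only [Fin.reduceFinMk, Fin.zero_eta, Fin.mk_one, adjSign, adjIndex, Matrix.cons_val]
    simp only [genZero, ofCoords, onCoords, Matrix.cons_val, Prod.smul_fst, Prod.smul_snd]
    simp only [hip, Sum.elim_inl, Sum.elim_inr, Pi.smul_apply, Matrix.cons_val, smul_eq_mul, map_mul,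
      map_neg, conj_I, map_ofNat, map_zero]
    push_cast
    try ring

/-- The sum (`ε = 1`) or difference (`ε = -1`) of a generator of weight zero and its adjoint. -/
def adjSum (ε : ℤ) (i : Fin 30) : hol := symZero i + ((ε * adjSign i : ℤ) : ℝ) • symZero (adjIndex i)

lemma adjSum_apply (ε : ℤ) (i : Fin 30) (x : E) :
    (adjSum ε i).1.1 x = genZero i x + ((ε * adjSign i : ℤ) : ℂ) • genZero (adjIndex i) x := by
  funext c
  change genZero i x c + ((ε * adjSign i : ℤ) : ℝ) • genZero (adjIndex i) x c = _
  simp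

lemma symZero_mem (i : Fin 30) : symZero i ∈ gradedPiece 0 := genHol_mem _

lemma adjSum_mem (ε : ℤ) (i : Fin 30) : adjSum ε i ∈ gradedPiece 0 :=
  add_mem (symZero_mem _) (Submodule.smul_mem _ _ (symZero_mem _))

lemma isSelfAdj_adjSum {ε : ℤ} (hε : ε * ε = 1) (i : Fin 30) : IsSelfAdj ε (adjSum ε i) := by
  intro p q
  have h1 : (ε : ℂ) * ε = 1 := by exact_mod_cast hε
  have h2 : (adjSign i : ℂ) * adjSign (adjIndex i) = 1 := by exact_mod_cast adjSign_mul_adjSign i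
  rw [adjSum_apply, adjSum_apply, hip_add_left, hip_add_right, hip_smul_left, hip_smul_right,
    hip_genZero, hip_genZero, adjIndex_adjIndex]
  push_cast
  rw [map_mul, map_intCast, map_intCast]
  linear_combination (ε * hip p (genZero i q)) * h2 -
    (adjSign i * hip p (genZero (adjIndex i) q)) * h1

lemma repr_symZero (i k : Fin 30) :
    holBasis.repr (symZero i) (.inr (.inr (.inl k))) = if i = k then 1 else 0 := by
  rw [symZero, ← holBasis_apply, Module.Basis.repr_self, Finsupp.single_apply]
  simp

/-- The hypothesis says that no generator in the family is the adjoint of another one up to sign,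
and that `adjSum` does not cancel where a generator is its own adjoint. -/
lemma linearIndependent_adjSum {n : ℕ} {ε : ℤ} {f : Fin n → Fin 30} (hf : Function.Injective f)
    (h : ∀ j k, adjIndex (f j) = f k → j = k ∧ ε * adjSign (f j) = 1) :
    LinearIndependent ℝ fun j => adjSum ε (f j) := by
  rw [Fintype.linearIndependent_iff]
  intro g hg k
  have h1 := DFunLike.congr_fun (congrArg holBasis.repr hg) (.inr (.inr (.inl (f k))))
  have h2 : ∀ j, holBasis.repr (adjSum ε (f j)) (.inr (.inr (.inl (f k)))) =
      if j = k then 1 + (if adjIndex (f k) = f k then 1 else 0) else 0 := fun j => by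
    rw [adjSum, map_add, map_smul, Finsupp.add_apply, Finsupp.smul_apply, repr_symZero,
      repr_symZero]
    by_cases hj : j = k
    · subst hj
      by_cases h3 : adjIndex (f j) = f j
      · simp [h3, (h j j h3).2]
      · simp [h3]
    · have h3 : adjIndex (f j) ≠ f k := fun h4 => hj (h j k h4).1
      simp [hj, h3, hf.ne hj]
  simp only [map_sum, map_smul, Finsupp.coe_finsetSum, Finset.sum_apply, Finsupp.smul_apply, h2,
    smul_eq_mul, mul_ite, mul_zero, Finset.sum_ite_eq', Finset.mem_univ, if_true, map_zero,
    Finsupp.coe_zero, Pi.zero_apply] at h1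
  refine (mul_eq_zero.1 h1).resolve_right ?_
  split_ifs <;> norm_num

/-- The (skew-)Hermitian fields of weight zero. -/
def selfAdj (ε : ℝ) : Submodule ℝ hol where
  carrier := {X | X ∈ gradedPiece 0 ∧ IsSelfAdj ε X}
  zero_mem' := ⟨zero_mem _, fun p q => by
    have h : ∀ p : E, (0 : hol).1.1 p = (0 : ℂ) • p := fun p => (zero_smul ℂ p).symm
    rw [h, h, hip_smul_left, hip_smul_right, map_zero]; ring⟩
  add_mem' {X Y} hX hY := ⟨add_mem hX.1 hY.1, fun p q => by
    have h : ∀ p : E, (X + Y).1.1 p = X.1.1 p + Y.1.1 p := fun p => rfl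
    rw [h, h, hip_add_left, hip_add_right, hX.2, hY.2, mul_add]⟩
  smul_mem' r X hX := ⟨Submodule.smul_mem _ _ hX.1, fun p q => by
    have h : ∀ p : E, (r • X).1.1 p = (r : ℂ) • X.1.1 p := fun p => rfl
    rw [h, h, hip_smul_left, hip_smul_right, hX.2, conj_ofReal]; ring⟩

lemma le_finrank_selfAdj {n : ℕ} {ε : ℤ} (hε : ε * ε = 1) {f : Fin n → Fin 30}
    (hf : Function.Injective f)
    (h : ∀ j k, adjIndex (f j) = f k → j = k ∧ ε * adjSign (f j) = 1) :
    n ≤ Module.finrank ℝ (selfAdj ε) := by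
  have h1 : LinearIndependent ℝ fun j =>
      (⟨adjSum ε (f j), adjSum_mem _ _, isSelfAdj_adjSum hε _⟩ : selfAdj ε) :=
    (linearIndependent_adjSum hf h).of_comp (selfAdj ε).subtype
  simpa using h1.fintype_card_le_finrank

lemma le_finrank_selfAdj_one : 8 ≤ Module.finrank ℝ (selfAdj ((1 : ℤ) : ℝ)) :=
  le_finrank_selfAdj (f := ![0, 1, 2, 14, 15, 16, 6, 13]) (by decide) (by decide) (by decide)

lemma le_finrank_selfAdj_neg_one : 22 ≤ Module.finrank ℝ (selfAdj ((-1 : ℤ) : ℝ)) :=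
  le_finrank_selfAdj (f := ![0, 1, 2, 14, 15, 16, 7, 8, 9, 10, 11, 12, 20, 21, 22, 23, 24, 25, 26, 27,
    28, 29]) (by decide) (by decide) (by decide)

lemma killingForm_eq_zero {j k : ℤ} (hjk : j + k ≠ 0) {X Y : hol} (hX : X ∈ gradedPiece j)
    (hY : Y ∈ gradedPiece k) : killingForm ℝ hol X Y = 0 := by
  have h := LieModule.traceForm_apply_lie_apply' ℝ hol hol eulerField X Y
  rw [lie_euler hX, lie_euler hY, map_smul, map_smul, LinearMap.smul_apply, smul_eq_mul,
    smul_eq_mul] at h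
  have h2 : ((j + k : ℤ) : ℝ) * killingForm ℝ hol X Y = 0 := by
    push_cast
    linear_combination h
  exact (mul_eq_zero.1 h2).resolve_left (by exact_mod_cast hjk)

/-- The (skew-)Hermitian fields of weight zero together with the fields of positive weight. -/
def selfAdjPos (ε : ℝ) : Submodule ℝ hol := selfAdj ε ⊔ (gradedPiece 1 ⊔ gradedPiece 2)

/-- The summands lie in different weights, and `𝔤₁` and `𝔤₂` have dimensions `16` and `8`. -/
lemma finrank_selfAdjPos (ε : ℝ) :
    Module.finrank ℝ (selfAdjPos ε) = Module.finrank ℝ (selfAdj ε) + 24 := by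
  have h1 : Disjoint (selfAdj ε) (gradedPiece 1 ⊔ gradedPiece 2) :=
    (iSupIndep_gradedPiece 0).mono (fun X hX => hX.1) (sup_le
      (le_iSup₂_of_le (f := fun j (_ : j ≠ 0) => gradedPiece j) 1 one_ne_zero le_rfl)
      (le_iSup₂_of_le (f := fun j (_ : j ≠ 0) => gradedPiece j) 2 two_ne_zero le_rfl))
  have h2 : Disjoint (gradedPiece 1) (gradedPiece 2) :=
    iSupIndep_gradedPiece.pairwiseDisjoint (by norm_num)
  have h3 := Submodule.finrank_sup_add_finrank_inf_eq (selfAdj ε) (gradedPiece 1 ⊔ gradedPiece 2)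
  have h4 := Submodule.finrank_sup_add_finrank_inf_eq (gradedPiece 1) (gradedPiece 2)
  rw [disjoint_iff.1 h1, finrank_bot] at h3
  rw [disjoint_iff.1 h2, finrank_bot, finrank_one, finrank_two] at h4
  rw [selfAdjPos]
  omega

/-- The Killing form pairs `𝔤_j` with `𝔤₋ⱼ` only, so fields of positive weight do not contribute. -/
lemma mul_killingQuadratic_nonneg {ε : ℝ} {X : hol} (hX : X ∈ selfAdjPos ε) :
    0 ≤ ε * killingQuadratic hol X := by
  obtain ⟨S, hS, N, hN, rfl⟩ := Submodule.mem_sup.1 hX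
  obtain ⟨Y, hY, Z, hZ, rfl⟩ := Submodule.mem_sup.1 hN
  have h : killingQuadratic hol (S + (Y + Z)) = killingForm ℝ hol S S := by
    rw [killingQuadratic, LinearMap.BilinMap.toQuadraticMap_apply]
    simp only [map_add, LinearMap.add_apply, killingForm_eq_zero (by norm_num) hS.1 hY,
      killingForm_eq_zero (by norm_num) hS.1 hZ, killingForm_eq_zero (by norm_num) hY hS.1,
      killingForm_eq_zero (by norm_num) hZ hS.1, killingForm_eq_zero (by norm_num) hY hY,
      killingForm_eq_zero (by norm_num) hY hZ, killingForm_eq_zero (by norm_num) hZ hY,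
      killingForm_eq_zero (by norm_num) hZ hZ, add_zero]
  rw [h]
  exact mul_killingForm_nonneg hS.1 hS.2

lemma radical_killingQuadratic : (killingQuadratic hol).radical = ⊥ := by
  have : Invertible (2 : ℝ) := invertibleOfNonzero two_ne_zero
  rw [QuadraticMap.radical_eq_ker_associated, killingQuadratic,
    QuadraticMap.associated_left_inverse _ (LieModule.traceForm_comm ℝ hol hol)]
  exact LieAlgebra.IsKilling.ker_killingForm_eq_bot ℝ hol

/-- The form is semidefinite on subspaces of dimensions at least `8 + 24 = 32` and `22 + 24 = 46`,
and `32 + 46 = 78`. -/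
lemma signature_killingQuadratic :
    sigPos (killingQuadratic hol) = 32 ∧ sigNeg (killingQuadratic hol) = 46 := by
  have h1 := QuadraticForm.sigPos_add_finrank_le_of_nonpos (Q := killingQuadratic hol)
    (V := selfAdjPos ((-1 : ℤ) : ℝ)) fun x hx => by
      have := mul_killingQuadratic_nonneg hx
      push_cast at this
      linarith
  have h2 := QuadraticForm.sigPos_add_finrank_le_of_nonpos (Q := -killingQuadratic hol)
    (V := selfAdjPos ((1 : ℤ) : ℝ)) fun x hx => by
      have := mul_killingQuadratic_nonneg hx
      push_cast at this
      rw [neg_apply]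
      linarith
  have h3 := QuadraticForm.sigPos_add_sigNeg_add_radical (Q := killingQuadratic hol)
  rw [radical_killingQuadratic, finrank_bot, finrank_hol] at h3
  rw [finrank_selfAdjPos, finrank_hol] at h1 h2
  rw [sigPos_neg] at h2
  have := le_finrank_selfAdj_one
  have := le_finrank_selfAdj_neg_one
  omega

lemma isEIII_hol : IsEIII hol := ⟨isTypeE6_CHol, signature_killingQuadratic⟩

end

end EIIIModel

end

theorem mainTheorem2 :
    (∃ b : Module.Basis GenIndex ℝ hol, ∀ i, (b i).1.1 = generator i) ∧
    Module.finrank ℝ hol = 78 ∧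
    (∀ U : Set E, IsOpen U → IsConnected U → (U ∩ M).Nonempty →
      ∀ L : E → E, AnalyticOnNhd ℂ L U → TangentOn L (U ∩ M) →
        ∃! X : hol, Set.EqOn L X.1.1 U) ∧
    DirectSum.IsInternal gradedPiece ∧
    (∀ j k : ℤ, ∀ X ∈ gradedPiece j, ∀ Y ∈ gradedPiece k, ⁅X, Y⁆ ∈ gradedPiece (j + k)) ∧
    (∀ k : ℤ, ∃ b : Module.Basis {i : GenIndex // genWeight i = k} ℝ (gradedPiece k),
      ∀ i, (b i).1.1.1 = generator i.1) ∧
    Module.finrank ℝ (gradedPiece (-2)) = 8 ∧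
    Module.finrank ℝ (gradedPiece (-1)) = 16 ∧
    Module.finrank ℝ (gradedPiece 0) = 30 ∧
    Module.finrank ℝ (gradedPiece 1) = 16 ∧
    Module.finrank ℝ (gradedPiece 2) = 8 ∧
    (∀ k : ℤ, 2 < |k| → gradedPiece k = ⊥) ∧
    IsEIII hol := by
  have hb : ∃ b : Module.Basis GenIndex ℝ hol, ∀ i, (b i).1.1 = generator i :=
    ⟨holBasis, fun i => by rw [holBasis_apply, genHol_coe]⟩
  have hk : ∀ k : ℤ, ∃ b : Module.Basis {i : GenIndex // genWeight i = k} ℝ (gradedPiece k),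
      ∀ i, (b i).1.1.1 = generator i.1 := fun k => by
    obtain ⟨b, hb⟩ := exists_basis_of_genWeight k
    exact ⟨b, fun i => by rw [hb, genHol_coe]⟩
  exact ⟨hb, finrank_hol, fun U hU hc hM L hL hT => existsUnique_eqOn hU hc hM hL hT,
    isInternal_gradedPiece, fun j k X hX Y hY => lie_mem_gradedPiece hX hY, hk, finrank_negTwo,
    finrank_negOne, finrank_zero, finrank_one, finrank_two, fun k => gradedPiece_eq_bot, isEIII_hol⟩
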